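/- Let $k$ be a field. A $\mathbf{Rex}_k$ category is an essentially small $k$-linear category with finite colimits; $k$-linear functors preserving finite colimits are called right exact, and $\operatorname{ind}(\mathcal C)$ denotes the ind-completion of $\mathcal C$. A $\mathbf{Rex}_k$ tensor category is a rigid monoidal $\mathbf{Rex}_k$ category whose tensor product is $k$-bilinear (and hence right exact in each variable). A tensor functor is a right exact (strong) monoidal functor $F:\mathcal A\to\mathcal B$ of such categories; it is dominant if every object of $\mathcal B$ is a subobject of some $F(a)$, $a\in\mathcal A$. An $\mathcal A$-module category is a $\mathbf{Rex}_k$ category $\mathcal M$ with a right action $\otimes:\mathcal M\times\mathcal A\to\mathcal M$ (with coherent associativity and unit isomorphisms) that is $k$-bilinear and right exact in each variable. Tensor products and actions are extended to ind-categories so as to preserve filtered colimits in each variable. For $m\in\mathcal M$ let $\operatorname{act}_m:\operatorname{ind}(\mathcal A)\to\operatorname{ind}(\mathcal M)$, $a\mapsto m\otimes a$, and let $\operatorname{act}_m^R:\operatorname{ind}(\mathcal M)\to\operatorname{ind}(\mathcal A)$ be its right adjoint (which exists). The object $m$ is an $\mathcal A$-generator if $\operatorname{act}_m^R$ is faithful,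 is $\mathcal A$-projective if $\operatorname{act}_m^R$ preserves colimits, and is an $\mathcal A$-progenerator if it is both. The object $\underline{\operatorname{End}}(m)=\operatorname{act}_m^R(m)$ is an algebra in $\operatorname{ind}(\mathcal A)$: its unit $\mathbf 1\to\operatorname{act}_m^R(m)$ corresponds under the adjunction to the isomorphism $m\otimes\mathbf 1\cong m$, and its product corresponds to the twofold evaluation $m\otimes\underline{\operatorname{End}}(m)\otimes\underline{\operatorname{End}}(m)\to m\otimes\underline{\operatorname{End}}(m)\to m$. For a tensor functor $F:\mathcal A\to\mathcal B$ let $\mathcal A$ act on $\mathcal B$ from the left by $a\cdot b=F(a)\otimes b$. A balanced functor $\mathcal M\times\mathcal B\to\mathcal E$ to a $\mathbf{Rex}_k$ category is a functor $T$ that is $k$-linear and right exact in each variable, with natural isomorphisms $T(m\otimes a,b)\cong T(m,F(a)\otimes b)$ compatible with the associativity and unit isomorphisms; morphisms of balanced functors are the natural transformations compatible with these isomorphisms. The relative tensor product $\mathcal M\boxtimes_{\mathcal A}\mathcal B$ is a $\mathbf{Rex}_k$ category with a balanced functor $(m,b)\mapsto m\boxtimes_{\mathcal A}b$ such that for every $\mathbf{Rex}_k$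 category $\mathcal E$ composition with it is an equivalence from the category of right exact functors $\mathcal M\boxtimes_{\mathcal A}\mathcal B\to\mathcal E$ to the category of balanced functors $\mathcal M\times\mathcal B\to\mathcal E$. It is a $\mathcal B$-module category by means of isomorphisms $(m\boxtimes_{\mathcal A} b)\otimes b'\cong m\boxtimes_{\mathcal A}(b\otimes b')$, natural in all variables and compatible with the balancing and with the module structure isomorphisms. \textbf{Theorem (Monadicity for base change).} Let $\mathcal A$ be an abelian $\mathbf{Rex}_k$ tensor category, $\mathcal B$ a $\mathbf{Rex}_k$ tensor category, $F:\mathcal A\to\mathcal B$ a dominant tensor functor, $\mathcal M$ an abelian $\mathcal A$-module category, and $m\in\mathcal M$ an $\mathcal A$-progenerator. Then the $\mathcal B$-module category $\mathcal M\boxtimes_{\mathcal A}\mathcal B$ exists, the object $m\boxtimes_{\mathcal A}\mathbf 1_{\mathcal B}$ is a $\mathcal B$-progenerator of it, and there is an equivalence of $\mathcal B$-module categories (indeed of $\operatorname{ind}(\mathcal B)$-module categories) $$\operatorname{ind}(\mathcal M\boxtimes_{\mathcal A}\mathcal B)\;\simeq\;F(\underline{\operatorname{End}}(m))\text{-}\mathrm{mod}_{\operatorname{ind}(\mathcal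 B)},$$ where $F(\underline{\operatorname{End}}(m))$ is the image of the algebra $\underline{\operatorname{End}}(m)$ under the extension $\operatorname{ind}(\mathcal A)\to\operatorname{ind}(\mathcal B)$ of $F$, and the right-hand side is the category of left modules over it in $\operatorname{ind}(\mathcal B)$, with $\operatorname{ind}(\mathcal B)$ acting by tensoring on the right. -/

import Mathlib

open CategoryTheory Limits Functor Opposite MonoidalCategory MonoidalRightAction

universe w v v₁ v₂ v₃ v₄ u₁ u₂ u₃ u₄ u₅ u₆

namespace IndExt

variable {C : Type u₁} [Category.{v} C] {D : Type u₂} [Category.{v} D]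
  {E : Type u₃} [Category.{v} E] {T : Type u₄} [Category.{w} T]

instance isFiltered_costructuredArrow (X : Ind C) :
    IsFiltered (CostructuredArrow (Ind.yoneda (C := C)) X) :=
  RepresentablyCoflat.filtered X

theorem costructuredArrow_equivalence (X : Ind C) :
    Nonempty (CostructuredArrow (Ind.yoneda (C := C)) X ≌
      CostructuredArrow yoneda ((Ind.inclusion C).obj X)) :=
  ⟨(CostructuredArrow.post Ind.yoneda (Ind.inclusion C) X).asEquivalence.trans
      (CostructuredArrow.mapNatIso Ind.yonedaCompInclusion)⟩

instance finallySmall_costructuredArrow (X : Ind C) :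
    FinallySmall.{v} (CostructuredArrow (Ind.yoneda (C := C)) X) := by
  obtain ⟨e⟩ := costructuredArrow_equivalence X
  have := (Ind.isIndObject_inclusion_obj X).finallySmall
  exact finallySmall_of_final_of_finallySmall e.inverse

instance isFinitelyPresentable_yoneda (c : C) :
    IsFinitelyPresentable.{v} ((Ind.yoneda (C := C)).obj c) := by
  rw [isFinitelyPresentable_iff_preservesFilteredColimits]
  have e : Ind.inclusion C ⋙ (evaluation _ _).obj (op c) ≅
      coyoneda.obj (op ((Ind.yoneda (C := C)).obj c)) :=
    NatIso.ofComponents (fun X => Equiv.toIso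
      (yonedaEquiv.symm.trans ((Iso.homCongr (Ind.yonedaCompInclusion.app c).symm (Iso.refl _)).trans
        Ind.inclusion.fullyFaithful.homEquiv.symm))) (by
      intro X Y f
      ext x
      apply (Ind.inclusion C).map_injective
      simp [yonedaEquiv_symm_naturality_right])
  exact ⟨fun J _ _ => preservesColimitsOfShape_of_natIso e⟩

/-- `F` preserves filtered colimits. -/
abbrev PresFilt (F : Ind C ⥤ T) : Prop := PreservesFilteredColimitsOfSize.{v, v} F

/-- The canonical presentation cocone of an ind-object. -/
noncomputable def presCocone (X : Ind C) : Cocone (X.presentation.F ⋙ Ind.yoneda) :=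
  (colimit.cocone _).extend (Ind.colimitPresentationCompYoneda X).hom

noncomputable def presIsColimit (X : Ind C) : IsColimit (presCocone X) :=
  (colimit.isColimit _).extendIso _

noncomputable def presToCostructuredArrow (X : Ind C) :
    X.presentation.I ⥤ CostructuredArrow (Ind.yoneda (C := C)) X where
  obj i := CostructuredArrow.mk (Y := X.presentation.F.obj i) ((presCocone X).ι.app i)
  map f := CostructuredArrow.homMk (X.presentation.F.map f) (by
    simpa using! (presCocone X).w f)

instance final_presToCostructuredArrow (X : Ind C) : (presToCostructuredArrow X).Final := by
  rw [Functor.final_iff_of_isFiltered]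
  refine ⟨fun f ↦ ?_, fun {f j} g₁ g₂ ↦ ?_⟩
  · obtain ⟨j, g, hg⟩ := IsFinitelyPresentable.exists_hom_of_isColimit (presIsColimit X) f.hom
    obtain ⟨g', rfl⟩ := Ind.yoneda.map_surjective g
    exact ⟨j, ⟨CostructuredArrow.homMk g' hg⟩⟩
  · obtain ⟨k, a, b, h⟩ := IsFinitelyPresentable.exists_eq_of_isColimit (presIsColimit X)
      (Ind.yoneda.map g₁.left) (Ind.yoneda.map g₂.left)
      ((CostructuredArrow.w g₁).trans (CostructuredArrow.w g₂).symm)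
    refine ⟨_, a ≫ IsFiltered.coeqHom a b, CostructuredArrow.hom_ext _ _
      (Ind.yoneda.map_injective ?_)⟩
    have h' := h =≫ (X.presentation.F ⋙ Ind.yoneda).map (IsFiltered.coeqHom a b)
    simp only [Category.assoc, ← Functor.map_comp] at h'
    rw [← IsFiltered.coeq_condition a b] at h'
    simp only [Functor.comp_map] at h'
    exact (Functor.map_comp _ _ _).trans (h'.trans (Functor.map_comp _ _ _).symm)

noncomputable def isPointwise (F : Ind C ⥤ T) [PresFilt F] :
    (LeftExtension.mk F (𝟙 (Ind.yoneda ⋙ F))).IsPointwiseLeftKanExtension := fun X ↦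
  (Functor.Final.isColimitWhiskerEquiv (presToCostructuredArrow X) _).1
    (IsColimit.ofIsoColimit (isColimitOfPreserves F (presIsColimit X))
      (Cocone.ext (Iso.refl _) (by
        intro j
        exact (Category.comp_id _).trans (Category.id_comp _).symm)))

instance isLeftKanExtension_of_presFilt (F : Ind C ⥤ T) [PresFilt F] :
    F.IsLeftKanExtension (𝟙 (Ind.yoneda ⋙ F)) :=
  ⟨⟨(isPointwise F).isUniversal⟩⟩

theorem hom_ext (F : Ind C ⥤ T) [PresFilt F] {X : Ind C} {Z : T} {f g : F.obj X ⟶ Z}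
    (h : ∀ (c : C) (u : Ind.yoneda.obj c ⟶ X), F.map u ≫ f = F.map u ≫ g) : f = g :=
  (isColimitOfPreserves F (presIsColimit X)).hom_ext fun _ ↦ h _ _

theorem presFilt_of_isPointwise {F : C ⥤ T} {G : Ind C ⥤ T} (η : F ⟶ Ind.yoneda ⋙ G)
    (hη : (LeftExtension.mk G η).IsPointwiseLeftKanExtension) : PresFilt G := by
  refine ⟨fun J _ _ ↦ ⟨fun {K} ↦ ⟨fun {c} hc ↦ ?_⟩⟩⟩
  have ext' {X : Ind C} {Z : T} (f g : G.obj X ⟶ Z) (h : ∀ (x : C) (u : Ind.yoneda.obj x ⟶ X),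
      η.app x ≫ G.map u ≫ f = η.app x ≫ G.map u ≫ g) : f = g :=
    (hη X).hom_ext fun u ↦
      (Category.assoc _ _ _).trans ((h u.left u.hom).trans (Category.assoc _ _ _).symm)
  have key (s : Cocone (K ⋙ G)) (x : C) (j j' : J) (p : Ind.yoneda.obj x ⟶ K.obj j)
      (p' : Ind.yoneda.obj x ⟶ K.obj j') (h : p ≫ c.ι.app j = p' ≫ c.ι.app j') :
      G.map p ≫ s.ι.app j = G.map p' ≫ s.ι.app j' := by
    obtain ⟨k, u, v, e⟩ := IsFinitelyPresentable.exists_eq_of_isColimit hc p p' h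
    rw [← s.w u, ← s.w v]
    simp only [Functor.comp_map, ← Category.assoc, ← Functor.map_comp, e]
  have ex (f : CostructuredArrow (Ind.yoneda (C := C)) c.pt) :
      ∃ (j : J) (p : Ind.yoneda.obj f.left ⟶ K.obj j), p ≫ c.ι.app j = f.hom :=
    IsFinitelyPresentable.exists_hom_of_isColimit hc f.hom
  choose jj pp hpp using ex
  let leg (s : Cocone (K ⋙ G)) : Cocone (CostructuredArrow.proj Ind.yoneda c.pt ⋙ F) :=
    Cocone.mk s.pt
      { app := fun f ↦ η.app f.left ≫ G.map (pp f) ≫ s.ι.app (jj f)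
        naturality := fun f g φ ↦ by
          have := key s f.left (jj f) (jj g) (pp f) (Ind.yoneda.map φ.left ≫ pp g)
            (by rw [hpp, Category.assoc, hpp]; exact (CostructuredArrow.w φ).symm)
          have n := η.naturality φ.left
          simp only [Functor.comp_map] at n
          refine Eq.trans ?_ (Category.comp_id _).symm
          rw [this, Functor.map_comp, Category.assoc]
          simpa only [Category.assoc] using! n =≫ (G.map (pp g) ≫ s.ι.app (jj g)) }
  let desc (s : Cocone (K ⋙ G)) : G.obj c.pt ⟶ s.pt := (hη c.pt).desc (leg s)
  have hdesc (s : Cocone (K ⋙ G)) (x : C) (j : J) (p : Ind.yoneda.obj x ⟶ K.obj j) :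
      η.app x ≫ G.map (p ≫ c.ι.app j) ≫ desc s = η.app x ≫ G.map p ≫ s.ι.app j := by
    have := (hη c.pt).fac (leg s) (CostructuredArrow.mk (p ≫ c.ι.app j))
    refine (Category.assoc _ _ _).symm.trans (this.trans ?_)
    exact congrArg (η.app x ≫ ·) (key s x _ j _ p (hpp _))
  refine ⟨IsColimit.mk desc (fun s j ↦ ?_) (fun s m hm ↦ ?_)⟩
  · refine ext' _ _ fun x u ↦ ?_
    rw [← hdesc s x j u, Functor.map_comp, Category.assoc]
    rfl
  · refine ext' _ _ fun x u ↦ ?_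
    obtain ⟨j, p, rfl⟩ := IsFinitelyPresentable.exists_hom_of_isColimit hc u
    rw [hdesc s x j p, ← hm j, Functor.map_comp, Category.assoc]
    rfl

section Desc

theorem exists_desc (F : Ind C ⥤ T) [PresFilt F] (X : Ind C) (Z : T)
    (φ : ∀ (c : C), (Ind.yoneda.obj c ⟶ X) → (F.obj (Ind.yoneda.obj c) ⟶ Z))
    (hφ : ∀ (c c' : C) (f : c ⟶ c') (u : Ind.yoneda.obj c' ⟶ X),
      F.map (Ind.yoneda.map f) ≫ φ c' u = φ c (Ind.yoneda.map f ≫ u)) :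
    ∃ d : F.obj X ⟶ Z, ∀ (c : C) (u : Ind.yoneda.obj c ⟶ X), F.map u ≫ d = φ c u := by
  let K : Cocone (CostructuredArrow.proj Ind.yoneda X ⋙ Ind.yoneda ⋙ F) :=
    Cocone.mk Z
      { app := fun f ↦ φ f.left f.hom
        naturality := fun f g m ↦ by
          refine Eq.trans ?_ (Category.comp_id _).symm
          refine (hφ _ _ m.left g.hom).trans ?_
          exact congrArg (φ f.left) (CostructuredArrow.w m) }
  refine ⟨(isPointwise F X).desc K, fun c u ↦ ?_⟩
  have := (isPointwise F X).fac K (CostructuredArrow.mk u)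
  refine Eq.trans ?_ this
  exact congrArg (· ≫ (isPointwise F X).desc K) (Category.id_comp _).symm

/-- The morphism out of `F.obj X` glued from a compatible family of morphisms out of the values
of `F` at the objects of `C` over `X`. -/
noncomputable def desc (F : Ind C ⥤ T) [PresFilt F] (X : Ind C) (Z : T)
    (φ : ∀ (c : C), (Ind.yoneda.obj c ⟶ X) → (F.obj (Ind.yoneda.obj c) ⟶ Z))
    (hφ : ∀ (c c' : C) (f : c ⟶ c') (u : Ind.yoneda.obj c' ⟶ X),
      F.map (Ind.yoneda.map f) ≫ φ c' u = φ c (Ind.yoneda.map f ≫ u)) : F.obj X ⟶ Z :=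
  (exists_desc F X Z φ hφ).choose

theorem map_desc (F : Ind C ⥤ T) [PresFilt F] (X : Ind C) (Z : T)
    (φ : ∀ (c : C), (Ind.yoneda.obj c ⟶ X) → (F.obj (Ind.yoneda.obj c) ⟶ Z))
    (hφ : ∀ (c c' : C) (f : c ⟶ c') (u : Ind.yoneda.obj c' ⟶ X),
      F.map (Ind.yoneda.map f) ≫ φ c' u = φ c (Ind.yoneda.map f ≫ u)) (c : C)
    (u : Ind.yoneda.obj c ⟶ X) : F.map u ≫ desc F X Z φ hφ = φ c u :=
  (exists_desc F X Z φ hφ).choose_spec c u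

end Desc

section Extension

variable [HasFilteredColimitsOfSize.{v, v} T]

instance hasPointwiseLeftKanExtension_yoneda (F : C ⥤ T) :
    Ind.yoneda.HasPointwiseLeftKanExtension F := fun X ↦
  have : HasColimitsOfShape X.presentation.I T := inferInstance
  have : HasColimitsOfShape (CostructuredArrow (Ind.yoneda (C := C)) X) T :=
    Final.hasColimitsOfShape_of_final (presToCostructuredArrow X)
  inferInstance

instance presFilt_lan (F : C ⥤ T) : PresFilt (Ind.yoneda.lan.obj F) :=
  presFilt_of_isPointwise _ (Ind.yoneda.isPointwiseLeftKanExtensionLeftKanExtensionUnit F)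

theorem presFilt_obj_of_presFilt_flip {U : Type u₅} [Category.{w} U] (B : Ind C ⥤ Ind D ⥤ U)
    [∀ Y, PresFilt (B.flip.obj Y)] (hB : ∀ c, PresFilt (B.obj (Ind.yoneda.obj c))) (X : Ind C) :
    PresFilt (B.obj X) := by
  refine ⟨fun J _ _ ↦ ⟨fun {K} ↦ ⟨fun {c} hc ↦ ?_⟩⟩⟩
  let dsc (s : Cocone (K ⋙ B.obj X)) (x : C) (u : Ind.yoneda.obj x ⟶ X) :
      (B.flip.obj c.pt).obj (Ind.yoneda.obj x) ⟶ s.pt :=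
    (isColimitOfPreserves (B.obj (Ind.yoneda.obj x)) hc).desc
      ((Cocone.precompose (Functor.whiskerLeft K (B.map u))).obj s)
  have hdsc (s : Cocone (K ⋙ B.obj X)) (x : C) (u : Ind.yoneda.obj x ⟶ X) (j : J) :
      (B.obj (Ind.yoneda.obj x)).map (c.ι.app j) ≫ dsc s x u =
        (B.map u).app (K.obj j) ≫ s.ι.app j :=
    (isColimitOfPreserves (B.obj (Ind.yoneda.obj x)) hc).fac _ j
  have hd (s : Cocone (K ⋙ B.obj X)) : ∀ (x x' : C) (f : x ⟶ x') (u : Ind.yoneda.obj x' ⟶ X),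
      (B.flip.obj c.pt).map (Ind.yoneda.map f) ≫ dsc s x' u = dsc s x (Ind.yoneda.map f ≫ u) := by
    intro x x' f u
    refine (isColimitOfPreserves (B.obj (Ind.yoneda.obj x)) hc).hom_ext fun j ↦ ?_
    refine Eq.trans ?_ (hdsc s x _ j).symm
    refine (NatTrans.naturality_assoc (B.map (Ind.yoneda.map f)) (c.ι.app j) (dsc s x' u)).trans ?_
    rw [hdsc]
    simp
  refine ⟨IsColimit.mk (fun s ↦ desc (B.flip.obj c.pt) X s.pt (dsc s) (hd s)) (fun s j ↦ ?_)
    (fun s m hm ↦ ?_)⟩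
  · refine hom_ext (B.flip.obj (K.obj j)) fun x u ↦ ?_
    refine (NatTrans.naturality_assoc (B.map u) (c.ι.app j) _).symm.trans ?_
    refine (congrArg ((B.obj (Ind.yoneda.obj x)).map (c.ι.app j) ≫ ·)
      (map_desc (B.flip.obj c.pt) X s.pt (dsc s) (hd s) x u)).trans ?_
    exact hdsc s x u j
  · refine hom_ext (B.flip.obj c.pt) fun x u ↦ ?_
    rw [map_desc]
    refine (isColimitOfPreserves (B.obj (Ind.yoneda.obj x)) hc).hom_ext fun j ↦ ?_
    refine Eq.trans ?_ (hdsc s x u j).symm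
    refine (NatTrans.naturality_assoc (B.map u) (c.ι.app j) m).trans ?_
    exact congrArg ((B.map u).app (K.obj j) ≫ ·) (hm j)

instance hasFilteredColimits_functor {U : Type u₅} [Category.{w} U]
    [HasFilteredColimitsOfSize.{v, v} U] : HasFilteredColimitsOfSize.{v, v} (D ⥤ U) :=
  ⟨fun _ _ _ ↦ inferInstance⟩

/-- The extension of functors on `C` to functors on `Ind C` preserving filtered colimits
(the left Kan extension along `C ⥤ Ind C`). -/
noncomputable def ext (C : Type u₁) [Category.{v} C] (T : Type u₄) [Category.{w} T]
    [HasFilteredColimitsOfSize.{v, v} T] : (C ⥤ T) ⥤ (Ind C ⥤ T) :=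
  Ind.yoneda.lan

instance presFilt_ext (F : C ⥤ T) : PresFilt ((ext C T).obj F) := presFilt_lan F

/-- The extension of `F` restricts to `F`. -/
noncomputable def extIso (F : C ⥤ T) : F ≅ Ind.yoneda ⋙ (ext C T).obj F :=
  have : IsIso (Ind.yoneda.lanUnit.app F) :=
    have : ∀ c, IsIso ((Ind.yoneda.lanUnit.app F).app c) := fun _ ↦ inferInstance
    NatIso.isIso_of_isIso_app _
  @asIso (C ⥤ T) _ F _ (Ind.yoneda.lanUnit.app F) this

theorem extIso_naturality {F G : C ⥤ T} (φ : F ⟶ G) :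
    φ ≫ (extIso G).hom = (extIso F).hom ≫ Functor.whiskerLeft Ind.yoneda ((ext C T).map φ) :=
  (Ind.yoneda.lanUnit (H := T)).naturality φ

end Extension

section One

/-- The functor `Ind C ⥤ Ind D` extending `F : C ⥤ D` and preserving filtered colimits. -/
noncomputable def indMap (F : C ⥤ D) : Ind C ⥤ Ind D := (ext C (Ind D)).obj (F ⋙ Ind.yoneda)

instance presFilt_indMap (F : C ⥤ D) : PresFilt (indMap F) := presFilt_ext _

/-- `indMap F` restricts to `F`. -/
noncomputable def indMapYoneda (F : C ⥤ D) : F ⋙ Ind.yoneda ≅ Ind.yoneda ⋙ indMap F :=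
  extIso _

end One

section Two

variable (P : C ⥤ D ⥤ E)

/-- The bifunctor `C ⥤ Ind D ⥤ Ind E` extending `P` in the second variable. -/
noncomputable def indRight : C ⥤ Ind D ⥤ Ind E :=
  P ⋙ (whiskeringRight D E (Ind E)).obj Ind.yoneda ⋙ ext D (Ind E)

/-- The bifunctor `Ind C ⥤ Ind D ⥤ Ind E` extending `P` and preserving filtered colimits in each
variable. -/
noncomputable def indBi : Ind C ⥤ Ind D ⥤ Ind E := (ext C (Ind D ⥤ Ind E)).obj (indRight P)

instance presFilt_indBi : PresFilt (indBi P) := presFilt_ext _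

instance presFilt_indBi_flip_obj (Y : Ind D) : PresFilt ((indBi P).flip.obj Y) :=
  ⟨fun J _ _ ↦
    have := (presFilt_indBi P).1 J
    inferInstanceAs (PreservesColimitsOfShape J (indBi P ⋙ (evaluation _ _).obj Y))⟩

instance presFilt_indBi_obj (X : Ind C) : PresFilt ((indBi P).obj X) :=
  presFilt_obj_of_presFilt_flip (indBi P) (fun c ↦ ⟨fun J _ _ ↦
    have : PreservesColimitsOfShape J ((indRight P).obj c) := (presFilt_ext (P.obj c ⋙ Ind.yoneda)).1 J
    preservesColimitsOfShape_of_natIso ((extIso (indRight P)).app c)⟩) X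

/-- The comparison `P(c, d) ≅ c ⊠ d`. -/
noncomputable def biIso (c : C) (d : D) : Ind.yoneda.obj ((P.obj c).obj d) ≅
    ((indBi P).obj (Ind.yoneda.obj c)).obj (Ind.yoneda.obj d) :=
  (extIso (P.obj c ⋙ Ind.yoneda)).app d ≪≫ ((extIso (indRight P)).app c).app (Ind.yoneda.obj d)

theorem biIso_natural_left {c c' : C} (f : c ⟶ c') (d : D) :
    Ind.yoneda.map ((P.map f).app d) ≫ (biIso P c' d).hom =
      (biIso P c d).hom ≫ ((indBi P).map (Ind.yoneda.map f)).app _ := by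
  have h1 := NatTrans.congr_app (extIso_naturality (Functor.whiskerRight (P.map f) Ind.yoneda)) d
  have h2 := NatTrans.congr_app ((extIso (indRight P)).hom.naturality f) (Ind.yoneda.obj d)
  have h1' := h1 =≫ ((extIso (indRight P)).hom.app c').app (Ind.yoneda.obj d)
  have h2' := (extIso (P.obj c ⋙ Ind.yoneda)).hom.app d ≫= h2
  exact ((Category.assoc _ _ _).symm.trans h1').trans
    ((Category.assoc _ _ _).trans (h2'.trans (Category.assoc _ _ _).symm))

theorem biIso_natural_right (c : C) {d d' : D} (f : d ⟶ d') :
    Ind.yoneda.map ((P.obj c).map f) ≫ (biIso P c d').hom =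
      (biIso P c d).hom ≫ ((indBi P).obj _).map (Ind.yoneda.map f) := by
  have h1 := (extIso (P.obj c ⋙ Ind.yoneda)).hom.naturality f
  have h2 := ((extIso (indRight P)).hom.app c).naturality (Ind.yoneda.map f)
  have h1' := h1 =≫ ((extIso (indRight P)).hom.app c).app (Ind.yoneda.obj d')
  have h2' := (extIso (P.obj c ⋙ Ind.yoneda)).hom.app d ≫= h2
  exact ((Category.assoc _ _ _).symm.trans h1').trans
    ((Category.assoc _ _ _).trans (h2'.trans (Category.assoc _ _ _).symm))

variable {P} {X X' : Ind C} {Y Y' : Ind D}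

/-- The morphism `P(c, d) ⟶ X ⊠ Y` determined by `u : c ⟶ X` and `w : d ⟶ Y`. -/
noncomputable def pair (P : C ⥤ D ⥤ E) {c : C} {d : D} (u : Ind.yoneda.obj c ⟶ X)
    (w : Ind.yoneda.obj d ⟶ Y) :
    Ind.yoneda.obj ((P.obj c).obj d) ⟶ ((indBi P).obj X).obj Y :=
  (biIso P c d).hom ≫ ((indBi P).map u).app _ ≫ ((indBi P).obj X).map w

variable {c c' : C} {d d' : D} (u : Ind.yoneda.obj c ⟶ X) (w : Ind.yoneda.obj d ⟶ Y)

theorem pair_map_left (f : X ⟶ X') :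
    pair P u w ≫ ((indBi P).map f).app Y = pair P (u ≫ f) w := by
  simp [pair]

theorem pair_map_right (g : Y ⟶ Y') :
    pair P u w ≫ ((indBi P).obj X).map g = pair P u (w ≫ g) := by
  simp [pair]

theorem map_left_pair (f : c' ⟶ c) :
    Ind.yoneda.map ((P.map f).app d) ≫ pair P u w = pair P (Ind.yoneda.map f ≫ u) w := by
  rw [pair, reassoc_of% biIso_natural_left]
  simp [pair]

theorem map_right_pair (g : d' ⟶ d) :
    Ind.yoneda.map ((P.obj c).map g) ≫ pair P u w = pair P u (Ind.yoneda.map g ≫ w) := by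
  rw [pair, reassoc_of% biIso_natural_right]
  simp [pair]

theorem pair_id (c : C) (d : D) :
    pair P (𝟙 (Ind.yoneda.obj c)) (𝟙 (Ind.yoneda.obj d)) = (biIso P c d).hom := by
  simp [pair]

/-- Morphisms out of `X ⊠ Y` are determined by their values on pairs. -/
theorem pair_hom_ext {Z : Ind E} {f g : ((indBi P).obj X).obj Y ⟶ Z}
    (h : ∀ (c : C) (d : D) (u : Ind.yoneda.obj c ⟶ X) (w : Ind.yoneda.obj d ⟶ Y),
      pair P u w ≫ f = pair P u w ≫ g) : f = g := by
  refine hom_ext ((indBi P).flip.obj Y) fun c u ↦ ?_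
  refine hom_ext ((indBi P).obj (Ind.yoneda.obj c)) fun d w ↦ ?_
  rw [← cancel_epi (biIso P c d).hom]
  simpa [pair] using h c d u w

/-- Every morphism `e ⟶ X ⊠ Y` factors through a pair. -/
theorem pair_surj (e : E) (f : Ind.yoneda.obj e ⟶ ((indBi P).obj X).obj Y) :
    ∃ (c : C) (d : D) (u : Ind.yoneda.obj c ⟶ X) (w : Ind.yoneda.obj d ⟶ Y)
      (g : e ⟶ (P.obj c).obj d), f = Ind.yoneda.map g ≫ pair P u w := by
  obtain ⟨i, p, hp⟩ := IsFinitelyPresentable.exists_hom_of_isColimit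
    (isColimitOfPreserves ((indBi P).flip.obj Y) (presIsColimit X)) f
  obtain ⟨j, q, hq⟩ := IsFinitelyPresentable.exists_hom_of_isColimit
    (isColimitOfPreserves ((indBi P).obj (Ind.yoneda.obj (X.presentation.F.obj i)))
      (presIsColimit Y)) p
  let c := X.presentation.F.obj i
  let d := Y.presentation.F.obj j
  let u : Ind.yoneda.obj c ⟶ X := (presCocone X).ι.app i
  let w : Ind.yoneda.obj d ⟶ Y := (presCocone Y).ι.app j
  have hq' : q ≫ ((indBi P).obj (Ind.yoneda.obj c)).map w = p := hq
  have hp' : p ≫ ((indBi P).map u).app Y = f := hp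
  obtain ⟨g, hg⟩ := Ind.yoneda.map_surjective (q ≫ (biIso P c d).inv)
  refine ⟨c, d, u, w, g, ?_⟩
  rw [hg, ← hp', ← hq', pair]
  simp only [Category.assoc]
  rw [Iso.inv_hom_id_assoc, NatTrans.naturality]
  rfl

/-- A compatible family of morphisms on pairs is given by a morphism out of `G (X ⊠ Y)`. -/
theorem pair_exists_desc (P : C ⥤ D ⥤ E) (G : Ind E ⥤ T) [PresFilt G] (X : Ind C) (Y : Ind D)
    (W : T) (φ : ∀ (c : C) (d : D), (Ind.yoneda.obj c ⟶ X) → (Ind.yoneda.obj d ⟶ Y) →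
      (G.obj (Ind.yoneda.obj ((P.obj c).obj d)) ⟶ W))
    (h₁ : ∀ (c c' : C) (d : D) (f : c ⟶ c') (u : Ind.yoneda.obj c' ⟶ X)
      (w : Ind.yoneda.obj d ⟶ Y),
      G.map (Ind.yoneda.map ((P.map f).app d)) ≫ φ c' d u w = φ c d (Ind.yoneda.map f ≫ u) w)
    (h₂ : ∀ (c : C) (d d' : D) (f : d ⟶ d') (u : Ind.yoneda.obj c ⟶ X)
      (w : Ind.yoneda.obj d' ⟶ Y),
      G.map (Ind.yoneda.map ((P.obj c).map f)) ≫ φ c d' u w = φ c d u (Ind.yoneda.map f ≫ w)) :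
    ∃ f : G.obj (((indBi P).obj X).obj Y) ⟶ W, ∀ (c : C) (d : D) (u : Ind.yoneda.obj c ⟶ X)
      (w : Ind.yoneda.obj d ⟶ Y), G.map (pair P u w) ≫ f = φ c d u w := by
  have ex (c : C) (u : Ind.yoneda.obj c ⟶ X) :=
    exists_desc ((indBi P).obj (Ind.yoneda.obj c) ⋙ G) Y W
      (fun d w ↦ G.map (biIso P c d).inv ≫ φ c d u w) (fun d d' f w ↦ by
        rw [← cancel_epi (G.map (biIso P c d).hom), ← Category.assoc, Functor.comp_map,
          ← G.map_comp, ← biIso_natural_right, ← h₂]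
        simp only [← G.map_comp_assoc, Category.assoc, Iso.hom_inv_id_assoc, Iso.hom_inv_id, Category.comp_id])
  choose a ha using ex
  obtain ⟨f, hf⟩ := exists_desc ((indBi P).flip.obj Y ⋙ G) X W a (fun c c' f u ↦ by
    refine hom_ext ((indBi P).obj (Ind.yoneda.obj c) ⋙ G) fun d w ↦ ?_
    rw [ha, ← h₁, ← cancel_epi (G.map (biIso P c d).hom)]
    refine Eq.trans (b := G.map ((biIso P c d).hom ≫ ((indBi P).map (Ind.yoneda.map f)).app _) ≫
      ((indBi P).obj (Ind.yoneda.obj c') ⋙ G).map w ≫ a c' u) ?_ ?_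
    · simp only [Functor.comp_map, Functor.flip_obj_map, ← G.map_comp_assoc, Category.assoc,
        NatTrans.naturality]
    · rw [ha, ← biIso_natural_left]
      simp only [← G.map_comp_assoc, Category.assoc, Iso.hom_inv_id_assoc, Iso.hom_inv_id, Category.comp_id])
  refine ⟨f, fun c d u w ↦ ?_⟩
  rw [pair, ← NatTrans.naturality, G.map_comp, G.map_comp, Category.assoc, Category.assoc]
  refine (congrArg (fun t ↦ G.map (biIso P c d).hom ≫ G.map (((indBi P).obj _).map w) ≫ t)
    (hf c u)).trans ?_
  refine (congrArg (fun t ↦ G.map (biIso P c d).hom ≫ t) (ha c u d w)).trans ?_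
  rw [← G.map_comp_assoc, Iso.hom_inv_id, G.map_id, Category.id_comp]

end Two

section Three

variable {C₁ : Type u₁} [Category.{v} C₁] {C₂ : Type u₂} [Category.{v} C₂]
  {C₃ : Type u₃} [Category.{v} C₃] {C₁₂ : Type u₄} [Category.{v} C₁₂]
  {C₂₃ : Type u₅} [Category.{v} C₂₃] {C₄ : Type u₆} [Category.{v} C₄]
  {P : C₁ ⥤ C₂ ⥤ C₁₂} {Q : C₁₂ ⥤ C₃ ⥤ C₄} {R : C₂ ⥤ C₃ ⥤ C₂₃} {S : C₁ ⥤ C₂₃ ⥤ C₄}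
  {X : Ind C₁} {Y : Ind C₂} {Z : Ind C₃} {W : Ind C₄}

theorem pair_left_hom_ext {f g : ((indBi Q).obj (((indBi P).obj X).obj Y)).obj Z ⟶ W}
    (h : ∀ (c : C₁) (d : C₂) (e : C₃) (u : Ind.yoneda.obj c ⟶ X) (w : Ind.yoneda.obj d ⟶ Y)
      (x : Ind.yoneda.obj e ⟶ Z),
      pair Q (pair P u w) x ≫ f = pair Q (pair P u w) x ≫ g) : f = g := by
  refine pair_hom_ext fun c d u w ↦ ?_
  obtain ⟨c, d, u, w, g, rfl⟩ := pair_surj _ u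
  rw [← map_left_pair, Category.assoc, Category.assoc, h]

theorem pair_right_hom_ext {f g : ((indBi S).obj X).obj (((indBi R).obj Y).obj Z) ⟶ W}
    (h : ∀ (c : C₁) (d : C₂) (e : C₃) (u : Ind.yoneda.obj c ⟶ X) (w : Ind.yoneda.obj d ⟶ Y)
      (x : Ind.yoneda.obj e ⟶ Z),
      pair S u (pair R w x) ≫ f = pair S u (pair R w x) ≫ g) : f = g := by
  refine pair_hom_ext fun c d u w ↦ ?_
  obtain ⟨c, d, w, x, g, rfl⟩ := pair_surj _ w
  rw [← map_right_pair, Category.assoc, Category.assoc, h]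

variable (P Q R S X Y Z W)

theorem pair_left_exists_desc
    (φ : ∀ (c : C₁) (d : C₂) (e : C₃), (Ind.yoneda.obj c ⟶ X) → (Ind.yoneda.obj d ⟶ Y) →
      (Ind.yoneda.obj e ⟶ Z) → (Ind.yoneda.obj ((Q.obj ((P.obj c).obj d)).obj e) ⟶ W))
    (h₁ : ∀ (c c' : C₁) (d : C₂) (e : C₃) (f : c ⟶ c') (u : Ind.yoneda.obj c' ⟶ X)
      (w : Ind.yoneda.obj d ⟶ Y) (x : Ind.yoneda.obj e ⟶ Z),
      Ind.yoneda.map ((Q.map ((P.map f).app d)).app e) ≫ φ c' d e u w x =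
        φ c d e (Ind.yoneda.map f ≫ u) w x)
    (h₂ : ∀ (c : C₁) (d d' : C₂) (e : C₃) (f : d ⟶ d') (u : Ind.yoneda.obj c ⟶ X)
      (w : Ind.yoneda.obj d' ⟶ Y) (x : Ind.yoneda.obj e ⟶ Z),
      Ind.yoneda.map ((Q.map ((P.obj c).map f)).app e) ≫ φ c d' e u w x =
        φ c d e u (Ind.yoneda.map f ≫ w) x)
    (h₃ : ∀ (c : C₁) (d : C₂) (e e' : C₃) (f : e ⟶ e') (u : Ind.yoneda.obj c ⟶ X)
      (w : Ind.yoneda.obj d ⟶ Y) (x : Ind.yoneda.obj e' ⟶ Z),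
      Ind.yoneda.map ((Q.obj ((P.obj c).obj d)).map f) ≫ φ c d e' u w x =
        φ c d e u w (Ind.yoneda.map f ≫ x)) :
    ∃ f : ((indBi Q).obj (((indBi P).obj X).obj Y)).obj Z ⟶ W,
      ∀ (c : C₁) (d : C₂) (e : C₃) (u : Ind.yoneda.obj c ⟶ X) (w : Ind.yoneda.obj d ⟶ Y)
        (x : Ind.yoneda.obj e ⟶ Z), pair Q (pair P u w) x ≫ f = φ c d e u w x := by
  have ex (c : C₁) (d : C₂) (u : Ind.yoneda.obj c ⟶ X) (w : Ind.yoneda.obj d ⟶ Y) :=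
    exists_desc ((indBi Q).obj (Ind.yoneda.obj ((P.obj c).obj d))) Z W
      (fun e x ↦ (biIso Q _ e).inv ≫ φ c d e u w x) (fun e e' f x ↦ by
        rw [← cancel_epi (biIso Q _ e).hom, ← Category.assoc, ← biIso_natural_right]
        simp [h₃])
  choose a ha using ex
  have ha' (c : C₁) (d : C₂) (e : C₃) (u : Ind.yoneda.obj c ⟶ X) (w : Ind.yoneda.obj d ⟶ Y)
      (x : Ind.yoneda.obj e ⟶ Z) : pair Q (𝟙 _) x ≫ a c d u w = φ c d e u w x := by
    simp [pair, ha]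
  have key (c c' : C₁) (d d' : C₂) (f : (P.obj c).obj d ⟶ (P.obj c').obj d')
      (u : Ind.yoneda.obj c ⟶ X) (w : Ind.yoneda.obj d ⟶ Y)
      (u' : Ind.yoneda.obj c' ⟶ X) (w' : Ind.yoneda.obj d' ⟶ Y)
      (h : ∀ e (x : Ind.yoneda.obj e ⟶ Z),
        Ind.yoneda.map ((Q.map f).app e) ≫ φ c' d' e u' w' x = φ c d e u w x) :
      ((indBi Q).map (Ind.yoneda.map f)).app Z ≫ a c' d' u' w' = a c d u w := by
    refine hom_ext ((indBi Q).obj _) fun e x ↦ ?_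
    rw [← cancel_epi (biIso Q _ e).hom]
    refine Eq.trans (b := pair Q (𝟙 _) x ≫
      ((indBi Q).map (Ind.yoneda.map f)).app Z ≫ a c' d' u' w') (by simp [pair]) ?_
    rw [← Category.assoc, pair_map_left, Category.id_comp, ← Category.comp_id (Ind.yoneda.map f),
      ← map_left_pair, Category.assoc, ha', h, ← ha']
    simp [pair]
  obtain ⟨f, hf⟩ := pair_exists_desc P ((indBi Q).flip.obj Z) X Y W a
    (fun c c' d f u w ↦ key _ _ _ _ _ _ _ _ _ fun e x ↦ h₁ _ _ _ _ _ _ _ _)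
    (fun c d d' f u w ↦ key _ _ _ _ _ _ _ _ _ fun e x ↦ h₂ _ _ _ _ _ _ _ _)
  refine ⟨f, fun c d e u w x ↦ ?_⟩
  rw [← ha', ← hf]
  refine Eq.trans ?_ (Category.assoc _ _ _)
  exact congrArg (· ≫ f) (by
    refine Eq.trans ?_ (pair_map_left (𝟙 _) x (pair P u w)).symm
    rw [Category.id_comp])

theorem pair_right_exists_desc
    (φ : ∀ (c : C₁) (d : C₂) (e : C₃), (Ind.yoneda.obj c ⟶ X) → (Ind.yoneda.obj d ⟶ Y) →
      (Ind.yoneda.obj e ⟶ Z) → (Ind.yoneda.obj ((S.obj c).obj ((R.obj d).obj e)) ⟶ W))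
    (h₁ : ∀ (c c' : C₁) (d : C₂) (e : C₃) (f : c ⟶ c') (u : Ind.yoneda.obj c' ⟶ X)
      (w : Ind.yoneda.obj d ⟶ Y) (x : Ind.yoneda.obj e ⟶ Z),
      Ind.yoneda.map ((S.map f).app ((R.obj d).obj e)) ≫ φ c' d e u w x =
        φ c d e (Ind.yoneda.map f ≫ u) w x)
    (h₂ : ∀ (c : C₁) (d d' : C₂) (e : C₃) (f : d ⟶ d') (u : Ind.yoneda.obj c ⟶ X)
      (w : Ind.yoneda.obj d' ⟶ Y) (x : Ind.yoneda.obj e ⟶ Z),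
      Ind.yoneda.map ((S.obj c).map ((R.map f).app e)) ≫ φ c d' e u w x =
        φ c d e u (Ind.yoneda.map f ≫ w) x)
    (h₃ : ∀ (c : C₁) (d : C₂) (e e' : C₃) (f : e ⟶ e') (u : Ind.yoneda.obj c ⟶ X)
      (w : Ind.yoneda.obj d ⟶ Y) (x : Ind.yoneda.obj e' ⟶ Z),
      Ind.yoneda.map ((S.obj c).map ((R.obj d).map f)) ≫ φ c d e' u w x =
        φ c d e u w (Ind.yoneda.map f ≫ x)) :
    ∃ f : ((indBi S).obj X).obj (((indBi R).obj Y).obj Z) ⟶ W,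
      ∀ (c : C₁) (d : C₂) (e : C₃) (u : Ind.yoneda.obj c ⟶ X) (w : Ind.yoneda.obj d ⟶ Y)
        (x : Ind.yoneda.obj e ⟶ Z), pair S u (pair R w x) ≫ f = φ c d e u w x := by
  have key (c : C₁) (r r' : C₂₃) (f : r ⟶ r') (φ₁ : Ind.yoneda.obj ((S.obj c).obj r) ⟶ W)
      (φ₂ : Ind.yoneda.obj ((S.obj c).obj r') ⟶ W)
      (h : Ind.yoneda.map ((S.obj c).map f) ≫ φ₂ = φ₁) :
      ((indBi S).obj _).map (Ind.yoneda.map f) ≫ (biIso S c r').inv ≫ φ₂ =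
        (biIso S c r).inv ≫ φ₁ := by
    rw [← cancel_epi (biIso S c r).hom, ← Category.assoc, ← biIso_natural_right]
    simp [h]
  have ex (c : C₁) (u : Ind.yoneda.obj c ⟶ X) :=
    pair_exists_desc R ((indBi S).obj (Ind.yoneda.obj c)) Y Z W
      (fun d e w x ↦ (biIso S c _).inv ≫ φ c d e u w x)
      (fun _ _ _ _ _ _ ↦ key _ _ _ _ _ _ (h₂ _ _ _ _ _ _ _ _))
      (fun _ _ _ _ _ _ ↦ key _ _ _ _ _ _ (h₃ _ _ _ _ _ _ _ _))
  choose a ha using ex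
  have ha' (c : C₁) (d : C₂) (e : C₃) (u : Ind.yoneda.obj c ⟶ X) (w : Ind.yoneda.obj d ⟶ Y)
      (x : Ind.yoneda.obj e ⟶ Z) : pair S (𝟙 _) (pair R w x) ≫ a c u = φ c d e u w x := by
    simp [pair]
    simpa [pair] using (biIso S c _).hom ≫= ha c u d e w x
  obtain ⟨f, hf⟩ := exists_desc ((indBi S).flip.obj (((indBi R).obj Y).obj Z)) X W a
    (fun c c' f u ↦ by
      refine pair_right_hom_ext (S := S) (R := R) fun c₀ d e g w x ↦ ?_
      obtain ⟨g, rfl⟩ := Ind.yoneda.map_surjective g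
      rw [← Category.comp_id (Ind.yoneda.map g), ← map_left_pair, Category.assoc, Category.assoc]
      congr 1
      rw [ha', ← h₁, ← ha', ← Category.assoc, ← Category.assoc, map_left_pair, Category.comp_id]
      congr 1
      refine (pair_map_left (P := S) (𝟙 _) (pair R w x) (Ind.yoneda.map f)).trans ?_
      rw [Category.id_comp])
  refine ⟨f, fun c d e u w x ↦ ?_⟩
  rw [← ha', ← hf]
  refine Eq.trans ?_ (Category.assoc _ _ _)
  exact congrArg (· ≫ f) (by
    refine Eq.trans ?_ (pair_map_left (𝟙 _) (pair R w x) u).symm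
    rw [Category.id_comp])

end Three

section Assoc

variable {C₁ : Type u₁} [Category.{v} C₁] {C₂ : Type u₂} [Category.{v} C₂]
  {C₃ : Type u₃} [Category.{v} C₃] {C₁₂ : Type u₄} [Category.{v} C₁₂]
  {C₂₃ : Type u₅} [Category.{v} C₂₃] {C₄ : Type u₆} [Category.{v} C₄]
  (P : C₁ ⥤ C₂ ⥤ C₁₂) (Q : C₁₂ ⥤ C₃ ⥤ C₄) (R : C₂ ⥤ C₃ ⥤ C₂₃) (S : C₁ ⥤ C₂₃ ⥤ C₄)

/-- A natural isomorphism `(c ⊠ d) ⊠ e ≅ c ⊠ (d ⊠ e)`. -/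
structure Assoc where
  /-- the isomorphism -/
  iso : ∀ (c : C₁) (d : C₂) (e : C₃),
    (Q.obj ((P.obj c).obj d)).obj e ≅ (S.obj c).obj ((R.obj d).obj e)
  nat₁ : ∀ {c c' : C₁} (f : c ⟶ c') (d : C₂) (e : C₃),
    (Q.map ((P.map f).app d)).app e ≫ (iso c' d e).hom =
      (iso c d e).hom ≫ (S.map f).app ((R.obj d).obj e)
  nat₂ : ∀ (c : C₁) {d d' : C₂} (f : d ⟶ d') (e : C₃),
    (Q.map ((P.obj c).map f)).app e ≫ (iso c d' e).hom =
      (iso c d e).hom ≫ (S.obj c).map ((R.map f).app e)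
  nat₃ : ∀ (c : C₁) (d : C₂) {e e' : C₃} (f : e ⟶ e'),
    (Q.obj ((P.obj c).obj d)).map f ≫ (iso c d e').hom =
      (iso c d e).hom ≫ (S.obj c).map ((R.obj d).map f)

variable {P Q R S} (a : Assoc P Q R S) {X X' : Ind C₁} {Y Y' : Ind C₂} {Z Z' : Ind C₃}

theorem Assoc.exists_hom (X : Ind C₁) (Y : Ind C₂) (Z : Ind C₃) :
    ∃ f : ((indBi Q).obj (((indBi P).obj X).obj Y)).obj Z ⟶
        ((indBi S).obj X).obj (((indBi R).obj Y).obj Z),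
      ∀ (c : C₁) (d : C₂) (e : C₃) (u : Ind.yoneda.obj c ⟶ X) (w : Ind.yoneda.obj d ⟶ Y)
        (x : Ind.yoneda.obj e ⟶ Z),
        pair Q (pair P u w) x ≫ f =
          Ind.yoneda.map (a.iso c d e).hom ≫ pair S u (pair R w x) := by
  refine pair_left_exists_desc P Q X Y Z _ (fun c d e u w x ↦
    Ind.yoneda.map (a.iso c d e).hom ≫ pair S u (pair R w x)) ?_ ?_ ?_
  · intro c c' d e f u w x
    rw [← Category.assoc, ← Functor.map_comp, a.nat₁, Functor.map_comp, Category.assoc,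
      map_left_pair]
  · intro c d d' e f u w x
    rw [← Category.assoc, ← Functor.map_comp, a.nat₂, Functor.map_comp, Category.assoc,
      map_right_pair, map_left_pair]
  · intro c d e e' f u w x
    rw [← Category.assoc, ← Functor.map_comp, a.nat₃, Functor.map_comp, Category.assoc,
      map_right_pair, map_right_pair]

theorem Assoc.exists_inv (X : Ind C₁) (Y : Ind C₂) (Z : Ind C₃) :
    ∃ f : ((indBi S).obj X).obj (((indBi R).obj Y).obj Z) ⟶
        ((indBi Q).obj (((indBi P).obj X).obj Y)).obj Z,
      ∀ (c : C₁) (d : C₂) (e : C₃) (u : Ind.yoneda.obj c ⟶ X) (w : Ind.yoneda.obj d ⟶ Y)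
        (x : Ind.yoneda.obj e ⟶ Z),
        pair S u (pair R w x) ≫ f =
          Ind.yoneda.map (a.iso c d e).inv ≫ pair Q (pair P u w) x := by
  refine pair_right_exists_desc R S X Y Z _ (fun c d e u w x ↦
    Ind.yoneda.map (a.iso c d e).inv ≫ pair Q (pair P u w) x) ?_ ?_ ?_
  · intro c c' d e f u w x
    have h : (S.map f).app _ ≫ (a.iso c' d e).inv =
        (a.iso c d e).inv ≫ (Q.map ((P.map f).app d)).app e := by
      rw [Iso.comp_inv_eq, Category.assoc, a.nat₁, Iso.inv_hom_id_assoc]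
    rw [← Category.assoc, ← Functor.map_comp, h, Functor.map_comp, Category.assoc,
      map_left_pair, map_left_pair]
  · intro c d d' e f u w x
    have h : (S.obj c).map ((R.map f).app e) ≫ (a.iso c d' e).inv =
        (a.iso c d e).inv ≫ (Q.map ((P.obj c).map f)).app e := by
      rw [Iso.comp_inv_eq, Category.assoc, a.nat₂, Iso.inv_hom_id_assoc]
    rw [← Category.assoc, ← Functor.map_comp, h, Functor.map_comp, Category.assoc,
      map_left_pair, map_right_pair]
  · intro c d e e' f u w x
    have h : (S.obj c).map ((R.obj d).map f) ≫ (a.iso c d e').inv =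
        (a.iso c d e).inv ≫ (Q.obj ((P.obj c).obj d)).map f := by
      rw [Iso.comp_inv_eq, Category.assoc, a.nat₃, Iso.inv_hom_id_assoc]
    rw [← Category.assoc, ← Functor.map_comp, h, Functor.map_comp, Category.assoc,
      map_right_pair]

/-- The extension of the natural isomorphism `(c ⊠ d) ⊠ e ≅ c ⊠ (d ⊠ e)` to ind-objects. -/
noncomputable def Assoc.ind (X : Ind C₁) (Y : Ind C₂) (Z : Ind C₃) :
    ((indBi Q).obj (((indBi P).obj X).obj Y)).obj Z ≅
      ((indBi S).obj X).obj (((indBi R).obj Y).obj Z) where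
  hom := (a.exists_hom X Y Z).choose
  inv := (a.exists_inv X Y Z).choose
  hom_inv_id := by
    refine pair_left_hom_ext fun c d e u w x ↦ ?_
    rw [← Category.assoc, (a.exists_hom X Y Z).choose_spec, Category.assoc,
      (a.exists_inv X Y Z).choose_spec, ← Category.assoc, ← Functor.map_comp]
    simp
  inv_hom_id := by
    refine pair_right_hom_ext fun c d e u w x ↦ ?_
    rw [← Category.assoc, (a.exists_inv X Y Z).choose_spec, Category.assoc,
      (a.exists_hom X Y Z).choose_spec, ← Category.assoc, ← Functor.map_comp]
    simp

variable {c : C₁} {d : C₂} {e : C₃} (u : Ind.yoneda.obj c ⟶ X) (w : Ind.yoneda.obj d ⟶ Y)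
  (x : Ind.yoneda.obj e ⟶ Z)

theorem Assoc.pair_ind : pair Q (pair P u w) x ≫ (a.ind X Y Z).hom =
    Ind.yoneda.map (a.iso c d e).hom ≫ pair S u (pair R w x) :=
  (a.exists_hom X Y Z).choose_spec c d e u w x

end Assoc

section Unit

variable {C : Type u₁} [Category.{v} C] {D : Type u₂} [Category.{v} D]

/-- A functor on `Ind C` preserving filtered colimits and isomorphic to the inclusion of `C` on
objects of `C` is isomorphic to the identity. -/
theorem exists_unit_iso (F : Ind C ⥤ Ind C) [PresFilt F]
    (r : Ind.yoneda ⋙ F ≅ Ind.yoneda (C := C)) (X : Ind C) :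
    ∃ i : F.obj X ≅ X, ∀ (c : C) (u : Ind.yoneda.obj c ⟶ X),
      F.map u ≫ i.hom = r.hom.app c ≫ u := by
  obtain ⟨f, hf⟩ := exists_desc F X X (fun c u ↦ r.hom.app c ≫ u) (fun c c' f u ↦ by
    rw [← Category.assoc]
    exact (r.hom.naturality f =≫ u).trans (Category.assoc _ _ _))
  obtain ⟨g, hg⟩ := exists_desc (𝟭 (Ind C)) X (F.obj X) (fun c u ↦ r.inv.app c ≫ F.map u)
    (fun c c' f u ↦ by
      rw [F.map_comp, ← Category.assoc, ← Category.assoc]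
      exact r.inv.naturality f =≫ F.map u)
  refine ⟨⟨f, g, ?_, ?_⟩, hf⟩
  · refine hom_ext F fun c u ↦ ?_
    rw [← Category.assoc, hf, Category.assoc]
    refine (congrArg (r.hom.app c ≫ ·) (hg c u)).trans ?_
    simp
  · refine hom_ext (𝟭 (Ind C)) fun c u ↦ ?_
    rw [← Category.assoc, hg, Category.assoc, hf]
    simp

variable (P : C ⥤ D ⥤ C) (d₀ : D) (r : P.flip.obj d₀ ≅ 𝟭 C) (X : Ind C)

theorem exists_right_unit : ∃ i : ((indBi P).obj X).obj (Ind.yoneda.obj d₀) ≅ X,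
    ∀ (c : C) (u : Ind.yoneda.obj c ⟶ X),
      pair P u (𝟙 _) ≫ i.hom = Ind.yoneda.map (r.hom.app c) ≫ u := by
  obtain ⟨i, hi⟩ := exists_unit_iso ((indBi P).flip.obj (Ind.yoneda.obj d₀))
    (NatIso.ofComponents (fun c ↦ (biIso P c d₀).symm ≪≫ Ind.yoneda.mapIso (r.app c))
      (fun {c c'} f ↦ by
        have h := r.hom.naturality f
        rw [← cancel_epi (biIso P c d₀).hom]
        refine Eq.trans (b := ((biIso P c d₀).hom ≫ ((indBi P).map (Ind.yoneda.map f)).app _) ≫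
          (biIso P c' d₀).inv ≫ Ind.yoneda.map (r.hom.app c')) (by simp) ?_
        rw [← biIso_natural_left]
        refine Eq.trans (b := Ind.yoneda.map ((P.flip.obj d₀).map f ≫ r.hom.app c')) ?_ ?_
        · simp
        · rw [h]; simp)) X
  refine ⟨i, fun c u ↦ ?_⟩
  have := (biIso P c d₀).hom ≫= hi c u
  simpa [pair] using! this

/-- The extension of a natural isomorphism `c ⊠ d₀ ≅ c` to ind-objects. -/
noncomputable def rightUnit : ((indBi P).obj X).obj (Ind.yoneda.obj d₀) ≅ X :=
  (exists_right_unit P d₀ r X).choose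

theorem pair_rightUnit {c : C} (u : Ind.yoneda.obj c ⟶ X) :
    pair P u (𝟙 _) ≫ (rightUnit P d₀ r X).hom = Ind.yoneda.map (r.hom.app c) ≫ u :=
  (exists_right_unit P d₀ r X).choose_spec c u

variable (P : D ⥤ C ⥤ C) (d₀ : D) (r : P.obj d₀ ≅ 𝟭 C) (X : Ind C)

theorem exists_left_unit : ∃ i : ((indBi P).obj (Ind.yoneda.obj d₀)).obj X ≅ X,
    ∀ (c : C) (u : Ind.yoneda.obj c ⟶ X),
      pair P (𝟙 _) u ≫ i.hom = Ind.yoneda.map (r.hom.app c) ≫ u := by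
  obtain ⟨i, hi⟩ := exists_unit_iso ((indBi P).obj (Ind.yoneda.obj d₀))
    (NatIso.ofComponents (fun c ↦ (biIso P d₀ c).symm ≪≫ Ind.yoneda.mapIso (r.app c))
      (fun {c c'} f ↦ by
        have h := r.hom.naturality f
        rw [← cancel_epi (biIso P d₀ c).hom]
        refine Eq.trans (b := ((biIso P d₀ c).hom ≫ ((indBi P).obj _).map (Ind.yoneda.map f)) ≫
          (biIso P d₀ c').inv ≫ Ind.yoneda.map (r.hom.app c')) (by simp) ?_
        rw [← biIso_natural_right]
        refine Eq.trans (b := Ind.yoneda.map ((P.obj d₀).map f ≫ r.hom.app c')) ?_ ?_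
        · simp only [Category.assoc, Iso.hom_inv_id_assoc, Functor.map_comp]
        · rw [h]; simp)) X
  refine ⟨i, fun c u ↦ ?_⟩
  have := (biIso P d₀ c).hom ≫= hi c u
  simpa [pair] using! this

/-- The extension of a natural isomorphism `d₀ ⊠ c ≅ c` to ind-objects. -/
noncomputable def leftUnit : ((indBi P).obj (Ind.yoneda.obj d₀)).obj X ≅ X :=
  (exists_left_unit P d₀ r X).choose

theorem pair_leftUnit {c : C} (u : Ind.yoneda.obj c ⟶ X) :
    pair P (𝟙 _) u ≫ (leftUnit P d₀ r X).hom = Ind.yoneda.map (r.hom.app c) ≫ u :=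
  (exists_left_unit P d₀ r X).choose_spec c u

end Unit

section Monoidal

variable (A : Type u₁) [Category.{v} A] [MonoidalCategory A]

/-- The associator of a monoidal category. -/
def tensorAssoc : Assoc (curriedTensor A) (curriedTensor A) (curriedTensor A)
    (curriedTensor A) where
  iso c d e := α_ c d e
  nat₁ f d e := associator_naturality_left f d e
  nat₂ c _ _ f e := associator_naturality_middle c f e
  nat₃ c d _ _ f := associator_naturality_right c d f

noncomputable instance indMonoidalCategoryStruct : MonoidalCategoryStruct (Ind A) where
  tensorObj X Y := ((indBi (curriedTensor A)).obj X).obj Y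
  whiskerLeft X _ _ f := ((indBi (curriedTensor A)).obj X).map f
  whiskerRight f Y := ((indBi (curriedTensor A)).map f).app Y
  tensorUnit := Ind.yoneda.obj (𝟙_ A)
  associator X Y Z := (tensorAssoc A).ind X Y Z
  leftUnitor X := leftUnit (curriedTensor A) (𝟙_ A) (leftUnitorNatIso A) X
  rightUnitor X := rightUnit (curriedTensor A) (𝟙_ A) (rightUnitorNatIso A) X

variable {A} {X X' Y Y' Z W : Ind A} {c d e a b : A}

/-- The morphism `c ⊗ d ⟶ X ⊗ Y` determined by `c ⟶ X` and `d ⟶ Y`. -/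
noncomputable def tmul (u : Ind.yoneda.obj c ⟶ X) (w : Ind.yoneda.obj d ⟶ Y) :
    Ind.yoneda.obj (c ⊗ d) ⟶ X ⊗ Y := pair (curriedTensor A) u w

variable (u : Ind.yoneda.obj c ⟶ X) (w : Ind.yoneda.obj d ⟶ Y) (x : Ind.yoneda.obj e ⟶ Z)

theorem tmul_whiskerRight (f : X ⟶ X') : tmul u w ≫ f ▷ Y = tmul (u ≫ f) w :=
  pair_map_left u w f

theorem tmul_whiskerLeft (f : Y ⟶ Y') : tmul u w ≫ X ◁ f = tmul u (w ≫ f) :=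
  pair_map_right u w f

theorem tmul_tensorHom (f : X ⟶ X') (g : Y ⟶ Y') :
    tmul u w ≫ (f ⊗ₘ g) = tmul (u ≫ f) (w ≫ g) := by
  refine (Category.assoc _ _ _).symm.trans ?_
  refine (congrArg (· ≫ X' ◁ g) (tmul_whiskerRight u w f)).trans ?_
  exact tmul_whiskerLeft _ _ _

theorem map_tmul_left (f : a ⟶ c) :
    Ind.yoneda.map (f ▷ d) ≫ tmul u w = tmul (Ind.yoneda.map f ≫ u) w :=
  map_left_pair (P := curriedTensor A) u w f

theorem map_tmul_right (f : a ⟶ d) :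
    Ind.yoneda.map (c ◁ f) ≫ tmul u w = tmul u (Ind.yoneda.map f ≫ w) :=
  map_right_pair (P := curriedTensor A) u w f

theorem tmul_associator : tmul (tmul u w) x ≫ (α_ X Y Z).hom =
    Ind.yoneda.map (α_ c d e).hom ≫ tmul u (tmul w x) :=
  (tensorAssoc A).pair_ind u w x

theorem tmul_leftUnitor (f : a ⟶ 𝟙_ A) : tmul (Y := X) (Ind.yoneda.map f) u ≫ (λ_ X).hom =
    Ind.yoneda.map (f ▷ c ≫ (λ_ c).hom) ≫ u := by
  have h := map_tmul_left (𝟙 _) u f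
  rw [Category.comp_id] at h
  rw [← h, Functor.map_comp, Category.assoc, Category.assoc]
  exact congrArg (Ind.yoneda.map (f ▷ c) ≫ ·) (pair_leftUnit _ _ (leftUnitorNatIso A) X u)

theorem tmul_rightUnitor (f : a ⟶ 𝟙_ A) : tmul (X := X) u (Ind.yoneda.map f) ≫ (ρ_ X).hom =
    Ind.yoneda.map (c ◁ f ≫ (ρ_ c).hom) ≫ u := by
  have h := map_tmul_right u (𝟙 _) f
  rw [Category.comp_id] at h
  rw [← h, Functor.map_comp, Category.assoc, Category.assoc]
  exact congrArg (Ind.yoneda.map (c ◁ f) ≫ ·) (pair_rightUnit _ _ (rightUnitorNatIso A) X u)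

theorem tmul_hom_ext {f g : X ⊗ Y ⟶ W}
    (h : ∀ (c : A) (d : A) (u : Ind.yoneda.obj c ⟶ X) (w : Ind.yoneda.obj d ⟶ Y),
      tmul u w ≫ f = tmul u w ≫ g) : f = g := pair_hom_ext h

theorem tmul_surj (f : Ind.yoneda.obj e ⟶ X ⊗ Y) :
    ∃ (c : A) (d : A) (u : Ind.yoneda.obj c ⟶ X) (w : Ind.yoneda.obj d ⟶ Y)
      (g : e ⟶ c ⊗ d), f = Ind.yoneda.map g ≫ tmul u w := pair_surj e f

theorem tmul_hom_ext₃ {f g : (X ⊗ Y) ⊗ Z ⟶ W}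
    (h : ∀ (c d e : A) (u : Ind.yoneda.obj c ⟶ X) (w : Ind.yoneda.obj d ⟶ Y)
      (x : Ind.yoneda.obj e ⟶ Z), tmul (tmul u w) x ≫ f = tmul (tmul u w) x ≫ g) : f = g :=
  pair_left_hom_ext h

theorem tmul_hom_ext₄ {V : Ind A} {f g : ((X ⊗ Y) ⊗ Z) ⊗ V ⟶ W}
    (h : ∀ (c d e b : A) (u : Ind.yoneda.obj c ⟶ X) (w : Ind.yoneda.obj d ⟶ Y)
      (x : Ind.yoneda.obj e ⟶ Z) (y : Ind.yoneda.obj b ⟶ V),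
      tmul (tmul (tmul u w) x) y ≫ f = tmul (tmul (tmul u w) x) y ≫ g) : f = g := by
  refine tmul_hom_ext₃ fun c d e u w x ↦ ?_
  obtain ⟨c, d', u, w', g, rfl⟩ := tmul_surj u
  rw [← map_tmul_left, ← map_tmul_left, Category.assoc, Category.assoc, h]

/-- The monoidal structure on ind-objects extending that of `A` and preserving filtered colimits
in each variable. -/
noncomputable instance indMonoidalCategory : MonoidalCategory (Ind A) where
  tensorHom_def _ _ := rfl
  id_tensorHom_id _ _ := tmul_hom_ext fun c d u w ↦ by simp [tmul_tensorHom]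
  tensorHom_comp_tensorHom _ _ _ _ := tmul_hom_ext fun c d u w ↦ by
    rw [← Category.assoc, tmul_tensorHom, tmul_tensorHom, tmul_tensorHom]
    simp
  whiskerLeft_id _ _ := tmul_hom_ext fun c d u w ↦ by simp [tmul_whiskerLeft]
  id_whiskerRight _ _ := tmul_hom_ext fun c d u w ↦ by simp [tmul_whiskerRight]
  associator_naturality _ _ _ := tmul_hom_ext₃ fun c d e u w x ↦ by
    rw [← Category.assoc, tmul_tensorHom, tmul_tensorHom, tmul_associator, ← Category.assoc,
      tmul_associator, Category.assoc, tmul_tensorHom, tmul_tensorHom]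
  leftUnitor_naturality f := tmul_hom_ext fun c d u w ↦ by
    obtain ⟨u, rfl⟩ := Ind.yoneda.map_surjective u
    rw [← Category.assoc, tmul_whiskerLeft]
    refine (tmul_leftUnitor _ u).trans ?_
    rw [← Category.assoc, ← Category.assoc]
    exact congrArg (· ≫ f) (tmul_leftUnitor _ u).symm
  rightUnitor_naturality f := tmul_hom_ext fun c d u w ↦ by
    obtain ⟨w, rfl⟩ := Ind.yoneda.map_surjective w
    rw [← Category.assoc, tmul_whiskerRight]
    refine (tmul_rightUnitor _ w).trans ?_
    rw [← Category.assoc, ← Category.assoc]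
    exact congrArg (· ≫ f) (tmul_rightUnitor _ w).symm
  pentagon X Y Z V := tmul_hom_ext₄ fun c d e b u w x y ↦ by
    rw [← Category.assoc, tmul_whiskerRight, tmul_associator, ← map_tmul_left, Category.assoc,
      ← Category.assoc (tmul _ _), tmul_associator, Category.assoc, tmul_whiskerLeft,
      tmul_associator, ← map_tmul_right, ← Category.assoc (tmul _ _), tmul_associator,
      Category.assoc, tmul_associator]
    simp only [← Category.assoc, ← Functor.map_comp]
    simp
  triangle X Y := tmul_hom_ext₃ fun c d e u w x ↦ by
    obtain ⟨w, rfl⟩ := Ind.yoneda.map_surjective w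
    rw [← Category.assoc, tmul_associator, Category.assoc, tmul_whiskerLeft, tmul_whiskerRight]
    refine (congrArg (fun t ↦ _ ≫ tmul u t) (tmul_leftUnitor x w)).trans ?_
    refine Eq.trans ?_ (congrArg (fun t ↦ tmul t x) (tmul_rightUnitor u w)).symm
    rw [← map_tmul_right, ← map_tmul_left, ← Category.assoc, ← Functor.map_comp]
    simp

end Monoidal

section RightAction

open MonoidalRightAction

variable (A : Type u₁) [Category.{v} A] [MonoidalCategory A] (M : Type u₂) [Category.{v} M]
  [MonoidalRightAction A M]

/-- The action of `A` on `M` as a bifunctor. -/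
def actBi : M ⥤ A ⥤ M where
  obj m :=
    { obj := fun a ↦ m ⊙ᵣ a
      map := fun f ↦ m ⊴ᵣ f }
  map f :=
    { app := fun a ↦ f ⊵ᵣ a
      naturality := fun _ _ g ↦ action_exchange f g }

/-- The associator of a module category. -/
def actAssoc : Assoc (actBi A M) (actBi A M) (curriedTensor A) (actBi A M) where
  iso m a b := (αᵣ m a b).symm
  nat₁ f a b := by
    have h : (f ⊵ᵣ a) ⊵ᵣ b ≫ (αᵣ _ a b).inv = (αᵣ _ a b).inv ≫ f ⊵ᵣ (a ⊗ b) := by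
      rw [Iso.comp_inv_eq, Category.assoc, Iso.eq_inv_comp]
      simp
    exact h
  nat₂ m _ _ f b := by
    have h : (m ⊴ᵣ f) ⊵ᵣ b ≫ (αᵣ m _ b).inv = (αᵣ m _ b).inv ≫ m ⊴ᵣ (f ▷ b) := by
      rw [Iso.comp_inv_eq, Category.assoc, Iso.eq_inv_comp]
      simp
    exact h
  nat₃ m a _ _ f := by
    have h : (m ⊙ᵣ a) ⊴ᵣ f ≫ (αᵣ m a _).inv = (αᵣ m a _).inv ≫ m ⊴ᵣ (a ◁ f) := by
      rw [Iso.comp_inv_eq, Category.assoc, Iso.eq_inv_comp]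
      simp
    exact h

/-- The unit isomorphism of a module category. -/
def actUnit : (actBi A M).flip.obj (𝟙_ A) ≅ 𝟭 M :=
  NatIso.ofComponents (fun m ↦ ρᵣ m) (fun f ↦ (actionUnitIso_hom_naturality f).symm)

noncomputable instance indRightActionStruct : MonoidalRightActionStruct (Ind A) (Ind M) where
  actionObj X Y := ((indBi (actBi A M)).obj X).obj Y
  actionHomRight X _ _ f := ((indBi (actBi A M)).obj X).map f
  actionHomLeft f Y := ((indBi (actBi A M)).map f).app Y
  actionAssocIso X Y Z := ((actAssoc A M).ind X Y Z).symm
  actionUnitIso X := rightUnit (actBi A M) (𝟙_ A) (actUnit A M) X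

variable {A M} {X X' W : Ind M} {Y Y' Z Z' : Ind A} {m n : M} {a b c d : A}

/-- The morphism `m ⊙ a ⟶ X ⊙ Y` determined by `m ⟶ X` and `a ⟶ Y`. -/
noncomputable def amul (u : Ind.yoneda.obj m ⟶ X) (w : Ind.yoneda.obj a ⟶ Y) :
    Ind.yoneda.obj (m ⊙ᵣ a) ⟶ X ⊙ᵣ Y := pair (actBi A M) u w

variable (u : Ind.yoneda.obj m ⟶ X) (w : Ind.yoneda.obj a ⟶ Y) (x : Ind.yoneda.obj b ⟶ Z)

theorem amul_actionHomLeft (f : X ⟶ X') : amul u w ≫ f ⊵ᵣ Y = amul (u ≫ f) w :=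
  pair_map_left u w f

theorem amul_actionHomRight (f : Y ⟶ Y') : amul u w ≫ X ⊴ᵣ f = amul u (w ≫ f) :=
  pair_map_right u w f

theorem amul_actionHom (f : X ⟶ X') (g : Y ⟶ Y') :
    amul u w ≫ (f ⊙ᵣₘ g) = amul (u ≫ f) (w ≫ g) := by
  refine (Category.assoc _ _ _).symm.trans ?_
  refine (congrArg (· ≫ X' ⊴ᵣ g) (amul_actionHomLeft u w f)).trans ?_
  exact amul_actionHomRight _ _ _

theorem map_amul_left (f : n ⟶ m) :
    Ind.yoneda.map (f ⊵ᵣ a) ≫ amul u w = amul (Ind.yoneda.map f ≫ u) w :=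
  map_left_pair (P := actBi A M) u w f

theorem map_amul_right (f : b ⟶ a) :
    Ind.yoneda.map (m ⊴ᵣ f) ≫ amul u w = amul u (Ind.yoneda.map f ≫ w) :=
  map_right_pair (P := actBi A M) u w f

theorem amul_actionAssocIso : amul u (tmul w x) ≫ (αᵣ X Y Z).hom =
    Ind.yoneda.map (αᵣ m a b).hom ≫ amul (amul u w) x := by
  have h : amul (amul u w) x ≫ (αᵣ X Y Z).inv =
    Ind.yoneda.map (αᵣ m a b).inv ≫ amul u (tmul w x) := (actAssoc A M).pair_ind u w x
  rw [← Iso.eq_comp_inv, Category.assoc, h, ← Category.assoc, ← Functor.map_comp,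
    Iso.hom_inv_id, CategoryTheory.Functor.map_id, Category.id_comp]

theorem amul_actionUnitIso (f : a ⟶ 𝟙_ A) :
    amul (X := X) u (Ind.yoneda.map f) ≫ (ρᵣ[Ind A] X).hom =
    Ind.yoneda.map (m ⊴ᵣ f ≫ (ρᵣ m).hom) ≫ u := by
  have h := map_amul_right u (𝟙 _) f
  rw [Category.comp_id] at h
  rw [← h, Functor.map_comp, Category.assoc, Category.assoc]
  exact congrArg (Ind.yoneda.map (m ⊴ᵣ f) ≫ ·) (pair_rightUnit _ _ (actUnit A M) X u)

theorem amul_hom_ext {f g : X ⊙ᵣ Y ⟶ W}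
    (h : ∀ (c : M) (d : A) (u : Ind.yoneda.obj c ⟶ X) (w : Ind.yoneda.obj d ⟶ Y),
      amul u w ≫ f = amul u w ≫ g) : f = g := pair_hom_ext h

theorem amul_hom_ext₃ {f g : X ⊙ᵣ (Y ⊗ Z) ⟶ W}
    (h : ∀ (c : M) (d e : A) (u : Ind.yoneda.obj c ⟶ X) (w : Ind.yoneda.obj d ⟶ Y)
      (x : Ind.yoneda.obj e ⟶ Z), amul u (tmul w x) ≫ f = amul u (tmul w x) ≫ g) : f = g :=
  pair_right_hom_ext h

theorem amul_hom_ext₄ {V : Ind A} {f g : X ⊙ᵣ ((Y ⊗ Z) ⊗ V) ⟶ W}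
    (h : ∀ (c : M) (d e b : A) (u : Ind.yoneda.obj c ⟶ X) (w : Ind.yoneda.obj d ⟶ Y)
      (x : Ind.yoneda.obj e ⟶ Z) (y : Ind.yoneda.obj b ⟶ V),
      amul u (tmul (tmul w x) y) ≫ f = amul u (tmul (tmul w x) y) ≫ g) : f = g := by
  refine amul_hom_ext₃ fun c d e u w x ↦ ?_
  obtain ⟨d, d', w, w', g, rfl⟩ := tmul_surj w
  rw [← map_tmul_left, ← map_amul_right, Category.assoc, Category.assoc, h]

/-- The right action of ind-objects of `A` on ind-objects of `M` extending that of `A` on `M` and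
preserving filtered colimits in each variable. -/
noncomputable instance indRightAction : MonoidalRightAction (Ind A) (Ind M) where
  actionHom_def _ _ := rfl
  actionHomRight_id _ _ := amul_hom_ext fun c d u w ↦ by simp [amul_actionHomRight]
  id_actionHomLeft _ _ := amul_hom_ext fun c d u w ↦ by simp [amul_actionHomLeft]
  actionHom_comp _ _ _ _ := amul_hom_ext fun c d u w ↦ by
    rw [← Category.assoc, amul_actionHom, amul_actionHom, amul_actionHom]
    simp
  actionAssocIso_hom_naturality _ _ _ := amul_hom_ext₃ fun c d e u w x ↦ by
    rw [← Category.assoc, amul_actionHom, tmul_tensorHom, amul_actionAssocIso, ← Category.assoc,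
      amul_actionAssocIso, Category.assoc, amul_actionHom, amul_actionHom]
  actionUnitIso_hom_naturality f := amul_hom_ext fun c d u w ↦ by
    obtain ⟨w, rfl⟩ := Ind.yoneda.map_surjective w
    rw [← Category.assoc, ← Category.assoc, amul_actionHomLeft]
    refine (congrArg (· ≫ f) (amul_actionUnitIso u w)).trans ?_
    exact (Category.assoc _ _ _).trans (amul_actionUnitIso _ w).symm
  actionHomRight_whiskerRight f Z X := by
    rw [← Category.assoc, ← cancel_mono (αᵣ _ _ _).hom, Category.assoc, Category.assoc,
      Iso.inv_hom_id, Category.comp_id]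
    refine amul_hom_ext₃ fun c d e u w x ↦ ?_
    rw [← Category.assoc, ← Category.assoc, amul_actionAssocIso, amul_actionHomRight,
      tmul_whiskerRight, amul_actionAssocIso, Category.assoc, amul_actionHomLeft,
      amul_actionHomRight]
  whiskerRight_actionHomLeft Z _ _ f X := by
    rw [← Category.assoc, ← cancel_mono (αᵣ _ _ _).hom, Category.assoc, Category.assoc,
      Iso.inv_hom_id, Category.comp_id]
    refine amul_hom_ext₃ fun c d e u w x ↦ ?_
    rw [← Category.assoc, ← Category.assoc, amul_actionAssocIso, amul_actionHomRight,
      tmul_whiskerLeft, amul_actionAssocIso, Category.assoc, amul_actionHomRight]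
  actionHom_associator Y Z V X := amul_hom_ext₄ fun c d e b u w x y ↦ by
    rw [← Category.assoc, amul_actionHomRight, tmul_associator, ← map_amul_right,
      Category.assoc, ← Category.assoc (amul _ _), amul_actionAssocIso, Category.assoc,
      amul_actionAssocIso, ← Category.assoc (amul _ _), amul_actionAssocIso, Category.assoc,
      amul_actionHomLeft, amul_actionAssocIso, ← map_amul_left]
    simp only [← Category.assoc, ← Functor.map_comp]
    simp
  actionHom_leftUnitor Y X := amul_hom_ext₃ fun c d e u w x ↦ by
    obtain ⟨w, rfl⟩ := Ind.yoneda.map_surjective w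
    rw [← Category.assoc, amul_actionAssocIso, Category.assoc, amul_actionHomLeft,
      amul_actionHomRight]
    refine (congrArg (fun t ↦ amul u t) (tmul_leftUnitor x w)).trans ?_
    refine Eq.trans ?_ (congrArg (fun t ↦ _ ≫ amul t x) (amul_actionUnitIso u w)).symm
    rw [← map_amul_right, ← map_amul_left, ← Category.assoc, ← Functor.map_comp]
    simp
  actionHom_rightUnitor Y X := amul_hom_ext₃ fun c d e u w x ↦ by
    obtain ⟨x, rfl⟩ := Ind.yoneda.map_surjective x
    rw [← Category.assoc, amul_actionAssocIso, Category.assoc, amul_actionHomRight]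
    refine (congrArg (fun t ↦ amul u t) (tmul_rightUnitor w x)).trans ?_
    refine Eq.trans ?_ (congrArg (fun t ↦ _ ≫ t) (amul_actionUnitIso _ x)).symm
    rw [← map_amul_right, ← Category.assoc, ← Functor.map_comp]
    simp

end RightAction

section Desc

variable {C₁ : Type u₁} [Category.{v} C₁] {C₂ : Type u₂} [Category.{v} C₂]
  {U : Type u₃} [Category.{w} U]

theorem exists_desc₂ (B : Ind C₁ ⥤ Ind C₂ ⥤ U) [∀ Y, PresFilt (B.flip.obj Y)]
    [∀ X, PresFilt (B.obj X)] (X : Ind C₁) (Y : Ind C₂) (Z : U)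
    (φ : ∀ (c : C₁) (d : C₂), (Ind.yoneda.obj c ⟶ X) → (Ind.yoneda.obj d ⟶ Y) →
      ((B.obj (Ind.yoneda.obj c)).obj (Ind.yoneda.obj d) ⟶ Z))
    (h₁ : ∀ (c c' : C₁) (d : C₂) (f : c ⟶ c') (u : Ind.yoneda.obj c' ⟶ X)
      (w : Ind.yoneda.obj d ⟶ Y),
      (B.map (Ind.yoneda.map f)).app _ ≫ φ c' d u w = φ c d (Ind.yoneda.map f ≫ u) w)
    (h₂ : ∀ (c : C₁) (d d' : C₂) (f : d ⟶ d') (u : Ind.yoneda.obj c ⟶ X)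
      (w : Ind.yoneda.obj d' ⟶ Y),
      (B.obj _).map (Ind.yoneda.map f) ≫ φ c d' u w = φ c d u (Ind.yoneda.map f ≫ w)) :
    ∃ f : (B.obj X).obj Y ⟶ Z, ∀ (c : C₁) (d : C₂) (u : Ind.yoneda.obj c ⟶ X)
      (w : Ind.yoneda.obj d ⟶ Y), (B.map u).app _ ≫ (B.obj X).map w ≫ f = φ c d u w := by
  have ex (c : C₁) (u : Ind.yoneda.obj c ⟶ X) :=
    exists_desc (B.obj (Ind.yoneda.obj c)) Y Z (fun d w ↦ φ c d u w)
      (fun d d' f w ↦ h₂ c d d' f u w)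
  choose a ha using ex
  obtain ⟨f, hf⟩ := exists_desc (B.flip.obj Y) X Z a (fun c c' f u ↦ by
    refine hom_ext (B.obj (Ind.yoneda.obj c)) fun d w ↦ ?_
    rw [ha, ← h₁, ← ha]
    exact NatTrans.naturality_assoc (B.map (Ind.yoneda.map f)) w (a c' u))
  refine ⟨f, fun c d u w ↦ ?_⟩
  rw [← NatTrans.naturality_assoc, ← ha, ← hf]
  rfl

end Desc

section IndMap

variable {A : Type u₁} [Category.{v} A] {B : Type u₂} [Category.{v} B] (F : A ⥤ B)
  {X X' Y Y' : Ind A} {W : Ind B} {a b c d : A}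

/-- The morphism `F c ⟶ F X` determined by `u : c ⟶ X`. -/
noncomputable def el (u : Ind.yoneda.obj c ⟶ X) :
    Ind.yoneda.obj (F.obj c) ⟶ (indMap F).obj X :=
  (indMapYoneda F).hom.app c ≫ (indMap F).map u

variable (u : Ind.yoneda.obj c ⟶ X) (w : Ind.yoneda.obj d ⟶ Y)

theorem el_map (f : X ⟶ X') : el F u ≫ (indMap F).map f = el F (u ≫ f) := by
  simp [el]

theorem map_el (f : b ⟶ c) :
    Ind.yoneda.map (F.map f) ≫ el F u = el F (Ind.yoneda.map f ≫ u) := by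
  have := (indMapYoneda F).hom.naturality f
  refine (Category.assoc _ _ _).symm.trans ((congrArg (· ≫ (indMap F).map u) this).trans ?_)
  simp [el]

theorem el_id : el F (𝟙 (Ind.yoneda.obj c)) = (indMapYoneda F).hom.app c := by
  simp [el]

instance isIso_el_id : IsIso (el F (𝟙 (Ind.yoneda.obj c))) := by
  rw [el_id]
  infer_instance

theorem el_hom_ext {f g : (indMap F).obj X ⟶ W}
    (h : ∀ (c : A) (u : Ind.yoneda.obj c ⟶ X), el F u ≫ f = el F u ≫ g) : f = g := by
  refine hom_ext (indMap F) fun c u ↦ ?_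
  have := h c u
  rw [el, Category.assoc, Category.assoc] at this
  exact (cancel_epi ((indMapYoneda F).hom.app c)).1 this

theorem el_surj {e : B} (f : Ind.yoneda.obj e ⟶ (indMap F).obj X) :
    ∃ (c : A) (u : Ind.yoneda.obj c ⟶ X) (g : e ⟶ F.obj c), f = Ind.yoneda.map g ≫ el F u := by
  obtain ⟨i, p, hp⟩ := IsFinitelyPresentable.exists_hom_of_isColimit
    (isColimitOfPreserves (indMap F) (presIsColimit X)) f
  let c := X.presentation.F.obj i
  obtain ⟨g, hg⟩ := Ind.yoneda.map_surjective (p ≫ (indMapYoneda F).inv.app c)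
  refine ⟨c, (presCocone X).ι.app i, g, ?_⟩
  rw [hg, ← hp]
  refine Eq.trans ?_ (Category.assoc _ _ _).symm
  refine congrArg (p ≫ ·) ?_
  simp [el]
  rfl

end IndMap

section LaxMonoidal

open Functor.LaxMonoidal

variable {A : Type u₁} [Category.{v} A] {B : Type u₂} [Category.{v} B]
  [MonoidalCategory B] (F : A ⥤ B) {X X' Y Y' Z : Ind A} {W : Ind B} {a b c d e : A}

theorem tmul_el_hom_ext {f g : (indMap F).obj X ⊗ (indMap F).obj Y ⟶ W}
    (h : ∀ (c d : A) (u : Ind.yoneda.obj c ⟶ X) (w : Ind.yoneda.obj d ⟶ Y),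
      tmul (el F u) (el F w) ≫ f = tmul (el F u) (el F w) ≫ g) : f = g := by
  refine tmul_hom_ext fun c d u w ↦ ?_
  obtain ⟨c', u, p, rfl⟩ := el_surj F u
  obtain ⟨d', w, q, rfl⟩ := el_surj F w
  rw [← map_tmul_left, ← map_tmul_right]
  simp only [Category.assoc, h]

theorem tmul_el_hom_ext₃ {f g : ((indMap F).obj X ⊗ (indMap F).obj Y) ⊗ (indMap F).obj Z ⟶ W}
    (h : ∀ (c d e : A) (u : Ind.yoneda.obj c ⟶ X) (w : Ind.yoneda.obj d ⟶ Y)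
      (x : Ind.yoneda.obj e ⟶ Z), tmul (tmul (el F u) (el F w)) (el F x) ≫ f =
        tmul (tmul (el F u) (el F w)) (el F x) ≫ g) : f = g := by
  refine tmul_hom_ext₃ fun c d e u w x ↦ ?_
  obtain ⟨c', u, p, rfl⟩ := el_surj F u
  obtain ⟨d', w, q, rfl⟩ := el_surj F w
  obtain ⟨e', x, r, rfl⟩ := el_surj F x
  rw [← map_tmul_left, ← map_tmul_left, ← map_tmul_right, ← map_tmul_right, ← map_tmul_left]
  simp only [Category.assoc, h]

theorem exists_isIso_tmul_el (c d : A) :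
    IsIso (tmul (el F (𝟙 (Ind.yoneda.obj c))) (el F (𝟙 (Ind.yoneda.obj d)))) := by
  have h : tmul (el F (𝟙 (Ind.yoneda.obj c))) (el F (𝟙 (Ind.yoneda.obj d))) =
      tmul (𝟙 (Ind.yoneda.obj (F.obj c))) (𝟙 (Ind.yoneda.obj (F.obj d))) ≫
        (el F (𝟙 (Ind.yoneda.obj c)) ⊗ₘ el F (𝟙 (Ind.yoneda.obj d))) := by
    rw [tmul_tensorHom, Category.id_comp, Category.id_comp]
  have : IsIso (tmul (𝟙 (Ind.yoneda.obj (F.obj c))) (𝟙 (Ind.yoneda.obj (F.obj d)))) := by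
    rw [tmul, pair_id]
    infer_instance
  rw [h]
  infer_instance

variable [MonoidalCategory A]

theorem exists_tensorComparison [F.LaxMonoidal] (X Y : Ind A) :
    ∃ f : (indMap F).obj X ⊗ (indMap F).obj Y ⟶ (indMap F).obj (X ⊗ Y),
      ∀ (c d : A) (u : Ind.yoneda.obj c ⟶ X) (w : Ind.yoneda.obj d ⟶ Y),
        tmul (el F u) (el F w) ≫ f = Ind.yoneda.map (μ F c d) ≫ el F (tmul u w) := by
  let T : Ind A ⥤ Ind A ⥤ Ind B :=
    indMap F ⋙ indBi (curriedTensor B) ⋙ (whiskeringLeft _ _ _).obj (indMap F)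
  have h₁ (Y : Ind A) : PresFilt (T.flip.obj Y) :=
    inferInstanceAs (PresFilt (indMap F ⋙ (indBi (curriedTensor B)).flip.obj ((indMap F).obj Y)))
  have h₂ (X : Ind A) : PresFilt (T.obj X) :=
    inferInstanceAs (PresFilt (indMap F ⋙ (indBi (curriedTensor B)).obj ((indMap F).obj X)))
  have hi := exists_isIso_tmul_el F
  let θ (c d : A) := tmul (el F (𝟙 (Ind.yoneda.obj c))) (el F (𝟙 (Ind.yoneda.obj d)))
  have hθ (c d : A) : IsIso (θ c d) := hi c d
  obtain ⟨f, hf⟩ := exists_desc₂ T X Y ((indMap F).obj (X ⊗ Y))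
    (fun c d u w ↦ inv (θ c d) ≫ Ind.yoneda.map (μ F c d) ≫ el F (tmul u w)) (by
      intro c c' d f u w
      rw [← cancel_epi (θ c d), IsIso.hom_inv_id_assoc]
      have h : θ c d ≫ (indMap F).map (Ind.yoneda.map f) ▷ _ =
          Ind.yoneda.map (F.map f ▷ F.obj d) ≫ θ c' d := by
        rw [tmul_whiskerRight, map_tmul_left, el_map, map_el, Category.id_comp, Category.comp_id]
      refine (Category.assoc _ _ _).symm.trans ((congrArg (· ≫ _) h).trans ?_)
      rw [Category.assoc, IsIso.hom_inv_id_assoc, ← map_tmul_left, ← map_el,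
        ← Category.assoc, ← Category.assoc, ← Functor.map_comp, ← Functor.map_comp,
        μ_natural_left]) (by
      intro c d d' f u w
      rw [← cancel_epi (θ c d), IsIso.hom_inv_id_assoc]
      have h : θ c d ≫ _ ◁ (indMap F).map (Ind.yoneda.map f) =
          Ind.yoneda.map (F.obj c ◁ F.map f) ≫ θ c d' := by
        rw [tmul_whiskerLeft, map_tmul_right, el_map, map_el, Category.id_comp, Category.comp_id]
      refine (Category.assoc _ _ _).symm.trans ((congrArg (· ≫ _) h).trans ?_)
      rw [Category.assoc, IsIso.hom_inv_id_assoc, ← map_tmul_right, ← map_el,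
        ← Category.assoc, ← Category.assoc, ← Functor.map_comp, ← Functor.map_comp,
        μ_natural_right])
  refine ⟨f, fun c d u w ↦ ?_⟩
  have h := θ c d ≫= hf c d u w
  rw [IsIso.hom_inv_id_assoc] at h
  refine Eq.trans ?_ h
  have h' : tmul (el F u) (el F w) =
      θ c d ≫ ((indMap F).map u ▷ _) ≫ (_ ◁ (indMap F).map w) := by
    rw [← Category.assoc, tmul_whiskerRight, tmul_whiskerLeft, el_map, el_map, Category.id_comp,
      Category.id_comp]
  rw [h', Category.assoc, Category.assoc]
  rfl

theorem left_unit_aux [F.LaxMonoidal] {d' : A} {b : B} (u : b ⟶ 𝟙_ B)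
    (w : Ind.yoneda.obj d' ⟶ X)
    (f : (indMap F).obj (𝟙_ (Ind A)) ⊗ (indMap F).obj X ⟶ (indMap F).obj (𝟙_ (Ind A) ⊗ X))
    (hf : ∀ (c d : A) (u : Ind.yoneda.obj c ⟶ 𝟙_ (Ind A)) (w : Ind.yoneda.obj d ⟶ X),
      tmul (el F u) (el F w) ≫ f = Ind.yoneda.map (μ F c d) ≫ el F (tmul u w))
    (ε' : 𝟙_ (Ind B) ⟶ (indMap F).obj (𝟙_ (Ind A)))
    (hε : ε' = Ind.yoneda.map (ε F) ≫ el F (X := 𝟙_ (Ind A)) (𝟙 (Ind.yoneda.obj (𝟙_ A)))) :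
    tmul (X := 𝟙_ (Ind B)) (Ind.yoneda.map u) (el F w) ≫ ε' ▷ (indMap F).obj X ≫ f ≫
        (indMap F).map (λ_ X).hom =
      Ind.yoneda.map (u ▷ F.obj d' ≫ (λ_ (F.obj d')).hom) ≫ el F w := by
  rw [← Category.assoc (tmul _ _), tmul_whiskerRight]
  have e2 : (show Ind.yoneda.obj b ⟶ 𝟙_ (Ind B) from Ind.yoneda.map u) ≫ ε' =
      Ind.yoneda.map (u ≫ ε F) ≫ el F (X := 𝟙_ (Ind A)) (𝟙 (Ind.yoneda.obj (𝟙_ A))) := by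
    rw [hε, Functor.map_comp, Category.assoc]
  refine (congrArg (fun t ↦ tmul t (el F w) ≫ _) e2).trans ?_
  rw [← map_tmul_left, Category.assoc, ← Category.assoc (tmul _ _), hf, Category.assoc, el_map]
  have h := tmul_leftUnitor w (𝟙 (𝟙_ A))
  rw [CategoryTheory.Functor.map_id] at h
  refine (congrArg (fun t ↦ _ ≫ _ ≫ el F t) h).trans ?_
  rw [← map_el]
  simp only [← Category.assoc, ← Functor.map_comp]
  simp

theorem right_unit_aux [F.LaxMonoidal] {d' : A} {b : B} (u : b ⟶ 𝟙_ B)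
    (w : Ind.yoneda.obj d' ⟶ X)
    (f : (indMap F).obj X ⊗ (indMap F).obj (𝟙_ (Ind A)) ⟶ (indMap F).obj (X ⊗ 𝟙_ (Ind A)))
    (hf : ∀ (c d : A) (u : Ind.yoneda.obj c ⟶ X) (w : Ind.yoneda.obj d ⟶ 𝟙_ (Ind A)),
      tmul (el F u) (el F w) ≫ f = Ind.yoneda.map (μ F c d) ≫ el F (tmul u w))
    (ε' : 𝟙_ (Ind B) ⟶ (indMap F).obj (𝟙_ (Ind A)))
    (hε : ε' = Ind.yoneda.map (ε F) ≫ el F (X := 𝟙_ (Ind A)) (𝟙 (Ind.yoneda.obj (𝟙_ A)))) :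
    tmul (Y := 𝟙_ (Ind B)) (el F w) (Ind.yoneda.map u) ≫ (indMap F).obj X ◁ ε' ≫ f ≫
        (indMap F).map (ρ_ X).hom =
      Ind.yoneda.map (F.obj d' ◁ u ≫ (ρ_ (F.obj d')).hom) ≫ el F w := by
  rw [← Category.assoc (tmul _ _), tmul_whiskerLeft]
  have e2 : (show Ind.yoneda.obj b ⟶ 𝟙_ (Ind B) from Ind.yoneda.map u) ≫ ε' =
      Ind.yoneda.map (u ≫ ε F) ≫ el F (X := 𝟙_ (Ind A)) (𝟙 (Ind.yoneda.obj (𝟙_ A))) := by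
    rw [hε, Functor.map_comp, Category.assoc]
  refine (congrArg (fun t ↦ tmul (el F w) t ≫ _) e2).trans ?_
  rw [← map_tmul_right, Category.assoc, ← Category.assoc (tmul _ _), hf, Category.assoc, el_map]
  have h := tmul_rightUnitor w (𝟙 (𝟙_ A))
  rw [CategoryTheory.Functor.map_id] at h
  refine (congrArg (fun t ↦ _ ≫ _ ≫ el F t) h).trans ?_
  rw [← map_el]
  simp only [← Category.assoc, ← Functor.map_comp]
  simp

/-- The lax monoidal structure on the extension of a lax monoidal functor to ind-objects. -/
noncomputable instance indMapLaxMonoidal [F.LaxMonoidal] : (indMap F).LaxMonoidal where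
  ε := Ind.yoneda.map (ε F) ≫ el F (𝟙 _)
  μ X Y := (exists_tensorComparison F X Y).choose
  μ_natural_left f X := tmul_el_hom_ext F fun c d u w ↦ by
    rw [← Category.assoc, tmul_whiskerRight, el_map,
      (exists_tensorComparison F _ _).choose_spec, ← Category.assoc,
      (exists_tensorComparison F _ _).choose_spec, Category.assoc, el_map, tmul_whiskerRight]
  μ_natural_right X f := tmul_el_hom_ext F fun c d u w ↦ by
    rw [← Category.assoc, tmul_whiskerLeft, el_map,
      (exists_tensorComparison F _ _).choose_spec, ← Category.assoc,
      (exists_tensorComparison F _ _).choose_spec, Category.assoc, el_map, tmul_whiskerLeft]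
  associativity X Y Z := tmul_el_hom_ext₃ F fun c d e u w x ↦ by
    rw [← Category.assoc, tmul_whiskerRight, (exists_tensorComparison F _ _).choose_spec,
      ← map_tmul_left, Category.assoc, ← Category.assoc (tmul _ _),
      (exists_tensorComparison F _ _).choose_spec, Category.assoc, el_map, tmul_associator,
      ← map_el, ← Category.assoc (tmul _ _), tmul_associator, Category.assoc,
      ← Category.assoc (tmul _ _), tmul_whiskerLeft, (exists_tensorComparison F _ _).choose_spec,
      ← map_tmul_right, Category.assoc, (exists_tensorComparison F _ _).choose_spec]
    simp only [← Category.assoc, ← Functor.map_comp]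
    simp
  left_unitality X := tmul_hom_ext fun c d u w ↦ by
    obtain ⟨u, rfl⟩ := Ind.yoneda.map_surjective u
    obtain ⟨d', w, q, rfl⟩ := el_surj F w
    refine (tmul_leftUnitor _ u).trans ?_
    rw [← map_tmul_right, Category.assoc]
    refine Eq.trans ?_ (congrArg (Ind.yoneda.map (c ◁ q) ≫ ·) (left_unit_aux F u w _
      (exists_tensorComparison F _ _).choose_spec _ rfl)).symm
    simp only [← Category.assoc, ← Functor.map_comp]
    simp [whisker_exchange_assoc]
  right_unitality X := tmul_hom_ext fun c d u w ↦ by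
    obtain ⟨w, rfl⟩ := Ind.yoneda.map_surjective w
    obtain ⟨d', u, q, rfl⟩ := el_surj F u
    refine (tmul_rightUnitor _ w).trans ?_
    rw [← map_tmul_left, Category.assoc]
    refine Eq.trans ?_ (congrArg (Ind.yoneda.map (q ▷ d) ≫ ·) (right_unit_aux F w u _
      (exists_tensorComparison F _ _).choose_spec _ rfl)).symm
    simp only [← Category.assoc, ← Functor.map_comp]
    simp [← whisker_exchange_assoc]

end LaxMonoidal

section Adjoint

variable {C : Type u₁} [Category.{v} C] [EssentiallySmall.{v} C] [HasFiniteColimits C]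
  {T : Type u₂} [Category.{v} T]

/-- A functor on `Ind C` that preserves filtered colimits and is right exact on `C` has a right
adjoint. -/
theorem isLeftAdjoint_of_rightExact (L : Ind C ⥤ T) [PresFilt L]
    [PreservesFiniteColimits (Ind.yoneda ⋙ L)] : L.IsLeftAdjoint := by
  have (Y : T) : HasTerminal (CostructuredArrow L Y) := by
    let J := CostructuredArrow (Ind.yoneda ⋙ L) Y
    have : IsFiltered J := (coflat_of_preservesFiniteColimits (Ind.yoneda ⋙ L)).filtered Y
    let e : J ≌ SmallModel.{v} J := equivSmallModel J
    have : IsFiltered (SmallModel.{v} J) := IsFiltered.of_equivalence e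
    have : HasColimitsOfShape J (Ind C) := hasColimitsOfShape_of_equivalence e.symm
    have : PreservesColimitsOfShape J L := preservesColimitsOfShape_of_equiv e.symm L
    let K : J ⥤ Ind C := CostructuredArrow.proj _ _ ⋙ Ind.yoneda
    let hK := isColimitOfPreserves L (colimit.isColimit K)
    let s : Cocone (K ⋙ L) := Cocone.mk Y
      { app := fun j ↦ j.hom
        naturality := fun i j f ↦ (CostructuredArrow.w f).trans (Category.comp_id _).symm }
    let ε : L.obj (colimit K) ⟶ Y := hK.desc s
    have hε (j : J) : L.map (colimit.ι K j) ≫ ε = j.hom := hK.fac s j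
    have h₁ (c : C) (p : Ind.yoneda.obj c ⟶ colimit K) :
        p = colimit.ι K (CostructuredArrow.mk (Y := c) (L.map p ≫ ε)) := by
      obtain ⟨i, q, hq⟩ := IsFinitelyPresentable.exists_hom_of_isColimit
        ((Functor.Final.isColimitWhiskerEquiv e.inverse _).symm (colimit.isColimit K)) p
      obtain ⟨q, rfl⟩ := Ind.yoneda.map_surjective q
      let j : J := e.inverse.obj i
      have hq' : Ind.yoneda.map q ≫ colimit.ι K j = p := hq
      let f : CostructuredArrow.mk (S := Ind.yoneda ⋙ L) (Y := c) (L.map p ≫ ε) ⟶ j :=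
        CostructuredArrow.homMk q (by
          refine Eq.trans ?_ (congrArg (fun t ↦ L.map t ≫ ε) hq')
          refine Eq.trans ?_ (congrArg (· ≫ ε) (L.map_comp _ _)).symm
          rw [Category.assoc, hε]
          rfl)
      exact hq'.symm.trans (colimit.w K f)
    have h₂ (X : Ind C) (f : L.obj X ⟶ Y) : ∃ g : X ⟶ colimit K, L.map g ≫ ε = f := by
      obtain ⟨g, hg⟩ := exists_desc (𝟭 (Ind C)) X (colimit K)
        (fun c u ↦ colimit.ι K (CostructuredArrow.mk (Y := c) (L.map u ≫ f)))
        (fun c c' p u ↦ by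
          let m : CostructuredArrow.mk (S := Ind.yoneda ⋙ L) (Y := c)
              (L.map (Ind.yoneda.map p ≫ u) ≫ f) ⟶
              CostructuredArrow.mk (S := Ind.yoneda ⋙ L) (Y := c') (L.map u ≫ f) :=
            CostructuredArrow.homMk p (by simp)
          exact colimit.w K m)
      refine ⟨g, hom_ext L fun c u ↦ ?_⟩
      have hg' : u ≫ g = colimit.ι K (CostructuredArrow.mk (Y := c) (L.map u ≫ f)) := hg c u
      rw [← Category.assoc, ← L.map_comp]
      exact (congrArg (L.map · ≫ ε) hg').trans (hε _)
    refine IsTerminal.hasTerminal (X := CostructuredArrow.mk ε) (IsTerminal.ofUniqueHom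
      (fun X ↦ CostructuredArrow.homMk (h₂ X.left X.hom).choose (h₂ X.left X.hom).choose_spec)
      (fun X m ↦ ?_))
    refine CostructuredArrow.hom_ext _ _ (hom_ext (𝟭 (Ind C)) fun c u ↦ ?_)
    refine (h₁ c (u ≫ m.left)).trans (Eq.trans ?_ (h₁ c (u ≫ (h₂ X.left X.hom).choose)).symm)
    have h : L.map m.left ≫ ε = L.map (h₂ X.left X.hom).choose ≫ ε :=
      (CostructuredArrow.w m).trans (h₂ X.left X.hom).choose_spec.symm
    rw [L.map_comp, L.map_comp, Category.assoc, Category.assoc, h]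
  exact isLeftAdjoint_of_costructuredArrowTerminals L

end Adjoint

end IndExt

namespace RexTensor

open IndExt

section InternalEnd

variable (C : Type u₁) [Category.{v₁} C] [MonoidalCategory C] {D : Type u₂} [Category.{v₂} D]
  [MonoidalRightAction C D] (d : D) [(actionLeft C d).IsLeftAdjoint]

/-- The internal hom `Hom(d, n)`, the value at `n` of the right adjoint of `c ↦ d ⊙ᵣ c`. -/
noncomputable def internalHom (n : D) : C := (rightAdjoint (actionLeft C d)).obj n

/-- The evaluation `d ⊙ᵣ Hom(d, n) ⟶ n`. -/
noncomputable def internalEv (n : D) : d ⊙ᵣ internalHom C d n ⟶ n :=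
  (Adjunction.ofIsLeftAdjoint (actionLeft C d)).counit.app n

variable {C d} in
/-- The adjoint transpose of `d ⊙ᵣ c ⟶ n`. -/
noncomputable def internalCurry {c : C} {n : D} (f : d ⊙ᵣ c ⟶ n) : c ⟶ internalHom C d n :=
  (Adjunction.ofIsLeftAdjoint (actionLeft C d)).homEquiv c n f

variable {C d} in
theorem internalCurry_ev {c : C} {n : D} (f : d ⊙ᵣ c ⟶ n) :
    d ⊴ᵣ internalCurry f ≫ internalEv C d n = f :=
  ((Adjunction.ofIsLeftAdjoint (actionLeft C d)).homEquiv_counit c n (internalCurry f)).symm.trans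
    (Equiv.symm_apply_apply _ f)

variable {C d} in
theorem internalHom_hom_ext {c : C} {n : D} {f g : c ⟶ internalHom C d n}
    (h : d ⊴ᵣ f ≫ internalEv C d n = d ⊴ᵣ g ≫ internalEv C d n) : f = g := by
  apply ((Adjunction.ofIsLeftAdjoint (actionLeft C d)).homEquiv c n).symm.injective
  refine (Adjunction.homEquiv_counit (Adjunction.ofIsLeftAdjoint (actionLeft C d)) c n f).trans
    (h.trans (Adjunction.homEquiv_counit (Adjunction.ofIsLeftAdjoint (actionLeft C d)) c n g).symm)

/-- The composition `Hom(d, d) ⊗ Hom(d, n) ⟶ Hom(d, n)`. -/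
noncomputable def internalComp (n : D) :
    internalHom C d d ⊗ internalHom C d n ⟶ internalHom C d n :=
  internalCurry ((αᵣ d _ _).hom ≫ internalEv C d d ⊵ᵣ _ ≫ internalEv C d n)

theorem internalComp_ev (n : D) : d ⊴ᵣ internalComp C d n ≫ internalEv C d n =
    (αᵣ d _ _).hom ≫ internalEv C d d ⊵ᵣ _ ≫ internalEv C d n :=
  internalCurry_ev _

/-- The unit `𝟙 ⟶ Hom(d, d)`. -/
noncomputable def internalOne : 𝟙_ C ⟶ internalHom C d d := internalCurry (ρᵣ d).hom

theorem internalOne_comp (n : D) :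
    internalOne C d ▷ internalHom C d n ≫ internalComp C d n = (λ_ _).hom := by
  apply internalHom_hom_ext
  rw [actionHomRight_comp, Category.assoc, internalComp, internalCurry_ev,
    actionHomRight_whiskerRight, Category.assoc, Category.assoc, Iso.inv_hom_id_assoc,
    ← comp_actionHomLeft_assoc, internalOne, internalCurry_ev, actionHom_leftUnitor,
    Category.assoc]

theorem internalComp_one :
    internalHom C d d ◁ internalOne C d ≫ internalComp C d d = (ρ_ _).hom := by
  apply internalHom_hom_ext
  rw [actionHomRight_comp, Category.assoc, internalComp, internalCurry_ev,
    whiskerRight_actionHomLeft, Category.assoc, Category.assoc, Iso.inv_hom_id_assoc,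
    action_exchange_assoc, internalOne, internalCurry_ev, actionHom_rightUnitor,
    Category.assoc, actionUnitIso_hom_naturality]

theorem internalComp_assoc (n : D) :
    internalComp C d d ▷ internalHom C d n ≫ internalComp C d n =
      (α_ _ _ _).hom ≫ internalHom C d d ◁ internalComp C d n ≫ internalComp C d n := by
  apply internalHom_hom_ext
  simp only [actionHomRight_comp, Category.assoc, internalComp_ev]
  rw [actionHomRight_whiskerRight, whiskerRight_actionHomLeft]
  simp only [Category.assoc, Iso.inv_hom_id_assoc]
  rw [action_exchange_assoc, internalComp_ev, ← comp_actionHomLeft_assoc, internalComp_ev,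
    actionHomLeft_tensor]
  simp only [Category.assoc, Iso.inv_hom_id_assoc]
  rw [actionHom_associator_assoc, comp_actionHomLeft, comp_actionHomLeft, Category.assoc,
    Category.assoc]

/-- The algebra structure on the internal endomorphism object `End(d) = Hom(d, d)`. -/
noncomputable instance internalEndMonObj : MonObj (internalHom C d d) where
  one := internalOne C d
  mul := internalComp C d d
  one_mul := internalOne_comp C d d
  mul_one := internalComp_one C d
  mul_assoc := internalComp_assoc C d d

end InternalEnd

section ModAction

open MonObj

variable {C : Type u₁} [Category.{v₁} C] [MonoidalCategory C] (E : C) [MonObj E]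

/-- The action morphism of a left `E`-module. -/
abbrev actMap (X : C) [ModObj E X] : E ⊗ X ⟶ X := ModObj.smul (M := E) (X := X)

theorem one_actMap (X : C) [ModObj E X] : MonObj.one ▷ X ≫ actMap E X = (λ_ X).hom :=
  ModObj.one_smul (M := E) X

theorem mul_actMap (X : C) [ModObj E X] :
    MonObj.mul ▷ X ≫ actMap E X = (α_ E E X).hom ≫ E ◁ actMap E X ≫ actMap E X :=
  ModObj.mul_smul (M := E) X

theorem hom_actMap {X Y : Mod C E} (f : X ⟶ Y) :
    actMap E X.X ≫ f.hom = E ◁ f.hom ≫ actMap E Y.X :=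
  IsModHom.smul_hom

/-- The left `E`-module structure on `X ⊗ c`, for a left `E`-module `X`. -/
abbrev tensorModObj (X : C) [ModObj E X] (c : C) : ModObj E (X ⊗ c) where
  smul := (α_ E X c).inv ≫ actMap E X ▷ c
  one_smul := by
    have h : (MonObj.one : 𝟙_ C ⟶ E) ▷ (X ⊗ c) ≫ (α_ E X c).inv ≫ actMap E X ▷ c =
        (λ_ (X ⊗ c)).hom := by
      rw [associator_inv_naturality_left_assoc, ← comp_whiskerRight, one_actMap]
      simp
    exact h
  mul_smul := by
    have h : (MonObj.mul : E ⊗ E ⟶ E) ▷ (X ⊗ c) ≫ (α_ E X c).inv ≫ actMap E X ▷ c =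
        (α_ E E (X ⊗ c)).hom ≫ E ◁ ((α_ E X c).inv ≫ actMap E X ▷ c) ≫
          (α_ E X c).inv ≫ actMap E X ▷ c := by
      rw [associator_inv_naturality_left_assoc, ← comp_whiskerRight, mul_actMap]
      simp
    exact h

/-- The left `E`-module `X ⊗ c`. -/
def modTensor (X : Mod C E) (c : C) : Mod C E where
  X := X.X ⊗ c
  mod := tensorModObj E X.X c

variable {E}

/-- A morphism `X ⊗ c ⟶ Y ⊗ c'` of modules from a morphism of objects. -/
def modHomMk {X Y : Mod C E} (f : X.X ⟶ Y.X)
    (h : actMap E X.X ≫ f = E ◁ f ≫ actMap E Y.X) : X ⟶ Y := Mod.Hom.mk' f h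

/-- An isomorphism of modules from an isomorphism of objects. -/
def modIsoMk {X Y : Mod C E} (f : X.X ≅ Y.X)
    (h : actMap E X.X ≫ f.hom = E ◁ f.hom ≫ actMap E Y.X) : X ≅ Y where
  hom := modHomMk f.hom h
  inv := modHomMk f.inv (by
    rw [Iso.comp_inv_eq, Category.assoc, h, ← MonoidalCategory.whiskerLeft_comp_assoc, f.inv_hom_id]
    simp)
  hom_inv_id := Mod.hom_ext _ _ f.hom_inv_id
  inv_hom_id := Mod.hom_ext _ _ f.inv_hom_id

variable (E)

/-- The right action of `C` on the category of left `E`-modules in `C`. -/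
instance modRightAction : MonoidalRightAction C (Mod C E) where
  actionObj X c := modTensor E X c
  actionHomRight X c c' f := modHomMk (X := modTensor E X c) (Y := modTensor E X c')
    (X.X ◁ f) (by
      have h : ((α_ E X.X c).inv ≫ actMap E X.X ▷ c) ≫ X.X ◁ f =
        E ◁ (X.X ◁ f) ≫ (α_ E X.X c').inv ≫ actMap E X.X ▷ c' := by simp [← whisker_exchange]
      exact h)
  actionHomLeft {X Y} f c := modHomMk (X := modTensor E X c) (Y := modTensor E Y c)
    (f.hom ▷ c) (by
      have h : ((α_ E X.X c).inv ≫ actMap E X.X ▷ c) ≫ f.hom ▷ c =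
          E ◁ (f.hom ▷ c) ≫ (α_ E Y.X c).inv ≫ actMap E Y.X ▷ c := by
        rw [Category.assoc, ← comp_whiskerRight, hom_actMap]
        simp
      exact h)
  actionAssocIso X c c' := modIsoMk (X := modTensor E X (c ⊗ c'))
    (Y := modTensor E (modTensor E X c) c') (α_ X.X c c').symm (by
      have h : ((α_ E X.X (c ⊗ c')).inv ≫ actMap E X.X ▷ (c ⊗ c')) ≫ (α_ X.X c c').inv =
          E ◁ (α_ X.X c c').inv ≫ (α_ E (X.X ⊗ c) c').inv ≫
            ((α_ E X.X c).inv ≫ actMap E X.X ▷ c) ▷ c' := by simp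
      exact h)
  actionUnitIso X := modIsoMk (X := modTensor E X (𝟙_ C)) (ρ_ X.X) (by
      have h : ((α_ E X.X (𝟙_ C)).inv ≫ actMap E X.X ▷ (𝟙_ C)) ≫ (ρ_ X.X).hom =
          E ◁ (ρ_ X.X).hom ≫ actMap E X.X := by simp
      exact h)
  actionHom_def _ _ := rfl
  actionHomRight_id c X := Mod.hom_ext _ _ (whiskerLeft_id X.X c)
  id_actionHomLeft c X := Mod.hom_ext _ _ (id_whiskerRight X.X c)
  actionHom_comp {_ _ _ _ _ _} f₁ f₂ g₁ g₂ := Mod.hom_ext _ _ (by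
    have h : (f₁.hom ≫ f₂.hom) ▷ _ ≫ _ ◁ (g₁ ≫ g₂) =
      (f₁.hom ▷ _ ≫ _ ◁ g₁) ≫ (f₂.hom ▷ _ ≫ _ ◁ g₂) := by
        simp [whisker_exchange_assoc]
    exact h)
  actionAssocIso_hom_naturality {X₁ X₂ c₁ c₂ c₃ c₄} f g h := Mod.hom_ext _ _ (by
    have h : (f.hom ▷ (c₁ ⊗ c₃) ≫ X₂.X ◁ (g ⊗ₘ h)) ≫ (α_ X₂.X c₂ c₄).inv =
      (α_ X₁.X c₁ c₃).inv ≫ (f.hom ▷ c₁ ≫ X₂.X ◁ g) ▷ c₃ ≫ (X₂.X ⊗ c₂) ◁ h := by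
        simp [MonoidalCategory.tensorHom_def]
    exact h)
  actionUnitIso_hom_naturality f := Mod.hom_ext _ _ (rightUnitor_naturality f.hom).symm
  actionHomRight_whiskerRight {c' c''} f c X := Mod.hom_ext _ _ (by
    have h : X.X ◁ (f ▷ c) = (α_ _ _ _).inv ≫ (X.X ◁ f) ▷ c ≫ (α_ _ _ _).hom := by simp
    exact h)
  whiskerRight_actionHomLeft c {c' c''} f X := Mod.hom_ext _ _ (by
    have h : X.X ◁ (c ◁ f) = (α_ _ _ _).inv ≫ (X.X ⊗ c) ◁ f ≫ (α_ _ _ _).hom := by simp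
    exact h)
  actionHom_associator c₁ c₂ c₃ X := Mod.hom_ext _ _ (by
    have h : X.X ◁ (α_ c₁ c₂ c₃).hom ≫ (α_ X.X c₁ (c₂ ⊗ c₃)).inv ≫ (α_ (X.X ⊗ c₁) c₂ c₃).inv =
      (α_ X.X (c₁ ⊗ c₂) c₃).inv ≫ (α_ X.X c₁ c₂).inv ▷ c₃ := by simp
    exact h)
  actionHom_leftUnitor c X := Mod.hom_ext _ _ (by
    have h : X.X ◁ (λ_ c).hom = (α_ _ _ _).inv ≫ (ρ_ X.X).hom ▷ c := by simp
    exact h)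
  actionHom_rightUnitor c X := Mod.hom_ext _ _ (by
    have h : X.X ◁ (ρ_ c).hom = (α_ _ _ _).inv ≫ (ρ_ (X.X ⊗ c)).hom := by simp
    exact h)

end ModAction

section ModuleCategory

/-- The action of `A` on `M` is right exact in each variable. -/
class RightExactAction (A : Type u₁) [Category.{v₁} A] [MonoidalCategory A]
    (M : Type u₂) [Category.{v₂} M] [MonoidalRightAction A M] : Prop where
  preservesFiniteColimits_actionLeft (m : M) : PreservesFiniteColimits (actionLeft A m)
  preservesFiniteColimits_actionRight (a : A) : PreservesFiniteColimits (actionRight M a)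

/-- The action of `A` on `M` is `k`-bilinear. -/
class BilinearAction (k : Type w) [Field k] (A : Type u₁) [Category.{v₁} A] [Preadditive A]
    [Linear k A] [MonoidalCategory A] (M : Type u₂) [Category.{v₂} M] [Preadditive M] [Linear k M]
    [MonoidalRightAction A M] : Prop where
  add_actionHomLeft {m n : M} (f g : m ⟶ n) (a : A) : (f + g) ⊵ᵣ a = f ⊵ᵣ a + g ⊵ᵣ a
  smul_actionHomLeft {m n : M} (r : k) (f : m ⟶ n) (a : A) : (r • f) ⊵ᵣ a = r • f ⊵ᵣ a
  actionHomRight_add (m : M) {a b : A} (f g : a ⟶ b) : m ⊴ᵣ (f + g) = m ⊴ᵣ f + m ⊴ᵣ g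
  actionHomRight_smul (m : M) {a b : A} (r : k) (f : a ⟶ b) : m ⊴ᵣ (r • f) = r • m ⊴ᵣ f

end ModuleCategory

section Progenerator

variable (A : Type u₁) [Category.{v} A] [EssentiallySmall.{v} A] [HasFiniteColimits A]
  [MonoidalCategory A] {M : Type u₂} [Category.{v} M] [HasFiniteColimits M]
  [MonoidalRightAction A M] [RightExactAction A M] (m : M)

/-- The action functor `X ↦ m ⊗ X` from ind-objects of `A` to ind-objects of `M`. -/
noncomputable abbrev indAct : Ind A ⥤ Ind M := actionLeft (Ind A) (Ind.yoneda.obj m)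

instance isLeftAdjoint_indAct : (indAct A m).IsLeftAdjoint := by
  have : PresFilt (indAct A m) :=
    inferInstanceAs (PresFilt ((indBi (actBi A M)).obj (Ind.yoneda.obj m)))
  have : PreservesFiniteColimits (actionLeft A m) :=
    RightExactAction.preservesFiniteColimits_actionLeft m
  have : PreservesFiniteColimits (Ind.yoneda ⋙ indAct A m) :=
    preservesFiniteColimits_of_natIso (F := actionLeft A m ⋙ Ind.yoneda)
      (NatIso.ofComponents (fun a ↦ biIso (actBi A M) m a)
        (fun f ↦ biIso_natural_right (actBi A M) m f))
  exact isLeftAdjoint_of_rightExact _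

/-- The right adjoint `act_m^R` of the action functor of `m`, a functor from ind-objects of `M` to
ind-objects of `A`. -/
noncomputable abbrev indActR : Ind M ⥤ Ind A := rightAdjoint (indAct A m)

/-- The internal endomorphism algebra of `m`, an algebra in ind-objects of `A` with underlying
object `act_m^R(m)`; its multiplication corresponds to the iterated evaluation
`m ⊙ (End(m) ⊗ End(m)) ≅ (m ⊙ End(m)) ⊙ End(m) ⟶ m ⊙ End(m) ⟶ m`. -/
noncomputable abbrev iEnd : Ind A := internalHom (Ind A) (Ind.yoneda.obj m) (Ind.yoneda.obj m)

/-- `m` is an `A`-generator: `act_m^R` is faithful. -/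
def IsGenerator : Prop := (indActR A m).Faithful

/-- `m` is `A`-projective: `act_m^R` preserves colimits. -/
def IsProjective : Prop := PreservesColimitsOfSize.{v, v} (indActR A m)

/-- `m` is an `A`-progenerator. -/
structure IsProgenerator : Prop where
  isGenerator : IsGenerator A m
  isProjective : IsProjective A m

end Progenerator

section Dominant

variable {A : Type u₁} [Category.{v₁} A] {B : Type u₂} [Category.{v₂} B]

/-- Every object of `B` is a subobject of an object in the image of `F`. -/
def IsDominant (F : A ⥤ B) : Prop := ∀ b : B, ∃ (a : A) (i : b ⟶ F.obj a), Mono i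

end Dominant

section Image

/-- The image of an algebra in ind-objects of `A` under the extension of a monoidal functor. -/
noncomputable instance indMapMonObj {A : Type u₁} [Category.{v} A] [MonoidalCategory A]
    {B : Type u₂} [Category.{v} B] [MonoidalCategory B] (F : A ⥤ B) [F.Monoidal] (X : Ind A)
    [MonObj X] :
    MonObj ((indMap F).obj X) := monObjObj (F := indMap F) X

end Image

section Rex

variable (k : Type w) [Field k]

/-- A `k`-linear right exact functor. -/
structure IsRex {C : Type u₁} [Category.{v₁} C] [Preadditive C] [Linear k C]
    {D : Type u₂} [Category.{v₂} D] [Preadditive D] [Linear k D] (G : C ⥤ D) : Prop where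
  map_add {X Y : C} (f g : X ⟶ Y) : G.map (f + g) = G.map f + G.map g
  map_smul {X Y : C} (r : k) (f : X ⟶ Y) : G.map (r • f) = r • G.map f
  preservesFiniteColimits : PreservesFiniteColimits G

theorem IsRex.comp {C : Type u₁} [Category.{v₁} C] [Preadditive C] [Linear k C]
    {D : Type u₂} [Category.{v₂} D] [Preadditive D] [Linear k D]
    {E : Type u₃} [Category.{v₃} E] [Preadditive E] [Linear k E] {G : C ⥤ D} {H : D ⥤ E}
    (hG : IsRex k G) (hH : IsRex k H) : IsRex k (G ⋙ H) where
  map_add f g := by simp [hG.map_add, hH.map_add]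
  map_smul r f := by simp [hG.map_smul, hH.map_smul]
  preservesFiniteColimits :=
    have := hG.preservesFiniteColimits
    have := hH.preservesFiniteColimits
    comp_preservesFiniteColimits G H

/-- The category of `k`-linear right exact functors and natural transformations. -/
abbrev Rex (C : Type u₁) [Category.{v₁} C] [Preadditive C] [Linear k C]
    (D : Type u₂) [Category.{v₂} D] [Preadditive D] [Linear k D] :=
  ObjectProperty.FullSubcategory (fun G : C ⥤ D ↦ IsRex k G)

end Rex

section BalancedFunctor

open Functor.OplaxMonoidal

variable (k : Type w) [Field k] {A : Type u₁} [Category.{v₁} A] [MonoidalCategory A]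
  {B : Type u₂} [Category.{v₂} B] [Preadditive B] [Linear k B] [MonoidalCategory B]
  (F : A ⥤ B) [F.Monoidal]
  (M : Type u₃) [Category.{v₃} M] [Preadditive M] [Linear k M] [MonoidalRightAction A M]
  (E : Type u₄) [Category.{v₄} E] [Preadditive E] [Linear k E]

/-- An `A`-balanced functor on `M × B` with values in `E`, `k`-linear and right exact in each
variable. Here `M` is a right `A`-module category, and `A` acts on `B` on the left by
`a ⊙ b = F(a) ⊗ b`. -/
structure BalancedFunctor where
  /-- the underlying functor -/
  functor : M ⥤ B ⥤ E
  isRex_left (b : B) : IsRex k (functor.flip.obj b)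
  isRex_right (m : M) : IsRex k (functor.obj m)
  /-- the balancing `T(m ⊙ a, b) ≅ T(m, a ⊙ b)` -/
  bal (m : M) (a : A) (b : B) :
    (functor.obj (m ⊙ᵣ a)).obj b ≅ (functor.obj m).obj (F.obj a ⊗ b)
  bal_natural_left {m m' : M} (f : m ⟶ m') (a : A) (b : B) :
    (functor.map (f ⊵ᵣ a)).app b ≫ (bal m' a b).hom =
      (bal m a b).hom ≫ (functor.map f).app (F.obj a ⊗ b)
  bal_natural_middle (m : M) {a a' : A} (f : a ⟶ a') (b : B) :
    (functor.map (m ⊴ᵣ f)).app b ≫ (bal m a' b).hom =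
      (bal m a b).hom ≫ (functor.obj m).map (F.map f ▷ b)
  bal_natural_right (m : M) (a : A) {b b' : B} (f : b ⟶ b') :
    (functor.obj (m ⊙ᵣ a)).map f ≫ (bal m a b').hom =
      (bal m a b).hom ≫ (functor.obj m).map (F.obj a ◁ f)
  bal_tensor (m : M) (a a' : A) (b : B) :
    (functor.map (αᵣ m a a').hom).app b ≫ (bal (m ⊙ᵣ a) a' b).hom ≫
        (bal m a (F.obj a' ⊗ b)).hom =
      (bal m (a ⊗ a') b).hom ≫
        (functor.obj m).map (δ F a a' ▷ b ≫ (α_ (F.obj a) (F.obj a') b).hom)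
  bal_unit (m : M) (b : B) :
    (bal m (𝟙_ A) b).hom ≫ (functor.obj m).map (η F ▷ b ≫ (λ_ b).hom) =
      (functor.map (ρᵣ m).hom).app b

variable {k F M E}

/-- A morphism of balanced functors: a natural transformation compatible with the balancings. -/
@[ext]
structure BalancedHom (S T : BalancedFunctor k F M E) where
  /-- the underlying natural transformation -/
  hom : S.functor ⟶ T.functor
  bal_hom (m : M) (a : A) (b : B) :
    (S.bal m a b).hom ≫ (hom.app m).app (F.obj a ⊗ b) =
      (hom.app (m ⊙ᵣ a)).app b ≫ (T.bal m a b).hom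

instance balancedFunctorCategory : Category (BalancedFunctor k F M E) where
  Hom S T := BalancedHom S T
  id S := { hom := 𝟙 _, bal_hom := by simp }
  comp f g :=
    { hom := f.hom ≫ g.hom
      bal_hom := fun m a n ↦ by
        simp only [NatTrans.comp_app, Category.assoc]
        rw [← g.bal_hom, ← Category.assoc, f.bal_hom, Category.assoc] }
  id_comp f := BalancedHom.ext (Category.id_comp f.hom)
  comp_id f := BalancedHom.ext (Category.comp_id f.hom)
  assoc f g h := BalancedHom.ext (Category.assoc f.hom g.hom h.hom)

variable {P : Type u₅} [Category.{v} P] [Preadditive P] [Linear k P]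

/-- The composition of a balanced functor with a right exact functor. -/
def BalancedFunctor.comp (T : BalancedFunctor k F M P) {G : P ⥤ E} (hG : IsRex k G) :
    BalancedFunctor k F M E where
  functor := T.functor ⋙ (whiskeringRight B P E).obj G
  isRex_left n := (T.isRex_left n).comp k hG
  isRex_right m := (T.isRex_right m).comp k hG
  bal m a n := G.mapIso (T.bal m a n)
  bal_natural_left f a n := by simpa using! congrArg G.map (T.bal_natural_left f a n)
  bal_natural_middle m _ _ f n := by simpa using! congrArg G.map (T.bal_natural_middle m f n)
  bal_natural_right m a _ _ f := by simpa using! congrArg G.map (T.bal_natural_right m a f)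
  bal_tensor m a b n := by simpa using! congrArg G.map (T.bal_tensor m a b n)
  bal_unit m n := by simpa using! congrArg G.map (T.bal_unit m n)

/-- Composition with a balanced functor `T`, from right exact functors to balanced functors. -/
def BalancedFunctor.compFunctor (T : BalancedFunctor k F M P) (E : Type u₄) [Category.{v₄} E]
    [Preadditive E] [Linear k E] : Rex k P E ⥤ BalancedFunctor k F M E where
  obj G := T.comp G.property
  map φ :=
    { hom := Functor.whiskerLeft T.functor ((whiskeringRight B P E).map φ.hom)
      bal_hom := fun m a n ↦ φ.hom.naturality (T.bal m a n).hom }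
  map_id _ := rfl
  map_comp _ _ := rfl

/-- The balanced functor `T` exhibits `P` as the relative Kelly tensor product of `M` and `B`
over `A`: composition with `T` is an equivalence from right exact functors `P ⥤ E` to balanced
functors `M × B ⥤ E`, for every finitely cocomplete `k`-linear category `E`. -/
def BalancedFunctor.IsUniversal (T : BalancedFunctor k F M P) : Prop :=
  ∀ (E : Type v) [SmallCategory E] [Preadditive E] [Linear k E] [HasFiniteColimits E],
    (T.compFunctor E).IsEquivalence

end BalancedFunctor

section BaseChange

open Functor.LaxRightLinear

variable (k : Type w) [Field k] {A : Type u₁} [Category.{v₁} A] [MonoidalCategory A]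
  {B : Type u₂} [Category.{v₂} B] [Preadditive B] [Linear k B] [MonoidalCategory B]
  (F : A ⥤ B) [F.Monoidal]
  (M : Type u₃) [Category.{v₃} M] [Preadditive M] [Linear k M] [MonoidalRightAction A M]
  (P : Type u₄) [Category.{v} P] [Preadditive P] [Linear k P] [MonoidalRightAction B P]

/-- A presentation of the `B`-module category `P` as the base change of the `A`-module category
`M` along `F : A ⥤ B`, i.e. as the relative Kelly tensor product of `M` and `B` over `A` with the
action `(m ⊠ b) ⊗ b' = m ⊠ (b ⊗ b')` of `B`. -/
structure BaseChange where
  /-- the universal balanced functor `(m, b) ↦ m ⊠ b` -/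
  tensor : BalancedFunctor k F M P
  isUniversal : tensor.IsUniversal
  /-- the isomorphisms `(m ⊠ b) ⊗ b' ≅ m ⊠ (b ⊗ b')` -/
  [linear (m : M) : (tensor.functor.obj m).RightLinear B]
  linear_natural {m m' : M} (f : m ⟶ m') (b b' : B) :
    (tensor.functor.map f).app b ⊵ᵣ b' ≫ μᵣ (tensor.functor.obj m') b b' =
      μᵣ (tensor.functor.obj m) b b' ≫ (tensor.functor.map f).app (b ⊗ b')
  linear_bal (m : M) (a : A) (b b' : B) :
    μᵣ (tensor.functor.obj (m ⊙ᵣ a)) b b' ≫ (tensor.bal m a (b ⊗ b')).hom =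
      (tensor.bal m a b).hom ⊵ᵣ b' ≫ μᵣ (tensor.functor.obj m) (F.obj a ⊗ b) b' ≫
        (tensor.functor.obj m).map (α_ (F.obj a) b b').hom

variable {k F M P} in
/-- The object `m ⊠ b` of the base change. -/
abbrev BaseChange.box (T : BaseChange k F M P) (m : M) (b : B) : P :=
  (T.tensor.functor.obj m).obj b

end BaseChange

end RexTensor

open IndExt RexTensor

open CategoryTheory Limits Functor Opposite MonoidalCategory MonoidalRightAction

set_option linter.unusedSectionVars false
set_option linter.unusedVariables false

/-! Write Hom(m, -) for the right adjoint act_m^R and R for the algebra F(End(m)) in ind(B). The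
whole argument runs through one explicit model of the relative tensor product: the full subcategory
`finMod R` of left R-modules in ind(B) generated under finite colimits by the free modules R ⊗ b
with b in B, together with the balanced functor T(n, b) = F(Hom(m, n)) ⊗ b (`finTensor`).

The values of T are finite modules for the following reason. Since m is a generator, the counit m ⊗
Hom(m, n) ⟶ n is an epimorphism. Since n is finitely presentable in ind(M) and M is abelian, some m
⊗ a with a in A already covers n, so n has a presentation m ⊗ a' ⟶ m ⊗ a ⟶ n ⟶ 0
(`exists_presentation`). Since m is projective, n ↦ F(Hom(m, n)) is right exact (`isRex_imageMod`).
Rigidity of A gives Hom(m, n ⊗ a) ≅ Hom(m, n) ⊗ a (`isIso_μᵣ_of_exactPairing`); this is the source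
of the balancing, and for n = m it shows that F(Hom(m, m ⊗ a)) is the free module on F(a). So
F(Hom(m, n)) is a cokernel of a morphism between free modules.

Universality is a representability argument. Let S be a balanced functor with values in E and e an
object of E. For each n the functor b ↦ Hom(S(n, b), e) is represented by an ind-object W(n) of B.
The balancing identifies the b-valued elements of W(n ⊗ a) with the (F(a) ⊗ b)-valued elements of
W(n); pulling back along morphisms m ⊗ a ⟶ n then produces F(Hom(m, n)) ⊗ W(n) ⟶ W(m), in particular
an R-module structure on W(m). Now R-linear morphisms F(Hom(m, n)) ⊗ b ⟶ W(m) are the same as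
morphisms S(n, b) ⟶ e (`bijective_repHom`): for n = m by freeness, for n = m ⊗ a by balancing, in
general by the presentation of n. Hence e ↦ W(m) has a left adjoint defined on the finite modules,
and this right exact functor restricts to S along T (`essSurj_compFunctor`). If S is T followed by a
right exact G, the same modules satisfy Hom(G(Z), e) ≅ Hom_R(Z, W(m)) for every finite Z
(`bijective_finHom`), so a transformation between two such functors is determined by its values on
free modules (`faithful_compFunctor`) and can be constructed from them (`full_compFunctor`). That
the construction returns the given values on all T(n, b) uses that every morphism T(m, c) ⟶ T(n, b)
is composed of the structure maps of T (`exists_finTensor_hom`).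

Finite modules are finitely presentable and the free ones detect isomorphisms, so the ind-completion
of the model is the category of all R-modules in ind(B) (`isEquivalence_ext_incl`). Any other base
change P is equivalent to the model by universality (`BalancedFunctor.exists_isEquivalence`). The
equivalence is B-linear because all coherence conditions can be tested on the objects n ⊠ b
(`BaseChange.exists_laxRightLinear`), and the linear structure extends to ind-objects
(`extRightLinear`). Finally m ⊠ 𝟙 corresponds to R itself; its action functor becomes the free
module functor, whose right adjoint is the forgetful functor, faithful and cocontinuous
(`isProgenerator_of_rightLinear`). -/

namespace IndExt

/-! ### Functors on ind-objects: reduction to representables -/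

section Generic

variable {C : Type u₁} [Category.{v} C] {D : Type u₂} [Category.{v₂} D]
  {T : Type u₄} [Category.{w} T]

/-- A natural transformation between functors preserving filtered colimits is invertible if it is
invertible on representable objects. -/
theorem isIso_app_of_yoneda {F G : Ind C ⥤ T} [PresFilt F] [PresFilt G] (τ : F ⟶ G)
    (h : ∀ c, IsIso (τ.app (Ind.yoneda.obj c))) (X : Ind C) : IsIso (τ.app X) := by
  let hF := isColimitOfPreserves F (presIsColimit X)
  let hG := isColimitOfPreserves G (presIsColimit X)
  let e : (X.presentation.F ⋙ Ind.yoneda) ⋙ F ≅ (X.presentation.F ⋙ Ind.yoneda) ⋙ G :=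
    NatIso.ofComponents (fun i ↦ asIso (τ.app (Ind.yoneda.obj (X.presentation.F.obj i))))
      (fun f ↦ τ.naturality _)
  have : τ.app X = (IsColimit.coconePointsIsoOfNatIso hF hG e).hom := by
    refine hF.hom_ext fun j ↦ ?_
    refine Eq.trans ?_ (IsColimit.comp_coconePointsIsoOfNatIso_hom hF hG e j).symm
    exact τ.naturality _
  exact this ▸ Iso.isIso_hom _

/-- B(X, -) is a filtered colimit of the functors B(c, -) over the representables c mapping to X,
and colimits commute with colimits. Applied to the tensor product, where the B(c, -) are left
adjoints by duality, it makes tensoring with any ind-object cocontinuous. -/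
theorem preservesColimitsOfShape_obj (B : Ind C ⥤ D ⥤ T) [∀ Y, PresFilt (B.flip.obj Y)]
    {J : Type u₅} [Category.{v₃} J]
    (hB : ∀ c, PreservesColimitsOfShape J (B.obj (Ind.yoneda.obj c))) (X : Ind C) :
    PreservesColimitsOfShape J (B.obj X) := by
  refine ⟨fun {K} ↦ ⟨fun {c} hc ↦ ?_⟩⟩
  -- The induced morphism at one stage B(x, -) of B(X, -); the compatibility `hd` allows gluing over
  -- all x mapping to X.
  let dsc (s : Cocone (K ⋙ B.obj X)) (x : C) (u : Ind.yoneda.obj x ⟶ X) :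
      (B.flip.obj c.pt).obj (Ind.yoneda.obj x) ⟶ s.pt :=
    (isColimitOfPreserves (B.obj (Ind.yoneda.obj x)) hc).desc
      ((Cocone.precompose (Functor.whiskerLeft K (B.map u))).obj s)
  have hdsc (s : Cocone (K ⋙ B.obj X)) (x : C) (u : Ind.yoneda.obj x ⟶ X) (j : J) :
      (B.obj (Ind.yoneda.obj x)).map (c.ι.app j) ≫ dsc s x u =
        (B.map u).app (K.obj j) ≫ s.ι.app j :=
    (isColimitOfPreserves (B.obj (Ind.yoneda.obj x)) hc).fac _ j
  have hd (s : Cocone (K ⋙ B.obj X)) : ∀ (x x' : C) (f : x ⟶ x') (u : Ind.yoneda.obj x' ⟶ X),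
      (B.flip.obj c.pt).map (Ind.yoneda.map f) ≫ dsc s x' u = dsc s x (Ind.yoneda.map f ≫ u) := by
    intro x x' f u
    refine (isColimitOfPreserves (B.obj (Ind.yoneda.obj x)) hc).hom_ext fun j ↦ ?_
    refine Eq.trans ?_ (hdsc s x _ j).symm
    refine (NatTrans.naturality_assoc (B.map (Ind.yoneda.map f)) (c.ι.app j) (dsc s x' u)).trans ?_
    rw [hdsc]
    simp
  refine ⟨IsColimit.mk (fun s ↦ desc (B.flip.obj c.pt) X s.pt (dsc s) (hd s)) (fun s j ↦ ?_)
    (fun s m hm ↦ ?_)⟩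
  · refine hom_ext (B.flip.obj (K.obj j)) fun x u ↦ ?_
    refine (NatTrans.naturality_assoc (B.map u) (c.ι.app j) _).symm.trans ?_
    refine (congrArg ((B.obj (Ind.yoneda.obj x)).map (c.ι.app j) ≫ ·)
      (map_desc (B.flip.obj c.pt) X s.pt (dsc s) (hd s) x u)).trans ?_
    exact hdsc s x u j
  · refine hom_ext (B.flip.obj c.pt) fun x u ↦ ?_
    rw [map_desc]
    refine (isColimitOfPreserves (B.obj (Ind.yoneda.obj x)) hc).hom_ext fun j ↦ ?_
    refine Eq.trans ?_ (hdsc s x u j).symm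
    refine (NatTrans.naturality_assoc (B.map u) (c.ι.app j) m).trans ?_
    exact congrArg ((B.map u).app (K.obj j) ≫ ·) (hm j)

end Generic

/-! ### Factoring morphisms through the stages of a presentation -/

section Leg

variable {C : Type u₁} [Category.{v} C]

/-- The legs of the canonical presentation of an ind-object. -/
noncomputable def presLeg (X : Ind C) (i : X.presentation.I) :
    Ind.yoneda.obj (X.presentation.F.obj i) ⟶ X := (presCocone X).ι.app i

theorem map_presLeg (X : Ind C) {i j : X.presentation.I} (f : i ⟶ j) :
    Ind.yoneda.map (X.presentation.F.map f) ≫ presLeg X j = presLeg X i := (presCocone X).w f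

theorem exists_presLeg {X : Ind C} {c : C} (p : Ind.yoneda.obj c ⟶ X) :
    ∃ (i : X.presentation.I) (q : c ⟶ X.presentation.F.obj i),
      p = Ind.yoneda.map q ≫ presLeg X i := by
  obtain ⟨i, p, rfl⟩ := IsFinitelyPresentable.exists_hom_of_isColimit (presIsColimit X) p
  obtain ⟨p, rfl⟩ := Ind.yoneda.map_surjective p
  exact ⟨i, p, rfl⟩

theorem exists_map_presLeg {T : Type u₄} [Category.{w} T] (Φ : Ind C ⥤ T) [PresFilt Φ] {X : Ind C}
    {t : T} [IsFinitelyPresentable.{v} t] (p : t ⟶ Φ.obj X) :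
    ∃ (i : X.presentation.I) (q : t ⟶ Φ.obj (Ind.yoneda.obj (X.presentation.F.obj i))),
      p = q ≫ Φ.map (presLeg X i) := by
  obtain ⟨i, p, rfl⟩ := IsFinitelyPresentable.exists_hom_of_isColimit
    (isColimitOfPreserves Φ (presIsColimit X)) p
  exact ⟨i, p, rfl⟩

theorem exists_map_presLeg_eq {T : Type u₄} [Category.{w} T] (Φ : Ind C ⥤ T) [PresFilt Φ]
    {X : Ind C} {t : T} [IsFinitelyPresentable.{v} t] {i j : X.presentation.I}
    (p : t ⟶ Φ.obj (Ind.yoneda.obj (X.presentation.F.obj i)))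
    (q : t ⟶ Φ.obj (Ind.yoneda.obj (X.presentation.F.obj j)))
    (h : p ≫ Φ.map (presLeg X i) = q ≫ Φ.map (presLeg X j)) :
    ∃ (l : X.presentation.I) (s : i ⟶ l) (r : j ⟶ l),
      p ≫ Φ.map (Ind.yoneda.map (X.presentation.F.map s)) =
        q ≫ Φ.map (Ind.yoneda.map (X.presentation.F.map r)) :=
  IsFinitelyPresentable.exists_eq_of_isColimit
    (isColimitOfPreserves Φ (presIsColimit X)) _ _ h

end Leg

/-! ### Criteria for a functor on ind-objects to be fully faithful or an equivalence -/

section FullyFaithful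

variable {C : Type u₁} [Category.{v} C] {T : Type u₂} [Category.{v} T]
  (Φ : Ind C ⥤ T) [PresFilt Φ] [(Ind.yoneda ⋙ Φ).Full] [(Ind.yoneda ⋙ Φ).Faithful]
  [∀ c, IsFinitelyPresentable.{v} (Φ.obj (Ind.yoneda.obj c))]

/-- Both morphisms live at a finite stage of Y. As Φ(c) is finitely presentable, the equality of
their images in Φ(Y) already holds at a later stage, where Φ is faithful. -/
theorem map_injective_of_yoneda {c : C} {Y : Ind C} {p q : Ind.yoneda.obj c ⟶ Y}
    (h : Φ.map p = Φ.map q) : p = q := by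
  obtain ⟨i, p, rfl⟩ := exists_presLeg p
  obtain ⟨j, q, rfl⟩ := exists_presLeg q
  rw [Φ.map_comp, Φ.map_comp] at h
  obtain ⟨l, s, t, e⟩ := exists_map_presLeg_eq Φ _ _ h
  have e' : p ≫ Y.presentation.F.map s = q ≫ Y.presentation.F.map t :=
    (Ind.yoneda ⋙ Φ).map_injective (by simpa using! e)
  rw [← map_presLeg Y s, ← map_presLeg Y t, ← Category.assoc, ← Category.assoc,
    ← Functor.map_comp, ← Functor.map_comp, e']

/-- Finite presentability of Φ(c) factors g through the image of a stage of Y, and there fullness on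
representables applies. -/
theorem map_surjective_of_yoneda {c : C} {Y : Ind C} (g : Φ.obj (Ind.yoneda.obj c) ⟶ Φ.obj Y) :
    ∃ p : Ind.yoneda.obj c ⟶ Y, Φ.map p = g := by
  obtain ⟨i, p, rfl⟩ := exists_map_presLeg Φ g
  obtain ⟨p, rfl⟩ := (Ind.yoneda ⋙ Φ).map_surjective p
  exact ⟨Ind.yoneda.map p ≫ presLeg Y i, Φ.map_comp _ _⟩

theorem faithful_of_yoneda : Φ.Faithful where
  map_injective {X Y f g} h := hom_ext (𝟭 (Ind C)) fun c u ↦ map_injective_of_yoneda Φ (by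
    simp [h])

/-- Preimages are chosen on all representables over X; they are compatible because preimages are
unique, so they glue. -/
theorem full_of_yoneda : Φ.Full where
  map_surjective {X Y} g := by
    choose p hp using fun (c : C) (u : Ind.yoneda.obj c ⟶ X) ↦
      map_surjective_of_yoneda Φ (Φ.map u ≫ g)
    obtain ⟨f, hf⟩ := exists_desc (𝟭 (Ind C)) X Y p (fun c c' f u ↦
      map_injective_of_yoneda Φ (by simp [hp]))
    refine ⟨f, hom_ext Φ fun c u ↦ ?_⟩
    rw [← hp, ← Φ.map_comp]
    exact congrArg Φ.map (hf c u)

/-- Φ is a fully faithful left adjoint, so only the counit has to be inverted. Composing morphisms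
out of Φ(c) with the counit is the adjunction bijection after full faithfulness, hence bijective,
and `hdet` says that such morphisms detect isomorphisms. -/
theorem isEquivalence_of_yoneda [EssentiallySmall.{v} C] [HasFiniteColimits C]
    [PreservesFiniteColimits (Ind.yoneda ⋙ Φ)]
    (hdet : ∀ {X Y : T} (f : X ⟶ Y), (∀ c, Function.Bijective
      (fun g : Φ.obj (Ind.yoneda.obj c) ⟶ X ↦ g ≫ f)) → IsIso f) : Φ.IsEquivalence := by
  have := faithful_of_yoneda Φ
  have := full_of_yoneda Φ
  have := isLeftAdjoint_of_rightExact Φ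
  let adj := Adjunction.ofIsLeftAdjoint Φ
  have (Z : T) : IsIso (adj.counit.app Z) := hdet _ fun c ↦ by
    have e : (fun g : Φ.obj (Ind.yoneda.obj c) ⟶ Φ.obj ((rightAdjoint Φ).obj Z) ↦
        g ≫ adj.counit.app Z) = (adj.homEquiv _ _).symm ∘ Φ.preimage := by
      ext g
      simp [Adjunction.homEquiv_counit]
    exact (congrArg Function.Bijective e).mpr ((Equiv.bijective _).comp
      (Functor.FullyFaithful.ofFullyFaithful Φ).homEquiv.symm.bijective)
  exact { essSurj := ⟨fun Z ↦ ⟨_, ⟨asIso (adj.counit.app Z)⟩⟩⟩ }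

end FullyFaithful

end IndExt

namespace IndExt

/-! ### Right exact functors between additive categories are additive -/

section Additive

variable {C : Type u₁} [Category.{v₁} C] [Preadditive C] {D : Type u₂} [Category.{v₂} D]
  [Preadditive D]

/-- Finite coproducts are biproducts here, and a functor preserving the zero object and binary
biproducts preserves sums of morphisms. -/
theorem additive_of_preservesFiniteColimits [HasFiniteColimits C] (G : C ⥤ D)
    [PreservesFiniteColimits G] : G.Additive := by
  have : HasBinaryBiproducts C := HasBinaryBiproducts.of_hasBinaryCoproducts
  have : HasZeroObject C := hasZeroObject_of_hasInitial_object
  have : HasInitial D := (IsInitial.isInitialObj G _ initialIsInitial).hasInitial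
  have : HasZeroObject D := hasZeroObject_of_hasInitial_object
  have : G.PreservesZeroMorphisms := preservesZeroMorphisms_of_preserves_initial_object
  have := preservesBinaryBiproducts_of_preservesBinaryCoproducts G
  exact Functor.additive_of_preservesBinaryBiproducts G

end Additive

/-! ### The k-linear structure on ind-objects -/

section Preadditive

variable (C : Type u₁) [Category.{v} C] [EssentiallySmall.{v} C]

theorem isFinitelyPresentable_of_iso' {T : Type u₂} [Category.{v} T] {X Y : T} (e : X ≅ Y)
    [IsFinitelyPresentable.{v} X] : IsFinitelyPresentable.{v} Y := by
  rw [isFinitelyPresentable_iff_preservesFilteredColimits] at *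
  exact ⟨fun J _ _ ↦ preservesColimitsOfShape_of_natIso (coyoneda.mapIso e.symm.op)⟩

/-- The embedding of ind-objects of `C` into ind-objects of a small model of `C`. -/
noncomputable def indSmall : Ind C ⥤ Ind (SmallModel.{v} C) := indMap (equivSmallModel C).functor

/-- On representables the functor is fully faithful with finitely presentable values, so the
criteria above apply. The additive structure of `Ind C` is pulled back along this embedding. -/
theorem indSmall_full_faithful : (indSmall C).Full ∧ (indSmall C).Faithful := by
  let e := indMapYoneda (equivSmallModel.{v} C).functor
  have : PresFilt (indSmall C) := presFilt_indMap _
  have : (Ind.yoneda ⋙ indSmall C).Full := Functor.Full.of_iso e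
  have : (Ind.yoneda ⋙ indSmall C).Faithful := Functor.Faithful.of_iso e
  have (c : C) : IsFinitelyPresentable.{v} ((indSmall C).obj (Ind.yoneda.obj c)) :=
    have : IsFinitelyPresentable.{v} (((equivSmallModel.{v} C).functor ⋙ Ind.yoneda).obj c) :=
      isFinitelyPresentable_yoneda _
    isFinitelyPresentable_of_iso' (e.app c)
  exact ⟨full_of_yoneda _, faithful_of_yoneda _⟩

variable [Preadditive C] [HasFiniteColimits C]

noncomputable instance indPreadditive : Preadditive (Ind C) := by
  letI : Preadditive (SmallModel.{v} C) :=
    Preadditive.ofFullyFaithful (equivSmallModel.{v} C).fullyFaithfulInverse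
  haveI : HasFiniteColimits (SmallModel.{v} C) :=
    ⟨fun J _ _ ↦ Adjunction.hasColimitsOfShape_of_equivalence (equivSmallModel.{v} C).inverse⟩
  haveI := (indSmall_full_faithful C).1
  haveI := (indSmall_full_faithful C).2
  exact Preadditive.ofFullyFaithful (Functor.FullyFaithful.ofFullyFaithful (indSmall C))

instance additive_indYoneda : (Ind.yoneda (C := C)).Additive :=
  additive_of_preservesFiniteColimits _

variable (k : Type w) [Field k] [Linear k C]

variable {C k} in
-- Multiplication by r is natural on representables and therefore glues. These endomorphisms are
-- central, which is how the k-linear structure on ind-objects is defined.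
theorem exists_indScalar (r : k) (X : Ind C) :
    ∃ f : X ⟶ X, ∀ (c : C) (u : Ind.yoneda.obj c ⟶ X), u ≫ f = Ind.yoneda.map (r • 𝟙 c) ≫ u :=
  exists_desc (𝟭 (Ind C)) X X (fun c u ↦ Ind.yoneda.map (r • 𝟙 c) ≫ u) (fun c c' f u ↦ by
    simp only [Functor.id_map, ← Category.assoc, ← Functor.map_comp]
    simp)

variable {C k} in
/-- Multiplication by a scalar on an ind-object. -/
noncomputable def indScalar (r : k) (X : Ind C) : X ⟶ X := (exists_indScalar r X).choose

variable {C k} in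
theorem comp_indScalar (r : k) {X : Ind C} {c : C} (u : Ind.yoneda.obj c ⟶ X) :
    u ≫ indScalar r X = Ind.yoneda.map (r • 𝟙 c) ≫ u := (exists_indScalar r X).choose_spec c u

variable {C} in
theorem yoneda_hom_ext {X Y : Ind C} {f g : X ⟶ Y}
    (h : ∀ (c : C) (u : Ind.yoneda.obj c ⟶ X), u ≫ f = u ≫ g) : f = g :=
  hom_ext (𝟭 (Ind C)) h

/-- The action of scalars on ind-objects. -/
noncomputable def indCenter : k →+* CatCenter (Ind C) where
  toFun r :=
    { app := fun X ↦ indScalar r X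
      naturality := fun X Y f ↦ yoneda_hom_ext fun c u ↦ by
        have h : (u ≫ f) ≫ indScalar r Y = (u ≫ indScalar r X) ≫ f := by
          rw [comp_indScalar]
          refine Eq.trans ?_ (congrArg (· ≫ f) (comp_indScalar r (X := X) u).symm)
          simp
        exact (Category.assoc _ _ _).symm.trans (h.trans (Category.assoc _ _ _)) }
  map_one' := by
    ext X
    refine yoneda_hom_ext fun c u ↦ ?_
    refine (comp_indScalar _ u).trans ?_
    simp
  map_mul' r s := by
    ext X
    refine yoneda_hom_ext fun c u ↦ ?_
    refine (comp_indScalar _ u).trans (Eq.trans ?_ (Category.assoc _ _ _))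
    rw [comp_indScalar]
    refine Eq.trans ?_ (Category.assoc _ _ _).symm
    refine Eq.trans ?_ (congrArg (Ind.yoneda.map (s • 𝟙 c) ≫ ·) (comp_indScalar r u).symm)
    simp [← Functor.map_comp_assoc, smul_smul]
  map_zero' := by
    ext X
    refine yoneda_hom_ext fun c u ↦ ?_
    refine (comp_indScalar _ u).trans ?_
    simp
  map_add' r s := by
    ext X
    refine yoneda_hom_ext fun c u ↦ ?_
    refine (comp_indScalar _ u).trans ?_
    refine Eq.trans ?_ (Preadditive.comp_add _ _ _ _ _ _).symm
    rw [comp_indScalar, comp_indScalar, add_smul, Functor.map_add, Preadditive.add_comp]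

noncomputable instance indLinear : Linear k (Ind C) := Linear.ofRingMorphism (indCenter C k)

variable {C k}

theorem indScalar_eq (r : k) (X : Ind C) : r • 𝟙 X = indScalar r X :=
  (Category.comp_id (indScalar r X) : indScalar r X ≫ 𝟙 X = _)

instance linear_indYoneda : (Ind.yoneda (C := C)).Linear k where
  map_smul {X Y} f r := by
    have h : Ind.yoneda.map (r • 𝟙 X) = r • 𝟙 (Ind.yoneda.obj X) := by
      rw [indScalar_eq, ← Category.id_comp (indScalar r _), comp_indScalar, Category.comp_id]
    rw [← Category.id_comp f, ← Linear.smul_comp, Functor.map_comp, h, Linear.smul_comp,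
      Category.id_comp, Category.id_comp]

theorem isRex_indYoneda : IsRex k (Ind.yoneda (C := C)) where
  map_add _ _ := Functor.map_add _
  map_smul r f := (Ind.yoneda (C := C)).map_smul r f
  preservesFiniteColimits := inferInstance

end Preadditive

/-! ### A criterion for k-linear right exactness -/

section IsRex

variable {k : Type w} [Field k] {C : Type u₁} [Category.{v₁} C] [Preadditive C] [Linear k C]
  [HasFiniteColimits C] {D : Type u₂} [Category.{v₂} D] [Preadditive D] [Linear k D]

/-- Additivity is automatic, and r • f = (r • 𝟙) ≫ f reduces k-linearity to scalar multiples of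
identities. -/
theorem isRex_of_preservesFiniteColimits (G : C ⥤ D) [PreservesFiniteColimits G]
    (h : ∀ (r : k) (X : C), G.map (r • 𝟙 X) = r • 𝟙 (G.obj X)) : IsRex k G where
  map_add _ _ := have := additive_of_preservesFiniteColimits G; G.map_add
  map_smul {X Y} r f := by
    rw [← Category.id_comp f, ← Linear.smul_comp, Functor.map_comp, h]
    simp
  preservesFiniteColimits := inferInstance

end IsRex

end IndExt

namespace IndExt

open Functor.LaxMonoidal Functor.OplaxMonoidal

/-! ### The embedding of a monoidal category into its ind-objects is monoidal -/

section Yoneda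

variable {A : Type u₁} [Category.{v} A] [MonoidalCategory A]

instance isIso_tmul_id (c d : A) :
    IsIso (tmul (𝟙 (Ind.yoneda.obj c)) (𝟙 (Ind.yoneda.obj d))) := by
  rw [tmul, pair_id]
  infer_instance

/-- The comparison `y(c) ⊗ y(d) ≅ y(c ⊗ d)`. -/
noncomputable def yonedaTensorIso (c d : A) :
    Ind.yoneda.obj c ⊗ Ind.yoneda.obj d ≅ Ind.yoneda.obj (c ⊗ d) :=
  (asIso (tmul (𝟙 (Ind.yoneda.obj c)) (𝟙 (Ind.yoneda.obj d)))).symm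

theorem tmul_id_yonedaTensorIso (c d : A) :
    tmul (𝟙 (Ind.yoneda.obj c)) (𝟙 (Ind.yoneda.obj d)) ≫ (yonedaTensorIso c d).hom = 𝟙 _ :=
  IsIso.hom_inv_id _

theorem tmul_map_yonedaTensorIso {a b c d : A} (f : a ⟶ c) (g : b ⟶ d) :
    tmul (Ind.yoneda.map f) (Ind.yoneda.map g) ≫ (yonedaTensorIso c d).hom =
      Ind.yoneda.map (f ⊗ₘ g) := by
  rw [← Category.comp_id (Ind.yoneda.map f), ← Category.comp_id (Ind.yoneda.map g),
    ← map_tmul_left, ← map_tmul_right, Category.assoc, Category.assoc, tmul_id_yonedaTensorIso,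
    Category.comp_id, ← Functor.map_comp, MonoidalCategory.tensorHom_def]

theorem tmul_eq {X Y : Ind A} {c d : A} (u : Ind.yoneda.obj c ⟶ X) (w : Ind.yoneda.obj d ⟶ Y) :
    tmul u w = (yonedaTensorIso c d).inv ≫ (u ⊗ₘ w) := by
  rw [Iso.eq_inv_comp, ← cancel_epi (tmul (𝟙 (Ind.yoneda.obj c)) (𝟙 (Ind.yoneda.obj d))),
    ← Category.assoc, tmul_id_yonedaTensorIso, Category.id_comp, tmul_tensorHom, Category.id_comp,
    Category.id_comp]

/-- The structure isomorphisms of the monoidal functor from `A` to its ind-objects. -/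
noncomputable def yonedaCoreMonoidal : (Ind.yoneda (C := A)).CoreMonoidal where
  εIso := Iso.refl _
  μIso := yonedaTensorIso
  μIso_hom_natural_left {X Y} f Z := by
    rw [← cancel_epi (tmul (𝟙 (Ind.yoneda.obj X)) (𝟙 (Ind.yoneda.obj Z))), ← Category.assoc,
      ← Category.assoc, tmul_whiskerRight, tmul_id_yonedaTensorIso, Category.id_comp,
      Category.id_comp, ← CategoryTheory.Functor.map_id, tmul_map_yonedaTensorIso, tensorHom_id]
  μIso_hom_natural_right {X Y} Z f := by
    rw [← cancel_epi (tmul (𝟙 (Ind.yoneda.obj Z)) (𝟙 (Ind.yoneda.obj X))), ← Category.assoc,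
      ← Category.assoc, tmul_whiskerLeft, tmul_id_yonedaTensorIso, Category.id_comp,
      Category.id_comp, ← CategoryTheory.Functor.map_id, tmul_map_yonedaTensorIso, id_tensorHom]
  associativity X Y Z := tmul_hom_ext₃ fun c d e u w x ↦ by
    obtain ⟨u, rfl⟩ := Ind.yoneda.map_surjective u
    obtain ⟨w, rfl⟩ := Ind.yoneda.map_surjective w
    obtain ⟨x, rfl⟩ := Ind.yoneda.map_surjective x
    rw [← Category.assoc, tmul_whiskerRight, tmul_map_yonedaTensorIso, ← Category.assoc,
      tmul_map_yonedaTensorIso, ← Category.assoc (tmul _ _), tmul_associator, Category.assoc,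
      ← Category.assoc (tmul _ _), tmul_whiskerLeft, tmul_map_yonedaTensorIso,
      tmul_map_yonedaTensorIso, ← Functor.map_comp, ← Functor.map_comp, associator_naturality]
  left_unitality X := tmul_hom_ext fun c d u w ↦ by
    obtain ⟨u, rfl⟩ := Ind.yoneda.map_surjective u
    obtain ⟨w, rfl⟩ := Ind.yoneda.map_surjective w
    refine (tmul_leftUnitor _ u).trans ?_
    simp only [Iso.refl_hom, id_whiskerRight, Category.id_comp]
    refine Eq.trans ?_ (Category.assoc _ _ _)
    refine Eq.trans ?_ (congrArg (· ≫ _) (tmul_map_yonedaTensorIso u w).symm)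
    rw [← Functor.map_comp, ← Functor.map_comp]
    simp [MonoidalCategory.tensorHom_def]
  right_unitality X := tmul_hom_ext fun c d u w ↦ by
    obtain ⟨u, rfl⟩ := Ind.yoneda.map_surjective u
    obtain ⟨w, rfl⟩ := Ind.yoneda.map_surjective w
    refine (tmul_rightUnitor _ w).trans ?_
    simp only [Iso.refl_hom, MonoidalCategory.whiskerLeft_id, Category.id_comp]
    refine Eq.trans ?_ (Category.assoc _ _ _)
    refine Eq.trans ?_ (congrArg (· ≫ _) (tmul_map_yonedaTensorIso u w).symm)
    rw [← Functor.map_comp, ← Functor.map_comp]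
    simp [tensorHom_def']

noncomputable instance yonedaMonoidal : (Ind.yoneda (C := A)).Monoidal :=
  yonedaCoreMonoidal.toMonoidal

theorem μ_yoneda (c d : A) : μ (Ind.yoneda (C := A)) c d = (yonedaTensorIso c d).hom := rfl

theorem ε_yoneda : ε (Ind.yoneda (C := A)) = 𝟙 _ := rfl

end Yoneda

/-! ### The extension of a strong monoidal functor to ind-objects is strong -/

section IndMap

variable {A : Type u₁} [Category.{v} A] [MonoidalCategory A] {B : Type u₂} [Category.{v} B]
  [MonoidalCategory B] (F : A ⥤ B) {X Y : Ind A} {c d : A}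

theorem tmul_el_μ [F.LaxMonoidal] (u : Ind.yoneda.obj c ⟶ X) (w : Ind.yoneda.obj d ⟶ Y) :
    tmul (el F u) (el F w) ≫ μ (indMap F) X Y = Ind.yoneda.map (μ F c d) ≫ el F (tmul u w) :=
  (exists_tensorComparison F X Y).choose_spec c d u w

theorem ε_indMap [F.LaxMonoidal] : ε (indMap F) = Ind.yoneda.map (ε F) ≫ el F (𝟙 _) := rfl

theorem isIso_el {u : Ind.yoneda.obj c ⟶ X} [IsIso u] : IsIso (el F u) := by
  rw [← Category.id_comp u, ← el_map]
  infer_instance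

variable [F.Monoidal]

/-- Source and target preserve filtered colimits in each variable, so both variables can be reduced
to representables, where the comparison is that of F up to canonical isomorphisms. -/
instance isIso_μ_indMap (X Y : Ind A) : IsIso (μ (indMap F) X Y) := by
  have h₁ (c d : A) : IsIso (μ (indMap F) (Ind.yoneda.obj c) (Ind.yoneda.obj d)) := by
    have := exists_isIso_tmul_el F c d
    have : IsIso (el F (tmul (𝟙 (Ind.yoneda.obj c)) (𝟙 (Ind.yoneda.obj d)))) := isIso_el F
    have h := tmul_el_μ F (𝟙 (Ind.yoneda.obj c)) (𝟙 (Ind.yoneda.obj d))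
    rw [← IsIso.eq_inv_comp] at h
    rw [h]
    infer_instance
  have h₂ (c : A) (Y : Ind A) : IsIso (μ (indMap F) (Ind.yoneda.obj c) Y) := by
    let G : Ind A ⥤ Ind B :=
      indMap F ⋙ (indBi (curriedTensor B)).obj ((indMap F).obj (Ind.yoneda.obj c))
    let G' : Ind A ⥤ Ind B := (indBi (curriedTensor A)).obj (Ind.yoneda.obj c) ⋙ indMap F
    have : PresFilt G := inferInstance
    have : PresFilt G' := inferInstance
    let τ : G ⟶ G' :=
      { app := fun Y ↦ μ (indMap F) (Ind.yoneda.obj c) Y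
        naturality := fun _ _ f ↦ μ_natural_right (indMap F) _ f }
    exact isIso_app_of_yoneda τ (h₁ c) Y
  let G : Ind A ⥤ Ind B :=
    indMap F ⋙ (indBi (curriedTensor B)).flip.obj ((indMap F).obj Y)
  let G' : Ind A ⥤ Ind B := (indBi (curriedTensor A)).flip.obj Y ⋙ indMap F
  have : PresFilt G := inferInstance
  have : PresFilt G' := inferInstance
  let τ : G ⟶ G' :=
    { app := fun X ↦ μ (indMap F) X Y
      naturality := fun _ _ f ↦ μ_natural_left (indMap F) f _ }
  exact isIso_app_of_yoneda τ (fun c ↦ h₂ c Y) X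

end IndMap

/-! ### Monoidal functors preserve duals -/

section Duals

variable {C : Type u₁} [Category.{v₁} C] [MonoidalCategory C] {D : Type u₂} [Category.{v₂} D]
  [MonoidalCategory D]

/-- A monoidal functor preserves exact pairings. -/
@[reducible]
def mapExactPairing (F : C ⥤ D) [F.Monoidal] (X Y : C) [ExactPairing X Y] :
    ExactPairing (F.obj X) (F.obj Y) where
  coevaluation' := ε F ≫ F.map (η_ X Y) ≫ δ F X Y
  evaluation' := μ F Y X ≫ F.map (ε_ X Y) ≫ η F
  coevaluation_evaluation' := by
    have h := congrArg F.map (ExactPairing.coevaluation_evaluation X Y)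
    simp only [Functor.map_comp, Functor.Monoidal.map_whiskerLeft,
      Functor.Monoidal.map_whiskerRight, Functor.Monoidal.map_associator_inv,
      Functor.Monoidal.map_rightUnitor, Functor.Monoidal.map_leftUnitor_inv,
      Category.assoc, Functor.Monoidal.μ_δ_assoc] at h
    -- The image of the zigzag identity under F, with the comparison isomorphisms of F put at both
    -- ends.
    have h' := (F.obj Y ◁ ε F ≫ μ F _ _) ≫= (h =≫ (δ F _ _ ≫ η F ▷ F.obj Y))
    simp only [Category.assoc, Functor.Monoidal.μ_δ_assoc, MonoidalCategory.whiskerLeft_comp,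
      comp_whiskerRight] at h' ⊢
    rw [h']
    simp only [← MonoidalCategory.whiskerLeft_comp_assoc, ← comp_whiskerRight,
      Functor.Monoidal.ε_η]
    simp
  evaluation_coevaluation' := by
    have h := congrArg F.map (ExactPairing.evaluation_coevaluation X Y)
    simp only [Functor.map_comp, Functor.Monoidal.map_whiskerLeft,
      Functor.Monoidal.map_whiskerRight, Functor.Monoidal.map_associator,
      Functor.Monoidal.map_leftUnitor, Functor.Monoidal.map_rightUnitor_inv,
      Category.assoc, Functor.Monoidal.μ_δ_assoc] at h
    have h' := (ε F ▷ F.obj X ≫ μ F _ _) ≫= (h =≫ (δ F _ _ ≫ F.obj X ◁ η F))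
    simp only [Category.assoc, Functor.Monoidal.μ_δ_assoc, MonoidalCategory.whiskerLeft_comp,
      comp_whiskerRight] at h' ⊢
    rw [h']
    simp only [← MonoidalCategory.whiskerLeft_comp, ← comp_whiskerRight_assoc,
      Functor.Monoidal.ε_η]
    simp

end Duals

/-! ### The tensor product of ind-objects is cocontinuous and bilinear -/

section Colimits

variable {A : Type u₁} [Category.{v} A] [MonoidalCategory A] [RigidCategory A]
  {J : Type u₂} [Category.{v₁} J]

/-- Rigidity enters here: tensoring with a representable y(a) has a right adjoint, tensoring with a
dual of a. General X follows by `preservesColimitsOfShape_obj`, for any shape J. -/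
instance preservesColimitsOfShape_tensorLeft (X : Ind A) :
    PreservesColimitsOfShape J (tensorLeft X) :=
  preservesColimitsOfShape_obj (indBi (curriedTensor A)) (fun a ↦
    letI := mapExactPairing (Ind.yoneda (C := A)) (ᘁa) a
    have := (tensorLeftAdjunction (Ind.yoneda.obj (ᘁa)) (Ind.yoneda.obj a)).isLeftAdjoint
    inferInstanceAs (PreservesColimitsOfShape J (tensorLeft (Ind.yoneda.obj a)))) X

instance preservesColimitsOfShape_tensorRight (X : Ind A) :
    PreservesColimitsOfShape J (tensorRight X) :=
  have (Y : Ind A) : PresFilt ((indBi (curriedTensor A)).flip.flip.obj Y) :=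
    inferInstanceAs (PresFilt ((indBi (curriedTensor A)).obj Y))
  preservesColimitsOfShape_obj (indBi (curriedTensor A)).flip (fun a ↦
    letI := mapExactPairing (Ind.yoneda (C := A)) a (aᘁ)
    have := (tensorRightAdjunction (Ind.yoneda.obj a) (Ind.yoneda.obj (aᘁ))).isLeftAdjoint
    inferInstanceAs (PreservesColimitsOfShape J (tensorRight (Ind.yoneda.obj a)))) X

instance preservesFiniteColimits_tensorLeft (X : Ind A) :
    PreservesFiniteColimits (tensorLeft X) := ⟨fun _ _ _ ↦ inferInstance⟩

instance preservesFiniteColimits_tensorRight (X : Ind A) :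
    PreservesFiniteColimits (tensorRight X) := ⟨fun _ _ _ ↦ inferInstance⟩

variable [EssentiallySmall.{v} A] [Preadditive A] [HasFiniteColimits A]

noncomputable instance indMonoidalPreadditive : MonoidalPreadditive (Ind A) :=
  have _hl (X : Ind A) := additive_of_preservesFiniteColimits (tensorLeft X)
  have _hr (X : Ind A) := additive_of_preservesFiniteColimits (tensorRight X)
  { whiskerLeft_zero := fun {X} _ _ ↦ (tensorLeft X).map_zero _ _
    zero_whiskerRight := fun {X} _ _ ↦ (tensorRight X).map_zero _ _
    whiskerLeft_add := fun {X} _ _ _ _ ↦ (tensorLeft X).map_add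
    add_whiskerRight := fun {X} _ _ _ _ ↦ (tensorRight X).map_add }

variable {k : Type w} [Field k] [Linear k A] [MonoidalPreadditive A] [MonoidalLinear k A]

noncomputable instance indMonoidalLinear : MonoidalLinear k (Ind A) where
  whiskerLeft_smul X {Y Z} r f := by
    -- It is enough to compare on the pieces c ⊗ d ⟶ X ⊗ Y, where scalars can be moved between the
    -- factors because the tensor product of A is bilinear.
    have h : X ◁ (r • 𝟙 Y) = r • 𝟙 (X ⊗ Y) := tmul_hom_ext fun c d u w ↦ by
      rw [tmul_whiskerLeft, indScalar_eq, comp_indScalar, ← map_tmul_right, indScalar_eq,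
        comp_indScalar]
      simp
    rw [← Category.id_comp f, ← Linear.smul_comp, MonoidalCategory.whiskerLeft_comp, h,
      Linear.smul_comp, Category.id_comp, Category.id_comp]
  smul_whiskerRight r {Y Z} f X := by
    have h : (r • 𝟙 Y) ▷ X = r • 𝟙 (Y ⊗ X) := tmul_hom_ext fun c d u w ↦ by
      rw [tmul_whiskerRight, indScalar_eq, comp_indScalar, ← map_tmul_left, indScalar_eq,
        comp_indScalar]
      simp
    rw [← Category.id_comp f, ← Linear.smul_comp, comp_whiskerRight, h,
      Linear.smul_comp, Category.id_comp, Category.id_comp]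

end Colimits

/-! ### Right exact functors extend to cocontinuous functors of ind-objects -/

section IndMapColimits

variable {A : Type u₁} [Category.{v} A] [EssentiallySmall.{v} A] [HasFiniteColimits A]
  {B : Type u₂} [Category.{v} B] (F : A ⥤ B) [PreservesFiniteColimits F]

instance isLeftAdjoint_indMap : (indMap F).IsLeftAdjoint := by
  have : PreservesFiniteColimits (Ind.yoneda ⋙ indMap F) :=
    preservesFiniteColimits_of_natIso (indMapYoneda F)
  exact isLeftAdjoint_of_rightExact _

end IndMapColimits

section IndMapRex

variable {A : Type u₁} [Category.{v} A] [EssentiallySmall.{v} A] [Preadditive A]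
  [HasFiniteColimits A] {B : Type u₂} [Category.{v} B] [EssentiallySmall.{v} B] [Preadditive B]
  [HasFiniteColimits B] {k : Type w} [Field k] [Linear k A] [Linear k B]

/-- The extension is a left adjoint, hence right exact; scalars are compared on the morphisms `el F
u`, which jointly determine morphisms out of F(X). -/
theorem isRex_indMap {F : A ⥤ B} (hF : IsRex k F) : IsRex k (indMap F) :=
  have := hF.preservesFiniteColimits
  isRex_of_preservesFiniteColimits _ fun r X ↦ el_hom_ext F fun c u ↦ by
    rw [el_map, indScalar_eq, comp_indScalar, ← map_el, indScalar_eq, comp_indScalar,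
      hF.map_smul, CategoryTheory.Functor.map_id]

end IndMapRex

end IndExt

namespace RexTensor

/-! ### Colimits of modules over an algebra -/

section ModColimits

variable {C : Type u₁} [Category.{v₁} C] [MonoidalCategory C] (E : C) [MonObj E]

/-- The functor from left `E`-modules in `C` to `C`. -/
abbrev modForget : Mod C E ⥤ C := Mod.forget E

instance faithful_modForget : (modForget E).Faithful where
  map_injective h := Mod.hom_ext _ _ h

instance reflectsIsomorphisms_modForget : (modForget E).ReflectsIsomorphisms where
  reflects {X Y} f h :=
    have : IsIso f.hom := h
    (modIsoMk (asIso f.hom) (hom_actMap E f)).isIso_hom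

variable {J : Type u₂} [Category.{v₂} J] [PreservesColimitsOfShape J (tensorLeft E)]
  {K : J ⥤ Mod C E} {c : Cocone (K ⋙ modForget E)} (hc : IsColimit c)

variable {E} in
-- Together with `whiskerLeft_mul_act` and `whiskerLeft_desc_act` this verifies the module axioms on
-- a colimit, and the linearity of the induced morphism, after restriction along one leg i
-- intertwining the actions. There each identity reduces to the one for Z.
theorem comp_one_act {X Z : C} [ModObj E Z] (i : Z ⟶ X) {a : E ⊗ X ⟶ X}
    (h : E ◁ i ≫ a = actMap E Z ≫ i) :
    i ≫ (λ_ X).inv ≫ MonObj.one ▷ X ≫ a = i ≫ 𝟙 _ := by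
  rw [leftUnitor_inv_naturality_assoc, whisker_exchange_assoc, h, reassoc_of% one_actMap E Z,
    Iso.inv_hom_id_assoc, Category.comp_id]

variable {E} in
theorem whiskerLeft_mul_act {X Z : C} [ModObj E Z] (i : Z ⟶ X) {a : E ⊗ X ⟶ X}
    (h : E ◁ i ≫ a = actMap E Z ≫ i) :
    E ◁ (E ◁ i) ≫ (α_ E E X).inv ≫ MonObj.mul ▷ X ≫ a = E ◁ (E ◁ i) ≫ E ◁ a ≫ a := by
  rw [← MonoidalCategory.whiskerLeft_comp_assoc, h, MonoidalCategory.whiskerLeft_comp,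
    Category.assoc, h, associator_inv_naturality_right_assoc, whisker_exchange_assoc, h,
    reassoc_of% mul_actMap E Z, Iso.inv_hom_id_assoc]

variable {E} in
theorem whiskerLeft_desc_act {X Z W : C} [ModObj E Z] [ModObj E W] {i : Z ⟶ X} {a : E ⊗ X ⟶ X}
    {d : X ⟶ W} {f : Z ⟶ W} (h : E ◁ i ≫ a = actMap E Z ≫ i) (h₁ : i ≫ d = f)
    (h₂ : actMap E Z ≫ f = E ◁ f ≫ actMap E W) :
    E ◁ i ≫ a ≫ d = E ◁ i ≫ E ◁ d ≫ actMap E W := by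
  rw [reassoc_of% h, h₁, h₂, ← MonoidalCategory.whiskerLeft_comp_assoc, h₁]

include hc in
-- Since E ⊗ - preserves the colimit, the actions on the objects of the diagram glue to an action on
-- its colimit.
theorem exists_colimitAct : ∃ a : E ⊗ c.pt ⟶ c.pt, ∀ j,
    E ◁ c.ι.app j ≫ a = actMap E (K.obj j).X ≫ c.ι.app j := by
  let s : Cocone ((K ⋙ modForget E) ⋙ tensorLeft E) := Cocone.mk c.pt
    { app := fun j ↦ actMap E (K.obj j).X ≫ c.ι.app j
      naturality := fun i j f ↦ by
        have h : (K.map f).hom ≫ c.ι.app j = c.ι.app i := c.w f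
        refine Eq.trans ?_ (Category.comp_id _).symm
        refine (Category.assoc _ _ _).symm.trans
          ((congrArg (· ≫ c.ι.app j) (hom_actMap E (K.map f)).symm).trans ?_)
        exact (Category.assoc _ _ _).trans (congrArg (_ ≫ ·) h) }
  exact ⟨(isColimitOfPreserves (tensorLeft E) hc).desc s,
    (isColimitOfPreserves (tensorLeft E) hc).fac s⟩

include hc in
theorem whiskerLeft_hom_ext {Z : C} {f g : E ⊗ c.pt ⟶ Z}
    (h : ∀ j, E ◁ c.ι.app j ≫ f = E ◁ c.ι.app j ≫ g) : f = g :=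
  (isColimitOfPreserves (tensorLeft E) hc).hom_ext h

/-- The module structure on a colimit of modules. -/
@[reducible]
noncomputable def colimitModObj : ModObj E c.pt where
  smul := (exists_colimitAct E hc).choose
  one_smul := (Iso.inv_comp_eq (λ_ c.pt) (g := 𝟙 _)).1 (hc.hom_ext fun j ↦
    comp_one_act (Z := (K.obj j).X) (c.ι.app j) ((exists_colimitAct E hc).choose_spec j)) |>.trans
      (Category.comp_id _)
  mul_smul := (Iso.inv_comp_eq (α_ E E c.pt)).1
    ((isColimitOfPreserves (tensorLeft E) (isColimitOfPreserves (tensorLeft E) hc)).hom_ext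
      fun j ↦ whiskerLeft_mul_act (Z := (K.obj j).X) (c.ι.app j) ((exists_colimitAct E hc).choose_spec j))

/-- The cocone of modules over a colimit of underlying objects. -/
noncomputable def colimitModCocone : Cocone K :=
  letI := colimitModObj E hc
  { pt := ⟨c.pt⟩
    ι :=
      { app := fun j ↦ Mod.Hom.mk' (N := ⟨c.pt⟩) (c.ι.app j)
          ((exists_colimitAct E hc).choose_spec j).symm
        naturality := fun i j f ↦ Mod.hom_ext _ _ (c.ι.naturality f) } }

/-- Colimits of modules are computed on underlying objects. -/
noncomputable def isColimitColimitModCocone : IsColimit (colimitModCocone E hc) where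
  desc s := Mod.Hom.mk' (hc.desc ((modForget E).mapCocone s))
    (whiskerLeft_hom_ext E hc fun j ↦ whiskerLeft_desc_act
      (Z := (K.obj j).X)
      ((exists_colimitAct E hc).choose_spec j) (hc.fac ((modForget E).mapCocone s) j)
      (hom_actMap E (s.ι.app j)))
  fac s j := Mod.hom_ext _ _ (hc.fac ((modForget E).mapCocone s) j)
  uniq s m hm := Mod.hom_ext _ _ (hc.hom_ext fun j ↦
    (congrArg Mod.Hom.hom (hm j)).trans (hc.fac ((modForget E).mapCocone s) j).symm)

instance hasColimitsOfShape_mod [HasColimitsOfShape J C] : HasColimitsOfShape J (Mod C E) where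
  has_colimit K := ⟨⟨⟨_, isColimitColimitModCocone E (colimit.isColimit (K ⋙ modForget E))⟩⟩⟩

instance preservesColimitsOfShape_modForget [HasColimitsOfShape J C] :
    PreservesColimitsOfShape J (modForget E) where
  preservesColimit {K} := preservesColimit_of_preserves_colimit_cocone
    (isColimitColimitModCocone E (colimit.isColimit (K ⋙ modForget E)))
    ((colimit.isColimit (K ⋙ modForget E)).ofIsoColimit (Cocone.ext (Iso.refl _) (fun j ↦
      Category.comp_id _)))

end ModColimits

/-! ### Free modules -/

section ModFree

variable {C : Type u₁} [Category.{v₁} C] [MonoidalCategory C] (E : C) [MonObj E]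

/-- The free left `E`-module functor. -/
abbrev modFree : C ⥤ Mod C E := actionLeft C (Mod.regular E)

variable {E} in
-- A linear morphism out of E ⊗ c is recovered from its restriction along the unit: linearity turns
-- the action on Z into multiplication in E, and the unit law cancels it. This is one half of the
-- free-forgetful bijection.
theorem whiskerLeft_one_act {c Z : C} [ModObj E Z] {f : E ⊗ c ⟶ Z}
    (h : ((α_ E E c).inv ≫ MonObj.mul ▷ c) ≫ f = E ◁ f ≫ actMap E Z) :
    E ◁ ((λ_ c).inv ≫ (MonObj.one : 𝟙_ C ⟶ E) ▷ c ≫ f) ≫ actMap E Z = f := by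
  have h' : E ◁ (MonObj.one ▷ c) ≫ (α_ E E c).inv ≫ MonObj.mul ▷ c =
      (α_ _ _ _).inv ≫ (ρ_ E).hom ▷ c := by
    rw [associator_inv_naturality_middle_assoc, ← comp_whiskerRight, MonObj.mul_one]
  rw [MonoidalCategory.whiskerLeft_comp, MonoidalCategory.whiskerLeft_comp, Category.assoc,
    Category.assoc, ← h, Category.assoc, reassoc_of% h']
  simp

variable {E} in
theorem one_whiskerRight_act {c Z : C} [ModObj E Z] (g : c ⟶ Z) :
    (λ_ c).inv ≫ (MonObj.one : 𝟙_ C ⟶ E) ▷ c ≫ E ◁ g ≫ actMap E Z = g := by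
  rw [← whisker_exchange_assoc, one_actMap E Z]
  simp

variable {E} in
theorem free_act {c Z : C} [ModObj E Z] (g : c ⟶ Z) :
    ((α_ E E c).inv ≫ MonObj.mul ▷ c) ≫ E ◁ g ≫ actMap E Z =
      E ◁ (E ◁ g ≫ actMap E Z) ≫ actMap E Z := by
  rw [Category.assoc, ← whisker_exchange_assoc, mul_actMap E Z]
  simp

/-- The free-forgetful bijection for left `E`-modules. -/
def modFreeEquiv (c : C) (Z : Mod C E) : ((modFree E).obj c ⟶ Z) ≃ (c ⟶ Z.X) where
  toFun f := (λ_ c).inv ≫ (MonObj.one : 𝟙_ C ⟶ E) ▷ c ≫ f.hom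
  invFun g := modHomMk (X := (modFree E).obj c) (E ◁ g ≫ actMap E Z.X) (free_act g)
  left_inv f := Mod.hom_ext _ _ (whiskerLeft_one_act (hom_actMap E f))
  right_inv g := one_whiskerRight_act g

theorem modFreeEquiv_naturality_right {c : C} {Z Z' : Mod C E} (f : (modFree E).obj c ⟶ Z)
    (g : Z ⟶ Z') : modFreeEquiv E c Z' (f ≫ g) = modFreeEquiv E c Z f ≫ g.hom :=
  ((Category.assoc _ _ _).trans (congrArg (_ ≫ ·) (Category.assoc _ _ _))).symm

theorem modFreeEquiv_naturality_left {c c' : C} {Z : Mod C E} (f : c ⟶ c')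
    (g : (modFree E).obj c' ⟶ Z) :
    modFreeEquiv E c Z ((modFree E).map f ≫ g) = f ≫ modFreeEquiv E c' Z g := by
  have h (p : E ⊗ c' ⟶ Z.X) : (λ_ c).inv ≫ (MonObj.one : 𝟙_ C ⟶ E) ▷ c ≫ E ◁ f ≫ p =
      f ≫ (λ_ c').inv ≫ (MonObj.one : 𝟙_ C ⟶ E) ▷ c' ≫ p := by
    rw [← whisker_exchange_assoc, leftUnitor_inv_naturality_assoc]
  exact h g.hom

/-- The free-forgetful adjunction for left `E`-modules. -/
def modFreeAdj : modFree E ⊣ modForget E :=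
  Adjunction.mkOfHomEquiv
    { homEquiv := modFreeEquiv E
      homEquiv_naturality_left_symm := fun {_ _ Z} f g ↦
        (modFreeEquiv E _ Z).symm_apply_eq.2 (Eq.symm ((modFreeEquiv_naturality_left E f _).trans
          (congrArg (f ≫ ·) ((modFreeEquiv E _ Z).apply_symm_apply g))))
      homEquiv_naturality_right := fun f g ↦ modFreeEquiv_naturality_right E f g }

end ModFree

/-! ### The k-linear structure on modules -/

section ModLinear

variable {C : Type u₁} [Category.{v₁} C] [MonoidalCategory C] [Preadditive C]
  [MonoidalPreadditive C] (E : C) [MonObj E]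

instance (X Y : Mod C E) : Add (X ⟶ Y) where
  add f g := modHomMk (f.hom + g.hom) (by
    rw [Preadditive.comp_add, MonoidalPreadditive.whiskerLeft_add, Preadditive.add_comp,
      hom_actMap, hom_actMap])

instance (X Y : Mod C E) : Zero (X ⟶ Y) where
  zero := modHomMk 0 (by simp)

instance (X Y : Mod C E) : Neg (X ⟶ Y) where
  neg f := modHomMk (-f.hom) (by
    have h := hom_actMap E f
    have e : E ◁ (-f.hom) = - E ◁ f.hom := (tensorLeft E).map_neg
    rw [Preadditive.comp_neg, e, Preadditive.neg_comp, h])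

instance modHomAddCommGroup (X Y : Mod C E) : AddCommGroup (X ⟶ Y) where
  add_assoc f g h := Mod.hom_ext _ _ (add_assoc f.hom g.hom h.hom)
  zero_add f := Mod.hom_ext _ _ (zero_add f.hom)
  add_zero f := Mod.hom_ext _ _ (add_zero f.hom)
  neg_add_cancel f := Mod.hom_ext _ _ (neg_add_cancel f.hom)
  add_comm f g := Mod.hom_ext _ _ (add_comm f.hom g.hom)
  nsmul := nsmulRec
  zsmul := zsmulRec

@[simp]
theorem mod_add_hom {X Y : Mod C E} (f g : X ⟶ Y) : (f + g).hom = f.hom + g.hom := rfl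

instance modPreadditive : Preadditive (Mod C E) where
  add_comp _ _ _ f f' g := by ext; simp
  comp_add _ _ _ f g g' := by ext; simp

variable {k : Type w} [Field k] [Linear k C] [MonoidalLinear k C]

instance modHomModule (X Y : Mod C E) : Module k (X ⟶ Y) where
  smul r f := modHomMk (r • f.hom) (by
    rw [Linear.comp_smul, MonoidalLinear.whiskerLeft_smul, Linear.smul_comp, hom_actMap])
  one_smul f := Mod.hom_ext _ _ (one_smul k f.hom)
  mul_smul r s f := Mod.hom_ext _ _ (mul_smul r s f.hom)
  smul_zero r := Mod.hom_ext _ _ (smul_zero r)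
  smul_add r f g := Mod.hom_ext _ _ (smul_add r f.hom g.hom)
  add_smul r s f := Mod.hom_ext _ _ (add_smul r s f.hom)
  zero_smul f := Mod.hom_ext _ _ (zero_smul k f.hom)

@[simp]
theorem mod_smul_hom {X Y : Mod C E} (r : k) (f : X ⟶ Y) : (r • f).hom = r • f.hom := rfl

instance modLinear : Linear k (Mod C E) where
  smul_comp _ _ _ r f g := by ext; simp
  comp_smul _ _ _ f r g := by ext; simp

instance bilinearAction_mod : BilinearAction k C (Mod C E) where
  add_actionHomLeft f g a :=
    Mod.hom_ext _ _ (MonoidalPreadditive.add_whiskerRight (X := a) f.hom g.hom)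
  smul_actionHomLeft r f a := Mod.hom_ext _ _ (MonoidalLinear.smul_whiskerRight r f.hom a)
  actionHomRight_add m _ _ f g := Mod.hom_ext _ _ (MonoidalPreadditive.whiskerLeft_add f g)
  actionHomRight_smul m _ _ r f := Mod.hom_ext _ _ (MonoidalLinear.whiskerLeft_smul m.X r f)

end ModLinear

/-! ### Exactness of the right action on modules -/

section ModRightExact

variable {C : Type u₁} [Category.{v₁} C] [MonoidalCategory C] (E : C) [MonObj E]
  {J : Type u₂} [Category.{v₂} J] [HasColimitsOfShape J C]
  [∀ X : C, PreservesColimitsOfShape J (tensorLeft X)]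

instance reflectsColimitsOfShape_modForget : ReflectsColimitsOfShape J (modForget E) :=
  reflectsColimitsOfShape_of_reflectsIsomorphisms

/-- The forgetful functor preserves and reflects these colimits and turns the action into the tensor
product of C, which preserves them. -/
instance preservesColimitsOfShape_modActionLeft (X : Mod C E) :
    PreservesColimitsOfShape J (actionLeft C X) :=
  have : PreservesColimitsOfShape J (actionLeft C X ⋙ modForget E) :=
    inferInstanceAs (PreservesColimitsOfShape J (tensorLeft X.X))
  preservesColimitsOfShape_of_reflects_of_preserves _ (modForget E)

instance preservesColimitsOfShape_modActionRight (c : C)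
    [PreservesColimitsOfShape J (tensorRight c)] :
    PreservesColimitsOfShape J (actionRight (Mod C E) c) :=
  have : PreservesColimitsOfShape J (actionRight (Mod C E) c ⋙ modForget E) :=
    inferInstanceAs (PreservesColimitsOfShape J (modForget E ⋙ tensorRight c))
  preservesColimitsOfShape_of_reflects_of_preserves _ (modForget E)

end ModRightExact

end RexTensor

namespace RexTensor

open Functor.LaxMonoidal Functor.LaxRightLinear

/-! ### Functors between module categories, linear over a monoidal functor -/

section SemiLin

variable {C : Type u₁} [Category.{v₁} C] [MonoidalCategory C] {C' : Type u₂} [Category.{v₂} C']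
  [MonoidalCategory C'] (G G₂ : C ⥤ C') [G.LaxMonoidal] [G₂.LaxMonoidal]
  {D : Type u₃} [Category.{v₃} D] [MonoidalRightAction C D] {D' : Type u₄} [Category.{v₄} D']
  [MonoidalRightAction C' D'] (K : D ⥤ D')

/-- A lax linear structure on a functor of module categories, over a lax monoidal functor. -/
structure SemiLin where
  /-- the comparison -/
  app (n : D) (a : C) : K.obj n ⊙ᵣ G.obj a ⟶ K.obj (n ⊙ᵣ a)
  natural_left {n n' : D} (f : n ⟶ n') (a : C) :
    K.map f ⊵ᵣ G.obj a ≫ app n' a = app n a ≫ K.map (f ⊵ᵣ a)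
  natural_right (n : D) {a a' : C} (f : a ⟶ a') :
    K.obj n ⊴ᵣ G.map f ≫ app n a' = app n a ≫ K.map (n ⊴ᵣ f)
  assoc (n : D) (a a' : C) : K.obj n ⊴ᵣ μ G a a' ≫ app n (a ⊗ a') ≫ K.map (αᵣ n a a').hom =
    (αᵣ (K.obj n) (G.obj a) (G.obj a')).hom ≫ app n a ⊵ᵣ G.obj a' ≫ app (n ⊙ᵣ a) a'
  unit (n : D) : K.obj n ⊴ᵣ ε G ≫ app n (𝟙_ C) ≫ K.map (ρᵣ n).hom = (ρᵣ (K.obj n)).hom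

namespace SemiLin

variable {G G₂ K} (s : SemiLin G K)

/-- Change of the lax monoidal functor. -/
def transport (j : G₂ ⟶ G) [NatTrans.IsMonoidal j] : SemiLin G₂ K where
  app n a := K.obj n ⊴ᵣ j.app a ≫ s.app n a
  natural_left f a := by rw [Category.assoc, ← s.natural_left, action_exchange_assoc]
  natural_right n a a' f := by
    rw [Category.assoc, ← s.natural_right, ← actionHomRight_comp_assoc, j.naturality,
      actionHomRight_comp, Category.assoc]
  assoc n a a' := by
    rw [Category.assoc, ← actionHomRight_comp_assoc, NatTrans.IsMonoidal.tensor,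
      actionHomRight_comp, Category.assoc, s.assoc, MonoidalCategory.tensorHom_def,
      actionHomRight_comp, actionHomRight_whiskerRight, whiskerRight_actionHomLeft,
      comp_actionHomLeft]
    simp only [Category.assoc, Iso.inv_hom_id_assoc, action_exchange_assoc]
  unit n := by
    rw [Category.assoc, ← actionHomRight_comp_assoc, NatTrans.IsMonoidal.unit, s.unit]

/-- Composition with a linear functor. -/
def compLinear {D₂ : Type u₅} [Category.{v} D₂] [MonoidalRightAction C' D₂] (L : D' ⥤ D₂)
    [L.LaxRightLinear C'] : SemiLin G (K ⋙ L) where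
  app n a := μᵣ L (K.obj n) (G.obj a) ≫ L.map (s.app n a)
  natural_left f a := by
    rw [Functor.comp_map, μᵣ_naturality_left_assoc, ← L.map_comp, s.natural_left, L.map_comp,
      Category.assoc]
    rfl
  natural_right n a a' f := by
    simp only [Functor.comp_obj, Functor.comp_map, Category.assoc]
    rw [μᵣ_naturality_right_assoc, ← L.map_comp, s.natural_right, L.map_comp]
  assoc n a a' := by
    simp only [Functor.comp_obj, Functor.comp_map, Category.assoc, comp_actionHomLeft]
    rw [μᵣ_naturality_right_assoc, ← L.map_comp, ← L.map_comp, s.assoc, L.map_comp, L.map_comp,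
      μᵣ_associativity_assoc, μᵣ_naturality_left_assoc]
  unit n := by
    simp only [Functor.comp_obj, Functor.comp_map, Category.assoc]
    rw [μᵣ_naturality_right_assoc, ← L.map_comp, ← L.map_comp, s.unit, ← μᵣ_unitality]

/-- Composition of lax linear functors. -/
def comp {C₂ : Type u₆} [Category.{v} C₂] [MonoidalCategory C₂] {D₂ : Type u₅}
    [Category.{w} D₂] [MonoidalRightAction C₂ D₂] {H : C' ⥤ C₂} [H.LaxMonoidal] {L : D' ⥤ D₂}
    (t : SemiLin H L) : SemiLin (G ⋙ H) (K ⋙ L) where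
  app n a := t.app (K.obj n) (G.obj a) ≫ L.map (s.app n a)
  natural_left f a := by
    simp only [Functor.comp_obj, Functor.comp_map, Category.assoc]
    rw [← L.map_comp, ← s.natural_left, L.map_comp, reassoc_of% t.natural_left]
  natural_right n a a' f := by
    simp only [Functor.comp_obj, Functor.comp_map, Category.assoc]
    rw [← L.map_comp, ← s.natural_right, L.map_comp, reassoc_of% t.natural_right]
  assoc n a a' := by
    simp only [Functor.comp_obj, Functor.comp_map, Category.assoc, comp_actionHomLeft, comp_μ,
      actionHomRight_comp]
    rw [reassoc_of% t.natural_right, ← L.map_comp, ← L.map_comp, s.assoc, L.map_comp, L.map_comp,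
      reassoc_of% t.assoc, reassoc_of% t.natural_left]
  unit n := by
    simp only [Functor.comp_obj, Functor.comp_map, Category.assoc, comp_ε, actionHomRight_comp]
    rw [reassoc_of% t.natural_right, ← L.map_comp, ← L.map_comp, s.unit, t.unit]

end SemiLin

end SemiLin

/-! ### Lax linear functors are strong at objects with a dual -/

section Dual

variable {C : Type u₁} [Category.{v₁} C] [MonoidalCategory C] {D : Type u₂} [Category.{v₂} D]
  [MonoidalRightAction C D] {D' : Type u₃} [Category.{v₃} D'] [MonoidalRightAction C D']
  (X a : C) [ExactPairing X a]

/-- This is p acted on by the zigzag identity of the pairing, with the associators and unitors of C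
rewritten as those of the action. -/
theorem action_zigzag (p : D) : (ρᵣ (p ⊙ᵣ a)).inv ≫ (p ⊙ᵣ a) ⊴ᵣ η_ X a ≫
    (αᵣ (p ⊙ᵣ a) X a).hom ≫ ((αᵣ p a X).inv ≫ p ⊴ᵣ ε_ X a ≫ (ρᵣ p).hom) ⊵ᵣ a = 𝟙 _ := by
  have h := congrArg (p ⊴ᵣ ·) (ExactPairing.coevaluation_evaluation X a)
  have e₁ : (ρᵣ (p ⊙ᵣ a)).inv = p ⊴ᵣ (ρ_ a).inv ≫ (αᵣ p a (𝟙_ C)).hom := by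
    rw [← cancel_mono (ρᵣ _).hom, Iso.inv_hom_id, Category.assoc, ← actionHom_rightUnitor,
      actionHomRight_inv_hom]
  have e₂ : (ρᵣ p).hom ⊵ᵣ a = (αᵣ _ _ _).inv ≫ p ⊴ᵣ (λ_ a).hom := by
    rw [actionHom_leftUnitor, Iso.inv_hom_id_assoc]
  have e₃ : (αᵣ (p ⊙ᵣ a) X a).hom ≫ (αᵣ p a X).inv ⊵ᵣ a =
      (αᵣ _ _ _).inv ≫ p ⊴ᵣ (α_ a X a).inv ≫ (αᵣ _ _ _).hom := by
    rw [Iso.eq_inv_comp, ← cancel_epi (p ⊴ᵣ (α_ a X a).hom), actionHom_associator_assoc,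
      hom_inv_actionHomLeft, Category.comp_id, actionHomRight_hom_inv_assoc]
  have e₄ : (p ⊴ᵣ ε_ X a) ⊵ᵣ a = (αᵣ _ _ _).inv ≫ p ⊴ᵣ (ε_ X a ▷ a) ≫ (αᵣ _ _ _).hom := by
    simp
  rw [comp_actionHomLeft, comp_actionHomLeft, reassoc_of% e₃, e₁, e₂, e₄, action_actionHomRight]
  simp only [Category.assoc, Iso.hom_inv_id_assoc, ← actionHomRight_comp]
  simp only [actionHomRight_comp] at h ⊢
  rw [reassoc_of% h]
  simp only [← actionHomRight_comp]
  simp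

variable {a} in
include X in
-- The inverse inserts the coevaluation 𝟙 ⟶ X ⊗ a, applies the comparison of K for X, and contracts
-- a with X inside K by the evaluation; both composites are zigzags. Applied to Hom(m, -) it yields
-- Hom(m, n ⊙ a) ≅ Hom(m, n) ⊗ a.
theorem isIso_μᵣ_of_exactPairing (K : D ⥤ D') [K.LaxRightLinear C] (n : D) :
    IsIso (μᵣ K n a) := by
  refine ⟨(ρᵣ (K.obj (n ⊙ᵣ a))).inv ≫ K.obj (n ⊙ᵣ a) ⊴ᵣ η_ X a ≫ (αᵣ _ X a).hom ≫
    (μᵣ K (n ⊙ᵣ a) X ≫ K.map ((αᵣ n a X).inv ≫ n ⊴ᵣ ε_ X a ≫ (ρᵣ n).hom)) ⊵ᵣ a, ?_, ?_⟩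
  · have h : μᵣ K n a ⊵ᵣ X ≫ μᵣ K (n ⊙ᵣ a) X =
        (αᵣ _ _ _).inv ≫ μᵣ K n (a ⊗ X) ≫ K.map (αᵣ n a X).hom := by
      rw [μᵣ_associativity, Iso.inv_hom_id_assoc]
    have h' : μᵣ K n a ≫ (ρᵣ (K.obj (n ⊙ᵣ a))).inv ≫ K.obj (n ⊙ᵣ a) ⊴ᵣ η_ X a ≫
        (αᵣ _ X a).hom = (ρᵣ (K.obj n ⊙ᵣ a)).inv ≫ (K.obj n ⊙ᵣ a) ⊴ᵣ η_ X a ≫ (αᵣ _ X a).hom ≫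
          (μᵣ K n a ⊵ᵣ X) ⊵ᵣ a := by
      rw [← actionUnitIso_inv_naturality_assoc, ← action_exchange_assoc, actionHomLeft_tensor]
      simp
    rw [reassoc_of% h', ← comp_actionHomLeft, reassoc_of% h, ← K.map_comp, Iso.hom_inv_id_assoc,
      K.map_comp, ← μᵣ_naturality_right_assoc, ← μᵣ_unitality, action_zigzag]
  · simp only [Category.assoc, comp_actionHomLeft]
    rw [μᵣ_naturality_left, ← μᵣ_associativity_assoc, μᵣ_naturality_right_assoc]
    have h : (ρᵣ (K.obj (n ⊙ᵣ a))).inv ≫ μᵣ K (n ⊙ᵣ a) (𝟙_ C) = K.map (ρᵣ (n ⊙ᵣ a)).inv := by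
      rw [Iso.inv_comp_eq, μᵣ_unitality, Category.assoc, ← K.map_comp, Iso.hom_inv_id, K.map_id,
        Category.comp_id]
    rw [reassoc_of% h, ← K.map_comp, ← K.map_comp, ← K.map_comp, action_zigzag, K.map_id]

end Dual

/-! ### Internal homs as a linear functor to modules over the internal endomorphism algebra -/

section InternalHom

variable (C : Type u₁) [Category.{v₁} C] [MonoidalCategory C] {D : Type u₂} [Category.{v₂} D]
  [MonoidalRightAction C D] (d : D) [(actionLeft C d).IsLeftAdjoint]

/-- The functor `n ↦ Hom(d, n)`. -/
noncomputable def internalMap {n n' : D} (f : n ⟶ n') : internalHom C d n ⟶ internalHom C d n' :=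
  (rightAdjoint (actionLeft C d)).map f

theorem internalMap_ev {n n' : D} (f : n ⟶ n') :
    d ⊴ᵣ internalMap C d f ≫ internalEv C d n' = internalEv C d n ≫ f :=
  (Adjunction.ofIsLeftAdjoint (actionLeft C d)).counit.naturality f

theorem internalComp_natural {n n' : D} (f : n ⟶ n') :
    internalComp C d n ≫ internalMap C d f =
      internalHom C d d ◁ internalMap C d f ≫ internalComp C d n' := by
  apply internalHom_hom_ext
  rw [actionHomRight_comp, actionHomRight_comp, Category.assoc, Category.assoc, internalMap_ev,
    internalComp_ev, reassoc_of% internalComp_ev C d n, whiskerRight_actionHomLeft,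
    Category.assoc, Category.assoc, Iso.inv_hom_id_assoc, action_exchange_assoc, internalMap_ev]

/-- The left `End(d)`-module structure on `Hom(d, n)`. -/
@[reducible]
noncomputable def internalModObj (n : D) : ModObj (internalHom C d d) (internalHom C d n) where
  smul := internalComp C d n
  one_smul := internalOne_comp C d n
  mul_smul := internalComp_assoc C d n

/-- The functor `n ↦ Hom(d, n)` with values in left `End(d)`-modules. -/
noncomputable def internalMod : D ⥤ Mod C (internalHom C d d) where
  obj n :=
    letI := internalModObj C d n
    ⟨internalHom C d n⟩
  map {n n'} f :=
    letI := internalModObj C d n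
    letI := internalModObj C d n'
    Mod.Hom.mk'' (internalMap C d f) (internalComp_natural C d f)
  map_id n := Mod.hom_ext _ _ ((rightAdjoint (actionLeft C d)).map_id n)
  map_comp f g := Mod.hom_ext _ _ ((rightAdjoint (actionLeft C d)).map_comp f g)

/-- The comparison `Hom(d, n) ⊗ a ⟶ Hom(d, n ⊙ a)`. -/
noncomputable def internalTensor (n : D) (a : C) :
    internalHom C d n ⊗ a ⟶ internalHom C d (n ⊙ᵣ a) :=
  internalCurry ((αᵣ d _ a).hom ≫ internalEv C d n ⊵ᵣ a)

theorem internalTensor_ev (n : D) (a : C) :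
    d ⊴ᵣ internalTensor C d n a ≫ internalEv C d (n ⊙ᵣ a) =
      (αᵣ d _ a).hom ≫ internalEv C d n ⊵ᵣ a := internalCurry_ev _

/-- After evaluation both sides evaluate Hom(d, d) and then Hom(d, n), carrying a along. Thus the
comparison Hom(d, n) ⊗ a ⟶ Hom(d, n ⊙ a) is a morphism of left End(d)-modules. -/
theorem internalTensor_comp (n : D) (a : C) :
    ((α_ _ _ _).inv ≫ internalComp C d n ▷ a) ≫ internalTensor C d n a =
      internalHom C d d ◁ internalTensor C d n a ≫ internalComp C d (n ⊙ᵣ a) := by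
  rw [Category.assoc, Iso.inv_comp_eq]
  apply internalHom_hom_ext
  simp only [actionHomRight_comp, Category.assoc]
  rw [internalTensor_ev, internalComp_ev, actionHomRight_whiskerRight, whiskerRight_actionHomLeft]
  simp only [Category.assoc, Iso.inv_hom_id_assoc]
  rw [action_exchange_assoc, internalTensor_ev, ← comp_actionHomLeft, internalComp_ev,
    actionHomLeft_tensor]
  simp

theorem internalTensor_natural_left {n n' : D} (f : n ⟶ n') (a : C) :
    internalMap C d f ▷ a ≫ internalTensor C d n' a =
      internalTensor C d n a ≫ internalMap C d (f ⊵ᵣ a) := by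
  apply internalHom_hom_ext
  simp only [actionHomRight_comp, Category.assoc]
  rw [internalTensor_ev, internalMap_ev, reassoc_of% internalTensor_ev C d n,
    actionHomRight_whiskerRight]
  simp only [Category.assoc, Iso.inv_hom_id_assoc]
  rw [← comp_actionHomLeft, internalMap_ev, comp_actionHomLeft]

theorem internalTensor_natural_right (n : D) {a a' : C} (f : a ⟶ a') :
    internalHom C d n ◁ f ≫ internalTensor C d n a' =
      internalTensor C d n a ≫ internalMap C d (n ⊴ᵣ f) := by
  apply internalHom_hom_ext
  simp only [actionHomRight_comp, Category.assoc]
  rw [internalTensor_ev, internalMap_ev, reassoc_of% internalTensor_ev C d n,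
    whiskerRight_actionHomLeft]
  simp only [Category.assoc, Iso.inv_hom_id_assoc]
  rw [action_exchange]

theorem internalTensor_assoc (n : D) (a a' : C) :
    internalTensor C d n (a ⊗ a') ≫ internalMap C d (αᵣ n a a').hom =
      (α_ _ _ _).inv ≫ internalTensor C d n a ▷ a' ≫ internalTensor C d (n ⊙ᵣ a) a' := by
  rw [Iso.eq_inv_comp]
  apply internalHom_hom_ext
  simp only [actionHomRight_comp, Category.assoc]
  rw [internalTensor_ev, internalMap_ev, reassoc_of% internalTensor_ev C d n,
    actionHomRight_whiskerRight]
  simp only [Category.assoc, Iso.inv_hom_id_assoc]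
  rw [← comp_actionHomLeft, internalTensor_ev, actionHomLeft_tensor]
  simp

theorem internalTensor_unit (n : D) :
    (ρ_ _).hom = internalTensor C d n (𝟙_ C) ≫ internalMap C d (ρᵣ n).hom := by
  apply internalHom_hom_ext
  simp only [actionHomRight_comp, Category.assoc]
  rw [internalMap_ev, reassoc_of% internalTensor_ev C d n]
  simp

noncomputable instance internalModLaxRightLinear : (internalMod C d).LaxRightLinear C where
  μᵣ n a := modHomMk (X := (internalMod C d).obj n ⊙ᵣ a) (Y := (internalMod C d).obj (n ⊙ᵣ a))
    (internalTensor C d n a) (internalTensor_comp C d n a)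
  μᵣ_naturality_left f a := Mod.hom_ext _ _ (internalTensor_natural_left C d f a)
  μᵣ_naturality_right n _ _ f := Mod.hom_ext _ _ (internalTensor_natural_right C d n f)
  μᵣ_associativity n a a' := Mod.hom_ext _ _ (internalTensor_assoc C d n a a')
  μᵣ_unitality n := Mod.hom_ext _ _ (internalTensor_unit C d n)

end InternalHom

end RexTensor

namespace RexTensor

open Functor.LaxMonoidal

/-! ### Images of modules under a monoidal functor -/

section ModMap

variable {C : Type u₁} [Category.{v₁} C] [MonoidalCategory C] {C' : Type u₂} [Category.{v₂} C']
  [MonoidalCategory C'] (G : C ⥤ C') [G.LaxMonoidal] (E : C) [MonObj E] (X : C) [ModObj E X]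

theorem map_one_act : (ε G ≫ G.map MonObj.one) ▷ G.obj X ≫ μ G E X ≫ G.map (actMap E X) =
    (λ_ (G.obj X)).hom := by
  rw [comp_whiskerRight, Category.assoc, μ_natural_left_assoc, ← G.map_comp, one_actMap,
    ← left_unitality]

theorem map_mul_act : (μ G E E ≫ G.map MonObj.mul) ▷ G.obj X ≫ μ G E X ≫ G.map (actMap E X) =
    (α_ _ _ _).hom ≫ G.obj E ◁ (μ G E X ≫ G.map (actMap E X)) ≫ μ G E X ≫
      G.map (actMap E X) := by
  rw [comp_whiskerRight, Category.assoc, μ_natural_left_assoc, ← G.map_comp, mul_actMap,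
    G.map_comp, G.map_comp, associativity_assoc, MonoidalCategory.whiskerLeft_comp,
    Category.assoc, μ_natural_right_assoc]

theorem map_hom_act {Y : C} [ModObj E Y] (f : X ⟶ Y) (h : actMap E X ≫ f = E ◁ f ≫ actMap E Y) :
    (μ G E X ≫ G.map (actMap E X)) ≫ G.map f =
      G.obj E ◁ G.map f ≫ μ G E Y ≫ G.map (actMap E Y) := by
  rw [Category.assoc, ← G.map_comp, h, G.map_comp, μ_natural_right_assoc]

/-- Associativity of μ at E, X and c. It makes the comparison G(X) ⊗ G(c) ⟶ G(X ⊗ c) linear over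
G(E). -/
theorem map_tensor_act (c : C) :
    ((α_ _ _ _).inv ≫ (μ G E X ≫ G.map (actMap E X)) ▷ G.obj c) ≫ μ G X c =
      G.obj E ◁ μ G X c ≫ μ G E (X ⊗ c) ≫ G.map ((α_ E X c).inv ≫ actMap E X ▷ c) := by
  rw [comp_whiskerRight, Category.assoc, Category.assoc, μ_natural_left, G.map_comp,
    Iso.inv_comp_eq, associativity_inv_assoc, Iso.hom_inv_id_assoc]

end ModMap

section IndModMap

variable {A : Type u₁} [Category.{v} A] [MonoidalCategory A] {B : Type u₂} [Category.{v} B]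
  [MonoidalCategory B] (F : A ⥤ B) [F.Monoidal] (E : Ind A) [MonObj E]

/-- The left `F(E)`-module structure on the image of a left `E`-module. -/
@[reducible]
noncomputable def indMapModObj (X : Ind A) [ModObj E X] :
    ModObj ((indMap F).obj E) ((indMap F).obj X) where
  smul := μ (indMap F) E X ≫ (indMap F).map (actMap E X)
  one_smul := map_one_act (indMap F) E X
  mul_smul := map_mul_act (indMap F) E X

/-- The functor from left `E`-modules to left `F(E)`-modules. -/
noncomputable def modMap : Mod (Ind A) E ⥤ Mod (Ind B) ((indMap F).obj E) where
  obj N :=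
    letI := indMapModObj F E N.X
    ⟨(indMap F).obj N.X⟩
  map {N N'} f :=
    letI := indMapModObj F E N.X
    letI := indMapModObj F E N'.X
    Mod.Hom.mk'' ((indMap F).map f.hom) (map_hom_act (indMap F) E N.X f.hom (hom_actMap E f))
  map_id N := Mod.hom_ext _ _ ((indMap F).map_id N.X)
  map_comp f g := Mod.hom_ext _ _ ((indMap F).map_comp f.hom g.hom)

/-- The functor `modMap` is lax linear over the extension of `F`. -/
noncomputable def modMapSemiLin : SemiLin (indMap F) (modMap F E) where
  app N c := modHomMk (X := (modMap F E).obj N ⊙ᵣ (indMap F).obj c)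
    (Y := (modMap F E).obj (N ⊙ᵣ c)) (μ (indMap F) N.X c) (map_tensor_act (indMap F) E N.X c)
  natural_left f c := Mod.hom_ext _ _ (μ_natural_left (indMap F) f.hom c)
  natural_right N _ _ f := Mod.hom_ext _ _ (μ_natural_right (indMap F) N.X f)
  assoc N c c' := Mod.hom_ext _ _ (associativity_inv (indMap F) N.X c c')
  unit N := Mod.hom_ext _ _ (right_unitality (indMap F) N.X).symm

theorem isIso_of_isIso_hom {C : Type u₁} [Category.{v₁} C] [MonoidalCategory C] {R : C} [MonObj R]
    {X Y : Mod C R} (f : X ⟶ Y) [h : IsIso f.hom] : IsIso f :=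
  have : IsIso ((modForget R).map f) := h
  isIso_of_reflects_iso f (modForget R)

instance isIso_modMapSemiLin_app (N : Mod (Ind A) E) (c : Ind A) :
    IsIso ((modMapSemiLin F E).app N c) :=
  have : IsIso ((modMapSemiLin F E).app N c).hom := isIso_μ_indMap F N.X c
  isIso_of_isIso_hom _

end IndModMap

/-! ### The embedding of a module category into its ind-objects is linear -/

section YonedaSemiLin

variable {A : Type u₁} [Category.{v} A] [MonoidalCategory A] {M : Type u₂} [Category.{v} M]
  [MonoidalRightAction A M]

instance isIso_amul_id (n : M) (a : A) :
    IsIso (amul (𝟙 (Ind.yoneda.obj n)) (𝟙 (Ind.yoneda.obj a))) := by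
  rw [amul, pair_id]
  exact Iso.isIso_hom _

/-- The comparison `y(n) ⊙ y(a) ≅ y(n ⊙ a)`. -/
noncomputable def yonedaActIso (n : M) (a : A) :
    Ind.yoneda.obj n ⊙ᵣ Ind.yoneda.obj a ≅ Ind.yoneda.obj (n ⊙ᵣ a) :=
  (asIso (amul (𝟙 (Ind.yoneda.obj n)) (𝟙 (Ind.yoneda.obj a)))).symm

theorem amul_id_yonedaActIso (n : M) (a : A) :
    amul (𝟙 (Ind.yoneda.obj n)) (𝟙 (Ind.yoneda.obj a)) ≫ (yonedaActIso n a).hom = 𝟙 _ :=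
  IsIso.hom_inv_id _

theorem amul_map_yonedaActIso {n n' : M} {a a' : A} (f : n ⟶ n') (g : a ⟶ a') :
    amul (Ind.yoneda.map f) (Ind.yoneda.map g) ≫ (yonedaActIso n' a').hom =
      Ind.yoneda.map (f ⊵ᵣ a ≫ n' ⊴ᵣ g) := by
  rw [← Category.comp_id (Ind.yoneda.map f), ← Category.comp_id (Ind.yoneda.map g),
    ← map_amul_left, ← map_amul_right, Category.assoc, Category.assoc, amul_id_yonedaActIso,
    Category.comp_id, ← Functor.map_comp]

/-- The embedding of a module category into its ind-objects is linear. -/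
noncomputable def yonedaSemiLin : SemiLin (Ind.yoneda (C := A)) (Ind.yoneda (C := M)) where
  app n a := (yonedaActIso n a).hom
  natural_left {n n'} f a := by
    rw [← cancel_epi (amul (𝟙 (Ind.yoneda.obj n)) (𝟙 (Ind.yoneda.obj a))), ← Category.assoc,
      ← Category.assoc, amul_actionHomLeft, amul_id_yonedaActIso, Category.id_comp,
      Category.id_comp, ← CategoryTheory.Functor.map_id, amul_map_yonedaActIso]
    simp
  natural_right n a a' f := by
    rw [← cancel_epi (amul (𝟙 (Ind.yoneda.obj n)) (𝟙 (Ind.yoneda.obj a))), ← Category.assoc,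
      ← Category.assoc, amul_actionHomRight, amul_id_yonedaActIso, Category.id_comp,
      Category.id_comp, ← CategoryTheory.Functor.map_id, amul_map_yonedaActIso]
    simp
  assoc n a a' := amul_hom_ext₃ fun c d e u w x ↦ by
    obtain ⟨u, rfl⟩ := Ind.yoneda.map_surjective u
    obtain ⟨w, rfl⟩ := Ind.yoneda.map_surjective w
    obtain ⟨x, rfl⟩ := Ind.yoneda.map_surjective x
    rw [← Category.assoc, ← Category.assoc, ← Category.assoc, ← Category.assoc,
      amul_actionHomRight, μ_yoneda, tmul_map_yonedaTensorIso, amul_map_yonedaActIso,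
      amul_actionAssocIso, Category.assoc, Category.assoc, ← Category.assoc (amul _ _),
      amul_actionHomLeft, amul_map_yonedaActIso, amul_map_yonedaActIso, ← Functor.map_comp,
      ← Functor.map_comp]
    congr 1
    have h := actionAssocIso_hom_naturality u w x
    rw [actionHom_def, actionHom_def, actionHom_def] at h
    exact h
  unit n := amul_hom_ext fun c d u w ↦ by
    obtain ⟨u, rfl⟩ := Ind.yoneda.map_surjective u
    obtain ⟨w, rfl⟩ := Ind.yoneda.map_surjective w
    refine Eq.trans ?_ (amul_actionUnitIso _ w).symm
    rw [ε_yoneda, actionHomRight_id, Category.id_comp]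
    refine (Category.assoc _ _ _).symm.trans
      ((congrArg (· ≫ _) (amul_map_yonedaActIso u w)).trans ?_)
    rw [← Functor.map_comp, ← Functor.map_comp]
    simp [← action_exchange]

instance isIso_yonedaSemiLin_app (n : M) (a : A) :
    IsIso ((yonedaSemiLin (A := A) (M := M)).app n a) := Iso.isIso_hom (yonedaActIso n a)

end YonedaSemiLin

/-! ### Compatibility of a monoidal functor with its extension to ind-objects -/

section Compare

variable {A : Type u₁} [Category.{v} A] [MonoidalCategory A] {B : Type u₂} [Category.{v} B]
  [MonoidalCategory B] (F : A ⥤ B) [F.Monoidal]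

/-- Needed to pass, by `SemiLin.transport`, from functors linear over y followed by ind(F) to
functors linear over F followed by y. -/
instance isMonoidal_indMapYoneda : NatTrans.IsMonoidal (indMapYoneda F).hom where
  unit := by
    rw [comp_ε, comp_ε, ε_yoneda, ε_yoneda, CategoryTheory.Functor.map_id, Category.comp_id,
      Category.id_comp, ε_indMap, ← el_id]
  tensor a a' := by
    rw [comp_μ, comp_μ, μ_yoneda, μ_yoneda,
      ← cancel_epi (tmul (𝟙 (Ind.yoneda.obj (F.obj a))) (𝟙 (Ind.yoneda.obj (F.obj a'))))]
    have h₁ := tmul_id_yonedaTensorIso (F.obj a) (F.obj a')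
    have h₂ := tmul_tensorHom (𝟙 (Ind.yoneda.obj (F.obj a))) (𝟙 (Ind.yoneda.obj (F.obj a')))
      ((indMapYoneda F).hom.app a) ((indMapYoneda F).hom.app a')
    rw [Category.id_comp, Category.id_comp, ← el_id, ← el_id] at h₂
    rw [← el_id, ← el_id, ← el_id]
    refine Eq.trans (b := Ind.yoneda.map (μ F a a') ≫ el F (𝟙 _)) ?_ ?_
    · simp only [← Category.assoc]
      refine congrArg (· ≫ _) ((congrArg (· ≫ _) h₁).trans (Category.id_comp _))
    · refine Eq.trans ?_ (Category.assoc _ _ _)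
      refine Eq.trans ?_ (congrArg (· ≫ _) h₂.symm)
      refine Eq.trans ?_ (Category.assoc _ _ _)
      refine Eq.trans ?_ (congrArg (· ≫ _) (tmul_el_μ F _ _).symm)
      rw [Category.assoc, el_map, tmul_id_yonedaTensorIso]

end Compare

end RexTensor

namespace RexTensor

open Functor.LaxMonoidal Functor.OplaxMonoidal Functor.LaxRightLinear

/-! ### Restricting an action to a full subcategory closed under it -/

section Restrict

variable {B : Type u₁} [Category.{v₁} B] [MonoidalCategory B] {C : Type u₂} [Category.{v₂} C]
  [MonoidalCategory C] (G : B ⥤ C) [G.Monoidal] {D : Type u₃} [Category.{v₃} D]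
  [MonoidalRightAction C D] {Q : Type u₄} [Category.{v₄} Q] (ι : Q ⥤ D)

/-- A fully faithful functor compatible with the data of an action on its source and an action on
its target, up to given isomorphisms. -/
structure ActionEmbedding [MonoidalRightActionStruct B Q] where
  /-- the comparison -/
  iso (X : Q) (b : B) : ι.obj (X ⊙ᵣ b) ≅ ι.obj X ⊙ᵣ G.obj b
  map_right (X : Q) {b b' : B} (f : b ⟶ b') :
    ι.map (X ⊴ᵣ f) = (iso X b).hom ≫ ι.obj X ⊴ᵣ G.map f ≫ (iso X b').inv
  map_left {X X' : Q} (f : X ⟶ X') (b : B) :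
    ι.map (f ⊵ᵣ b) = (iso X b).hom ≫ ι.map f ⊵ᵣ G.obj b ≫ (iso X' b).inv
  map_hom {X X' : Q} (f : X ⟶ X') {b b' : B} (g : b ⟶ b') :
    ι.map (f ⊙ᵣₘ g) =
      (iso X b).hom ≫ ι.map f ⊵ᵣ G.obj b ≫ ι.obj X' ⊴ᵣ G.map g ≫ (iso X' b').inv
  map_assoc (X : Q) (b b' : B) : ι.map (αᵣ X b b').hom =
    (iso X (b ⊗ b')).hom ≫ ι.obj X ⊴ᵣ δ G b b' ≫ (αᵣ _ _ _).hom ≫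
        (iso X b).inv ⊵ᵣ G.obj b' ≫ (iso (X ⊙ᵣ b) b').inv
  map_unit (X : Q) : ι.map (ρᵣ X).hom = (iso X (𝟙_ B)).hom ≫ ι.obj X ⊴ᵣ η G ≫ (ρᵣ _).hom

variable {G ι} in
theorem ActionEmbedding.map_assoc_inv [MonoidalRightActionStruct B Q]
    (i : ActionEmbedding G ι) (X : Q) (b b' : B) : ι.map (αᵣ X b b').inv =
      (i.iso (X ⊙ᵣ b) b').hom ≫ (i.iso X b).hom ⊵ᵣ G.obj b' ≫ (αᵣ _ _ _).inv ≫
        ι.obj X ⊴ᵣ μ G b b' ≫ (i.iso X (b ⊗ b')).inv := by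
  rw [← cancel_mono (ι.map (αᵣ X b b').hom), ← ι.map_comp, Iso.inv_hom_id, i.map_assoc]
  simp [← actionHomRight_comp_assoc]

variable {G ι} in
/-- The action on the source of an embedding. -/
@[reducible]
def ActionEmbedding.action [ι.Faithful] [MonoidalRightActionStruct B Q]
    (i : ActionEmbedding G ι) : MonoidalRightAction B Q where
  actionHom_def f g := ι.map_injective (by
    simp [i.map_hom, i.map_left, i.map_right])
  actionHomRight_id b X := ι.map_injective (by simp [i.map_right])
  id_actionHomLeft b X := ι.map_injective (by simp [i.map_left])
  actionHom_comp f₁ f₂ g₁ g₂ := ι.map_injective (by simp [i.map_hom, action_exchange_assoc])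
  actionAssocIso_hom_naturality {X X' b b' c c'} f g h := ι.map_injective (by
    have h₁ := actionAssocIso_hom_naturality (ι.map f) (G.map g) (G.map h)
    rw [actionHom_def, actionHom_def, actionHom_def, Category.assoc] at h₁
    simp only [ι.map_comp, i.map_hom, i.map_assoc, comp_actionHomLeft, Category.assoc,
      Iso.inv_hom_id_assoc]
    rw [← actionHomRight_comp_assoc, ← δ_natural, actionHomRight_comp, Category.assoc,
      ← action_exchange_assoc, reassoc_of% h₁]
    simp only [action_exchange_assoc, comp_actionHomLeft, Category.assoc,
      inv_hom_actionHomLeft_assoc])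
  actionUnitIso_hom_naturality f := ι.map_injective (by
    simp only [i.map_left, i.map_unit, ι.map_comp, Category.assoc, Iso.inv_hom_id_assoc,
      ← action_exchange_assoc, ← actionUnitIso_hom_naturality])
  actionHomRight_whiskerRight f b X := ι.map_injective (by
    simp only [i.map_right, i.map_assoc, i.map_assoc_inv, i.map_left, ι.map_comp,
      Category.assoc, Iso.inv_hom_id_assoc, comp_actionHomLeft, inv_hom_actionHomLeft_assoc]
    rw [Functor.Monoidal.map_whiskerRight]
    simp only [actionHomRight_comp, actionHomRight_whiskerRight, Category.assoc])
  whiskerRight_actionHomLeft b _ _ f X := ι.map_injective (by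
    simp only [i.map_right, i.map_assoc, i.map_assoc_inv, ι.map_comp,
      Category.assoc, Iso.inv_hom_id_assoc, ← action_exchange_assoc, inv_hom_actionHomLeft_assoc]
    rw [Functor.Monoidal.map_whiskerLeft]
    simp only [actionHomRight_comp, whiskerRight_actionHomLeft, Category.assoc])
  actionHom_associator b₁ b₂ b₃ X := ι.map_injective (by
    have h := actionHom_associator (G.obj b₁) (G.obj b₂) (G.obj b₃) (ι.obj X)
    -- Coherence of the comparison δ of G, acting on ι(X). Combined with the pentagon `h` of the
    -- ambient action it gives the pentagon of the restricted one.
    have h' : ι.obj X ⊴ᵣ δ G (b₁ ⊗ b₂) b₃ ≫ ι.obj X ⊴ᵣ (δ G b₁ b₂ ▷ G.obj b₃) ≫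
        ι.obj X ⊴ᵣ (α_ _ _ _).hom = ι.obj X ⊴ᵣ G.map (α_ b₁ b₂ b₃).hom ≫
          ι.obj X ⊴ᵣ δ G b₁ (b₂ ⊗ b₃) ≫ ι.obj X ⊴ᵣ (G.obj b₁ ◁ δ G b₂ b₃) := by
      simp only [← actionHomRight_comp, OplaxMonoidal.associativity]
    simp only [i.map_right, i.map_assoc, i.map_left, ι.map_comp, Category.assoc,
      Iso.inv_hom_id_assoc, comp_actionHomLeft, inv_hom_actionHomLeft_assoc,
      ← action_exchange_assoc]
    simp only [action_actionHomRight, Category.assoc, Iso.hom_inv_id_assoc, actionHomLeft_tensor,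
      Iso.inv_hom_id_assoc]
    rw [← reassoc_of% h', reassoc_of% h, actionHomRight_whiskerRight]
    simp only [Category.assoc, Iso.inv_hom_id_assoc])
  actionHom_leftUnitor b X := ι.map_injective (by
    simp only [i.map_right, i.map_assoc, i.map_left, i.map_unit, ι.map_comp, Category.assoc,
      Iso.inv_hom_id_assoc, comp_actionHomLeft, inv_hom_actionHomLeft_assoc]
    rw [Functor.Monoidal.map_leftUnitor]
    simp only [actionHomRight_comp, actionHom_leftUnitor, actionHomRight_whiskerRight,
      Category.assoc, Iso.inv_hom_id_assoc])
  actionHom_rightUnitor b X := ι.map_injective (by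
    simp only [i.map_right, i.map_assoc, i.map_unit, ι.map_comp, Category.assoc,
      Iso.inv_hom_id_assoc, ← action_exchange_assoc, ← actionUnitIso_hom_naturality]
    rw [Functor.Monoidal.map_rightUnitor]
    simp only [actionHomRight_comp, actionHom_rightUnitor, whiskerRight_actionHomLeft,
      Category.assoc, Iso.inv_hom_id_assoc])

section Construct

variable [ι.Full] [ι.Faithful] (h : ∀ (X : Q) (b : B), ι.essImage (ι.obj X ⊙ᵣ G.obj b))

/-- The data of an action on a full subcategory closed under the action. -/
@[reducible]
noncomputable def restrictStruct : MonoidalRightActionStruct B Q where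
  actionObj X b := (h X b).choose
  actionHomRight X _ _ f := ι.preimage
    ((h X _).choose_spec.some.hom ≫ ι.obj X ⊴ᵣ G.map f ≫ (h X _).choose_spec.some.inv)
  actionHomLeft f b := ι.preimage
    ((h _ b).choose_spec.some.hom ≫ ι.map f ⊵ᵣ G.obj b ≫ (h _ b).choose_spec.some.inv)
  actionAssocIso X b b' := ι.preimageIso ((h X (b ⊗ b')).choose_spec.some ≪≫
    (actionLeft C (ι.obj X)).mapIso (Functor.Monoidal.μIso G b b').symm ≪≫ αᵣ _ _ _ ≪≫
      (actionRight D (G.obj b')).mapIso (h X b).choose_spec.some.symm ≪≫ (h _ b').choose_spec.some.symm)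
  actionUnitIso X := ι.preimageIso ((h X (𝟙_ B)).choose_spec.some ≪≫
    (actionLeft C (ι.obj X)).mapIso (Functor.Monoidal.εIso G).symm ≪≫ ρᵣ _)

/-- The embedding of a full subcategory closed under the action. -/
noncomputable def restrictEmbedding :
    letI := restrictStruct G ι h
    ActionEmbedding G ι :=
  letI := restrictStruct G ι h
  { iso X b := (h X b).choose_spec.some
    map_right X _ _ f := ι.map_preimage _
    map_left f b := ι.map_preimage _
    map_hom f _ _ g := by
      refine (ι.map_comp _ _).trans ?_
      refine (congrArg₂ (· ≫ ·) (ι.map_preimage _) (ι.map_preimage _)).trans ?_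
      simp
    map_assoc X b b' := (ι.map_preimage _).trans (by simp; rfl)
    map_unit X := (ι.map_preimage _).trans (by simp; rfl) }

/-- The action on a full subcategory closed under the action. -/
@[reducible]
noncomputable def restrictAction : MonoidalRightAction B Q :=
  letI := restrictStruct G ι h
  (restrictEmbedding G ι h).action

/-- The inclusion of a full subcategory closed under the action is linear. -/
noncomputable def restrictSemiLin :
    letI := restrictAction G ι h
    SemiLin G ι :=
  letI := restrictAction G ι h
  letI i : ActionEmbedding G ι := restrictEmbedding G ι h
  { app X b := (i.iso X b).inv
    natural_left f b := by simp [i.map_left]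
    natural_right X _ _ f := by simp [i.map_right]
    assoc X b b' := by simp [i.map_assoc, ← actionHomRight_comp_assoc]
    unit X := by simp [i.map_unit, ← actionHomRight_comp_assoc] }

instance isIso_restrictSemiLin_app (X : Q) (b : B) :
    letI := restrictAction G ι h
    IsIso ((restrictSemiLin G ι h).app X b) :=
  letI := restrictStruct G ι h
  Iso.isIso_inv ((restrictEmbedding G ι h).iso X b)

end Construct

end Restrict

end RexTensor

namespace RexTensor

open Functor.LaxMonoidal Functor.OplaxMonoidal Functor.LaxRightLinear

/-! ### Right exactness and bilinearity along a linear embedding -/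

section SemiLinExact

variable {B : Type u₁} [Category.{v₁} B] [MonoidalCategory B] {C : Type u₂} [Category.{v₂} C]
  [MonoidalCategory C] {G : B ⥤ C} [G.LaxMonoidal] {D : Type u₃} [Category.{v₃} D]
  [MonoidalRightAction C D] {Q : Type u₄} [Category.{v₄} Q] [MonoidalRightAction B Q]
  {ι : Q ⥤ D}

/-- The comparison of the actions as an isomorphism natural in the acting object. -/
noncomputable def SemiLin.isoLeft (s : SemiLin G ι) [∀ X b, IsIso (s.app X b)] (X : Q) :
    G ⋙ actionLeft C (ι.obj X) ≅ actionLeft B X ⋙ ι :=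
  NatIso.ofComponents (fun b ↦ (asIso (s.app X b) : ι.obj X ⊙ᵣ G.obj b ≅ ι.obj (X ⊙ᵣ b))) (fun f ↦ s.natural_right X f)

/-- The comparison of the actions as an isomorphism natural in the object acted on. -/
noncomputable def SemiLin.isoRight (s : SemiLin G ι) [∀ X b, IsIso (s.app X b)] (b : B) :
    ι ⋙ actionRight D (G.obj b) ≅ actionRight Q b ⋙ ι :=
  NatIso.ofComponents (fun X ↦ (asIso (s.app X b) : ι.obj X ⊙ᵣ G.obj b ≅ ι.obj (X ⊙ᵣ b))) (fun f ↦ s.natural_left f b)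

/-- The comparison s identifies the restricted action with the ambient one, and a fully faithful
functor reflects the colimits in question. -/
theorem SemiLin.rightExactAction (s : SemiLin G ι) [∀ X b, IsIso (s.app X b)] [ι.Full] [ι.Faithful] [PreservesFiniteColimits ι]
    [PreservesFiniteColimits G] [RightExactAction C D] : RightExactAction B Q where
  preservesFiniteColimits_actionLeft X := ⟨fun J _ _ ↦
    have := RightExactAction.preservesFiniteColimits_actionLeft (A := C) (ι.obj X)
    have : PreservesColimitsOfShape J (actionLeft B X ⋙ ι) :=
      preservesColimitsOfShape_of_natIso (s.isoLeft X)
    preservesColimitsOfShape_of_reflects_of_preserves _ ι⟩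
  preservesFiniteColimits_actionRight b := ⟨fun J _ _ ↦
    have := RightExactAction.preservesFiniteColimits_actionRight (M := D) (G.obj b)
    have : PreservesColimitsOfShape J (actionRight Q b ⋙ ι) :=
      preservesColimitsOfShape_of_natIso (s.isoRight b)
    preservesColimitsOfShape_of_reflects_of_preserves _ ι⟩

theorem SemiLin.bilinearAction (s : SemiLin G ι) [∀ X b, IsIso (s.app X b)] {k : Type w} [Field k] [Preadditive B] [Linear k B]
    [Preadditive C] [Linear k C] [Preadditive D] [Linear k D] [Preadditive Q] [Linear k Q]
    [BilinearAction k C D] (hG : IsRex k G) (hι : IsRex k ι) [ι.Faithful] :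
    BilinearAction k B Q where
  add_actionHomLeft {X X'} f g b := ι.map_injective (by
    rw [← cancel_epi (s.app X b), hι.map_add, Preadditive.comp_add, ← s.natural_left,
      ← s.natural_left, ← s.natural_left, hι.map_add, BilinearAction.add_actionHomLeft k,
      Preadditive.add_comp])
  smul_actionHomLeft {X X'} r f b := ι.map_injective (by
    rw [← cancel_epi (s.app X b), hι.map_smul, Linear.comp_smul, ← s.natural_left,
      ← s.natural_left, hι.map_smul, BilinearAction.smul_actionHomLeft, Linear.smul_comp])
  actionHomRight_add X b b' f g := ι.map_injective (by
    rw [← cancel_epi (s.app X b), hι.map_add, Preadditive.comp_add, ← s.natural_right,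
      ← s.natural_right, ← s.natural_right, hG.map_add, BilinearAction.actionHomRight_add k,
      Preadditive.add_comp])
  actionHomRight_smul X b b' r f := ι.map_injective (by
    rw [← cancel_epi (s.app X b), hι.map_smul, Linear.comp_smul, ← s.natural_right,
      ← s.natural_right, hG.map_smul, BilinearAction.actionHomRight_smul, Linear.smul_comp])

end SemiLinExact

/-! ### Transport, lifting and inversion of linear structures -/

section OfIso

variable {C : Type u₁} [Category.{v₁} C] [MonoidalCategory C] {C' : Type u₂} [Category.{v₂} C']
  [MonoidalCategory C'] {G : C ⥤ C'} [G.LaxMonoidal]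
  {D : Type u₃} [Category.{v₃} D] [MonoidalRightAction C D] {D' : Type u₄} [Category.{v₄} D']
  [MonoidalRightAction C' D'] {K H : D ⥤ D'}

/-- Transport of a linear structure along an isomorphism of functors. -/
def SemiLin.ofIso (t : SemiLin G H) (e : K ≅ H) : SemiLin G K where
  app n a := e.hom.app n ⊵ᵣ G.obj a ≫ t.app n a ≫ e.inv.app (n ⊙ᵣ a)
  natural_left f a := by
    rw [Category.assoc, Category.assoc, ← comp_actionHomLeft_assoc, e.hom.naturality,
      comp_actionHomLeft_assoc, reassoc_of% t.natural_left, e.inv.naturality]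
  natural_right n a a' f := by
    rw [action_exchange_assoc, reassoc_of% t.natural_right, Category.assoc, Category.assoc,
      e.inv.naturality]
  assoc n a a' := by
    rw [Category.assoc, Category.assoc, action_exchange_assoc, ← e.inv.naturality,
      reassoc_of% t.assoc, actionHomLeft_tensor_assoc]
    simp only [comp_actionHomLeft, Category.assoc, Iso.inv_hom_id_assoc]
    rw [← comp_actionHomLeft_assoc (e.inv.app _), e.inv_hom_id_app, id_actionHomLeft,
      Category.id_comp]
  unit n := by
    rw [Category.assoc, Category.assoc, action_exchange_assoc, ← e.inv.naturality,
      reassoc_of% t.unit]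
    simp

instance SemiLin.isIso_ofIso_app (t : SemiLin G H) (e : K ≅ H) (n : D) (a : C)
    [IsIso (t.app n a)] : IsIso ((t.ofIso e).app n a) := by
  dsimp only [SemiLin.ofIso]
  have : IsIso (e.hom.app n ⊵ᵣ G.obj a) :=
    inferInstanceAs (IsIso ((actionRight D' (G.obj a)).map (e.hom.app n)))
  infer_instance

end OfIso

section Lift

variable {A : Type u₅} [Category.{v} A] [MonoidalCategory A]
  {B : Type u₁} [Category.{v₁} B] [MonoidalCategory B] {C : Type u₂} [Category.{v₂} C]
  [MonoidalCategory C] {G : B ⥤ C} [G.Monoidal] {F : A ⥤ B} [F.LaxMonoidal]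
  {D : Type u₃} [Category.{v₃} D] [MonoidalRightAction C D] {Q : Type u₄} [Category.{v₄} Q]
  [MonoidalRightAction B Q] {M : Type u₆} [Category.{w} M] [MonoidalRightAction A M]
  {ι : Q ⥤ D} [ι.Full] (s : SemiLin G ι) [∀ X b, IsIso (s.app X b)]
  {K : M ⥤ Q} (t : SemiLin (F ⋙ G) (K ⋙ ι))

/-- The comparison morphism lifted along a fully faithful linear functor. -/
noncomputable def SemiLin.liftApp (n : M) (a : A) : K.obj n ⊙ᵣ F.obj a ⟶ K.obj (n ⊙ᵣ a) :=
  ι.preimage (inv (s.app (K.obj n) (F.obj a)) ≫ t.app n a)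

theorem SemiLin.app_liftApp (n : M) (a : A) :
    s.app (K.obj n) (F.obj a) ≫ ι.map (s.liftApp t n a) = t.app n a := by
  rw [SemiLin.liftApp, ι.map_preimage, IsIso.hom_inv_id_assoc]

/-- Lift of a linear functor along a fully faithful linear functor. -/
noncomputable def SemiLin.lift [ι.Faithful] : SemiLin F K where
  app := s.liftApp t
  natural_left {n n'} f a := ι.map_injective (by
    have h := t.natural_left f a
    rw [← cancel_epi (s.app (K.obj n) (F.obj a)), ι.map_comp, ι.map_comp,
      ← reassoc_of% s.natural_left, s.app_liftApp, reassoc_of% s.app_liftApp]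
    exact h)
  natural_right n a a' f := ι.map_injective (by
    have h := t.natural_right n f
    rw [← cancel_epi (s.app (K.obj n) (F.obj a)), ι.map_comp, ι.map_comp,
      ← reassoc_of% s.natural_right, s.app_liftApp, reassoc_of% s.app_liftApp]
    exact h)
  assoc n a a' := ι.map_injective (by
    have h := t.assoc n a a'
    rw [comp_μ, actionHomRight_comp, Category.assoc] at h
    rw [← cancel_epi (s.app (K.obj n) (F.obj a ⊗ F.obj a')),
      ← cancel_epi (ι.obj (K.obj n) ⊴ᵣ μ G (F.obj a) (F.obj a'))]
    simp only [ι.map_comp]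
    rw [← reassoc_of% s.natural_right, reassoc_of% s.app_liftApp, reassoc_of% s.assoc,
      ← reassoc_of% s.natural_left, s.app_liftApp, ← comp_actionHomLeft_assoc, s.app_liftApp]
    exact h)
  unit n := ι.map_injective (by
    have h := t.unit n
    rw [comp_ε, actionHomRight_comp, Category.assoc] at h
    rw [← cancel_epi (s.app (K.obj n) (𝟙_ B)), ← cancel_epi (ι.obj (K.obj n) ⊴ᵣ ε G), s.unit]
    simp only [ι.map_comp]
    rw [← reassoc_of% s.natural_right, reassoc_of% s.app_liftApp]
    exact h)

instance SemiLin.isIso_lift_app [ι.Faithful] (n : M) (a : A) [IsIso (t.app n a)] :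
    IsIso ((s.lift t).app n a) :=
  have h' : IsIso (s.app (K.obj n) (F.obj a) ≫ ι.map (s.liftApp t n a)) :=
    (s.app_liftApp t n a).symm ▸ inferInstance
  have : IsIso (ι.map (s.liftApp t n a)) :=
    IsIso.of_isIso_comp_left (s.app (K.obj n) (F.obj a)) _
  isIso_of_reflects_iso (s.liftApp t n a) ι

end Lift

section Inverse

variable {A : Type u₁} [Category.{v₁} A] [MonoidalCategory A]
  {B : Type u₂} [Category.{v₂} B] [MonoidalCategory B] {F : A ⥤ B} [F.Monoidal]
  {M : Type u₃} [Category.{v₃} M] [MonoidalRightAction A M]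
  {P : Type u₄} [Category.{v₄} P] [MonoidalRightAction B P] {K : M ⥤ P} (s : SemiLin F K)
  [∀ X b, IsIso (s.app X b)]

theorem SemiLin.inv_natural_left {n n' : M} (f : n ⟶ n') (a : A) :
    K.map (f ⊵ᵣ a) ≫ inv (s.app n' a) = inv (s.app n a) ≫ K.map f ⊵ᵣ F.obj a := by
  rw [IsIso.comp_inv_eq, Category.assoc, s.natural_left, IsIso.inv_hom_id_assoc]

theorem SemiLin.inv_natural_right (n : M) {a a' : A} (f : a ⟶ a') :
    K.map (n ⊴ᵣ f) ≫ inv (s.app n a') = inv (s.app n a) ≫ K.obj n ⊴ᵣ F.map f := by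
  rw [IsIso.comp_inv_eq, Category.assoc, s.natural_right, IsIso.inv_hom_id_assoc]

theorem SemiLin.inv_assoc (n : M) (a a' : A) :
    K.map (αᵣ n a a').hom ≫ inv (s.app (n ⊙ᵣ a) a') ≫ inv (s.app n a) ⊵ᵣ F.obj a' =
      inv (s.app n (a ⊗ a')) ≫ K.obj n ⊴ᵣ δ F a a' ≫ (αᵣ _ _ _).hom := by
  rw [IsIso.eq_inv_comp, ← cancel_epi (K.obj n ⊴ᵣ μ F a a'), reassoc_of% s.assoc]
  simp [← actionHomRight_comp_assoc]

theorem SemiLin.inv_unit (n : M) :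
    inv (s.app n (𝟙_ A)) ≫ K.obj n ⊴ᵣ η F ≫ (ρᵣ _).hom = K.map (ρᵣ n).hom := by
  rw [IsIso.inv_comp_eq, ← cancel_epi (K.obj n ⊴ᵣ Functor.LaxMonoidal.ε F), s.unit]
  simp [← actionHomRight_comp_assoc]

end Inverse

/-! ### Axioms of a balanced functor from those of a linear functor -/

section BalancedAux

variable {B : Type u₂} [Category.{v₂} B] [MonoidalCategory B] {P : Type u₄} [Category.{v₄} P]
  [MonoidalRightAction B P]

/-- In the balanced functor (n, b) ↦ K(n) ⊙ b the balancing is i ⊵ b followed by an inverse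
associator, where i : K(n ⊙ a) ⟶ K(n) ⊙ F(a) inverts the linear structure. The lemmas
`balanced_natural_left`, `balanced_natural_middle`, `balanced_natural_right`, `balanced_tensor` and
`balanced_unit` isolate what each axiom requires of i. -/
theorem balanced_natural_left {p p' q q' : P} {c : B} {f : p ⟶ p'} {g : q ⟶ q'}
    {i : p ⟶ q ⊙ᵣ c} {i' : p' ⟶ q' ⊙ᵣ c} (h : f ≫ i' = i ≫ g ⊵ᵣ c) (b : B) :
    f ⊵ᵣ b ≫ i' ⊵ᵣ b ≫ (αᵣ q' c b).inv = (i ⊵ᵣ b ≫ (αᵣ q c b).inv) ≫ g ⊵ᵣ (c ⊗ b) := by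
  rw [← comp_actionHomLeft_assoc, h]
  simp

theorem balanced_natural_middle {p p' q : P} {c c' : B} {f : p ⟶ p'} {g : c ⟶ c'}
    {i : p ⟶ q ⊙ᵣ c} {i' : p' ⟶ q ⊙ᵣ c'} (h : f ≫ i' = i ≫ q ⊴ᵣ g) (b : B) :
    f ⊵ᵣ b ≫ i' ⊵ᵣ b ≫ (αᵣ q c' b).inv = (i ⊵ᵣ b ≫ (αᵣ q c b).inv) ≫ q ⊴ᵣ (g ▷ b) := by
  rw [← comp_actionHomLeft_assoc, h]
  simp [actionHomRight_whiskerRight]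

theorem balanced_natural_right {p q : P} {c b b' : B} (i : p ⟶ q ⊙ᵣ c) (f : b ⟶ b') :
    p ⊴ᵣ f ≫ i ⊵ᵣ b' ≫ (αᵣ q c b').inv = (i ⊵ᵣ b ≫ (αᵣ q c b).inv) ≫ q ⊴ᵣ (c ◁ f) := by
  rw [whiskerRight_actionHomLeft, Category.assoc, Iso.inv_hom_id_assoc, action_exchange_assoc]

/-- The hypothesis is the associativity of the linear structure; what remains after using it is the
pentagon of the action of B on P. -/
theorem balanced_tensor {p q r s : P} {c c' d : B} {f : s ⟶ p} {i : p ⟶ q ⊙ᵣ c'}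
    {j : q ⟶ r ⊙ᵣ c} {l : s ⟶ r ⊙ᵣ d} {g : d ⟶ c ⊗ c'}
    (h : f ≫ i ≫ j ⊵ᵣ c' = l ≫ r ⊴ᵣ g ≫ (αᵣ _ _ _).hom) (b : B) :
    f ⊵ᵣ b ≫ (i ⊵ᵣ b ≫ (αᵣ q c' b).inv) ≫ j ⊵ᵣ (c' ⊗ b) ≫ (αᵣ r c (c' ⊗ b)).inv =
      (l ⊵ᵣ b ≫ (αᵣ r d b).inv) ≫ r ⊴ᵣ (g ▷ b ≫ (α_ c c' b).hom) := by
  have h' : (αᵣ q c' b).inv ≫ j ⊵ᵣ (c' ⊗ b) = (j ⊵ᵣ c') ⊵ᵣ b ≫ (αᵣ _ _ _).inv := by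
    rw [Iso.inv_comp_eq, actionHomLeft_tensor]
  rw [Category.assoc, reassoc_of% h', ← comp_actionHomLeft_assoc, ← comp_actionHomLeft_assoc,
    Category.assoc, h, comp_actionHomLeft_assoc, comp_actionHomLeft_assoc, Category.assoc,
    actionHomRight_comp, actionHomRight_whiskerRight]
  simp only [Category.assoc, Iso.inv_hom_id_assoc]
  rw [← cancel_mono (αᵣ r c (c' ⊗ b)).hom, ← cancel_mono (αᵣ _ c' b).hom]
  simp only [Category.assoc, Iso.inv_hom_id, Category.comp_id]
  rw [actionHom_associator, Iso.inv_hom_id_assoc]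

theorem action_assoc_hom_naturality_right (p : P) (b : B) {c c' : B} (f : c ⟶ c') :
    p ⊴ᵣ (b ◁ f) ≫ (αᵣ p b c').hom = (αᵣ p b c).hom ≫ (p ⊙ᵣ b) ⊴ᵣ f := by
  rw [whiskerRight_actionHomLeft, Category.assoc, Category.assoc, Iso.inv_hom_id,
    Category.comp_id]

theorem action_assoc_hom_naturality_middle (p : P) {b b' : B} (f : b ⟶ b') (c : B) :
    p ⊴ᵣ (f ▷ c) ≫ (αᵣ p b' c).hom = (αᵣ p b c).hom ≫ (p ⊴ᵣ f) ⊵ᵣ c := by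
  simp [actionHomRight_whiskerRight]

theorem action_assoc_inv_naturality_right (p : P) (b : B) {c c' : B} (f : c ⟶ c') :
    (p ⊙ᵣ b) ⊴ᵣ f ≫ (αᵣ p b c').inv = (αᵣ p b c).inv ≫ p ⊴ᵣ (b ◁ f) := by
  rw [Iso.eq_inv_comp, ← reassoc_of% action_assoc_hom_naturality_right, Iso.hom_inv_id,
    Category.comp_id]

theorem action_assoc_inv_naturality_middle (p : P) {b b' : B} (f : b ⟶ b') (c : B) :
    (p ⊴ᵣ f) ⊵ᵣ c ≫ (αᵣ p b' c).inv = (αᵣ p b c).inv ≫ p ⊴ᵣ (f ▷ c) := by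
  rw [Iso.eq_inv_comp, ← reassoc_of% action_assoc_hom_naturality_middle, Iso.hom_inv_id,
    Category.comp_id]

theorem action_pentagon_inv (p : P) (b c d : B) :
    (αᵣ p b (c ⊗ d)).inv ≫ p ⊴ᵣ (α_ b c d).inv =
      (αᵣ (p ⊙ᵣ b) c d).hom ≫ (αᵣ p b c).inv ⊵ᵣ d ≫ (αᵣ p (b ⊗ c) d).inv := by
  have h := actionHom_associator b c d p
  rw [Iso.inv_comp_eq, ← cancel_epi (p ⊴ᵣ (α_ b c d).hom), actionHomRight_hom_inv,
    reassoc_of% h, hom_inv_actionHomLeft_assoc, Iso.hom_inv_id]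

theorem action_pentagon_hom (p : P) (b c d : B) :
    (αᵣ p b (c ⊗ d)).hom ≫ (αᵣ (p ⊙ᵣ b) c d).hom =
      p ⊴ᵣ (α_ b c d).inv ≫ (αᵣ p (b ⊗ c) d).hom ≫ (αᵣ p b c).hom ⊵ᵣ d := by
  rw [← actionHom_associator, actionHomRight_inv_hom_assoc]

theorem action_rightUnitor_hom (p : P) (b : B) :
    (ρᵣ (p ⊙ᵣ b)).inv = p ⊴ᵣ (ρ_ b).inv ≫ (αᵣ p b (𝟙_ B)).hom := by
  rw [← cancel_mono (ρᵣ _).hom, Iso.inv_hom_id, Category.assoc, ← actionHom_rightUnitor,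
    actionHomRight_inv_hom]

theorem action_rightUnitor_inv (p : P) (b : B) :
    (ρᵣ (p ⊙ᵣ b)).hom = (αᵣ p b (𝟙_ B)).inv ≫ p ⊴ᵣ (ρ_ b).hom := by
  rw [actionHom_rightUnitor, Iso.inv_hom_id_assoc]

/-- The linear structure on `b ↦ p ⊙ b`. -/
@[reducible]
def actionLeftLinear (p : P) : (actionLeft B p).RightLinear B where
  μᵣ b b' := (αᵣ p b b').inv
  δᵣ b b' := (αᵣ p b b').hom
  μᵣ_naturality_right b _ _ f := action_assoc_inv_naturality_right p b f
  μᵣ_naturality_left f b := action_assoc_inv_naturality_middle p f b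
  μᵣ_associativity b c d := action_pentagon_inv p b c d
  μᵣ_unitality b := action_rightUnitor_inv p b
  δᵣ_naturality_right b _ _ f := action_assoc_hom_naturality_right p b f
  δᵣ_naturality_left f b := action_assoc_hom_naturality_middle p f b
  δᵣ_associativity b c d := action_pentagon_hom p b c d
  δᵣ_unitality_inv b := action_rightUnitor_hom p b
  μᵣ_comp_δᵣ b c := (αᵣ p b c).inv_hom_id
  δᵣ_comp_μᵣ b c := (αᵣ p b c).hom_inv_id

theorem balanced_unit {p q : P} {c : B} {f : p ⟶ q} {i : p ⟶ q ⊙ᵣ c} {g : c ⟶ 𝟙_ B}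
    (h : i ≫ q ⊴ᵣ g ≫ (ρᵣ q).hom = f) (b : B) :
    (i ⊵ᵣ b ≫ (αᵣ q c b).inv) ≫ q ⊴ᵣ (g ▷ b ≫ (λ_ b).hom) = f ⊵ᵣ b := by
  rw [← h, actionHomRight_comp, actionHomRight_whiskerRight, actionHom_leftUnitor]
  simp

end BalancedAux

/-! ### The balanced functor of a linear functor -/

section Balanced

variable {k : Type w} [Field k] {A : Type u₁} [Category.{v₁} A] [MonoidalCategory A]
  {B : Type u₂} [Category.{v₂} B] [Preadditive B] [Linear k B] [MonoidalCategory B]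
  {F : A ⥤ B} [F.Monoidal]
  {M : Type u₃} [Category.{v₃} M] [Preadditive M] [Linear k M] [MonoidalRightAction A M]
  {P : Type u₄} [Category.{v₄} P] [Preadditive P] [Linear k P] [MonoidalRightAction B P]
  [RightExactAction B P] [BilinearAction k B P]

/-- The balanced functor `(n, b) ↦ K(n) ⊙ b` of a linear functor `K`. -/
noncomputable def SemiLin.balancedFunctor {K : M ⥤ P} (hK : IsRex k K) (s : SemiLin F K)
    [∀ X b, IsIso (s.app X b)] : BalancedFunctor k F M P where
  functor := K ⋙ (curriedAction B P).flip
  isRex_left b := hK.comp k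
    { map_add := fun f g ↦ BilinearAction.add_actionHomLeft k f g b
      map_smul := fun r f ↦ BilinearAction.smul_actionHomLeft r f b
      preservesFiniteColimits := RightExactAction.preservesFiniteColimits_actionRight b }
  isRex_right n :=
    { map_add := fun f g ↦ BilinearAction.actionHomRight_add k (K.obj n) f g
      map_smul := fun r f ↦ BilinearAction.actionHomRight_smul (K.obj n) r f
      preservesFiniteColimits := RightExactAction.preservesFiniteColimits_actionLeft (K.obj n) }
  bal n a b := (actionRight P b).mapIso (asIso (s.app n a)).symm ≪≫ (αᵣ _ _ _).symm
  bal_natural_left f a b := (balanced_natural_left (s.inv_natural_left f a) b)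
  bal_natural_middle n _ _ f b := balanced_natural_middle (s.inv_natural_right n f) b
  bal_natural_right n a _ _ f := balanced_natural_right (inv (s.app n a)) f
  bal_tensor n a a' b := balanced_tensor (s.inv_assoc n a a') b
  bal_unit n b := balanced_unit (s.inv_unit n) b

/-- The linear structure on the functors `b ↦ K(n) ⊙ b`. -/
@[reducible]
noncomputable def SemiLin.balancedLinear {K : M ⥤ P} (hK : IsRex k K) (s : SemiLin F K)
    [∀ X b, IsIso (s.app X b)] (n : M) :
    ((s.balancedFunctor hK).functor.obj n).RightLinear B :=
  actionLeftLinear (K.obj n)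

end Balanced

end RexTensor

namespace IndExt

open Functor.LaxMonoidal Functor.OplaxMonoidal

/-! ### Morphisms out of F(X) ⊗ Y in terms of elements -/

section TmulEl

variable {A : Type u₁} [Category.{v} A] {B : Type u₂} [Category.{v} B] [MonoidalCategory B]
  (F : A ⥤ B) {X X' : Ind A} {Y W : Ind B}

theorem tmul_el_left_hom_ext {f g : (indMap F).obj X ⊗ Y ⟶ W}
    (h : ∀ (a : A) (b : B) (u : Ind.yoneda.obj a ⟶ X) (w : Ind.yoneda.obj b ⟶ Y),
      tmul (el F u) w ≫ f = tmul (el F u) w ≫ g) : f = g := by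
  refine tmul_hom_ext fun c d u w ↦ ?_
  obtain ⟨c', u, p, rfl⟩ := el_surj F u
  rw [← map_tmul_left]
  simp only [Category.assoc, h]

theorem tmul_el_left_hom_ext₃ {Z : Ind B} {X₁ X₂ : Ind A}
    {f g : ((indMap F).obj X₁ ⊗ (indMap F).obj X₂) ⊗ Z ⟶ W}
    (h : ∀ (a a' : A) (b : B) (u : Ind.yoneda.obj a ⟶ X₁) (u' : Ind.yoneda.obj a' ⟶ X₂)
      (w : Ind.yoneda.obj b ⟶ Z),
      tmul (tmul (el F u) (el F u')) w ≫ f = tmul (tmul (el F u) (el F u')) w ≫ g) : f = g := by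
  refine tmul_hom_ext₃ fun c d e u w x ↦ ?_
  obtain ⟨c', u, p, rfl⟩ := el_surj F u
  obtain ⟨d', w, q, rfl⟩ := el_surj F w
  rw [← map_tmul_left, ← map_tmul_left, ← map_tmul_right, ← map_tmul_left]
  simp only [Category.assoc, h]

instance isIso_tmul_el_id (a : A) (b : B) :
    IsIso (tmul (el F (𝟙 (Ind.yoneda.obj a))) (𝟙 (Ind.yoneda.obj b))) := by
  rw [← Category.id_comp (el F (𝟙 (Ind.yoneda.obj a))), ← tmul_whiskerRight]
  infer_instance

theorem tmul_el_id_comp {a : A} {b : B} (u : Ind.yoneda.obj a ⟶ X) (w : Ind.yoneda.obj b ⟶ Y) :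
    tmul (el F (𝟙 (Ind.yoneda.obj a))) (𝟙 (Ind.yoneda.obj b)) ≫ (indMap F).map u ▷ _ ≫
      (indMap F).obj X ◁ w = tmul (el F u) w := by
  rw [← Category.assoc, tmul_whiskerRight, tmul_whiskerLeft, el_map, Category.id_comp,
    Category.id_comp]

/-- The bifunctor (X, Y) ↦ F(X) ⊗ Y preserves filtered colimits in each variable, and at
representables a, b it is y(F(a) ⊗ b); compatible families therefore glue. -/
theorem exists_tmul_el_desc (φ : ∀ (a : A) (b : B), (Ind.yoneda.obj a ⟶ X) →
      (Ind.yoneda.obj b ⟶ Y) → (Ind.yoneda.obj (F.obj a ⊗ b) ⟶ W))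
    (h₁ : ∀ (a a' : A) (b : B) (f : a ⟶ a') (u : Ind.yoneda.obj a' ⟶ X)
      (w : Ind.yoneda.obj b ⟶ Y),
      Ind.yoneda.map (F.map f ▷ b) ≫ φ a' b u w = φ a b (Ind.yoneda.map f ≫ u) w)
    (h₂ : ∀ (a : A) (b b' : B) (g : b ⟶ b') (u : Ind.yoneda.obj a ⟶ X)
      (w : Ind.yoneda.obj b' ⟶ Y),
      Ind.yoneda.map (F.obj a ◁ g) ≫ φ a b' u w = φ a b u (Ind.yoneda.map g ≫ w)) :
    ∃ f : (indMap F).obj X ⊗ Y ⟶ W, ∀ (a : A) (b : B) (u : Ind.yoneda.obj a ⟶ X)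
      (w : Ind.yoneda.obj b ⟶ Y), tmul (el F u) w ≫ f = φ a b u w := by
  let T : Ind A ⥤ Ind B ⥤ Ind B := indMap F ⋙ indBi (curriedTensor B)
  have h₃ (Z : Ind B) : PresFilt (T.flip.obj Z) :=
    inferInstanceAs (PresFilt (indMap F ⋙ (indBi (curriedTensor B)).flip.obj Z))
  have h₄ (Z : Ind A) : PresFilt (T.obj Z) :=
    inferInstanceAs (PresFilt ((indBi (curriedTensor B)).obj ((indMap F).obj Z)))
  obtain ⟨f, hf⟩ := exists_desc₂ T X Y W
    (fun a b u w ↦ inv (tmul (el F (𝟙 (Ind.yoneda.obj a))) (𝟙 (Ind.yoneda.obj b))) ≫ φ a b u w)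
    (fun a a' b f u w ↦ by
      have h : (indMap F).map (Ind.yoneda.map f) ▷ Ind.yoneda.obj b ≫
          inv (tmul (el F (𝟙 (Ind.yoneda.obj a'))) (𝟙 (Ind.yoneda.obj b))) =
          inv (tmul (el F (𝟙 (Ind.yoneda.obj a))) (𝟙 (Ind.yoneda.obj b))) ≫
            Ind.yoneda.map (F.map f ▷ b) := by
        rw [IsIso.comp_inv_eq, Category.assoc, IsIso.eq_inv_comp, tmul_whiskerRight, el_map,
          map_tmul_left, map_el, Category.id_comp, Category.comp_id]
      rw [← h₁]
      exact (reassoc_of% h) _)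
    (fun a b b' g u w ↦ by
      have h : (indMap F).obj (Ind.yoneda.obj a) ◁ Ind.yoneda.map g ≫
          inv (tmul (el F (𝟙 (Ind.yoneda.obj a))) (𝟙 (Ind.yoneda.obj b'))) =
          inv (tmul (el F (𝟙 (Ind.yoneda.obj a))) (𝟙 (Ind.yoneda.obj b))) ≫
            Ind.yoneda.map (F.obj a ◁ g) := by
        rw [IsIso.comp_inv_eq, Category.assoc, IsIso.eq_inv_comp, tmul_whiskerLeft,
          map_tmul_right, Category.id_comp, Category.comp_id]
      rw [← h₂]
      exact (reassoc_of% h) _)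
  refine ⟨f, fun a b u w ↦ ?_⟩
  rw [← tmul_el_id_comp, Category.assoc, ← IsIso.eq_inv_comp, ← hf]
  exact Category.assoc _ _ _

end TmulEl

end IndExt

namespace RexTensor

open Functor.LaxMonoidal Functor.OplaxMonoidal

/-! ### Elements of the internal hom as morphisms of M -/

section ElementMor

variable {A : Type u₁} [Category.{v} A] [MonoidalCategory A] {M : Type u₂} [Category.{v} M]
  [MonoidalRightAction A M] (m : M) [(actionLeft (Ind A) (Ind.yoneda.obj m)).IsLeftAdjoint]

/-- The object `Hom(m, n)` of the ind-completion of `A`. -/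
noncomputable abbrev iHom (n : Ind M) : Ind A := internalHom (Ind A) (Ind.yoneda.obj m) n

variable {m} {n n' : M} {a a' : A}

/-- The morphism `m ⊙ a ⟶ n` corresponding to an element of `Hom(m, n)`. -/
noncomputable def elMor (u : Ind.yoneda.obj a ⟶ iHom m (Ind.yoneda.obj n)) : m ⊙ᵣ a ⟶ n :=
  Ind.yoneda.preimage (amul (𝟙 _) u ≫ internalEv (Ind A) (Ind.yoneda.obj m) (Ind.yoneda.obj n))

theorem map_elMor (u : Ind.yoneda.obj a ⟶ iHom m (Ind.yoneda.obj n)) :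
    Ind.yoneda.map (elMor u) =
      amul (𝟙 _) u ≫ internalEv (Ind A) (Ind.yoneda.obj m) (Ind.yoneda.obj n) :=
  Ind.yoneda.map_preimage _

/-- This and the following lemmas on `elMor` translate naturality, unit, composition and tensor
comparison of internal homs into morphisms of M. Each is checked after y, where it becomes an
identity of evaluations. -/
theorem elMor_natural (f : a ⟶ a') (u : Ind.yoneda.obj a' ⟶ iHom m (Ind.yoneda.obj n)) :
    elMor (Ind.yoneda.map f ≫ u) = m ⊴ᵣ f ≫ elMor u :=
  Ind.yoneda.map_injective (by
    rw [map_elMor, Functor.map_comp, map_elMor, ← map_amul_right, Category.assoc])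

theorem elMor_map (u : Ind.yoneda.obj a ⟶ iHom m (Ind.yoneda.obj n)) (f : n ⟶ n') :
    elMor (u ≫ internalMap (Ind A) _ (Ind.yoneda.map f)) = elMor u ≫ f :=
  Ind.yoneda.map_injective (by
    rw [map_elMor, Functor.map_comp, map_elMor, Category.assoc, ← internalMap_ev,
      ← amul_actionHomRight, Category.assoc])

theorem elMor_one (f : a ⟶ 𝟙_ A) :
    elMor (Ind.yoneda.map f ≫ internalOne (Ind A) (Ind.yoneda.obj m)) = m ⊴ᵣ f ≫ (ρᵣ m).hom :=
  Ind.yoneda.map_injective (by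
    rw [map_elMor, ← amul_actionHomRight, Category.assoc, internalOne, internalCurry_ev]
    have h := amul_actionUnitIso (𝟙 (Ind.yoneda.obj m)) f
    refine h.trans ?_
    simp)

theorem elMor_comp (u : Ind.yoneda.obj a ⟶ iHom m (Ind.yoneda.obj m))
    (u' : Ind.yoneda.obj a' ⟶ iHom m (Ind.yoneda.obj n)) :
    elMor (tmul u u' ≫ internalComp (Ind A) _ _) =
      (αᵣ m a a').hom ≫ elMor u ⊵ᵣ a' ≫ elMor u' :=
  Ind.yoneda.map_injective (by
    rw [map_elMor, ← amul_actionHomRight, Category.assoc, internalComp_ev]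
    have h := amul_actionAssocIso (𝟙 (Ind.yoneda.obj m)) u u'
    rw [reassoc_of% h]
    simp only [Functor.map_comp]
    rw [map_elMor u', reassoc_of% amul_actionHomLeft (amul (𝟙 _) u) u', ← map_elMor,
      reassoc_of% map_amul_left (𝟙 (Ind.yoneda.obj m)) u' (elMor u)])

theorem elMor_tensor (u : Ind.yoneda.obj a ⟶ iHom m (Ind.yoneda.obj n)) (a' : A) :
    elMor (tmul u (𝟙 (Ind.yoneda.obj a')) ≫ internalTensor (Ind A) _ _ _ ≫
      internalMap (Ind A) _ (yonedaActIso n a').hom) = (αᵣ m a a').hom ≫ elMor u ⊵ᵣ a' :=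
  Ind.yoneda.map_injective (by
    have h := amul_actionAssocIso (𝟙 (Ind.yoneda.obj m)) u (𝟙 (Ind.yoneda.obj a'))
    have h' := amul_map_yonedaActIso (elMor u) (𝟙 a')
    rw [CategoryTheory.Functor.map_id, actionHomRight_id, Category.comp_id] at h'
    rw [map_elMor, ← Category.assoc (tmul _ _), ← amul_actionHomRight, Category.assoc,
      internalMap_ev, ← amul_actionHomRight, Category.assoc,
      reassoc_of% internalTensor_ev (Ind A) (Ind.yoneda.obj m) (Ind.yoneda.obj n),
      reassoc_of% h, reassoc_of% amul_actionHomLeft (amul (𝟙 _) u) (𝟙 (Ind.yoneda.obj a')),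
      ← map_elMor, h', Functor.map_comp])

end ElementMor

end RexTensor

namespace RexTensor

open Functor.LaxMonoidal Functor.OplaxMonoidal

/-! ### Balanced presheaves and the modules they define -/

section BalancedPresheaf

variable {A : Type u₁} [Category.{v} A] [MonoidalCategory A] {B : Type u₂} [Category.{v} B]
  [MonoidalCategory B] (F : A ⥤ B) [F.Monoidal] (M : Type u₃) [Category.{v} M]
  [MonoidalRightAction A M]

/-- A contravariant family of ind-objects of `B` indexed by `M` with a balancing. -/
structure BalancedPresheaf where
  /-- the objects -/
  obj : M → Ind B
  /-- the transition morphisms -/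
  map {n n' : M} (f : n ⟶ n') : obj n' ⟶ obj n
  map_comp {n n' n'' : M} (f : n ⟶ n') (g : n' ⟶ n'') : map (f ≫ g) = map g ≫ map f
  /-- the balancing -/
  bal (n : M) (a : A) (b : B) :
    (Ind.yoneda.obj b ⟶ obj (n ⊙ᵣ a)) ≃ (Ind.yoneda.obj (F.obj a ⊗ b) ⟶ obj n)
  bal_left {n n' : M} (f : n ⟶ n') (a : A) {b : B} (w : Ind.yoneda.obj b ⟶ obj (n' ⊙ᵣ a)) :
    bal n a b (w ≫ map (f ⊵ᵣ a)) = bal n' a b w ≫ map f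
  bal_middle (n : M) {a a' : A} (f : a ⟶ a') {b : B} (w : Ind.yoneda.obj b ⟶ obj (n ⊙ᵣ a')) :
    bal n a b (w ≫ map (n ⊴ᵣ f)) = Ind.yoneda.map (F.map f ▷ b) ≫ bal n a' b w
  bal_right (n : M) (a : A) {b b' : B} (g : b ⟶ b') (w : Ind.yoneda.obj b' ⟶ obj (n ⊙ᵣ a)) :
    bal n a b (Ind.yoneda.map g ≫ w) = Ind.yoneda.map (F.obj a ◁ g) ≫ bal n a b' w
  bal_tensor (n : M) (a a' : A) (b : B) (w : Ind.yoneda.obj b ⟶ obj ((n ⊙ᵣ a) ⊙ᵣ a')) :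
    bal n (a ⊗ a') b (w ≫ map (αᵣ n a a').hom) =
      Ind.yoneda.map (δ F a a' ▷ b ≫ (α_ _ _ b).hom) ≫ bal n a _ (bal (n ⊙ᵣ a) a' b w)
  bal_unit (n : M) (b : B) (w : Ind.yoneda.obj b ⟶ obj n) :
    bal n (𝟙_ A) b (w ≫ map (ρᵣ n).hom) = Ind.yoneda.map (η F ▷ b ≫ (λ_ b).hom) ≫ w

variable {F M} (W : BalancedPresheaf F M) (m : M)
  [(actionLeft (Ind A) (Ind.yoneda.obj m)).IsLeftAdjoint]

namespace BalancedPresheaf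

/-- An element u of Hom(m, n) over a is a morphism m ⊙ a ⟶ n. It pulls an element w of W(n) over b
back to W(m ⊙ a), and the balancing turns the result into an element of W(m) over F(a) ⊗ b.
Naturality of the balancing makes this glue. -/
theorem exists_act (n : M) : ∃ f : (indMap F).obj (iHom m (Ind.yoneda.obj n)) ⊗ W.obj n ⟶ W.obj m,
    ∀ (a : A) (b : B) (u : Ind.yoneda.obj a ⟶ iHom m (Ind.yoneda.obj n))
      (w : Ind.yoneda.obj b ⟶ W.obj n),
      tmul (el F u) w ≫ f = W.bal m a b (w ≫ W.map (elMor u)) :=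
  exists_tmul_el_desc F (fun a b u w ↦ W.bal m a b (w ≫ W.map (elMor u)))
    (fun a a' b f u w ↦ by rw [elMor_natural, W.map_comp, ← W.bal_middle, Category.assoc])
    (fun a b b' g u w ↦ by rw [Category.assoc, W.bal_right])

/-- The action `F(Hom(m, n)) ⊗ W(n) ⟶ W(m)`. -/
noncomputable def act (n : M) :
    (indMap F).obj (iHom m (Ind.yoneda.obj n)) ⊗ W.obj n ⟶ W.obj m := (W.exists_act m n).choose

variable {m} in
theorem tmul_el_act {n : M} {a : A} {b : B} (u : Ind.yoneda.obj a ⟶ iHom m (Ind.yoneda.obj n))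
    (w : Ind.yoneda.obj b ⟶ W.obj n) :
    tmul (el F u) w ≫ W.act m n = W.bal m a b (w ≫ W.map (elMor u)) :=
  (W.exists_act m n).choose_spec a b u w

/-- On elements both sides are an iterated balancing: `elMor_comp` computes the composite in Hom,
and `bal_tensor` with `bal_left` splits the balancing over a ⊗ a'. For n = m this is associativity
of the module W(m); for general n it gives the linearity of `ofElement`. -/
theorem comp_act (n : M) :
    (μ (indMap F) _ _ ≫ (indMap F).map (internalComp (Ind A) (Ind.yoneda.obj m)
      (Ind.yoneda.obj n))) ▷ W.obj n ≫ W.act m n =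
      (α_ _ _ _).hom ≫ _ ◁ W.act m n ≫ W.act m m :=
  tmul_el_left_hom_ext₃ F fun a a' b u u' w ↦ by
    rw [← Category.assoc, tmul_whiskerRight, ← Category.assoc (tmul _ _), tmul_el_μ,
      Category.assoc, el_map, ← map_tmul_left, Category.assoc, W.tmul_el_act, elMor_comp,
      ← Category.assoc (tmul _ _), tmul_associator, Category.assoc, ← Category.assoc (tmul _ _),
      tmul_whiskerLeft, W.tmul_el_act, W.tmul_el_act, W.map_comp, W.map_comp,
      ← Category.assoc, W.bal_tensor, ← W.bal_left, Category.assoc, ← Category.assoc,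
      ← Functor.map_comp]
    congr 1
    congr 1
    rw [← comp_whiskerRight_assoc, Functor.Monoidal.μ_δ]
    simp

theorem one_act :
    (ε (indMap F) ≫ (indMap F).map (internalOne (Ind A) (Ind.yoneda.obj m))) ▷ W.obj m ≫
      W.act m m = (λ_ (W.obj m)).hom :=
  tmul_hom_ext fun c d u w ↦ by
    obtain ⟨u, rfl⟩ := Ind.yoneda.map_surjective (Y := 𝟙_ B) u
    have h : Ind.yoneda.map u ≫ ε (indMap F) ≫
        (indMap F).map (internalOne (Ind A) (Ind.yoneda.obj m)) =
        Ind.yoneda.map (u ≫ ε F) ≫ el F (internalOne (Ind A) (Ind.yoneda.obj m)) := by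
      rw [ε_indMap, Category.assoc, el_map, Category.id_comp, Functor.map_comp, Category.assoc]
    refine Eq.trans ?_ (tmul_leftUnitor w u).symm
    rw [← Category.assoc, tmul_whiskerRight, h, ← map_tmul_left, Category.assoc, W.tmul_el_act]
    have h' := elMor_one (m := m) (𝟙 (𝟙_ A))
    rw [CategoryTheory.Functor.map_id, Category.id_comp, actionHomRight_id, Category.id_comp] at h'
    rw [h', W.bal_unit, ← Category.assoc, ← Functor.map_comp]
    congr 2
    rw [← comp_whiskerRight_assoc, Category.assoc, Functor.Monoidal.ε_η, Category.comp_id]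

/-- The left module structure on `W(m)`. -/
@[reducible]
noncomputable def modObj : ModObj ((indMap F).obj (internalHom (Ind A) (Ind.yoneda.obj m)
    (Ind.yoneda.obj m))) (W.obj m) where
  smul := W.act m m
  one_smul := W.one_act m
  mul_smul := W.comp_act m m

/-- The left module `W(m)`. -/
noncomputable def mod : Mod (Ind B) ((indMap F).obj (internalHom (Ind A) (Ind.yoneda.obj m)
    (Ind.yoneda.obj m))) :=
  letI := W.modObj m
  ⟨W.obj m⟩

end BalancedPresheaf

end BalancedPresheaf

end RexTensor

namespace RexTensor

open Functor.LaxMonoidal Functor.OplaxMonoidal Functor.LaxRightLinear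

/-! ### The modules F(Hom(m, n)) and their morphisms to W(m) -/

section ImageMod

variable {A : Type u₁} [Category.{v} A] [MonoidalCategory A] {B : Type u₂} [Category.{v} B]
  [MonoidalCategory B] (F : A ⥤ B) [F.Monoidal] {M : Type u₃} [Category.{v} M]
  [MonoidalRightAction A M] (m : M) [(actionLeft (Ind A) (Ind.yoneda.obj m)).IsLeftAdjoint]

/-- The image in ind-objects of `B` of the endomorphism algebra of `m`. -/
noncomputable abbrev imageEnd : Ind B := (indMap F).obj (iHom m (Ind.yoneda.obj m))

/-- The functor `n ↦ F(Hom(m, n))` to modules over the image of the endomorphism algebra. -/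
noncomputable def imageMod : M ⥤ Mod (Ind B) (imageEnd F m) :=
  (Ind.yoneda ⋙ internalMod (Ind A) (Ind.yoneda.obj m)) ⋙ modMap F _

/-- The comparison `F(Hom(m, n)) ⊗ F(a) ⟶ F(Hom(m, n ⊙ a))`. -/
noncomputable def imageModSemiLin : SemiLin (F ⋙ Ind.yoneda) (imageMod F m) :=
  (((yonedaSemiLin (A := A) (M := M)).compLinear
    (internalMod (Ind A) (Ind.yoneda.obj m))).comp (modMapSemiLin F _)).transport (indMapYoneda F).hom

/-- Rigidity of A inverts the comparison for Hom(m, -); the remaining factors are invertible because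
F and y are strong and F followed by y agrees with y followed by ind(F). -/
instance isIso_imageModSemiLin_app [RigidCategory A] (n : M) (a : A) :
    IsIso ((imageModSemiLin F m).app n a) := by
  let _ := mapExactPairing (Ind.yoneda (C := A)) (ᘁa) a
  have h₁ := isIso_μᵣ_of_exactPairing (Ind.yoneda.obj (ᘁa)) (a := Ind.yoneda.obj a)
    (internalMod (Ind A) (Ind.yoneda.obj m)) (Ind.yoneda.obj n)
  have h₂ : IsIso (((yonedaSemiLin (A := A) (M := M)).compLinear
    (internalMod (Ind A) (Ind.yoneda.obj m))).app n a) := by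
    dsimp only [SemiLin.compLinear]
    infer_instance
  have h₃ : IsIso ((((yonedaSemiLin (A := A) (M := M)).compLinear
    (internalMod (Ind A) (Ind.yoneda.obj m))).comp (modMapSemiLin F _)).app n a) := by
    dsimp only [SemiLin.comp]
    infer_instance
  have h₄ : IsIso ((imageMod F m).obj n ⊴ᵣ (indMapYoneda F).hom.app a) :=
    inferInstanceAs (IsIso ((actionLeft (Ind B) ((imageMod F m).obj n)).map _))
  dsimp only [imageModSemiLin, SemiLin.transport]
  exact IsIso.comp_isIso' h₄ h₃

end ImageMod

namespace BalancedPresheaf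

variable {A : Type u₁} [Category.{v} A] [MonoidalCategory A] {B : Type u₂} [Category.{v} B]
  [MonoidalCategory B] {F : A ⥤ B} [F.Monoidal] {M : Type u₃} [Category.{v} M]
  [MonoidalRightAction A M] (W : BalancedPresheaf F M) (m : M)
  [(actionLeft (Ind A) (Ind.yoneda.obj m)).IsLeftAdjoint]

theorem whiskerLeft_comp_act {n : M} {X : Ind B} (w : X ⟶ W.obj n) :
    ((α_ _ _ _).inv ≫ (μ (indMap F) _ _ ≫ (indMap F).map (internalComp (Ind A) (Ind.yoneda.obj m)
      (Ind.yoneda.obj n))) ▷ X) ≫ _ ◁ w ≫ W.act m n = _ ◁ (_ ◁ w ≫ W.act m n) ≫ W.act m m := by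
  rw [Category.assoc, ← whisker_exchange_assoc, comp_act]
  simp

/-- The morphism `F(Hom(m, n)) ⊗ b ⟶ W(m)` determined by an element of `W(n)`. -/
noncomputable def elementHom (n : M) (b : B) (w : Ind.yoneda.obj b ⟶ W.obj n) :
    (indMap F).obj (iHom m (Ind.yoneda.obj n)) ⊗ Ind.yoneda.obj b ⟶ W.obj m := _ ◁ w ≫ W.act m n

/-- The module morphism `F(Hom(m, n)) ⊗ b ⟶ W(m)` determined by an element of `W(n)`. -/
noncomputable def ofElement (n : M) (b : B) (w : Ind.yoneda.obj b ⟶ W.obj n) :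
    (imageMod F m).obj n ⊙ᵣ Ind.yoneda.obj b ⟶ W.mod m :=
  modHomMk (X := (imageMod F m).obj n ⊙ᵣ Ind.yoneda.obj b) (Y := W.mod m)
    (W.elementHom m n b w) (W.whiskerLeft_comp_act m w)

variable {m}

theorem tmul_el_elementHom {n : M} {b c : B} {a : A} (w : Ind.yoneda.obj b ⟶ W.obj n)
    (u : Ind.yoneda.obj a ⟶ iHom m (Ind.yoneda.obj n)) (g : Ind.yoneda.obj c ⟶ Ind.yoneda.obj b) :
    tmul (el F u) g ≫ W.elementHom m n b w = W.bal m a c ((g ≫ w) ≫ W.map (elMor u)) := by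
  rw [← W.tmul_el_act, ← tmul_whiskerLeft, Category.assoc, elementHom]

theorem elementHom_left {n n' : M} (f : n ⟶ n') (b : B) (w : Ind.yoneda.obj b ⟶ W.obj n') :
    (indMap F).map (internalMap (Ind A) (Ind.yoneda.obj m) (Ind.yoneda.map f)) ▷ Ind.yoneda.obj b ≫
      W.elementHom m n' b w = W.elementHom m n b (w ≫ W.map f) :=
  tmul_el_left_hom_ext F fun a c u g ↦ by
    rw [← Category.assoc, tmul_whiskerRight, el_map, W.tmul_el_elementHom, W.tmul_el_elementHom,
      elMor_map, W.map_comp, Category.assoc, Category.assoc, Category.assoc]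

theorem ofElement_left {n n' : M} (f : n ⟶ n') (b : B) (w : Ind.yoneda.obj b ⟶ W.obj n') :
    (imageMod F m).map f ⊵ᵣ Ind.yoneda.obj b ≫ W.ofElement m n' b w =
      W.ofElement m n b (w ≫ W.map f) :=
  Mod.hom_ext _ _ (W.elementHom_left f b w)

theorem elementHom_right (n : M) {b b' : B} (f : b ⟶ b') (w : Ind.yoneda.obj b' ⟶ W.obj n) :
    _ ◁ Ind.yoneda.map f ≫ W.elementHom m n b' w = W.elementHom m n b (Ind.yoneda.map f ≫ w) := by
  rw [elementHom, elementHom, MonoidalCategory.whiskerLeft_comp_assoc]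

theorem ofElement_right (n : M) {b b' : B} (f : b ⟶ b') (w : Ind.yoneda.obj b' ⟶ W.obj n) :
    (imageMod F m).obj n ⊴ᵣ Ind.yoneda.map f ≫ W.ofElement m n b' w =
      W.ofElement m n b (Ind.yoneda.map f ≫ w) :=
  Mod.hom_ext _ _ (W.elementHom_right n f w)

/-- For n = m the source is the free R-module on b, and `ofElement` unfolds to the inverse of the
free-forgetful bijection. -/
theorem bijective_ofElement_self (b : B) : Function.Bijective (W.ofElement m m b) :=
  (modFreeEquiv (imageEnd F m) (Ind.yoneda.obj b) (W.mod m)).symm.bijective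

end BalancedPresheaf

/-! ### The balancing of the functor (n, b) ↦ F(Hom(m, n)) ⊗ b -/

section BalComparison

variable {A : Type u₁} [Category.{v} A] [MonoidalCategory A] {B : Type u₂} [Category.{v} B]
  [MonoidalCategory B] (F : A ⥤ B) [F.Monoidal] {M : Type u₃} [Category.{v} M]
  [MonoidalRightAction A M] (m n : M) [(actionLeft (Ind A) (Ind.yoneda.obj m)).IsLeftAdjoint]
  (a : A) (b : B)

/-- The comparison of `F(Hom(m, n)) ⊗ (F(a) ⊗ b)` with `F(Hom(m, n ⊙ a)) ⊗ b`. -/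
noncomputable def balComparison :
    (imageMod F m).obj n ⊙ᵣ Ind.yoneda.obj (F.obj a ⊗ b) ⟶
      (imageMod F m).obj (n ⊙ᵣ a) ⊙ᵣ Ind.yoneda.obj b :=
  (imageMod F m).obj n ⊴ᵣ (yonedaTensorIso _ _).inv ≫ (αᵣ _ _ _).hom ≫
    (imageModSemiLin F m).app n a ⊵ᵣ Ind.yoneda.obj b

/-- The comparison `F(Hom(m, n)) ⊗ F(a) ⟶ F(Hom(m, n ⊙ a))` on underlying objects. -/
noncomputable def imageTensor : (indMap F).obj (iHom m (Ind.yoneda.obj n)) ⊗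
    Ind.yoneda.obj (F.obj a) ⟶ (indMap F).obj (iHom m (Ind.yoneda.obj (n ⊙ᵣ a))) :=
  _ ◁ el F (𝟙 _) ≫ μ (indMap F) _ _ ≫ (indMap F).map
      (internalTensor (Ind A) _ _ _ ≫ internalMap (Ind A) _ (yonedaActIso n a).hom)

theorem balComparison_hom : (balComparison F m n a b).hom = _ ◁ (yonedaTensorIso _ _).inv ≫
    (α_ _ _ _).inv ≫ imageTensor F m n a ▷ Ind.yoneda.obj b := by
  rw [imageTensor, el_id]
  rfl

variable {m n}

theorem tmul_el_imageTensor {a' : A} (u : Ind.yoneda.obj a' ⟶ iHom m (Ind.yoneda.obj n)) :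
    tmul (el F u) (𝟙 (Ind.yoneda.obj (F.obj a))) ≫ imageTensor F m n a =
      Ind.yoneda.map (μ F a' a) ≫ el F (tmul u (𝟙 (Ind.yoneda.obj a)) ≫
        internalTensor (Ind A) _ _ _ ≫ internalMap (Ind A) _ (yonedaActIso n a).hom) := by
  rw [imageTensor, ← el_map F (tmul u _), ← Category.assoc (Ind.yoneda.map _),
    ← tmul_el_μ, Category.assoc, ← Category.assoc (tmul _ _), tmul_whiskerLeft, Category.id_comp]

theorem tmul_el_balComparison {c : B} {a' : A}
    (u : Ind.yoneda.obj a' ⟶ iHom m (Ind.yoneda.obj n)) (g : c ⟶ F.obj a ⊗ b) :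
    tmul (el F u) (Ind.yoneda.map g) ≫ _ ◁ (yonedaTensorIso _ _).inv ≫
    (α_ _ _ _).inv ≫ imageTensor F m n a ▷ Ind.yoneda.obj b =
      Ind.yoneda.map (F.obj a' ◁ g ≫ (α_ _ _ _).inv ≫ μ F a' a ▷ b) ≫
        tmul (el F (tmul u (𝟙 (Ind.yoneda.obj a)) ≫ internalTensor (Ind A) _ _ _ ≫
      internalMap (Ind A) _ (yonedaActIso n a).hom)) (𝟙 _) := by
  have h₂ : tmul (el F u) (Ind.yoneda.map g) ≫ _ ◁ (yonedaTensorIso (F.obj a) b).inv =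
      Ind.yoneda.map (F.obj a' ◁ g) ≫ tmul (el F u) (tmul (𝟙 _) (𝟙 _)) := by
    rw [tmul_whiskerLeft, map_tmul_right]
    rfl
  have h₃ : tmul (el F u) (tmul (𝟙 (Ind.yoneda.obj (F.obj a))) (𝟙 (Ind.yoneda.obj b))) ≫
      (α_ _ _ _).inv = Ind.yoneda.map (α_ _ _ _).inv ≫ tmul (tmul (el F u) (𝟙 _)) (𝟙 _) := by
    rw [Iso.comp_inv_eq, Category.assoc, tmul_associator, ← Category.assoc, ← Functor.map_comp,
      Iso.inv_hom_id, CategoryTheory.Functor.map_id, Category.id_comp]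
  rw [reassoc_of% h₂, reassoc_of% h₃, tmul_whiskerRight, tmul_el_imageTensor, ← map_tmul_left]
  simp only [Functor.map_comp, Category.assoc]

end BalComparison

namespace BalancedPresheaf

variable {A : Type u₁} [Category.{v} A] [MonoidalCategory A] {B : Type u₂} [Category.{v} B]
  [MonoidalCategory B] {F : A ⥤ B} [F.Monoidal] {M : Type u₃} [Category.{v} M]
  [MonoidalRightAction A M] (W : BalancedPresheaf F M) {m : M}
  [(actionLeft (Ind A) (Ind.yoneda.obj m)).IsLeftAdjoint]

/-- On elements over a' the left side is computed by `elMor_tensor`; `bal_tensor` then splits the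
balancing over a' ⊗ a into the two balancings on the right. The comparisons μ and δ of F cancel. -/
theorem elementHom_bal (n : M) (a : A) (b : B) (w : Ind.yoneda.obj b ⟶ W.obj (n ⊙ᵣ a)) :
    (_ ◁ (yonedaTensorIso _ _).inv ≫
    (α_ _ _ _).inv ≫ imageTensor F m n a ▷ Ind.yoneda.obj b) ≫ W.elementHom m (n ⊙ᵣ a) b w =
      W.elementHom m n (F.obj a ⊗ b) (W.bal n a b w) :=
  tmul_el_left_hom_ext F fun a' c u g ↦ by
    obtain ⟨g, rfl⟩ := Ind.yoneda.map_surjective g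
    rw [← Category.assoc, tmul_el_balComparison, Category.assoc,
      W.tmul_el_elementHom, W.tmul_el_elementHom, elMor_tensor, Category.id_comp, W.map_comp,
      ← Category.assoc w, W.bal_tensor, Category.assoc, W.bal_right, ← W.bal_left,
      ← Category.assoc, ← Functor.map_comp]
    congr 2
    rw [Category.assoc, Category.assoc, ← comp_whiskerRight_assoc, Functor.Monoidal.μ_δ,
      id_whiskerRight, Category.id_comp, Iso.inv_hom_id, Category.comp_id]

theorem ofElement_bal (n : M) (a : A) (b : B) (w : Ind.yoneda.obj b ⟶ W.obj (n ⊙ᵣ a)) :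
    balComparison F m n a b ≫ W.ofElement m (n ⊙ᵣ a) b w =
      W.ofElement m n (F.obj a ⊗ b) (W.bal n a b w) :=
  Mod.hom_ext _ _ ((congrArg (· ≫ W.elementHom m (n ⊙ᵣ a) b w)
    (balComparison_hom F m n a b)).trans (W.elementHom_bal n a b w))

end BalancedPresheaf

end RexTensor

namespace RexTensor

/-! ### Linear structures induced by a fully faithful functor -/

section LinearTransfer

variable {k : Type w} [Field k] {C : Type u₁} [Category.{v₁} C] {D : Type u₂} [Category.{v₂} D]
  [Preadditive D] [Linear k D] {ι : C ⥤ D} (hι : ι.FullyFaithful)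

/-- The linear structure induced by a fully faithful functor. -/
@[reducible]
def linearOfFullyFaithful :
    letI := Preadditive.ofFullyFaithful hι
    Linear k C :=
  letI := Preadditive.ofFullyFaithful hι
  { homModule := fun X Y ↦ (hι.homEquiv (X := X) (Y := Y)).module k
    smul_comp := fun X Y Z r f g ↦ hι.map_injective (by
      have h (Y' : C) (f : X ⟶ Y') : ι.map ((hι.homEquiv (X := X) (Y := Y')).symm
        (r • hι.homEquiv f)) = r • ι.map f := hι.map_preimage _
      refine (ι.map_comp _ _).trans ((congrArg (· ≫ ι.map g) (h _ f)).trans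
        (Eq.trans ?_ (h _ (f ≫ g)).symm))
      rw [Linear.smul_comp, ι.map_comp])
    comp_smul := fun X Y Z f r g ↦ hι.map_injective (by
      have h (X' : C) (f : X' ⟶ Z) : ι.map ((hι.homEquiv (X := X') (Y := Z)).symm
        (r • hι.homEquiv f)) = r • ι.map f := hι.map_preimage _
      refine (ι.map_comp _ _).trans ((congrArg (ι.map f ≫ ·) (h _ g)).trans
        (Eq.trans ?_ (h _ (f ≫ g)).symm))
      rw [Linear.comp_smul, ι.map_comp]) }

theorem isRex_of_fullyFaithful [PreservesFiniteColimits ι] :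
    letI := Preadditive.ofFullyFaithful hι
    letI := linearOfFullyFaithful (k := k) hι
    IsRex k ι :=
  letI := Preadditive.ofFullyFaithful hι
  letI := linearOfFullyFaithful (k := k) hι
  { map_add := fun f g ↦ hι.map_preimage _
    map_smul := fun r f ↦ hι.map_preimage _
    preservesFiniteColimits := inferInstance }

end LinearTransfer

/-! ### Finite modules: the closure of the free modules under finite colimits -/

section FinMod

variable {B : Type u₁} [Category.{v} B] [EssentiallySmall.{v} B] [HasFiniteColimits B]
  [MonoidalCategory B] [RigidCategory B] (R : Ind B) [MonObj R]

/-- The modules generated under finite colimits by the free modules on objects of `B`. -/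
def finMod : ObjectProperty (Mod (Ind B) R) :=
  -- The generators are indexed by a v-small type, which makes the closure essentially small; the
  -- bound ℵ₀ on the shapes means finite colimits.
  (ObjectProperty.ofObj (fun b : SmallModel.{v} B ↦ (modFree R).obj
    (Ind.yoneda.obj ((equivSmallModel B).inverse.obj b)))).colimitsCardinalClosure
      Cardinal.aleph0.{v}

instance : ObjectProperty.EssentiallySmall.{v} (finMod R) := by
  dsimp only [finMod]
  infer_instance

instance : (finMod R).IsClosedUnderIsomorphisms := by
  dsimp only [finMod]
  infer_instance

instance (J : Type u₂) [SmallCategory J] [FinCategory J] :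
    (finMod R).IsClosedUnderColimitsOfShape J :=
  ObjectProperty.isClosedUnderColimitsOfShape_colimitsCardinalClosure _ _ J (by
    rw [hasCardinalLT_aleph0_iff]
    infer_instance)

theorem finMod_free (b : B) : finMod R ((modFree R).obj (Ind.yoneda.obj b)) :=
  (finMod R).prop_of_iso ((modFree R).mapIso (Ind.yoneda.mapIso
      ((equivSmallModel.{v} B).unitIso.app b).symm))
    (ObjectProperty.le_colimitsCardinalClosure _ _ _ (ObjectProperty.ofObj_apply _ _))

theorem finMod_le {Q : ObjectProperty (Mod (Ind B) R)} [Q.IsClosedUnderIsomorphisms]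
    (hQ : ∀ (J : Type v) [SmallCategory J] [FinCategory J], Q.IsClosedUnderColimitsOfShape J)
    (h : ∀ b : B, Q ((modFree R).obj (Ind.yoneda.obj b))) : finMod R ≤ Q :=
  ObjectProperty.colimitsCardinalClosure_le _ Cardinal.aleph0.{v} (fun J _ hJ ↦ by
    rw [hasCardinalLT_aleph0_iff] at hJ
    -- A shape with finitely many arrows is a finite category: the identities bound the objects, and
    -- each hom-set embeds in the arrows.
    have : Finite J := Finite.of_injective (fun j : J ↦ Arrow.mk (𝟙 j)) (fun _ _ h ↦
      congrArg (fun a : Arrow J ↦ a.left) h)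
    have (i j : J) : Finite (i ⟶ j) := Finite.of_injective (fun f : i ⟶ j ↦ Arrow.mk f)
      (Arrow.mk_injective i j)
    let : FinCategory J := ⟨Fintype.ofFinite J, fun i j ↦ Fintype.ofFinite (i ⟶ j)⟩
    exact hQ J) (by
    rintro _ ⟨b⟩
    exact h _)

/-- The modules that stay finite after tensoring with b are closed under finite colimits, which the
action preserves, and contain the free ones because (R ⊗ b') ⊗ b ≅ R ⊗ (b' ⊗ b). -/
theorem finMod_act (Z : Mod (Ind B) R) (hZ : finMod R Z) (b : B) :
    finMod R (Z ⊙ᵣ Ind.yoneda.obj b) := by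
  let Q : ObjectProperty (Mod (Ind B) R) :=
    (finMod R).inverseImage (actionRight (Mod (Ind B) R) (Ind.yoneda.obj b))
  refine finMod_le R (Q := Q) (fun J _ _ ↦ ⟨?_⟩) (fun b' ↦ ?_) Z hZ
  · rintro X ⟨p⟩
    have := preservesColimitsOfShape_modActionRight (J := J) R (Ind.yoneda.obj b)
    exact (finMod R).prop_of_isColimit
      (isColimitOfPreserves (actionRight (Mod (Ind B) R) (Ind.yoneda.obj b)) p.isColimit)
      p.prop_diag_obj
  · exact (finMod R).prop_of_iso ((modFree R).mapIso (yonedaTensorIso b' b).symm ≪≫ αᵣ _ _ _)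
      (finMod_free R (b' ⊗ b))

/-- Morphisms out of R ⊗ b are morphisms from the finitely presentable y(b) to the underlying
object, and the forgetful functor preserves filtered colimits. -/
theorem isFinitelyPresentable_modFree (b : B) :
    IsFinitelyPresentable.{v} ((modFree R).obj (Ind.yoneda.obj b)) := by
  have h := isFinitelyPresentable_yoneda b
  rw [isFinitelyPresentable_iff_preservesFilteredColimits] at h ⊢
  have (J : Type v) [SmallCategory J] [IsFiltered J] : PreservesColimitsOfShape J
      (modForget R ⋙ coyoneda.obj (op (Ind.yoneda.obj b))) :=
    have := h.1 J
    inferInstance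
  let e : modForget R ⋙ coyoneda.obj (op (Ind.yoneda.obj b)) ≅
      coyoneda.obj (op ((modFree R).obj (Ind.yoneda.obj b))) :=
    NatIso.ofComponents (fun Z ↦ (modFreeEquiv R (Ind.yoneda.obj b) Z).symm.toIso) (fun {Z Z'} f ↦ by
      ext g
      apply (modFreeEquiv R (Ind.yoneda.obj b) Z').injective
      refine ((modFreeEquiv R _ _).apply_symm_apply _).trans ?_
      refine Eq.trans ?_ (modFreeEquiv_naturality_right R _ f).symm
      exact (congrArg (· ≫ f.hom) ((modFreeEquiv R _ _).apply_symm_apply g)).symm)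
  exact ⟨fun J _ _ ↦ preservesColimitsOfShape_of_natIso e⟩

/-- Finitely presentable objects are closed under finite colimits, so the free case suffices. -/
theorem isFinitelyPresentable_finMod (Z : Mod (Ind B) R) (hZ : finMod R Z) :
    IsFinitelyPresentable.{v} Z :=
  have := Cardinal.fact_isRegular_aleph0.{v}
  ObjectProperty.colimitsCardinalClosure_le _ Cardinal.aleph0.{v}
    (Q := isCardinalPresentable (Mod (Ind B) R) Cardinal.aleph0.{v}) (fun J _ hJ ↦
      isClosedUnderColimitsOfShape_isCardinalPresentable _ hJ) (by
    rintro _ ⟨b⟩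
    exact isFinitelyPresentable_modFree R _) Z hZ

/-- A small model of the category of finite modules over `R`. -/
abbrev FinMod : Type v := SmallModel.{v} (finMod R).FullSubcategory

namespace FinMod

/-- The inclusion of the finite modules. -/
noncomputable def incl : FinMod R ⥤ Mod (Ind B) R :=
  (equivSmallModel.{v} (finMod R).FullSubcategory).inverse ⋙ (finMod R).ι

instance : (incl R).Full := by dsimp only [incl]; infer_instance

instance : (incl R).Faithful := by dsimp only [incl]; infer_instance

instance : HasFiniteColimits (FinMod R) := ⟨fun J _ _ ↦
  Adjunction.hasColimitsOfShape_of_equivalence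
    (equivSmallModel.{v} (finMod R).FullSubcategory).inverse⟩

instance : PreservesFiniteColimits (incl R) := ⟨fun J _ _ ↦ by
  dsimp only [incl]
  infer_instance⟩

theorem prop_incl (Z : FinMod R) : finMod R ((incl R).obj Z) := ObjectProperty.FullSubcategory.property _

variable {R} in
theorem exists_iso {Z : Mod (Ind B) R} (hZ : finMod R Z) : (incl R).essImage Z :=
  ⟨(equivSmallModel.{v} (finMod R).FullSubcategory).functor.obj ⟨Z, hZ⟩,
    ⟨(finMod R).ι.mapIso ((equivSmallModel.{v} (finMod R).FullSubcategory).unitIso.symm.app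
      ⟨Z, hZ⟩)⟩⟩

variable {R} in
/-- Induction on finite modules. -/
theorem induction {Q : ObjectProperty (FinMod R)} [Q.IsClosedUnderIsomorphisms]
    (hQ : ∀ (J : Type v) [SmallCategory J] [FinCategory J], Q.IsClosedUnderColimitsOfShape J)
    (h : ∀ (b : B) (Z : FinMod R) (_ : (modFree R).obj (Ind.yoneda.obj b) ≅ (incl R).obj Z), Q Z)
    (Z : FinMod R) : Q Z := by
  -- The property Q is moved to all modules. Quantifying over every Z with image X makes it
  -- invariant under isomorphism, and recording that X is finite keeps colimits of such diagrams
  -- inside the finite modules.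
  let Q' : ObjectProperty (Mod (Ind B) R) := fun X ↦
    finMod R X ∧ ∀ (Z : FinMod R) (_ : (incl R).obj Z ≅ X), Q Z
  have : Q'.IsClosedUnderIsomorphisms :=
    ⟨fun e h ↦ ⟨(finMod R).prop_of_iso e h.1, fun Z e' ↦ h.2 Z (e' ≪≫ e.symm)⟩⟩
  refine (finMod_le R (Q := Q') (fun J _ _ ↦ ⟨?_⟩) (fun b ↦ ⟨finMod_free R b, fun Z e ↦ h b Z e.symm⟩)
    _ (prop_incl R Z)).2 Z (Iso.refl _)
  rintro X ⟨p⟩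
  have hX : finMod R X := (finMod R).prop_of_isColimit p.isColimit (fun j ↦ (p.prop_diag_obj j).1)
  refine ⟨hX, fun Z e ↦ ?_⟩
  let E := equivSmallModel.{v} (finMod R).FullSubcategory
  let K : J ⥤ FinMod R := (finMod R).lift p.diag (fun j ↦ (p.prop_diag_obj j).1) ⋙ E.functor
  let α : K ⋙ incl R ≅ p.diag := Functor.isoWhiskerRight (Functor.isoWhiskerLeft
    ((finMod R).lift p.diag (fun j ↦ (p.prop_diag_obj j).1)) E.unitIso.symm) (finMod R).ι
  let i : (incl R).obj (colimit K) ≅ (incl R).obj Z :=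
    IsColimit.coconePointsIsoOfNatIso (isColimitOfPreserves (incl R) (colimit.isColimit K))
      p.isColimit α ≪≫ e.symm
  exact Q.prop_of_iso ((incl R).preimageIso i) (Q.prop_colimit K
    (fun j ↦ (p.prop_diag_obj j).2 _ (α.app j)))

section Structure

variable [Preadditive B] {k : Type w} [Field k] [Linear k B] [MonoidalPreadditive B]
  [MonoidalLinear k B]

noncomputable instance : Preadditive (FinMod R) :=
  Preadditive.ofFullyFaithful (Functor.FullyFaithful.ofFullyFaithful (incl R))

noncomputable instance : Linear k (FinMod R) :=
  linearOfFullyFaithful (Functor.FullyFaithful.ofFullyFaithful (incl R))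

theorem isRex_incl : IsRex k (incl R) :=
  isRex_of_fullyFaithful (Functor.FullyFaithful.ofFullyFaithful (incl R))

noncomputable instance : MonoidalRightAction B (FinMod R) :=
  restrictAction Ind.yoneda (incl R) (fun Z b ↦ exists_iso (finMod_act R _ (prop_incl R Z) b))

/-- The linear structure of the inclusion of the finite modules. -/
noncomputable def inclSemiLin : SemiLin (Ind.yoneda (C := B)) (incl R) :=
  restrictSemiLin Ind.yoneda (incl R) (fun Z b ↦ exists_iso (finMod_act R _ (prop_incl R Z) b))

instance (Z : FinMod R) (b : B) : IsIso ((inclSemiLin R).app Z b) :=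
  isIso_restrictSemiLin_app Ind.yoneda (incl R)
    (fun Z b ↦ exists_iso (finMod_act R _ (prop_incl R Z) b)) Z b

instance rightExactAction_mod : RightExactAction (Ind B) (Mod (Ind B) R) where
  preservesFiniteColimits_actionLeft X := ⟨fun J _ _ ↦ inferInstance⟩
  preservesFiniteColimits_actionRight X := ⟨fun J _ _ ↦ inferInstance⟩

instance : RightExactAction B (FinMod R) := (inclSemiLin R).rightExactAction

instance : BilinearAction k B (FinMod R) :=
  (inclSemiLin R).bilinearAction (isRex_indYoneda (k := k)) (isRex_incl R)

end Structure

end FinMod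

end FinMod

end RexTensor

namespace RexTensor

/-! ### Presentations of the objects of M by objects m ⊙ a -/

section Presentation

variable {A : Type u₁} [Category.{v} A] [MonoidalCategory A] {M : Type u₂} [Category.{v} M]
  [MonoidalRightAction A M] {m : M} [(actionLeft (Ind A) (Ind.yoneda.obj m)).IsLeftAdjoint]

theorem elMor_injective {n : M} {a : A} {u u' : Ind.yoneda.obj a ⟶ iHom m (Ind.yoneda.obj n)}
    (h : elMor u = elMor u') : u = u' := by
  apply internalHom_hom_ext
  rw [← cancel_epi (amul (𝟙 (Ind.yoneda.obj m)) (𝟙 (Ind.yoneda.obj a))), ← Category.assoc,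
    ← Category.assoc, amul_actionHomRight, amul_actionHomRight, Category.id_comp,
    Category.id_comp, ← map_elMor, ← map_elMor, h]

variable [EssentiallySmall.{v} M] [Abelian M]

/-- A compactness argument. Hom(m, n) is a filtered colimit of objects a of A, and the induced
morphisms m ⊙ a ⟶ n jointly cover n because the evaluation is an epimorphism. So n maps by zero to
the colimit of their cokernels, and as n is finitely presentable this happens at one stage; there
the cokernel vanishes. -/
theorem exists_epi (hm : ∀ n : Ind M, Epi (internalEv (Ind A) (Ind.yoneda.obj m) n)) (n : M) :
    ∃ (a : A) (π : m ⊙ᵣ a ⟶ n), Epi π := by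
  let X : Ind A := iHom (A := A) m (Ind.yoneda.obj n)
  let t (i : X.presentation.I) : m ⊙ᵣ X.presentation.F.obj i ⟶ n := elMor (presLeg X i)
  have ht {i j : X.presentation.I} (f : i ⟶ j) : m ⊴ᵣ X.presentation.F.map f ≫ t j = t i := by
    rw [← elMor_natural, map_presLeg]
  let Q : X.presentation.I ⥤ M :=
    { obj := fun i ↦ cokernel (t i)
      map := fun {i j} f ↦ cokernel.map (t i) (t j) (m ⊴ᵣ X.presentation.F.map f) (𝟙 n)
        (by rw [ht, Category.comp_id])
      map_id := fun i ↦ by ext; simp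
      map_comp := fun f g ↦ by ext; simp }
  have hQ {i j : X.presentation.I} (f : i ⟶ j) : cokernel.π (t i) ≫ Q.map f = cokernel.π (t j) :=
    (cokernel.π_desc _ _ _).trans (Category.id_comp _)
  -- The morphism from n to the colimit of the cokernels, through the stage i; it does not depend on
  -- i.
  let q (i : X.presentation.I) : Ind.yoneda.obj n ⟶ colimit (Q ⋙ Ind.yoneda) :=
    Ind.yoneda.map (cokernel.π (t i)) ≫ colimit.ι (Q ⋙ Ind.yoneda) i
  have hq {i j : X.presentation.I} (f : i ⟶ j) : q i = q j := by
    dsimp only [q]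
    rw [← hQ f, ← colimit.w (Q ⋙ Ind.yoneda) f, Functor.map_comp, Category.assoc]
    rfl
  have hq' (i j : X.presentation.I) : q i = q j :=
    (hq (IsFiltered.leftToMax i j)).trans (hq (IsFiltered.rightToMax i j)).symm
  obtain ⟨i₀⟩ : Nonempty X.presentation.I := IsFiltered.nonempty
  -- It suffices to precompose with the evaluation. Any element of m ⊙ Hom(m, n) comes from a stage
  -- i, and there q i₀ = q i begins with the cokernel of t i.
  have h₀ : q i₀ = 0 := by
    have := hm (Ind.yoneda.obj n)
    rw [← cancel_epi (internalEv (Ind A) (Ind.yoneda.obj m) (Ind.yoneda.obj n)), comp_zero]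
    refine amul_hom_ext fun m' a p u ↦ ?_
    obtain ⟨p, rfl⟩ := Ind.yoneda.map_surjective p
    obtain ⟨i, g, rfl⟩ := exists_presLeg u
    have h : amul (𝟙 (Ind.yoneda.obj m)) (presLeg X i) ≫
        internalEv (Ind A) (Ind.yoneda.obj m) (Ind.yoneda.obj n) ≫ q i₀ = 0 := by
      rw [← Category.assoc, ← map_elMor, hq' i₀ i, ← Category.assoc, ← Functor.map_comp,
        cokernel.condition, Functor.map_zero, zero_comp]
    rw [← Category.comp_id (Ind.yoneda.map p), ← map_amul_left, ← map_amul_right, Category.assoc,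
      Category.assoc, h]
    simp
  -- Vanishing in the filtered colimit is vanishing at some stage j, because n is finitely
  -- presentable.
  obtain ⟨j, s, s', hs⟩ := IsFinitelyPresentable.exists_eq_of_isColimit
    (colimit.isColimit (Q ⋙ Ind.yoneda)) (Ind.yoneda.map (cokernel.π (t i₀))) (j := i₀) 0
    (h₀.trans zero_comp.symm)
  have hs' : Ind.yoneda.map (cokernel.π (t i₀)) ≫ Ind.yoneda.map (Q.map s) = 0 :=
    hs.trans zero_comp
  rw [← Functor.map_comp, hQ s] at hs'
  exact ⟨_, t j, Abelian.epi_of_cokernel_π_eq_zero _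
    (Ind.yoneda.map_injective (hs'.trans (Functor.map_zero _ _ _).symm))⟩

/-- Cover n and then the kernel of the cover; in the abelian category M an epimorphism is the
cokernel of its kernel, and so of any morphism covering that kernel. -/
theorem exists_presentation (hm : ∀ n : Ind M, Epi (internalEv (Ind A) (Ind.yoneda.obj m) n))
    (n : M) : ∃ (a a' : A) (f : m ⊙ᵣ a' ⟶ m ⊙ᵣ a) (π : m ⊙ᵣ a ⟶ n) (w : f ≫ π = 0),
      Nonempty (IsColimit (CokernelCofork.ofπ π w)) := by
  obtain ⟨a, π, hπ⟩ := exists_epi hm n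
  obtain ⟨a', p, hp⟩ := exists_epi hm (kernel π)
  let hc := Abelian.epiIsCokernelOfKernel _ (kernelIsKernel π)
  exact ⟨a, a', p ≫ kernel.ι π, π, by simp, ⟨isCokernelEpiComp hc p rfl⟩⟩

end Presentation

/-! ### Right exactness of n ↦ F(Hom(m, n)) -/

section ImageModExact

variable {k : Type w} [Field k] {A : Type u₁} [Category.{v} A] [EssentiallySmall.{v} A]
  [Preadditive A] [HasFiniteColimits A] [Linear k A] [MonoidalCategory A] [MonoidalPreadditive A]
  [MonoidalLinear k A] [RigidCategory A]
  {B : Type u₂} [Category.{v} B] [EssentiallySmall.{v} B]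
  [Preadditive B] [HasFiniteColimits B] [Linear k B] [MonoidalCategory B] [MonoidalPreadditive B]
  [MonoidalLinear k B] [RigidCategory B] {F : A ⥤ B} [F.Monoidal] (hF : IsRex k F)
  {M : Type u₃} [Category.{v} M] [EssentiallySmall.{v} M] [Preadditive M] [HasFiniteColimits M]
  [Linear k M] [MonoidalRightAction A M] [BilinearAction k A M]
  (m : M) [(actionLeft (Ind A) (Ind.yoneda.obj m)).IsLeftAdjoint]

theorem internalMap_yoneda_smul (r : k) (n : M) :
    internalMap (Ind A) (Ind.yoneda.obj m) (Ind.yoneda.map (r • 𝟙 n)) = r • 𝟙 _ :=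
  yoneda_hom_ext fun a u ↦ elMor_injective (by
    rw [elMor_map, indScalar_eq, comp_indScalar, elMor_natural, BilinearAction.actionHomRight_smul]
    simp)

include hF in
-- Projectivity of m enters here: Hom(m, -) preserves colimits, the extension of the right exact F
-- preserves finite ones, and the forgetful functor reflects them.
theorem isRex_imageMod [h : PreservesColimitsOfSize.{v, v}
    (rightAdjoint (actionLeft (Ind A) (Ind.yoneda.obj m)))] : IsRex k (imageMod F m) := by
  have h₁ : IsRex k (indMap F) := isRex_indMap hF
  have := h₁.preservesFiniteColimits
  have : PreservesFiniteColimits (imageMod F m) := ⟨fun J _ _ ↦ by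
    have : PreservesColimitsOfSize.{0, 0}
        (rightAdjoint (actionLeft (Ind A) (Ind.yoneda.obj m))) :=
      preservesColimitsOfSize_shrink _
    have : PreservesColimitsOfShape J (rightAdjoint (actionLeft (Ind A) (Ind.yoneda.obj m))) :=
      inferInstance
    have : PreservesColimitsOfShape J (imageMod F m ⋙ modForget _) :=
      inferInstanceAs (PreservesColimitsOfShape J (Ind.yoneda ⋙
        rightAdjoint (actionLeft (Ind A) (Ind.yoneda.obj m)) ⋙ indMap F))
    exact preservesColimitsOfShape_of_reflects_of_preserves _ (modForget _)⟩
  refine isRex_of_preservesFiniteColimits _ fun r n ↦ Mod.hom_ext _ _ ?_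
  refine (congrArg (indMap F).map (internalMap_yoneda_smul m r n)).trans ?_
  rw [h₁.map_smul, CategoryTheory.Functor.map_id]
  rfl

end ImageModExact

end RexTensor

namespace RexTensor

open Functor.LaxMonoidal Functor.OplaxMonoidal Functor.LaxRightLinear

/-! ### Morphisms from free modules to F(Hom(m, n)) ⊗ b -/

section FreeElement

variable {A : Type u₁} [Category.{v} A] [MonoidalCategory A] {B : Type u₂} [Category.{v} B]
  [MonoidalCategory B] (F : A ⥤ B) [F.Monoidal] {M : Type u₃} [Category.{v} M]
  [MonoidalRightAction A M] {m n : M} [(actionLeft (Ind A) (Ind.yoneda.obj m)).IsLeftAdjoint]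

/-- The unit of End(m) tensored with a is the universal element of Hom(m, m ⊙ a), and the morphism m
⊙ a ⟶ n attached to u sends it to u. -/
theorem elMor_leftUnitor {a : A} (u : Ind.yoneda.obj a ⟶ iHom m (Ind.yoneda.obj n)) :
    tmul (internalOne (Ind A) (Ind.yoneda.obj m)) (𝟙 (Ind.yoneda.obj a)) ≫
      internalTensor (Ind A) _ _ _ ≫ internalMap (Ind A) _ (yonedaActIso m a).hom ≫
        internalMap (Ind A) _ (Ind.yoneda.map (elMor u)) = Ind.yoneda.map (λ_ a).hom ≫ u := by
  apply elMor_injective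
  have h := elMor_tensor (m := m) (a := 𝟙_ A) (internalOne (Ind A) (Ind.yoneda.obj m)) a
  have h₁ := elMor_one (m := m) (𝟙 (𝟙_ A))
  rw [CategoryTheory.Functor.map_id, Category.id_comp, actionHomRight_id, Category.id_comp] at h₁
  rw [← Category.assoc, ← Category.assoc, elMor_map, Category.assoc, elMor_natural]
  refine (congrArg (· ≫ elMor u) (h.trans (congrArg (fun p ↦ _ ≫ p ⊵ᵣ a) h₁))).trans ?_
  rw [← actionHom_leftUnitor]

theorem leftUnitor_inv_imageOne (c : B) : (λ_ (Ind.yoneda.obj c)).inv ≫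
    (ε (indMap F) ≫ (indMap F).map (internalOne (Ind A) (Ind.yoneda.obj m))) ▷ Ind.yoneda.obj c =
      Ind.yoneda.map ((λ_ c).inv ≫ ε F ▷ c) ≫ tmul (el F (internalOne (Ind A) (Ind.yoneda.obj m)))
        (Ind.yoneda.map (𝟙 c)) := by
  have h : ε (indMap F) ≫ (indMap F).map (internalOne (Ind A) (Ind.yoneda.obj m)) =
      Ind.yoneda.map (ε F) ≫ el F (internalOne (Ind A) (Ind.yoneda.obj m)) := by
    rw [ε_indMap, Category.assoc, el_map, Category.id_comp]
  rw [Iso.inv_comp_eq]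
  refine tmul_hom_ext fun d e u w ↦ ?_
  obtain ⟨u, rfl⟩ := Ind.yoneda.map_surjective (Y := 𝟙_ B) u
  obtain ⟨w, rfl⟩ := Ind.yoneda.map_surjective w
  rw [tmul_whiskerRight, h, ← Category.assoc (Ind.yoneda.map u), ← Functor.map_comp,
    ← map_tmul_left]
  refine Eq.trans ?_ ((reassoc_of% tmul_leftUnitor (Ind.yoneda.map w) u) _).symm
  rw [← Category.comp_id (Ind.yoneda.map w), ← map_tmul_right, CategoryTheory.Functor.map_id]
  simp only [← Category.assoc, ← Functor.map_comp, Category.comp_id]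
  congr 2
  simp only [Category.assoc]
  rw [← leftUnitor_naturality_assoc, Iso.hom_inv_id_assoc, whisker_exchange, comp_whiskerRight, Category.assoc]

theorem freeElement_aux {a : A} (b : B) (u : Ind.yoneda.obj a ⟶ iHom m (Ind.yoneda.obj n)) :
    ((λ_ (Ind.yoneda.obj (F.obj a ⊗ b))).inv ≫ (ε (indMap F) ≫ (indMap F).map
      (internalOne (Ind A) (Ind.yoneda.obj m))) ▷ Ind.yoneda.obj (F.obj a ⊗ b)) ≫
      (_ ◁ (yonedaTensorIso _ _).inv ≫ (α_ _ _ _).inv ≫ imageTensor F m m a ▷ Ind.yoneda.obj b) ≫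
      (indMap F).map (internalMap (Ind A) _ (Ind.yoneda.map (elMor u))) ▷ Ind.yoneda.obj b =
      tmul (el F u) (𝟙 (Ind.yoneda.obj b)) := by
  rw [leftUnitor_inv_imageOne, Category.assoc]
  have h := tmul_el_balComparison F a b (internalOne (Ind A) (Ind.yoneda.obj m)) (𝟙 (F.obj a ⊗ b))
  rw [← Category.assoc (tmul _ _), h, Category.assoc, tmul_whiskerRight, el_map, Category.assoc, Category.assoc,
    elMor_leftUnitor, ← map_el, ← map_tmul_left, ← Category.assoc, ← Category.assoc,
    ← Functor.map_comp, ← Functor.map_comp]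
  refine (congrArg (Ind.yoneda.map · ≫ _) ?_).trans
    ((congrArg (· ≫ _) (CategoryTheory.Functor.map_id Ind.yoneda _)).trans (Category.id_comp _))
  simp only [MonoidalCategory.whiskerLeft_id, Category.id_comp, Category.assoc]
  rw [associator_inv_naturality_left_assoc, ← comp_whiskerRight, ← comp_whiskerRight,
    ← Functor.LaxMonoidal.left_unitality, leftUnitor_whiskerRight, Iso.inv_hom_id_assoc,
    Iso.inv_hom_id]

/-- The free-forgetful bijection for the free modules `F(End(m)) ⊗ c`. -/
noncomputable def imageFree (m : M) [(actionLeft (Ind A) (Ind.yoneda.obj m)).IsLeftAdjoint]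
    (c : Ind B) (Z : Mod (Ind B) (imageEnd F m)) :
    ((imageMod F m).obj m ⊙ᵣ c ⟶ Z) ≃ (c ⟶ Z.X) := modFreeEquiv (imageEnd F m) c Z

theorem imageFree_comp {c : Ind B} {Z Z' : Mod (Ind B) (imageEnd F m)}
    (f : (imageMod F m).obj m ⊙ᵣ c ⟶ Z) (g : Z ⟶ Z') :
    imageFree F m c Z' (f ≫ g) = imageFree F m c Z f ≫ g.hom :=
  modFreeEquiv_naturality_right _ _ _

theorem imageFree_act {c c' : Ind B} {Z : Mod (Ind B) (imageEnd F m)} (g : c ⟶ c')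
    (f : (imageMod F m).obj m ⊙ᵣ c' ⟶ Z) :
    imageFree F m c Z ((imageMod F m).obj m ⊴ᵣ g ≫ f) = g ≫ imageFree F m c' Z f :=
  modFreeEquiv_naturality_left _ _ _

/-- Identifies the morphism R ⊗ (F(a) ⊗ b) ≅ F(Hom(m, m ⊙ a)) ⊗ b ⟶ F(Hom(m, n)) ⊗ b built from u by
its value on the generator, namely u tensored with b. Every morphism from a free module to F(Hom(m,
n)) ⊗ b can thereby be written through the bifunctor. -/
theorem imageFree_balComparison {a : A} (b : B)
    (u : Ind.yoneda.obj a ⟶ iHom m (Ind.yoneda.obj n)) :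
    imageFree F m (Ind.yoneda.obj (F.obj a ⊗ b)) ((imageMod F m).obj n ⊙ᵣ Ind.yoneda.obj b)
      (balComparison F m m a b ≫ (imageMod F m).map (elMor u) ⊵ᵣ Ind.yoneda.obj b) =
      tmul (el F u) (𝟙 (Ind.yoneda.obj b)) := by
  refine Eq.trans ?_ (freeElement_aux F b u)
  have h := congrArg (· ≫ (indMap F).map (internalMap (Ind A) _ (Ind.yoneda.map (elMor u))) ▷
    Ind.yoneda.obj b) (balComparison_hom F m m a b)
  exact (Category.assoc _ _ _).symm.trans (congrArg (fun p ↦ ((λ_ (Ind.yoneda.obj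
    (F.obj a ⊗ b))).inv ≫ (ε (indMap F) ≫ (indMap F).map (internalOne (Ind A)
      (Ind.yoneda.obj m))) ▷ Ind.yoneda.obj (F.obj a ⊗ b)) ≫ p) h)

/-- Elements of the tensor product and of F(X) both lift to finite stages; the component in b, being
a morphism of B, is absorbed into g. -/
theorem exists_tmul_el {X : Ind A} {b c : B}
    (z : Ind.yoneda.obj c ⟶ (indMap F).obj X ⊗ Ind.yoneda.obj b) :
    ∃ (a : A) (u : Ind.yoneda.obj a ⟶ X) (g : c ⟶ F.obj a ⊗ b),
      z = Ind.yoneda.map g ≫ tmul (el F u) (𝟙 (Ind.yoneda.obj b)) := by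
  obtain ⟨d, e, z, w, g, rfl⟩ := tmul_surj z
  obtain ⟨a, u, f, rfl⟩ := el_surj F z
  obtain ⟨w, rfl⟩ := Ind.yoneda.map_surjective w
  refine ⟨a, u, g ≫ f ▷ e ≫ F.obj a ◁ w, ?_⟩
  rw [Functor.map_comp, Functor.map_comp, Category.assoc, Category.assoc, map_tmul_right,
    map_tmul_left, Category.comp_id]

end FreeElement

end RexTensor

namespace RexTensor

open Functor.LaxMonoidal Functor.OplaxMonoidal Functor.LaxRightLinear

/-! ### Comparing balancings along a linear embedding -/

section BalComparisonAux

variable {B : Type u₁} [Category.{v₁} B] [MonoidalCategory B] {C : Type u₂} [Category.{v₂} C]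
  [MonoidalCategory C] {G : B ⥤ C} [G.LaxMonoidal] {D : Type u₃} [Category.{v₃} D]
  [MonoidalRightAction C D] {Q : Type u₄} [Category.{v₄} Q] [MonoidalRightAction B Q]
  {ι : Q ⥤ D} (s : SemiLin G ι)

/-- The abstract form of `finTensorIso_bal`: the balancing computed in Q and the one computed in D
agree under the embedding ι. Once the hypothesis h is used it is the associativity of s, with j a
section of μ. -/
theorem SemiLin.balancing_aux {Z Z' : D} {X X' : Q} (e : Z ⟶ ι.obj X) (e' : Z' ⟶ ι.obj X')
    {c b : B} (p : Z ⊙ᵣ G.obj c ⟶ Z') (l : X ⊙ᵣ c ≅ X')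
    (h : p ≫ e' = e ⊵ᵣ G.obj c ≫ s.app X c ≫ ι.map l.hom) (j : G.obj (c ⊗ b) ⟶ G.obj c ⊗ G.obj b)
    (hj : j ≫ μ G c b = 𝟙 _) :
    (Z ⊴ᵣ j ≫ (αᵣ _ _ _).hom ≫ p ⊵ᵣ G.obj b) ≫ (e' ⊵ᵣ G.obj b ≫ s.app X' b) ≫
      ι.map (l.inv ⊵ᵣ b ≫ (αᵣ _ _ _).inv) = e ⊵ᵣ G.obj (c ⊗ b) ≫ s.app X (c ⊗ b) := by
  have h' : (p ≫ e') ≫ ι.map l.inv = e ⊵ᵣ G.obj c ≫ s.app X c := by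
    rw [h, Category.assoc, Category.assoc, ← Functor.map_comp, Iso.hom_inv_id,
      CategoryTheory.Functor.map_id, Category.comp_id]
  have h₂ : (αᵣ Z (G.obj c) (G.obj b)).hom ≫ (e ⊵ᵣ G.obj c) ⊵ᵣ G.obj b =
      e ⊵ᵣ (G.obj c ⊗ G.obj b) ≫ (αᵣ _ _ _).hom := by
    rw [actionHomLeft_tensor]
    simp
  have h₃ := s.assoc X c b
  rw [Functor.map_comp]
  simp only [Category.assoc]
  rw [← reassoc_of% s.natural_left, ← comp_actionHomLeft_assoc, ← comp_actionHomLeft_assoc, h',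
    comp_actionHomLeft_assoc, reassoc_of% h₂, ← reassoc_of% h₃, ← Functor.map_comp,
    Iso.hom_inv_id, CategoryTheory.Functor.map_id, Category.comp_id, action_exchange_assoc,
    ← actionHomRight_comp_assoc, hj, actionHomRight_id, Category.id_comp]

end BalComparisonAux

/-! ### The balanced functor with values in finite modules -/

section FinImage

variable {k : Type w} [Field k] {A : Type u₁} [Category.{v} A] [EssentiallySmall.{v} A]
  [Preadditive A] [HasFiniteColimits A] [Linear k A] [MonoidalCategory A] [MonoidalPreadditive A]
  [MonoidalLinear k A] [RigidCategory A]
  {B : Type u₂} [Category.{v} B] [EssentiallySmall.{v} B]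
  [Preadditive B] [HasFiniteColimits B] [Linear k B] [MonoidalCategory B] [MonoidalPreadditive B]
  [MonoidalLinear k B] [RigidCategory B] {F : A ⥤ B} [F.Monoidal]
  {M : Type u₃} [Category.{v} M] [Preadditive M] [Linear k M] [MonoidalRightAction A M]
  {m : M} [(actionLeft (Ind A) (Ind.yoneda.obj m)).IsLeftAdjoint]

theorem finMod_imageMod_act (a : A) : finMod (imageEnd F m) ((imageMod F m).obj (m ⊙ᵣ a)) :=
  (finMod (imageEnd F m)).prop_of_iso (asIso ((imageModSemiLin F m).app m a) :
    (imageMod F m).obj m ⊙ᵣ Ind.yoneda.obj (F.obj a) ≅ (imageMod F m).obj (m ⊙ᵣ a))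
    (finMod_free (imageEnd F m) (F.obj a))

/-- Right exactness turns the presentation of n by objects m ⊙ a into a presentation by modules
F(Hom(m, m ⊙ a)), which are free on F(a). -/
theorem finMod_imageMod (hD : IsRex k (imageMod F m))
    (hp : ∀ n : M, ∃ (a a' : A) (f : m ⊙ᵣ a' ⟶ m ⊙ᵣ a) (π : m ⊙ᵣ a ⟶ n) (w : f ≫ π = 0),
      Nonempty (IsColimit (CokernelCofork.ofπ π w))) (n : M) :
    finMod (imageEnd F m) ((imageMod F m).obj n) := by
  obtain ⟨a, a', f, π, w, ⟨h⟩⟩ := hp n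
  have := hD.preservesFiniteColimits
  exact (finMod (imageEnd F m)).prop_of_isColimit (isColimitOfPreserves (imageMod F m) h) (by
    rintro (_ | _) <;> exact finMod_imageMod_act _)

variable (h : ∀ n, finMod (imageEnd F m) ((imageMod F m).obj n))

/-- The functor `n ↦ F(Hom(m, n))` to finite modules. -/
noncomputable def finImage : M ⥤ FinMod (imageEnd F m) :=
  (finMod (imageEnd F m)).lift (imageMod F m) h ⋙
    (equivSmallModel.{v} (finMod (imageEnd F m)).FullSubcategory).functor

/-- The underlying functor of `finImage`. -/
noncomputable def finImageIso : finImage h ⋙ FinMod.incl _ ≅ imageMod F m :=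
  Functor.isoWhiskerRight (Functor.isoWhiskerLeft ((finMod (imageEnd F m)).lift (imageMod F m) h)
    (equivSmallModel.{v} (finMod (imageEnd F m)).FullSubcategory).unitIso.symm)
      (finMod (imageEnd F m)).ι

theorem isRex_finImage (hD : IsRex k (imageMod F m)) : IsRex k (finImage h) := by
  have := hD.preservesFiniteColimits
  have hι : IsRex k (FinMod.incl (imageEnd F m)) := FinMod.isRex_incl _
  have : PreservesFiniteColimits (finImage h ⋙ FinMod.incl _) :=
    preservesFiniteColimits_of_natIso (finImageIso h).symm
  have e {n n' : M} (f : n ⟶ n') : (FinMod.incl _).map ((finImage h).map f) =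
      (finImageIso h).hom.app n ≫ (imageMod F m).map f ≫ (finImageIso h).inv.app n' := by
    rw [← (finImageIso h).hom.naturality_assoc, Iso.hom_inv_id_app, Category.comp_id]
    rfl
  exact
    { map_add := fun f g ↦ (FinMod.incl _).map_injective (by
        rw [hι.map_add, e, e, e, hD.map_add]
        simp)
      map_smul := fun r f ↦ (FinMod.incl _).map_injective (by
        rw [hι.map_smul, e, e, hD.map_smul]
        simp)
      preservesFiniteColimits := ⟨fun J _ _ ↦
        preservesColimitsOfShape_of_reflects_of_preserves (finImage h) (FinMod.incl _)⟩ }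

/-- The linear structure on `finImage`. -/
noncomputable def finImageSemiLin : SemiLin F (finImage h) :=
  (FinMod.inclSemiLin (imageEnd F m)).lift ((imageModSemiLin F m).ofIso (finImageIso h))

instance (n : M) (a : A) : IsIso ((finImageSemiLin h).app n a) := by
  dsimp only [finImageSemiLin]
  infer_instance

variable (hD : IsRex k (imageMod F m))

/-- The universal balanced functor `(n, b) ↦ F(Hom(m, n)) ⊗ b`. -/
noncomputable def finTensor : BalancedFunctor k F M (FinMod (imageEnd F m)) :=
  (finImageSemiLin h).balancedFunctor (isRex_finImage h hD)

/-- The module underlying the value of `finTensor`. -/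
noncomputable def finTensorIso (n : M) (b : B) : (imageMod F m).obj n ⊙ᵣ Ind.yoneda.obj b ≅
    (FinMod.incl _).obj (((finTensor h hD).functor.obj n).obj b) :=
  (actionRight _ (Ind.yoneda.obj b)).mapIso ((finImageIso h).symm.app n) ≪≫
    (asIso ((FinMod.inclSemiLin (imageEnd F m)).app ((finImage h).obj n) b) :
      (FinMod.incl _).obj ((finImage h).obj n) ⊙ᵣ Ind.yoneda.obj b ≅ _)

theorem finTensorIso_left {n n' : M} (f : n ⟶ n') (b : B) :
    (imageMod F m).map f ⊵ᵣ Ind.yoneda.obj b ≫ (finTensorIso h hD n' b).hom =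
      (finTensorIso h hD n b).hom ≫
        (FinMod.incl _).map (((finTensor h hD).functor.map f).app b) := by
  refine ((Category.assoc _ _ _).symm.trans (congrArg (· ≫ (FinMod.inclSemiLin (imageEnd F m)).app
    ((finImage h).obj n') b) (?_ : _ = (finImageIso h).inv.app n ⊵ᵣ Ind.yoneda.obj b ≫
      (FinMod.incl _).map ((finImage h).map f) ⊵ᵣ Ind.yoneda.obj b))).trans ?_
  · refine (comp_actionHomLeft _ _ _).symm.trans (Eq.trans (congrArg (· ⊵ᵣ _) ?_)
      (comp_actionHomLeft _ _ _))
    exact (finImageIso h).inv.naturality f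
  · rw [Category.assoc, SemiLin.natural_left]
    exact (Category.assoc _ _ _).symm

theorem finTensorIso_right (n : M) {b b' : B} (g : b ⟶ b') :
    (imageMod F m).obj n ⊴ᵣ Ind.yoneda.map g ≫ (finTensorIso h hD n b').hom =
      (finTensorIso h hD n b).hom ≫
        (FinMod.incl _).map (((finTensor h hD).functor.obj n).map g) := by
  have h₁ := action_exchange ((finImageIso h).inv.app n) (Ind.yoneda.map g)
  refine ((Category.assoc _ _ _).symm.trans (congrArg (· ≫ (FinMod.inclSemiLin (imageEnd F m)).app
    ((finImage h).obj n) b') h₁)).trans ?_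
  refine ((Category.assoc _ _ _).trans (congrArg ((finImageIso h).inv.app n ⊵ᵣ _ ≫ ·)
    ((FinMod.inclSemiLin (imageEnd F m)).natural_right ((finImage h).obj n) g))).trans ?_
  exact (Category.assoc _ _ _).symm

theorem finTensorIso_bal (n : M) (a : A) (b : B) :
    balComparison F m n a b ≫ (finTensorIso h hD (n ⊙ᵣ a) b).hom ≫
      (FinMod.incl _).map ((finTensor h hD).bal n a b).hom =
        (finTensorIso h hD n (F.obj a ⊗ b)).hom := by
  have hl := (FinMod.inclSemiLin (imageEnd F m)).app_liftApp
    ((imageModSemiLin F m).ofIso (finImageIso h)) n a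
  refine (FinMod.inclSemiLin (imageEnd F m)).balancing_aux ((finImageIso h).inv.app n)
    ((finImageIso h).inv.app (n ⊙ᵣ a)) ((imageModSemiLin F m).app n a)
    (asIso ((finImageSemiLin h).app n a) :
      (finImage h).obj n ⊙ᵣ F.obj a ≅ (finImage h).obj (n ⊙ᵣ a)) ?_ (yonedaTensorIso _ _).inv ?_
  · refine Eq.trans ?_ (congrArg ((finImageIso h).inv.app n ⊵ᵣ _ ≫ ·) hl.symm)
    refine Eq.trans ?_ (Category.assoc _ _ _)
    refine Eq.trans (Category.id_comp _).symm (congrArg (· ≫ (imageModSemiLin F m).app n a ≫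
      (finImageIso h).inv.app (n ⊙ᵣ a)) ?_)
    refine Eq.trans ?_ (comp_actionHomLeft ((finImageIso h).inv.app n)
      ((finImageIso h).hom.app n) (Ind.yoneda.obj (F.obj a)))
    rw [Iso.inv_hom_id_app, id_actionHomLeft]
  · rw [μ_yoneda, Iso.inv_hom_id]

/-- Morphisms of finite modules from the generators are elements. -/
noncomputable def finFree (b : B) (Z : FinMod (imageEnd F m)) :
    (((finTensor h hD).functor.obj m).obj b ⟶ Z) ≃
      (Ind.yoneda.obj b ⟶ ((FinMod.incl _).obj Z).X) :=
  ((Functor.FullyFaithful.ofFullyFaithful (FinMod.incl (imageEnd F m))).homEquiv.trans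
    (finTensorIso h hD m b).symm.homFromEquiv).trans
    (imageFree F m (Ind.yoneda.obj b) ((FinMod.incl (imageEnd F m)).obj Z))

theorem finFree_apply (b : B) {Z : FinMod (imageEnd F m)}
    (f : ((finTensor h hD).functor.obj m).obj b ⟶ Z) : finFree h hD b Z f =
      imageFree F m (Ind.yoneda.obj b) _ ((finTensorIso h hD m b).hom ≫ (FinMod.incl _).map f) :=
  rfl

theorem finFree_comp (b : B) {Z Z' : FinMod (imageEnd F m)}
    (f : ((finTensor h hD).functor.obj m).obj b ⟶ Z) (g : Z ⟶ Z') :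
    finFree h hD b Z' (f ≫ g) = finFree h hD b Z f ≫ ((FinMod.incl _).map g).hom := by
  rw [finFree_apply, finFree_apply, Functor.map_comp, ← Category.assoc, imageFree_comp]

theorem finFree_map {b b' : B} (g : b ⟶ b') {Z : FinMod (imageEnd F m)}
    (f : ((finTensor h hD).functor.obj m).obj b' ⟶ Z) :
    finFree h hD b Z (((finTensor h hD).functor.obj m).map g ≫ f) =
      Ind.yoneda.map g ≫ finFree h hD b' Z f := by
  rw [finFree_apply, finFree_apply, Functor.map_comp, ← Category.assoc, ← finTensorIso_right,
    Category.assoc, imageFree_act]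

theorem finFree_bal {n : M} {a : A} (u : Ind.yoneda.obj a ⟶ iHom m (Ind.yoneda.obj n)) (b : B) :
    finFree h hD (F.obj a ⊗ b) _ (((finTensor h hD).bal m a b).inv ≫
      ((finTensor h hD).functor.map (elMor u)).app b) =
      tmul (el F u) (𝟙 (Ind.yoneda.obj b)) ≫ (finTensorIso h hD n b).hom.hom := by
  refine Eq.trans ?_ (congrArg (· ≫ (finTensorIso h hD n b).hom.hom)
    (imageFree_balComparison F b u))
  refine Eq.trans ?_ (imageFree_comp F _ _)
  rw [finFree_apply]
  congr 1
  rw [← finTensorIso_bal, Functor.map_comp]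
  simp only [Category.assoc]
  rw [← Functor.map_comp_assoc, Iso.hom_inv_id, CategoryTheory.Functor.map_id, Category.id_comp,
    ← finTensorIso_left]

/-- Expresses the R-action on the elements of Z by the structure maps of the balanced functor alone.
A map defined on morphisms out of T(m, b) is seen to be R-linear in this way. -/
theorem finFree_act {a : A} (u : Ind.yoneda.obj a ⟶ iHom m (Ind.yoneda.obj m)) (b : B)
    {Z : FinMod (imageEnd F m)} (f : ((finTensor h hD).functor.obj m).obj b ⟶ Z) :
    finFree h hD (F.obj a ⊗ b) _ (((finTensor h hD).bal m a b).inv ≫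
      ((finTensor h hD).functor.map (elMor u)).app b ≫ f) =
      tmul (el F u) (finFree h hD b Z f) ≫ actMap (imageEnd F m) _ := by
  obtain ⟨z, hz⟩ := (imageFree F m (Ind.yoneda.obj b) ((FinMod.incl _).obj Z)).symm.surjective
    ((finTensorIso h hD m b).hom ≫ (FinMod.incl _).map f)
  have h₁ : finFree h hD b Z f = z := by
    rw [finFree_apply, ← hz, Equiv.apply_symm_apply]
  have h₂ : (imageEnd F m ◁ z ≫ actMap _ ((FinMod.incl _).obj Z).X) =
      (finTensorIso h hD m b).hom.hom ≫ ((FinMod.incl _).map f).hom :=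
    congrArg Mod.Hom.hom hz
  rw [← Category.assoc, finFree_comp, finFree_bal, h₁]
  refine (Category.assoc _ _ _).trans
    ((congrArg (tmul (el F u) (𝟙 (Ind.yoneda.obj b)) ≫ ·) h₂.symm).trans ?_)
  rw [← Category.assoc, tmul_whiskerLeft, Category.id_comp]

/-- By freeness f is an element of F(Hom(m, n)) ⊗ b over c, and `exists_tmul_el` factors it through
u tensored with b for some element u of Hom(m, n). A family of morphisms compatible with the
bifunctor and the balancing is therefore natural for every such f. -/
theorem exists_finTensor_hom {n : M} {b c : B} (f : ((finTensor h hD).functor.obj m).obj c ⟶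
    ((finTensor h hD).functor.obj n).obj b) :
    ∃ (a : A) (g : c ⟶ F.obj a ⊗ b) (t : m ⊙ᵣ a ⟶ n),
      f = ((finTensor h hD).functor.obj m).map g ≫ ((finTensor h hD).bal m a b).inv ≫
        ((finTensor h hD).functor.map t).app b := by
  have hi := congrArg Mod.Hom.hom (finTensorIso h hD n b).inv_hom_id
  let z : Ind.yoneda.obj c ⟶ (indMap F).obj (iHom m (Ind.yoneda.obj n)) ⊗ Ind.yoneda.obj b :=
    finFree h hD c _ f ≫ (finTensorIso h hD n b).inv.hom
  obtain ⟨a, u, g, hz⟩ := exists_tmul_el F z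
  refine ⟨a, g, elMor u, (finFree h hD c _).injective ?_⟩
  rw [finFree_map, finFree_bal]
  refine Eq.trans ?_ ((congrArg (· ≫ (finTensorIso h hD n b).hom.hom) hz).trans
    (Category.assoc _ _ _))
  exact ((Category.assoc _ _ _).trans ((congrArg (_ ≫ ·) hi).trans (Category.comp_id _))).symm

end FinImage

end RexTensor

namespace RexTensor

/-! ### Ind-objects representing b ↦ Hom(Γ(b), e) -/

section RestrictedAdjoint

variable {B : Type u₁} [Category.{v} B] [EssentiallySmall.{v} B] [HasFiniteColimits B]
  {E : Type u₂} [Category.{v} E] (Γ Γ' : B ⥤ E) [PreservesFiniteColimits Γ]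
  [PreservesFiniteColimits Γ']

/-- The ind-object of `B` representing the morphisms from the values of `Γ` to `e`. -/
noncomputable def indRep (e : E) : Ind B := (rightAdjoint (indMap Γ)).obj (Ind.yoneda.obj e)

/-- The elements of `indRep Γ e`. -/
noncomputable def indRepEquiv (b : B) (e : E) :
    (Γ.obj b ⟶ e) ≃ (Ind.yoneda.obj b ⟶ indRep Γ e) :=
  ((Functor.FullyFaithful.ofFullyFaithful (Ind.yoneda (C := E))).homEquiv.trans
    ((indMapYoneda Γ).app b).homFromEquiv).trans
    ((Adjunction.ofIsLeftAdjoint (indMap Γ)).homEquiv _ _)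

variable {Γ} in
theorem indRepEquiv_map {b b' : B} {e : E} (g : b ⟶ b') (f : Γ.obj b' ⟶ e) :
    indRepEquiv Γ b e (Γ.map g ≫ f) = Ind.yoneda.map g ≫ indRepEquiv Γ b' e f := by
  have h : (indMapYoneda Γ).inv.app b ≫ Ind.yoneda.map (Γ.map g ≫ f) =
      (indMap Γ).map (Ind.yoneda.map g) ≫ (indMapYoneda Γ).inv.app b' ≫ Ind.yoneda.map f := by
    rw [Functor.map_comp]
    exact ((reassoc_of% (indMapYoneda Γ).inv.naturality g) _).symm
  exact (congrArg ((Adjunction.ofIsLeftAdjoint (indMap Γ)).homEquiv _ _) h).trans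
    ((Adjunction.ofIsLeftAdjoint (indMap Γ)).homEquiv_naturality_left _ _)

variable {Γ Γ'} {e e' e'' : E} (φ : ∀ b, (Γ.obj b ⟶ e) → (Γ'.obj b ⟶ e'))
    (hφ : ∀ {b b' : B} (g : b ⟶ b') (f : Γ.obj b' ⟶ e), φ b (Γ.map g ≫ f) = Γ'.map g ≫ φ b' f)

include hφ in
theorem exists_indRepMap : ∃ f : indRep Γ e ⟶ indRep Γ' e', ∀ (b : B) (x : Γ.obj b ⟶ e),
    indRepEquiv Γ b e x ≫ f = indRepEquiv Γ' b e' (φ b x) := by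
  obtain ⟨f, hf⟩ := exists_desc (𝟭 (Ind B)) (indRep Γ e) (indRep Γ' e')
    (fun b w ↦ indRepEquiv Γ' b e' (φ b ((indRepEquiv Γ b e).symm w))) (fun b b' g w ↦ by
      obtain ⟨f, rfl⟩ := (indRepEquiv Γ b' e).surjective w
      change Ind.yoneda.map g ≫ _ = _
      rw [← indRepEquiv_map, ← indRepEquiv_map, Equiv.symm_apply_apply, Equiv.symm_apply_apply,
        hφ])
  refine ⟨f, fun b x ↦ (hf b _).trans ?_⟩
  rw [Equiv.symm_apply_apply]

/-- The morphism of representing ind-objects determined by its effect on elements. -/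
noncomputable def indRepMap : indRep Γ e ⟶ indRep Γ' e' := (exists_indRepMap φ hφ).choose

theorem indRepEquiv_indRepMap (b : B) (x : Γ.obj b ⟶ e) :
    indRepEquiv Γ b e x ≫ indRepMap φ hφ = indRepEquiv Γ' b e' (φ b x) :=
  (exists_indRepMap φ hφ).choose_spec b x

theorem indRep_hom_ext {X : Ind B} {f g : indRep Γ e ⟶ X}
    (h : ∀ (b : B) (x : Γ.obj b ⟶ e), indRepEquiv Γ b e x ≫ f = indRepEquiv Γ b e x ≫ g) : f = g :=
  hom_ext (𝟭 (Ind B)) fun b w ↦ by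
    obtain ⟨x, rfl⟩ := (indRepEquiv Γ b e).surjective w
    exact h b x

end RestrictedAdjoint

/-! ### Morphisms of balanced presheaves -/

section PresheafHom

variable {A : Type u₁} [Category.{v} A] [MonoidalCategory A] {B : Type u₂} [Category.{v} B]
  [MonoidalCategory B] {F : A ⥤ B} [F.Monoidal] {M : Type u₃} [Category.{v} M]
  [MonoidalRightAction A M]

namespace BalancedPresheaf

/-- A morphism of balanced presheaves. -/
structure Hom (W W' : BalancedPresheaf F M) where
  /-- the components -/
  app (n : M) : W.obj n ⟶ W'.obj n
  natural {n n' : M} (f : n ⟶ n') : W.map f ≫ app n = app n' ≫ W'.map f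
  bal_app (n : M) (a : A) (b : B) (w : Ind.yoneda.obj b ⟶ W.obj (n ⊙ᵣ a)) :
    W.bal n a b w ≫ app n = W'.bal n a b (w ≫ app (n ⊙ᵣ a))

variable {W W' : BalancedPresheaf F M} (φ : Hom W W') (m : M)
  [(actionLeft (Ind A) (Ind.yoneda.obj m)).IsLeftAdjoint]

theorem Hom.act_app (n : M) : W.act m n ≫ φ.app m = _ ◁ φ.app n ≫ W'.act m n :=
  tmul_el_left_hom_ext F fun a b u w ↦ by
    rw [← Category.assoc, W.tmul_el_act, ← Category.assoc, tmul_whiskerLeft, W'.tmul_el_act,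
      φ.bal_app, Category.assoc, Category.assoc, φ.natural]

/-- The module morphism induced by a morphism of balanced presheaves. -/
noncomputable def Hom.mod : W.mod m ⟶ W'.mod m := modHomMk (φ.app m) (φ.act_app m m)

theorem Hom.elementHom_app (n : M) (b : B) (w : Ind.yoneda.obj b ⟶ W.obj n) :
    W.elementHom m n b w ≫ φ.app m = W'.elementHom m n b (w ≫ φ.app n) := by
  rw [elementHom, elementHom, Category.assoc, φ.act_app, MonoidalCategory.whiskerLeft_comp_assoc]

theorem Hom.ofElement_mod (n : M) (b : B) (w : Ind.yoneda.obj b ⟶ W.obj n) :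
    W.ofElement m n b w ≫ φ.mod m = W'.ofElement m n b (w ≫ φ.app n) :=
  Mod.hom_ext _ _ (φ.elementHom_app m n b w)

end BalancedPresheaf

end PresheafHom

/-! ### The balanced presheaf of an object in the target of a balanced functor -/

section Representable

variable {k : Type w} [Field k] {A : Type u₁} [Category.{v} A] [MonoidalCategory A]
  {B : Type u₂} [Category.{v} B] [EssentiallySmall.{v} B]
  [Preadditive B] [HasFiniteColimits B] [Linear k B] [MonoidalCategory B] {F : A ⥤ B} [F.Monoidal]
  {M : Type u₃} [Category.{v} M] [Preadditive M] [Linear k M] [MonoidalRightAction A M]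
  {E : Type u₄} [Category.{v} E] [Preadditive E] [Linear k E]

namespace BalancedFunctor

instance preservesFiniteColimits_obj (S : BalancedFunctor k F M E) (n : M) :
    PreservesFiniteColimits (S.functor.obj n) := (S.isRex_right n).preservesFiniteColimits

variable (S S' : BalancedFunctor k F M E) (e e' : E)

/-- The presheaf represented by an object in the target of a balanced functor. -/
noncomputable def presheaf : BalancedPresheaf F M where
  obj n := indRep (S.functor.obj n) e
  map f := indRepMap (fun b x ↦ (S.functor.map f).app b ≫ x) (fun g x ↦ by simp)
  map_comp f g := indRep_hom_ext fun b x ↦ by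
    rw [indRepEquiv_indRepMap, ← Category.assoc, indRepEquiv_indRepMap, indRepEquiv_indRepMap]
    simp
  bal n a b := ((indRepEquiv _ _ _).symm.trans (S.bal n a b).homFromEquiv).trans (indRepEquiv _ _ _)
  bal_left f a b w := by
    obtain ⟨w, rfl⟩ := (indRepEquiv _ _ _).surjective w
    rw [indRepEquiv_indRepMap]
    simp only [Equiv.trans_apply, Equiv.symm_apply_apply]
    rw [indRepEquiv_indRepMap]
    simp [Iso.inv_comp_eq, ← reassoc_of% S.bal_natural_left]
  bal_middle n a a' f b w := by
    obtain ⟨w, rfl⟩ := (indRepEquiv _ _ _).surjective w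
    rw [indRepEquiv_indRepMap]
    simp only [Equiv.trans_apply, Equiv.symm_apply_apply]
    rw [← indRepEquiv_map]
    simp [Iso.inv_comp_eq, ← reassoc_of% S.bal_natural_middle]
  bal_right n a b b' g w := by
    obtain ⟨w, rfl⟩ := (indRepEquiv _ _ _).surjective w
    rw [← indRepEquiv_map]
    simp only [Equiv.trans_apply, Equiv.symm_apply_apply]
    rw [← indRepEquiv_map]
    simp [Iso.inv_comp_eq, ← reassoc_of% S.bal_natural_right]
  bal_tensor n a a' b w := by
    obtain ⟨w, rfl⟩ := (indRepEquiv _ _ _).surjective w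
    rw [indRepEquiv_indRepMap]
    simp only [Equiv.trans_apply, Equiv.symm_apply_apply]
    rw [← indRepEquiv_map]
    have h := S.bal_tensor n a a' b
    rw [← Iso.inv_comp_eq] at h
    congr 1
    simp only [Iso.homFromEquiv_apply]
    rw [← h]
    simp
  bal_unit n b w := by
    obtain ⟨w, rfl⟩ := (indRepEquiv _ _ _).surjective w
    rw [indRepEquiv_indRepMap]
    simp only [Equiv.trans_apply, Equiv.symm_apply_apply]
    rw [← indRepEquiv_map]
    simp [← S.bal_unit]

/-- The elements of the represented presheaf. -/
noncomputable def presheafEquiv (n : M) (b : B) :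
    ((S.functor.obj n).obj b ⟶ e) ≃ (Ind.yoneda.obj b ⟶ (S.presheaf e).obj n) :=
  indRepEquiv (S.functor.obj n) b e

variable {e e'}

theorem presheafEquiv_map {n n' : M} (f : n ⟶ n') (b : B) (x : (S.functor.obj n').obj b ⟶ e) :
    S.presheafEquiv e n' b x ≫ (S.presheaf e).map f =
      S.presheafEquiv e n b ((S.functor.map f).app b ≫ x) :=
  indRepEquiv_indRepMap (fun b x ↦ (S.functor.map f).app b ≫ x) (fun g x ↦ by simp) b x

theorem presheafEquiv_comp (n : M) {b b' : B} (g : b ⟶ b') (x : (S.functor.obj n).obj b' ⟶ e) :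
    S.presheafEquiv e n b ((S.functor.obj n).map g ≫ x) =
      Ind.yoneda.map g ≫ S.presheafEquiv e n b' x := indRepEquiv_map g x

theorem presheafEquiv_bal (n : M) (a : A) (b : B) (x : (S.functor.obj (n ⊙ᵣ a)).obj b ⟶ e) :
    (S.presheaf e).bal n a b (S.presheafEquiv e (n ⊙ᵣ a) b x) =
      S.presheafEquiv e n (F.obj a ⊗ b) ((S.bal n a b).inv ≫ x) := congrArg (fun z ↦ indRepEquiv (S.functor.obj n) _ e ((S.bal n a b).inv ≫ z))
    (Equiv.symm_apply_apply _ x)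

theorem presheaf_hom_ext {n : M} {X : Ind B} {f g : (S.presheaf e).obj n ⟶ X}
    (h : ∀ (b : B) (x : (S.functor.obj n).obj b ⟶ e),
      S.presheafEquiv e n b x ≫ f = S.presheafEquiv e n b x ≫ g) : f = g :=
  indRep_hom_ext h

variable {S S'}

/-- The components of `presheafMap`. -/
noncomputable def presheafMapApp (ψ : S' ⟶ S) (y : e ⟶ e') (n : M) :
    (S.presheaf e).obj n ⟶ (S'.presheaf e').obj n :=
  indRepMap (fun b x ↦ (ψ.hom.app n).app b ≫ x ≫ y) (fun g x ↦ by simp)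

theorem presheafEquiv_presheafMapApp (ψ : S' ⟶ S) (y : e ⟶ e') (n : M) (b : B)
    (x : (S.functor.obj n).obj b ⟶ e) : S.presheafEquiv e n b x ≫ presheafMapApp ψ y n =
      S'.presheafEquiv e' n b ((ψ.hom.app n).app b ≫ x ≫ y) :=
  indRepEquiv_indRepMap (fun b x ↦ (ψ.hom.app n).app b ≫ x ≫ y) (fun g x ↦ by simp) b x

/-- The functoriality of the represented presheaf. -/
noncomputable def presheafMap (ψ : S' ⟶ S) (y : e ⟶ e') :
    BalancedPresheaf.Hom (S.presheaf e) (S'.presheaf e') where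
  app n := presheafMapApp ψ y n
  natural {n n'} f := S.presheaf_hom_ext fun b x ↦ by
    rw [← Category.assoc, presheafEquiv_map, presheafEquiv_presheafMapApp,
      ← Category.assoc (S.presheafEquiv e n' b x), presheafEquiv_presheafMapApp, presheafEquiv_map]
    have h := congrArg (fun p ↦ p.app b) (ψ.hom.naturality f)
    dsimp only [NatTrans.comp_app] at h
    rw [reassoc_of% h, Category.assoc]
  bal_app n a b w := by
    obtain ⟨w, rfl⟩ := (S.presheafEquiv e _ _).surjective w
    rw [presheafEquiv_bal, presheafEquiv_presheafMapApp, presheafEquiv_presheafMapApp,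
      presheafEquiv_bal]
    congr 1
    rw [Iso.eq_inv_comp, reassoc_of% ψ.bal_hom, Category.assoc, Iso.hom_inv_id_assoc]

theorem presheafEquiv_presheafMap (ψ : S' ⟶ S) (y : e ⟶ e') (n : M) (b : B)
    (x : (S.functor.obj n).obj b ⟶ e) : S.presheafEquiv e n b x ≫ (presheafMap ψ y).app n =
      S'.presheafEquiv e' n b ((ψ.hom.app n).app b ≫ x ≫ y) :=
  presheafEquiv_presheafMapApp ψ y n b x

end BalancedFunctor

end Representable

end RexTensor

namespace RexTensor

/-- Hom(T₁(-), x) and Hom(T₂(-), y) both turn the colimit into a limit of sets, and κ is a natural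
map between these limits that is bijective at every stage. -/
theorem bijective_of_isColimit {C : Type u₁} [Category.{v₁} C] {D₁ : Type u₂} [Category.{v₂} D₁]
    {D₂ : Type u₃} [Category.{v₃} D₂] (T₁ : C ⥤ D₁) (T₂ : C ⥤ D₂) {x : D₁} {y : D₂}
    (κ : ∀ c : C, (T₁.obj c ⟶ x) → (T₂.obj c ⟶ y))
    (hκ : ∀ {c c' : C} (f : c ⟶ c') (g : T₁.obj c' ⟶ x), κ c (T₁.map f ≫ g) = T₂.map f ≫ κ c' g)
    {J : Type u₄} [Category.{v₄} J] {p : J ⥤ C} {s : Cocone p} (hs : IsColimit s)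
    [PreservesColimit p T₁] [PreservesColimit p T₂]
    (h : ∀ j, Function.Bijective (κ (p.obj j))) : Function.Bijective (κ s.pt) := by
  have h₁ := isColimitOfPreserves T₁ hs
  have h₂ := isColimitOfPreserves T₂ hs
  refine ⟨fun g g' hg ↦ h₁.hom_ext fun j ↦ (h j).1 ?_, fun g ↦ ?_⟩
  · exact (hκ (s.ι.app j) g).trans ((congrArg (T₂.map (s.ι.app j) ≫ ·) hg).trans
      (hκ (s.ι.app j) g').symm)
  · choose z hz using fun j ↦ (h j).2 (T₂.map (s.ι.app j) ≫ g)
    have hz' {i j : J} (f : i ⟶ j) : T₁.map (p.map f) ≫ z j = z i := (h i).1 (by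
      rw [hκ, hz, hz, ← s.w f, Functor.map_comp, Category.assoc])
    let c : Cocone (p ⋙ T₁) := Cocone.mk x
      { app := z
        naturality := fun i j f ↦ (hz' f).trans (Category.comp_id _).symm }
    refine ⟨h₁.desc c, h₂.hom_ext fun j ↦ ?_⟩
    refine (hκ (s.ι.app j) _).symm.trans (Eq.trans (congrArg (κ _) ?_) (hz j))
    exact h₁.fac c j

/-! ### Functors on finite modules and the modules they represent -/

section FinHom

variable {k : Type w} [Field k] {A : Type u₁} [Category.{v} A] [EssentiallySmall.{v} A]
  [Preadditive A] [HasFiniteColimits A] [Linear k A] [MonoidalCategory A] [MonoidalPreadditive A]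
  [MonoidalLinear k A] [RigidCategory A]
  {B : Type u₂} [Category.{v} B] [EssentiallySmall.{v} B]
  [Preadditive B] [HasFiniteColimits B] [Linear k B] [MonoidalCategory B] [MonoidalPreadditive B]
  [MonoidalLinear k B] [RigidCategory B] {F : A ⥤ B} [F.Monoidal]
  {M : Type u₃} [Category.{v} M] [Preadditive M] [Linear k M] [MonoidalRightAction A M]
  {m : M} [(actionLeft (Ind A) (Ind.yoneda.obj m)).IsLeftAdjoint]
  (h : ∀ n, finMod (imageEnd F m) ((imageMod F m).obj n)) (hD : IsRex k (imageMod F m))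
  {E : Type u₄} [Category.{v} E] [Preadditive E] [Linear k E]
  {G : FinMod (imageEnd F m) ⥤ E} (hG : IsRex k G)

/-- The module represented by an object in the target of a functor on finite modules. -/
noncomputable abbrev finRep (e : E) : Mod (Ind B) (imageEnd F m) :=
  (((finTensor h hD).comp hG).presheaf e).mod m

/-- The elements of the represented module. -/
noncomputable def finRepEquiv (b : B) (e : E) :
    (G.obj (((finTensor h hD).functor.obj m).obj b) ⟶ e) ≃
      (Ind.yoneda.obj b ⟶ (finRep h hD hG e).X) :=
  ((finTensor h hD).comp hG).presheafEquiv e m b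

theorem finRepEquiv_map {b b' : B} (g : b ⟶ b') {e : E}
    (x : G.obj (((finTensor h hD).functor.obj m).obj b') ⟶ e) :
    finRepEquiv h hD hG b e (G.map (((finTensor h hD).functor.obj m).map g) ≫ x) =
      Ind.yoneda.map g ≫ finRepEquiv h hD hG b' e x :=
  ((finTensor h hD).comp hG).presheafEquiv_comp m g x

theorem finRepEquiv_act {a : A} (u : Ind.yoneda.obj a ⟶ iHom m (Ind.yoneda.obj m)) (b : B) {e : E}
    (x : G.obj (((finTensor h hD).functor.obj m).obj b) ⟶ e) :
    tmul (el F u) (finRepEquiv h hD hG b e x) ≫ actMap (imageEnd F m) (finRep h hD hG e).X =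
      finRepEquiv h hD hG (F.obj a ⊗ b) e (G.map ((finTensor h hD).bal m a b).inv ≫
        G.map (((finTensor h hD).functor.map (elMor u)).app b) ≫ x) := by
  refine ((((finTensor h hD).comp hG).presheaf e).tmul_el_act u (n := m) _).trans ?_
  refine (congrArg ((((finTensor h hD).comp hG).presheaf e).bal m a b)
    (((finTensor h hD).comp hG).presheafEquiv_map (elMor u) b x)).trans ?_
  exact ((finTensor h hD).comp hG).presheafEquiv_bal m a b _

theorem finRepEquiv_presheafMap {G' : FinMod (imageEnd F m) ⥤ E} (hG' : IsRex k G')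
    (ψ : (finTensor h hD).comp hG' ⟶ (finTensor h hD).comp hG) {e e' : E} (y : e ⟶ e') {b : B}
    (x : G.obj (((finTensor h hD).functor.obj m).obj b) ⟶ e)
    {p : G'.obj (((finTensor h hD).functor.obj m).obj b) ⟶
      G.obj (((finTensor h hD).functor.obj m).obj b)} (hp : p = (ψ.hom.app m).app b) :
    finRepEquiv h hD hG b e x ≫ ((BalancedFunctor.presheafMap ψ y).mod m).hom =
      finRepEquiv h hD hG' b e' (p ≫ x ≫ y) := by
  subst hp
  exact BalancedFunctor.presheafEquiv_presheafMap ψ y m b x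

/-- On elements, z : T(m, b) ⟶ Z is sent to the element of the represented module given by G(z)
followed by x. It is linear because `finFree_act` and `finRepEquiv_act` write the two actions
through the same structure maps of T. -/
theorem exists_finHom {Z : FinMod (imageEnd F m)} {e : E} (x : G.obj Z ⟶ e) :
    ∃ f : (FinMod.incl _).obj Z ⟶ finRep h hD hG e,
      ∀ (b : B) (z : ((finTensor h hD).functor.obj m).obj b ⟶ Z),
        finFree h hD b Z z ≫ f.hom = finRepEquiv h hD hG b e (G.map z ≫ x) := by
  have hf : ∃ f : ((FinMod.incl _).obj Z).X ⟶ (finRep h hD hG e).X,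
      ∀ (b : B) (z : ((finTensor h hD).functor.obj m).obj b ⟶ Z),
        finFree h hD b Z z ≫ f = finRepEquiv h hD hG b e (G.map z ≫ x) := by
    obtain ⟨f, hf⟩ := exists_desc (𝟭 (Ind B)) ((FinMod.incl _).obj Z).X (finRep h hD hG e).X
      (fun b w ↦ finRepEquiv h hD hG b e (G.map ((finFree h hD b Z).symm w) ≫ x))
      (fun b b' g w ↦ by
        obtain ⟨z, rfl⟩ := (finFree h hD b' Z).surjective w
        change Ind.yoneda.map g ≫ _ = _
        rw [← finRepEquiv_map, ← finFree_map, Equiv.symm_apply_apply,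
          Equiv.symm_apply_apply, Functor.map_comp, Category.assoc])
    refine ⟨f, fun b z ↦ (hf b _).trans ?_⟩
    rw [Equiv.symm_apply_apply]
  obtain ⟨f, hf⟩ := hf
  refine ⟨modHomMk f (tmul_el_left_hom_ext F fun a b u w ↦ ?_), hf⟩
  obtain ⟨z, rfl⟩ := (finFree h hD b Z).surjective w
  rw [← Category.assoc, ← finFree_act, hf, ← Category.assoc (tmul _ _), tmul_whiskerLeft, hf,
    finRepEquiv_act]
  simp

/-- The module morphism corresponding to a morphism out of the image of a finite module. -/
noncomputable def finHom (Z : FinMod (imageEnd F m)) (e : E) (x : G.obj Z ⟶ e) :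
    (FinMod.incl _).obj Z ⟶ finRep h hD hG e := (exists_finHom h hD hG x).choose

theorem finFree_finHom {Z : FinMod (imageEnd F m)} {e : E} (x : G.obj Z ⟶ e) {b : B}
    (z : ((finTensor h hD).functor.obj m).obj b ⟶ Z) :
    finFree h hD b Z z ≫ (finHom h hD hG Z e x).hom = finRepEquiv h hD hG b e (G.map z ≫ x) :=
  (exists_finHom h hD hG x).choose_spec b z

theorem finMod_hom_ext {Z : FinMod (imageEnd F m)} {X : Mod (Ind B) (imageEnd F m)}
    {f g : (FinMod.incl _).obj Z ⟶ X}
    (hfg : ∀ (b : B) (z : ((finTensor h hD).functor.obj m).obj b ⟶ Z),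
      finFree h hD b Z z ≫ f.hom = finFree h hD b Z z ≫ g.hom) : f = g :=
  Mod.hom_ext _ _ (yoneda_hom_ext fun b w ↦ by
    obtain ⟨z, rfl⟩ := (finFree h hD b Z).surjective w
    exact hfg b z)

theorem finHom_natural {Z Z' : FinMod (imageEnd F m)} (f : Z ⟶ Z') {e : E} (x : G.obj Z' ⟶ e) :
    finHom h hD hG Z e (G.map f ≫ x) = (FinMod.incl _).map f ≫ finHom h hD hG Z' e x :=
  finMod_hom_ext h hD fun b z ↦ by
    rw [finFree_finHom, Mod.comp_hom', ← Category.assoc (finFree h hD b Z z), ← finFree_comp,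
      finFree_finHom, Functor.map_comp, Category.assoc]

theorem finFree_finHom_mod {G' : FinMod (imageEnd F m) ⥤ E} (hG' : IsRex k G')
    (ψ : (finTensor h hD).comp hG' ⟶ (finTensor h hD).comp hG)
    {Z : FinMod (imageEnd F m)} {e e' : E} (x : G.obj Z ⟶ e) (y : e ⟶ e') {b : B}
    (z : ((finTensor h hD).functor.obj m).obj b ⟶ Z)
    {p : G'.obj (((finTensor h hD).functor.obj m).obj b) ⟶
      G.obj (((finTensor h hD).functor.obj m).obj b)} (hp : p = (ψ.hom.app m).app b) :
    finFree h hD b Z z ≫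
      (finHom h hD hG Z e x ≫ (BalancedFunctor.presheafMap ψ y).mod m).hom =
        finRepEquiv h hD hG' b e' (p ≫ G.map z ≫ x ≫ y) := by
  rw [Mod.comp_hom', ← Category.assoc, finFree_finHom, finRepEquiv_presheafMap h hD hG hG' ψ y _ hp,
    Category.assoc]

/-- T(m, b) is free on b, so a morphism out of it is its value at the generator; under this
identification `finHom` becomes the bijection `finRepEquiv`. -/
theorem bijective_finHom_tensor (b : B) (e : E) : Function.Bijective
    (finHom h hD hG (((finTensor h hD).functor.obj m).obj b) e) := by
  let t : ((FinMod.incl _).obj (((finTensor h hD).functor.obj m).obj b) ⟶ finRep h hD hG e) ≃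
      (Ind.yoneda.obj b ⟶ (finRep h hD hG e).X) :=
    (finTensorIso h hD m b).symm.homFromEquiv.trans (imageFree F m _ _)
  have ht (f) : t f = finFree h hD b _ (𝟙 _) ≫ f.hom := by
    rw [finFree_apply, CategoryTheory.Functor.map_id, Category.comp_id, ← imageFree_comp]
    rfl
  have ht' : t ∘ finHom h hD hG (((finTensor h hD).functor.obj m).obj b) e =
      finRepEquiv h hD hG b e := by
    funext x
    rw [Function.comp_apply, ht, finFree_finHom, CategoryTheory.Functor.map_id, Category.id_comp]
  rw [← Function.Bijective.of_comp_iff' t.bijective, ht']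
  exact Equiv.bijective _

/-- G and the inclusion of finite modules are right exact, so bijectivity passes through finite
colimits by `bijective_of_isColimit`, starting from the free modules. -/
theorem bijective_finHom (Z : FinMod (imageEnd F m)) (e : E) :
    Function.Bijective (finHom h hD hG Z e) := by
  have := hG.preservesFiniteColimits
  let Q : ObjectProperty (FinMod (imageEnd F m)) := fun Z ↦ Function.Bijective (finHom h hD hG Z e)
  have hQ {Z Z' : FinMod (imageEnd F m)} (i : Z ≅ Z') (hZ : Q Z) : Q Z' := by
    have h' : finHom h hD hG Z' e = ((FinMod.incl _).mapIso i).homFromEquiv ∘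
        finHom h hD hG Z e ∘ (G.mapIso i).symm.homFromEquiv := by
      funext x
      simp [finHom_natural]
    dsimp only [Q]
    rw [h']
    exact (Equiv.bijective _).comp (hZ.comp (Equiv.bijective _))
  have : Q.IsClosedUnderIsomorphisms := ⟨hQ⟩
  refine FinMod.induction (Q := Q) (fun J _ _ ↦ ⟨?_⟩) (fun b Z i ↦ ?_) Z
  · rintro X ⟨p⟩
    exact bijective_of_isColimit G (FinMod.incl _) (fun Z x ↦ finHom h hD hG Z e x)
      (fun f x ↦ finHom_natural h hD hG f x) p.isColimit p.prop_diag_obj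
  · exact hQ ((FinMod.incl _).preimageIso ((finTensorIso h hD m b).symm ≪≫ i))
      (bijective_finHom_tensor h hD hG b e)

end FinHom

end RexTensor

namespace RexTensor

theorem BalancedHom.isIso {k : Type w} [Field k] {A : Type u₁} [Category.{v₁} A]
    [MonoidalCategory A] {B : Type u₂} [Category.{v₂} B] [Preadditive B] [Linear k B]
    [MonoidalCategory B] {F : A ⥤ B} [F.Monoidal]
    {M : Type u₃} [Category.{v₃} M] [Preadditive M] [Linear k M] [MonoidalRightAction A M]
    {E : Type u₄} [Category.{v₄} E] [Preadditive E] [Linear k E]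
    {S T : BalancedFunctor k F M E} (ψ : S ⟶ T) [IsIso ψ.hom] : IsIso ψ := by
  let φ : T ⟶ S :=
    { hom := inv ψ.hom
      bal_hom := fun n a b ↦ by
        have := ψ.bal_hom n a b
        rw [NatIso.isIso_inv_app, NatIso.isIso_inv_app, NatIso.isIso_inv_app,
          NatIso.isIso_inv_app, IsIso.comp_inv_eq, Category.assoc, this, IsIso.inv_hom_id_assoc] }
  exact ⟨φ, BalancedHom.ext (IsIso.hom_inv_id ψ.hom), BalancedHom.ext (IsIso.inv_hom_id ψ.hom)⟩

/-! ### Composition with T is fully faithful -/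

section FullyFaithful

variable {k : Type w} [Field k] {A : Type u₁} [Category.{v} A] [EssentiallySmall.{v} A]
  [Preadditive A] [HasFiniteColimits A] [Linear k A] [MonoidalCategory A] [MonoidalPreadditive A]
  [MonoidalLinear k A] [RigidCategory A]
  {B : Type u₂} [Category.{v} B] [EssentiallySmall.{v} B]
  [Preadditive B] [HasFiniteColimits B] [Linear k B] [MonoidalCategory B] [MonoidalPreadditive B]
  [MonoidalLinear k B] [RigidCategory B] {F : A ⥤ B} [F.Monoidal]
  {M : Type u₃} [Category.{v} M] [Preadditive M] [Linear k M] [MonoidalRightAction A M]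
  {m : M} [(actionLeft (Ind A) (Ind.yoneda.obj m)).IsLeftAdjoint]
  (h : ∀ n, finMod (imageEnd F m) ((imageMod F m).obj n)) (hD : IsRex k (imageMod F m))
  {E : Type u₄} [Category.{v} E] [Preadditive E] [Linear k E]
  {G : FinMod (imageEnd F m) ⥤ E} (hG : IsRex k G)

include hG in
-- Under the bijection `finHom` a morphism out of G(Z) is a morphism out of Z, which is determined
-- by its effect on elements.
theorem finMod_map_hom_ext {Z : FinMod (imageEnd F m)} {e : E} {x x' : G.obj Z ⟶ e}
    (hx : ∀ (b : B) (z : ((finTensor h hD).functor.obj m).obj b ⟶ Z),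
      G.map z ≫ x = G.map z ≫ x') : x = x' :=
  (bijective_finHom h hD hG Z e).1 (finMod_hom_ext h hD fun b z ↦ by
    rw [finFree_finHom, finFree_finHom, hx])

variable {G' : FinMod (imageEnd F m) ⥤ E} (hG' : IsRex k G')

/-- A Yoneda argument. The transformation ψ sends the module represented under G by an object e to
the one represented under G'. With e = G(Z), the morphism out of Z that corresponds to the identity
of G(Z) is thereby sent to one that corresponds to a morphism G'(Z) ⟶ G(Z). -/
theorem exists_extension (ψ : (finTensor h hD).comp hG' ⟶ (finTensor h hD).comp hG)
    (p : ∀ b, G'.obj (((finTensor h hD).functor.obj m).obj b) ⟶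
      G.obj (((finTensor h hD).functor.obj m).obj b)) (hp : ∀ b, p b = (ψ.hom.app m).app b)
    (Z : FinMod (imageEnd F m)) :
    ∃ φ : G'.obj Z ⟶ G.obj Z, ∀ (b : B) (z : ((finTensor h hD).functor.obj m).obj b ⟶ Z),
      G'.map z ≫ φ = p b ≫ G.map z := by
  obtain ⟨φ, hφ⟩ := (bijective_finHom h hD hG' Z (G.obj Z)).2
    (finHom h hD hG Z _ (𝟙 _) ≫ (BalancedFunctor.presheafMap ψ (𝟙 (G.obj Z))).mod m)
  refine ⟨φ, fun b z ↦ (finRepEquiv h hD hG' b _).injective ?_⟩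
  rw [← finFree_finHom, hφ, finFree_finHom_mod h hD hG hG' ψ _ _ z (hp b), Category.comp_id,
    Category.comp_id]

/-- Although ψ is only assumed compatible with the structure maps of T, it is natural for all
morphisms T(m, c) ⟶ T(n, b), since `exists_finTensor_hom` writes these as composites of structure
maps. -/
theorem map_finTensor_hom (ψ : (finTensor h hD).comp hG' ⟶ (finTensor h hD).comp hG)
    (p : ∀ n b, G'.obj (((finTensor h hD).functor.obj n).obj b) ⟶
      G.obj (((finTensor h hD).functor.obj n).obj b)) (hp : ∀ n b, p n b = (ψ.hom.app n).app b)
    {n : M} {b c : B} (f : ((finTensor h hD).functor.obj m).obj c ⟶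
    ((finTensor h hD).functor.obj n).obj b) : G'.map f ≫ p n b = p m c ≫ G.map f := by
  have h₁ {n n' : M} (t : n ⟶ n') (b : B) : G'.map (((finTensor h hD).functor.map t).app b) ≫
      p n' b = p n b ≫ G.map (((finTensor h hD).functor.map t).app b) := by
    rw [hp, hp]
    exact congrArg (fun q ↦ q.app b) (ψ.hom.naturality t)
  have h₂ (n : M) {b b' : B} (g : b ⟶ b') : G'.map (((finTensor h hD).functor.obj n).map g) ≫
      p n b' = p n b ≫ G.map (((finTensor h hD).functor.obj n).map g) := by
    rw [hp, hp]
    exact (ψ.hom.app n).naturality g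
  have h₃ (n : M) (a : A) (b : B) : G'.map ((finTensor h hD).bal n a b).inv ≫ p (n ⊙ᵣ a) b =
      p n (F.obj a ⊗ b) ≫ G.map ((finTensor h hD).bal n a b).inv := by
    rw [← cancel_epi (G'.map ((finTensor h hD).bal n a b).hom),
      ← cancel_mono (G.map ((finTensor h hD).bal n a b).hom)]
    simp only [Category.assoc]
    rw [← Functor.map_comp_assoc, Iso.hom_inv_id, ← Functor.map_comp, Iso.inv_hom_id,
      CategoryTheory.Functor.map_id, CategoryTheory.Functor.map_id, Category.id_comp,
      Category.comp_id, hp, hp]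
    exact (ψ.bal_hom n a b).symm
  obtain ⟨a, g, t, rfl⟩ := exists_finTensor_hom h hD f
  simp only [Functor.map_comp, Category.assoc]
  rw [h₁, reassoc_of% h₃, reassoc_of% h₂]

theorem full_compFunctor : ((finTensor h hD).compFunctor E).Full where
  map_surjective {G' G} ψ := by
    let p (n : M) (b : B) : G'.obj.obj (((finTensor h hD).functor.obj n).obj b) ⟶
      G.obj.obj (((finTensor h hD).functor.obj n).obj b) := (ψ.hom.app n).app b
    choose φ hφ using exists_extension h hD G.property G'.property ψ (p m) (fun _ ↦ rfl)
    let Φ : G'.obj ⟶ G.obj :=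
      { app := φ
        naturality := fun Z Z' f ↦ finMod_map_hom_ext h hD G'.property fun b z ↦ by
          rw [← Functor.map_comp_assoc, hφ, reassoc_of% hφ, Functor.map_comp] }
    refine ⟨ObjectProperty.homMk Φ, BalancedHom.ext ?_⟩
    ext n b
    -- Φ was built from ψ at the objects T(m, -) only. That it equals ψ at T(n, b) for every n is
    -- tested on morphisms T(m, c) ⟶ T(n, b).
    refine finMod_map_hom_ext h hD G'.property fun c z ↦ ?_
    exact (hφ _ c z).trans (map_finTensor_hom h hD G.property G'.property ψ p
      (fun _ _ ↦ rfl) z).symm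

theorem faithful_compFunctor : ((finTensor h hD).compFunctor E).Faithful where
  map_injective {G' G} φ φ' hφ := by
    have h' (b : B) : φ.hom.app (((finTensor h hD).functor.obj m).obj b) =
        φ'.hom.app (((finTensor h hD).functor.obj m).obj b) :=
      congrArg (fun ψ : BalancedHom _ _ ↦ (ψ.hom.app m).app b) hφ
    ext Z
    refine finMod_map_hom_ext h hD G'.property fun b z ↦ ?_
    rw [φ.hom.naturality, φ'.hom.naturality, h']

end FullyFaithful

end RexTensor

namespace RexTensor

/-- The bijections t make G a left adjoint of N relative to ι, and the proof that left adjoints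
preserve colimits applies to those preserved by ι. Naturality in Z is enough. -/
theorem preservesColimitsOfShape_of_homEquiv {C : Type u₁} [Category.{v₁} C] {D : Type u₂}
    [Category.{v₂} D] {T : Type u₃} [Category.{v₃} T] {G : C ⥤ D} {ι : C ⥤ T} {N : D ⥤ T}
    (t : ∀ (Z : C) (e : D), (G.obj Z ⟶ e) ≃ (ι.obj Z ⟶ N.obj e))
    (ht : ∀ {Z Z' : C} (f : Z ⟶ Z') {e : D} (x : G.obj Z' ⟶ e),
      t Z e (G.map f ≫ x) = ι.map f ≫ t Z' e x)
    (J : Type u₄) [Category.{v₄} J] [PreservesColimitsOfShape J ι] :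
    PreservesColimitsOfShape J G where
  preservesColimit {K} := ⟨fun {c} hc ↦ ⟨by
    have hι := isColimitOfPreserves ι hc
    have hj (s : Cocone (K ⋙ G)) {i j : J} (f : i ⟶ j) :
        ι.map (K.map f) ≫ t (K.obj j) s.pt (s.ι.app j) = t (K.obj i) s.pt (s.ι.app i) :=
      (ht (K.map f) (s.ι.app j)).symm.trans (congrArg (t _ _) (s.w f))
    let d (s : Cocone (K ⋙ G)) : Cocone (K ⋙ ι) := Cocone.mk (N.obj s.pt)
      { app := fun j ↦ t (K.obj j) s.pt (s.ι.app j)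
        naturality := fun i j f ↦ (hj s f).trans (Category.comp_id _).symm }
    exact
      { desc := fun s ↦ (t c.pt s.pt).symm (hι.desc (d s))
        fac := fun s j ↦ (t (K.obj j) s.pt).injective
          ((ht (c.ι.app j) _).trans ((congrArg (ι.map (c.ι.app j) ≫ ·)
            (Equiv.apply_symm_apply _ _)).trans (hι.fac (d s) j)))
        uniq := fun s y hy ↦ (t c.pt s.pt).injective (hι.hom_ext fun j ↦
          (ht (c.ι.app j) y).symm.trans ((congrArg (t _ _) (hy j)).trans ((hι.fac (d s) j).symm.trans
            (congrArg (ι.map (c.ι.app j) ≫ ·) (Equiv.apply_symm_apply _ _).symm)))) }⟩⟩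

/-! ### Extending a balanced functor to finite modules -/

section Extend

variable {k : Type w} [Field k] {A : Type u₁} [Category.{v} A] [EssentiallySmall.{v} A]
  [Preadditive A] [HasFiniteColimits A] [Linear k A] [MonoidalCategory A] [MonoidalPreadditive A]
  [MonoidalLinear k A] [RigidCategory A]
  {B : Type u₂} [Category.{v} B] [EssentiallySmall.{v} B]
  [Preadditive B] [HasFiniteColimits B] [Linear k B] [MonoidalCategory B] [MonoidalPreadditive B]
  [MonoidalLinear k B] [RigidCategory B] {F : A ⥤ B} [F.Monoidal]
  {M : Type u₃} [Category.{v} M] [Preadditive M] [Linear k M] [MonoidalRightAction A M]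
  {m : M} [(actionLeft (Ind A) (Ind.yoneda.obj m)).IsLeftAdjoint]
  {E : Type u₄} [Category.{v} E] [Preadditive E] [Linear k E] (S : BalancedFunctor k F M E)

variable (m) in
/-- The functor sending an object of the target of a balanced functor to the module that it
represents. -/
noncomputable def modRep : E ⥤ Mod (Ind B) (imageEnd F m) where
  obj e := (S.presheaf e).mod m
  map y := (BalancedFunctor.presheafMap (𝟙 S) y).mod m
  map_id e := Mod.hom_ext _ _ (S.presheaf_hom_ext fun b x ↦ by
    refine (BalancedFunctor.presheafEquiv_presheafMap (𝟙 S) (𝟙 e) m b x).trans ?_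
    refine Eq.trans (congrArg _ ?_) (Category.comp_id _).symm
    exact (Category.id_comp _).trans (Category.comp_id _))
  map_comp y z := Mod.hom_ext _ _ (S.presheaf_hom_ext fun b x ↦ by
    refine (BalancedFunctor.presheafEquiv_presheafMap (𝟙 S) (y ≫ z) m b x).trans ?_
    refine Eq.trans ?_ (Category.assoc _ _ _)
    refine Eq.trans ?_ (congrArg (· ≫ _)
      (BalancedFunctor.presheafEquiv_presheafMap (𝟙 S) y m b x).symm)
    refine Eq.trans (congrArg _ ?_)
      (BalancedFunctor.presheafEquiv_presheafMap (𝟙 S) z m b _).symm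
    change 𝟙 _ ≫ x ≫ y ≫ z = 𝟙 _ ≫ (𝟙 _ ≫ x ≫ y) ≫ z
    simp)

theorem modRep_map_smul (r : k) (e : E) : (modRep m S).map (r • 𝟙 e) = r • 𝟙 _ :=
  Mod.hom_ext _ _ (S.presheaf_hom_ext fun b x ↦ by
    refine (BalancedFunctor.presheafEquiv_presheafMap (𝟙 S) (r • 𝟙 e) m b x).trans ?_
    -- The scalar is moved from e to b, because S(m, -) is k-linear.
    have h₁ : (𝟙 _ ≫ x ≫ (r • 𝟙 e)) = (S.functor.obj m).map (r • 𝟙 b) ≫ x := by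
      rw [(S.isRex_right m).map_smul]
      simp
    refine (congrArg (S.presheafEquiv e m b) h₁).trans ?_
    rw [S.presheafEquiv_comp, ← comp_indScalar, ← indScalar_eq]
    rfl)

/-- The module morphism corresponding to a morphism out of a value of a balanced functor. -/
noncomputable def repHom (n : M) (b : B) (e : E) (x : (S.functor.obj n).obj b ⟶ e) :
    (imageMod F m).obj n ⊙ᵣ Ind.yoneda.obj b ⟶ (modRep m S).obj e :=
  (S.presheaf e).ofElement m n b (S.presheafEquiv e n b x)

theorem repHom_left {n n' : M} (f : n ⟶ n') (b : B) {e : E} (x : (S.functor.obj n').obj b ⟶ e) :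
    (imageMod F m).map f ⊵ᵣ Ind.yoneda.obj b ≫ repHom S n' b e x =
      repHom S n b e ((S.functor.map f).app b ≫ x) :=
  ((S.presheaf e).ofElement_left f b _).trans (congrArg _ (S.presheafEquiv_map f b x))

theorem repHom_right (n : M) {b b' : B} (g : b ⟶ b') {e : E} (x : (S.functor.obj n).obj b' ⟶ e) :
    (imageMod F m).obj n ⊴ᵣ Ind.yoneda.map g ≫ repHom S n b' e x =
      repHom S n b e ((S.functor.obj n).map g ≫ x) :=
  ((S.presheaf e).ofElement_right n g _).trans (congrArg _ (S.presheafEquiv_comp n g x).symm)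

theorem repHom_bal (n : M) (a : A) (b : B) {e : E} (x : (S.functor.obj (n ⊙ᵣ a)).obj b ⟶ e) :
    balComparison F m n a b ≫ repHom S (n ⊙ᵣ a) b e x =
      repHom S n (F.obj a ⊗ b) e ((S.bal n a b).inv ≫ x) :=
  ((S.presheaf e).ofElement_bal n a b _).trans (congrArg _ (S.presheafEquiv_bal n a b x))

theorem repHom_comp (n : M) (b : B) {e e' : E} (x : (S.functor.obj n).obj b ⟶ e) (y : e ⟶ e') :
    repHom S n b e x ≫ (modRep m S).map y = repHom S n b e' (x ≫ y) :=
  ((BalancedFunctor.presheafMap (𝟙 S) y).ofElement_mod m n b _).trans (congrArg _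
    ((BalancedFunctor.presheafEquiv_presheafMap (𝟙 S) y n b x).trans
      (congrArg _ (Category.id_comp _))))

theorem bijective_repHom_self (b : B) (e : E) : Function.Bijective (repHom (m := m) S m b e) :=
  ((S.presheaf e).bijective_ofElement_self b).comp (S.presheafEquiv e m b).bijective

instance isIso_balComparison (n : M) (a : A) (b : B) : IsIso (balComparison F m n a b) := by
  have h₁ : IsIso ((imageMod F m).obj n ⊴ᵣ (yonedaTensorIso (F.obj a) b).inv) :=
    inferInstanceAs (IsIso ((actionLeft (Ind B) ((imageMod F m).obj n)).map _))
  have h₂ : IsIso ((imageModSemiLin F m).app n a ⊵ᵣ Ind.yoneda.obj b) :=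
    inferInstanceAs (IsIso ((actionRight (Mod (Ind B) (imageEnd F m)) (Ind.yoneda.obj b)).map _))
  exact IsIso.comp_isIso' h₁ (IsIso.comp_isIso' inferInstance h₂)

/-- The balancing of S and `balComparison` carry this case to the free case at F(a) ⊗ b. -/
theorem bijective_repHom_act (a : A) (b : B) (e : E) :
    Function.Bijective (repHom (m := m) S (m ⊙ᵣ a) b e) := by
  have h : repHom (m := m) S (m ⊙ᵣ a) b e =
      (asIso (balComparison F m m a b)).homFromEquiv ∘ repHom (m := m) S m (F.obj a ⊗ b) e ∘
        (S.bal m a b).homFromEquiv := by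
    funext x
    simp [← repHom_bal]
  rw [h]
  exact (Equiv.bijective _).comp ((bijective_repHom_self S _ e).comp (Equiv.bijective _))

variable (h : ∀ n, finMod (imageEnd F m) ((imageMod F m).obj n)) (hD : IsRex k (imageMod F m))
  (hp : ∀ n : M, ∃ (a a' : A) (f : m ⊙ᵣ a' ⟶ m ⊙ᵣ a) (π : m ⊙ᵣ a ⟶ n) (w : f ≫ π = 0),
      Nonempty (IsColimit (CokernelCofork.ofπ π w)))

include hD hp in
-- S(-, b) and F(Hom(m, -)) ⊗ b are both right exact, so a presentation of n by objects m ⊙ a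
-- reduces the claim to those objects.
theorem bijective_repHom (n : M) (b : B) (e : E) :
    Function.Bijective (repHom (m := m) S n b e) := by
  obtain ⟨a, a', f, π, w, ⟨hc⟩⟩ := hp n
  have := (S.isRex_left b).preservesFiniteColimits
  have := hD.preservesFiniteColimits
  have := RightExactAction.preservesFiniteColimits_actionRight
    (M := Mod (Ind B) (imageEnd F m)) (Ind.yoneda.obj b)
  exact bijective_of_isColimit (S.functor.flip.obj b)
    (imageMod F m ⋙ actionRight (Mod (Ind B) (imageEnd F m)) (Ind.yoneda.obj b))
    (fun n x ↦ repHom (m := m) S n b e x) (fun f x ↦ (repHom_left S f b x).symm) hc (by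
      rintro (_ | _) <;> exact bijective_repHom_act S _ b e)

variable [HasFiniteColimits E]

instance isClosedUnderIsomorphisms_leftAdjointObjIsDefined {C : Type u₅} [Category.{v₁} C]
    {D : Type u₆} [Category.{v₂} D] (N : D ⥤ C) :
    N.leftAdjointObjIsDefined.IsClosedUnderIsomorphisms where
  of_iso {X Y} i hX := by
    have hX' : IsCorepresentable (N ⋙ coyoneda.obj (op X)) := hX
    exact (hX'.has_corepresentation.choose_spec.some.ofIso
      (Functor.isoWhiskerLeft N (coyoneda.mapIso i.symm.op))).isCorepresentable

/-- The modules at which the left adjoint is defined are closed under finite colimits, because E has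
them, and contain R ⊗ b, whose value is S(m, b). -/
theorem leftAdjointObjIsDefined_modRep (Z : Mod (Ind B) (imageEnd F m))
    (hZ : finMod (imageEnd F m) Z) : (modRep m S).leftAdjointObjIsDefined Z := by
  refine finMod_le (imageEnd F m) (Q := (modRep m S).leftAdjointObjIsDefined)
    (fun J _ _ ↦ ⟨?_⟩) (fun b ↦ ?_) Z hZ
  · rintro X ⟨p⟩
    have : HasColimitsOfShape J E := inferInstance
    exact leftAdjointObjIsDefined_of_isColimit p.isColimit p.prop_diag_obj
  · let t : (modRep m S ⋙ coyoneda.obj (op ((imageMod F m).obj m ⊙ᵣ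
        Ind.yoneda.obj b))).CorepresentableBy ((S.functor.obj m).obj b) :=
      { homEquiv := fun {e} ↦ Equiv.ofBijective _ (bijective_repHom_self S b e)
        homEquiv_comp := fun y x ↦ (repHom_comp S m b x y).symm }
    exact t.isCorepresentable

/-- The functor on finite modules determined by a balanced functor. -/
noncomputable def extend : FinMod (imageEnd F m) ⥤ E :=
  (modRep m S).leftAdjointObjIsDefined.lift (FinMod.incl (imageEnd F m))
    (fun Z ↦ leftAdjointObjIsDefined_modRep S _ (FinMod.prop_incl _ Z)) ⋙
      (modRep m S).partialLeftAdjoint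

/-- The universal property of the values of `extend`. -/
noncomputable def extendEquiv (Z : FinMod (imageEnd F m)) (e : E) :
    ((extend S).obj Z ⟶ e) ≃ ((FinMod.incl _).obj Z ⟶ (modRep m S).obj e) :=
  (modRep m S).partialLeftAdjointHomEquiv

theorem extendEquiv_comp (Z : FinMod (imageEnd F m)) {e e' : E} (x : (extend S).obj Z ⟶ e)
    (y : e ⟶ e') : extendEquiv S Z e' (x ≫ y) = extendEquiv S Z e x ≫ (modRep m S).map y :=
  (modRep m S).partialLeftAdjointHomEquiv_comp x y

theorem extendEquiv_map {Z Z' : FinMod (imageEnd F m)} (f : Z ⟶ Z') {e : E}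
    (x : (extend S).obj Z' ⟶ e) :
    extendEquiv S Z e ((extend S).map f ≫ x) = (FinMod.incl _).map f ≫ extendEquiv S Z' e x :=
  (modRep m S).partialLeftAdjointHomEquiv_map_comp _ x

theorem isRex_extend : IsRex k (extend (m := m) S) := by
  have : PreservesFiniteColimits (extend (m := m) S) := ⟨fun J _ _ ↦
    preservesColimitsOfShape_of_homEquiv (extendEquiv S) (extendEquiv_map S) J⟩
  have hι : IsRex k (FinMod.incl (imageEnd F m)) := FinMod.isRex_incl _
  refine isRex_of_preservesFiniteColimits _ fun r Z ↦ (extendEquiv S Z _).injective ?_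
  rw [← Category.comp_id ((extend S).map _), extendEquiv_map,
    ← Category.id_comp (r • 𝟙 ((extend S).obj Z)), extendEquiv_comp, modRep_map_smul, hι.map_smul, CategoryTheory.Functor.map_id,
    Linear.smul_comp, Linear.comp_smul, Category.id_comp, Category.comp_id]

include hp in
-- Both objects corepresent the R-linear morphisms from F(Hom(m, n)) ⊗ b to the module represented
-- by e: the first by construction of the extension, the second by `bijective_repHom`. The
-- isomorphism x corresponds to the identity of S(n, b).
theorem exists_extend_hom (n : M) (b : B) :
    ∃ x : (extend (m := m) S).obj (((finTensor h hD).functor.obj n).obj b) ⟶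
      (S.functor.obj n).obj b, IsIso x ∧
        (finTensorIso h hD n b).hom ≫ extendEquiv S _ _ x = repHom S n b _ (𝟙 _) := by
  let x := (extendEquiv S _ _).symm ((finTensorIso h hD n b).inv ≫ repHom S n b _ (𝟙 _))
  have hx : (finTensorIso h hD n b).hom ≫ extendEquiv S _ _ x = repHom S n b _ (𝟙 _) := by
    simp [x]
  refine ⟨x, ?_, hx⟩
  have hx' (e : E) : (extendEquiv S _ e).trans (finTensorIso h hD n b).symm.homFromEquiv ∘
      (fun y ↦ x ≫ y) = repHom S n b e := by
    funext y
    simp [extendEquiv_comp, reassoc_of% hx, repHom_comp]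
  refine isIso_of_coyoneda_map_bijective x fun e ↦ ?_
  have := bijective_repHom (m := m) S hD hp n b e
  rw [← hx'] at this
  exact ((Equiv.bijective _).of_comp_iff' _).1 this

theorem extend_hom_ext (n : M) (b : B) {e : E}
    {y y' : (extend (m := m) S).obj (((finTensor h hD).functor.obj n).obj b) ⟶ e}
    (hy : (finTensorIso h hD n b).hom ≫ extendEquiv S _ _ y =
      (finTensorIso h hD n b).hom ≫ extendEquiv S _ _ y') : y = y' :=
  (extendEquiv S _ _).injective ((cancel_epi _).1 hy)

include hp in
theorem essSurj_compFunctor : ((finTensor h hD).compFunctor E).EssSurj where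
  mem_essImage S := by
    choose x hx₁ hx₂ using exists_extend_hom S h hD hp
    have hx (n : M) (b : B) {e : E} (y : (S.functor.obj n).obj b ⟶ e) :
        (finTensorIso h hD n b).hom ≫ extendEquiv S _ _ (x n b ≫ y) = repHom S n b _ y := by
      rw [extendEquiv_comp, reassoc_of% hx₂, repHom_comp, Category.id_comp]
    have hx' (n : M) (b : B) : (finTensorIso h hD n b).hom ≫ extendEquiv S _ _ (x n b) =
      repHom S n b _ (𝟙 _) := hx₂ n b
    -- The isomorphisms x respect both variables and the balancing because `repHom` does; each
    -- identity is checked after transposing to morphisms of modules.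
    have h₁ {n n' : M} (f : n ⟶ n') (b : B) :
        (extend S).map (((finTensor h hD).functor.map f).app b) ≫ x n' b =
          x n b ≫ (S.functor.map f).app b := extend_hom_ext S h hD n b (by
      rw [hx, extendEquiv_map, ← Category.assoc, ← finTensorIso_left, Category.assoc, hx',
        repHom_left, Category.comp_id])
    have h₂ (n : M) {b b' : B} (g : b ⟶ b') :
        (extend S).map (((finTensor h hD).functor.obj n).map g) ≫ x n b' =
          x n b ≫ (S.functor.obj n).map g := extend_hom_ext S h hD n b (by
      rw [hx, extendEquiv_map, ← Category.assoc, ← finTensorIso_right, Category.assoc, hx',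
        repHom_right, Category.comp_id])
    have h₃ (n : M) (a : A) (b : B) :
        (extend S).map ((finTensor h hD).bal n a b).hom ≫ x n (F.obj a ⊗ b) =
          x (n ⊙ᵣ a) b ≫ (S.bal n a b).hom := extend_hom_ext S h hD _ b (by
      rw [hx, extendEquiv_map, ← cancel_epi (balComparison F m n a b), repHom_bal, Iso.inv_hom_id,
        ← hx', ← finTensorIso_bal, Category.assoc, Category.assoc])
    let ψ : (finTensor h hD).comp (isRex_extend (m := m) S) ⟶ S :=
      { hom :=
          { app := fun n ↦
              { app := fun b ↦ x n b
                naturality := fun b b' g ↦ h₂ n g }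
            naturality := fun n n' f ↦ by
              ext b
              exact h₁ f b }
        bal_hom := fun n a b ↦ h₃ n a b }
    have h₄ (n : M) (b : B) : IsIso ((ψ.hom.app n).app b) := hx₁ n b
    have h₅ (n : M) : IsIso (ψ.hom.app n) := NatIso.isIso_of_isIso_app _
    have : IsIso ψ.hom := NatIso.isIso_of_isIso_app _
    exact ⟨⟨_, isRex_extend (m := m) S⟩, ⟨@asIso _ _ _ _ ψ (BalancedHom.isIso ψ)⟩⟩

include hp in
/-- The balanced functor `finTensor` is universal. -/
theorem isEquivalence_compFunctor : ((finTensor h hD).compFunctor E).IsEquivalence where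
  full := full_compFunctor h hD
  faithful := faithful_compFunctor h hD
  essSurj := essSurj_compFunctor h hD hp

end Extend

end RexTensor

namespace RexTensor

open Functor.LaxRightLinear

/-! ### Base changes from linear functors -/

section BaseChangeSemiLin

variable {k : Type w} [Field k] {A : Type u₁} [Category.{v₁} A] [MonoidalCategory A]
  {B : Type u₂} [Category.{v₂} B] [Preadditive B] [Linear k B] [MonoidalCategory B]
  {F : A ⥤ B} [F.Monoidal]
  {M : Type u₃} [Category.{v₃} M] [Preadditive M] [Linear k M] [MonoidalRightAction A M]
  {P : Type u₄} [Category.{v} P] [Preadditive P] [Linear k P] [MonoidalRightAction B P]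
  [RightExactAction B P] [BilinearAction k B P]

/-- Naturality of the associator followed by the pentagon of the action. It supplies the
compatibility of the balancing with the B-action. -/
theorem balanced_linear_aux {p q : P} {c : B} (i : p ⟶ q ⊙ᵣ c) (b b' : B) :
    (αᵣ p b b').inv ≫ i ⊵ᵣ (b ⊗ b') ≫ (αᵣ q c (b ⊗ b')).inv =
      (i ⊵ᵣ b ≫ (αᵣ q c b).inv) ⊵ᵣ b' ≫ (αᵣ q (c ⊗ b) b').inv ≫ q ⊴ᵣ (α_ c b b').hom := by
  have h := action_pentagon_inv q c b b'
  have h' : (αᵣ p b b').inv ≫ i ⊵ᵣ (b ⊗ b') = (i ⊵ᵣ b) ⊵ᵣ b' ≫ (αᵣ _ _ _).inv := by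
    rw [Iso.inv_comp_eq, actionHomLeft_tensor]
  rw [reassoc_of% h', comp_actionHomLeft, Category.assoc]
  congr 1
  rw [← cancel_mono (q ⊴ᵣ (α_ c b b').inv), Category.assoc, Category.assoc, Category.assoc,
    actionHomRight_hom_inv, Category.comp_id, h, Iso.inv_hom_id_assoc]

/-- A universal balanced functor obtained from a linear functor is a base change. -/
@[reducible]
noncomputable def SemiLin.baseChange {K : M ⥤ P} (hK : IsRex k K) (s : SemiLin F K)
    [∀ X b, IsIso (s.app X b)] (h : (s.balancedFunctor hK).IsUniversal) : BaseChange k F M P :=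
  { tensor := s.balancedFunctor hK
    isUniversal := h
    linear := fun n ↦ s.balancedLinear hK n
    linear_natural := fun {n n'} f b b' ↦ by
      change (K.map f ⊵ᵣ b) ⊵ᵣ b' ≫ (αᵣ _ _ _).inv = (αᵣ _ _ _).inv ≫ K.map f ⊵ᵣ (b ⊗ b')
      rw [Iso.eq_inv_comp, actionHomLeft_tensor]
    linear_bal := fun n a b b' ↦ balanced_linear_aux (inv (s.app n a)) b b' }

end BaseChangeSemiLin

/-! ### The linear structure on a small model -/

section SmallModel

variable {k : Type w} [Field k] (P : Type u₁) [Category.{v} P] [EssentiallySmall.{v} P]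
  [Preadditive P] [Linear k P] [HasFiniteColimits P]

noncomputable instance : Preadditive (SmallModel.{v} P) :=
  Preadditive.ofFullyFaithful (equivSmallModel.{v} P).fullyFaithfulInverse

noncomputable instance : Linear k (SmallModel.{v} P) :=
  linearOfFullyFaithful (equivSmallModel.{v} P).fullyFaithfulInverse

instance : HasFiniteColimits (SmallModel.{v} P) := ⟨fun J _ _ ↦
  Adjunction.hasColimitsOfShape_of_equivalence (equivSmallModel.{v} P).inverse⟩

theorem isRex_equivSmallModel : IsRex k (equivSmallModel.{v} P).functor :=
  have h : IsRex k (equivSmallModel.{v} P).inverse :=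
    isRex_of_fullyFaithful (equivSmallModel.{v} P).fullyFaithfulInverse
  isRex_of_preservesFiniteColimits _ fun r X ↦ (equivSmallModel.{v} P).inverse.map_injective (by
    rw [h.map_smul, Equivalence.inv_fun_map]
    simp)

end SmallModel

/-! ### Uniqueness of the universal balanced functor -/

section Equivalence

variable {k : Type w} [Field k] {A : Type u₁} [Category.{v} A] [MonoidalCategory A]
  {B : Type u₂} [Category.{v} B] [Preadditive B] [Linear k B] [MonoidalCategory B]
  {F : A ⥤ B} [F.Monoidal]
  {M : Type u₃} [Category.{v} M] [Preadditive M] [Linear k M] [MonoidalRightAction A M]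
  {P : Type u₄} [Category.{v} P] [EssentiallySmall.{v} P] [Preadditive P] [Linear k P]
  [HasFiniteColimits P] {Q : Type v} [SmallCategory Q] [Preadditive Q] [Linear k Q]
  [HasFiniteColimits Q]

theorem isRex_id (P : Type u₄) [Category.{v₄} P] [Preadditive P] [Linear k P] : IsRex k (𝟭 P) where
  map_add _ _ := rfl
  map_smul _ _ := rfl
  preservesFiniteColimits := inferInstance

/-- The composition of a morphism of balanced functors with a right exact functor. -/
def BalancedFunctor.compMap {E : Type u₅} [Category.{v₄} E] [Preadditive E] [Linear k E]
    {D : Type u₆} [Category.{v} D] [Preadditive D] [Linear k D]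
    {S T : BalancedFunctor k F M D} (f : S ⟶ T) {G : D ⥤ E} (hG : IsRex k G) :
    S.comp hG ⟶ T.comp hG :=
  { hom := Functor.whiskerRight f.hom ((whiskeringRight B D E).obj G)
    bal_hom := fun n a b ↦ by simpa using! congrArg G.map (f.bal_hom n a b) }

theorem BalancedFunctor.compMap_comp {E : Type u₅} [Category.{v₄} E] [Preadditive E] [Linear k E]
    {D : Type u₆} [Category.{v} D] [Preadditive D] [Linear k D]
    {S T U : BalancedFunctor k F M D} (f : S ⟶ T) (g : T ⟶ U) {G : D ⥤ E} (hG : IsRex k G) :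
    compMap (f ≫ g) hG = compMap f hG ≫ compMap g hG :=
  BalancedHom.ext (Functor.whiskerRight_comp f.hom g.hom _)

theorem BalancedFunctor.compMap_id {E : Type u₅} [Category.{v₄} E] [Preadditive E] [Linear k E]
    {D : Type u₆} [Category.{v} D] [Preadditive D] [Linear k D]
    (S : BalancedFunctor k F M D) {G : D ⥤ E} (hG : IsRex k G) :
    compMap (𝟙 S) hG = 𝟙 (S.comp hG) :=
  BalancedHom.ext (Functor.whiskerRight_id' _)

/-- Balanced functors that are isomorphic stay so after composition with a right exact functor. -/
def BalancedFunctor.compIso {E : Type u₅} [Category.{v₄} E] [Preadditive E] [Linear k E]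
    {D : Type u₆} [Category.{v} D] [Preadditive D] [Linear k D]
    {S T : BalancedFunctor k F M D} (i : S ≅ T) {G : D ⥤ E} (hG : IsRex k G) :
    S.comp hG ≅ T.comp hG where
  hom := BalancedFunctor.compMap i.hom hG
  inv := BalancedFunctor.compMap i.inv hG
  hom_inv_id := by rw [← compMap_comp, i.hom_inv_id]; exact compMap_id S hG
  inv_hom_id := by rw [← compMap_comp, i.inv_hom_id]; exact compMap_id T hG

/-- Balanced functors that are both universal have equivalent targets. -/
theorem BalancedFunctor.exists_isEquivalence {T : BalancedFunctor k F M P} (hT : T.IsUniversal)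
    {T₀ : BalancedFunctor k F M Q} (h₁ : (T₀.compFunctor P).IsEquivalence)
    (h₂ : (T₀.compFunctor Q).IsEquivalence) :
    ∃ (Ψ : P ⥤ Q) (hΨ : IsRex k Ψ), Ψ.IsEquivalence ∧ Nonempty (T.comp hΨ ≅ T₀) := by
  have h₃ := hT Q
  -- T is universal against small targets only, so the second composite Ψ ⋙ Φ is compared with the
  -- identity after the equivalence q onto a small model; q is then cancelled by full faithfulness.
  have h₄ := hT (SmallModel.{v} P)
  let q := (equivSmallModel.{v} P).functor
  have hq : IsRex k q := isRex_equivSmallModel P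
  obtain ⟨⟨Ψ, hΨ⟩, ⟨ψ⟩⟩ := h₃.essSurj.mem_essImage T₀
  obtain ⟨⟨Φ, hΦ⟩, ⟨φ⟩⟩ := h₁.essSurj.mem_essImage T
  let i₁ : T₀.comp (hΦ.comp k hΨ) ≅ T₀.comp (isRex_id (k := k) Q) :=
    show (T₀.comp hΦ).comp hΨ ≅ T₀ from BalancedFunctor.compIso φ hΨ ≪≫ ψ
  let i₂ : T.comp ((hΨ.comp k hΦ).comp k hq) ≅ T.comp hq :=
    show ((T.comp hΨ).comp hΦ).comp hq ≅ T.comp hq from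
      BalancedFunctor.compIso (BalancedFunctor.compIso ψ hΦ ≪≫ φ) hq
  let j₁ : (⟨Φ ⋙ Ψ, hΦ.comp k hΨ⟩ : Rex k Q Q) ≅ ⟨𝟭 Q, isRex_id Q⟩ :=
    (T₀.compFunctor Q).preimageIso i₁
  let j₂ : (⟨(Ψ ⋙ Φ) ⋙ q, (hΨ.comp k hΦ).comp k hq⟩ : Rex k P (SmallModel.{v} P)) ≅ ⟨q, hq⟩ :=
    (T.compFunctor (SmallModel.{v} P)).preimageIso i₂
  let l₁ : Φ ⋙ Ψ ≅ 𝟭 Q := (ObjectProperty.ι _).mapIso j₁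
  let l₂ : (Ψ ⋙ Φ) ⋙ q ≅ q := (ObjectProperty.ι _).mapIso j₂
  let l₃ : Ψ ⋙ Φ ≅ 𝟭 P := Functor.fullyFaithfulCancelRight q l₂
  exact ⟨Ψ, hΨ, (CategoryTheory.Equivalence.mk Ψ Φ l₃.symm l₁).isEquivalence_functor, ⟨ψ⟩⟩

end Equivalence

end RexTensor

namespace RexTensor

open Functor.LaxRightLinear Functor.OplaxRightLinear

theorem inv_comp_eq_comp_inv {C : Type u₁} [Category.{v₁} C] {X X' Y Y' : C} (i : X ≅ Y)
    (j : X' ≅ Y') {f : X ⟶ X'} {g : Y ⟶ Y'} (h : f ≫ j.hom = i.hom ≫ g) :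
    i.inv ≫ f = g ≫ j.inv := by
  rw [Iso.inv_comp_eq, ← Category.assoc, ← h, Category.assoc, Iso.hom_inv_id, Category.comp_id]

/-! ### Right exact functors are compared on the objects n ⊠ b -/

section Universal

variable {k : Type w} [Field k] {A : Type u₁} [Category.{v₁} A] [MonoidalCategory A]
  {B : Type u₂} [Category.{v₂} B] [Preadditive B] [Linear k B] [MonoidalCategory B]
  {F : A ⥤ B} [F.Monoidal]
  {M : Type u₃} [Category.{v₃} M] [Preadditive M] [Linear k M] [MonoidalRightAction A M]
  {P : Type u₄} [Category.{v} P] [Preadditive P] [Linear k P]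
  {Q : Type v} [SmallCategory Q] [Preadditive Q] [Linear k Q] [HasFiniteColimits Q]
  {T : BalancedFunctor k F M P} (hT : T.IsUniversal) {G H : P ⥤ Q} (hG : IsRex k G)
  (hH : IsRex k H)

include hT hG hH

theorem BalancedFunctor.IsUniversal.hom_ext {f g : G ⟶ H}
    (h : ∀ n b, f.app ((T.functor.obj n).obj b) = g.app ((T.functor.obj n).obj b)) : f = g := by
  have := hT Q
  let f' : (⟨G, hG⟩ : Rex k P Q) ⟶ ⟨H, hH⟩ := ObjectProperty.homMk f
  let g' : (⟨G, hG⟩ : Rex k P Q) ⟶ ⟨H, hH⟩ := ObjectProperty.homMk g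
  have e : f' = g' := (T.compFunctor Q).map_injective (BalancedHom.ext
    (NatTrans.ext (funext fun n ↦ NatTrans.ext (funext fun b ↦ h n b))))
  exact congrArg (fun t : (⟨G, hG⟩ : Rex k P Q) ⟶ ⟨H, hH⟩ ↦ t.hom) e

/-- The maps β need not be known to be the balancing of a balanced functor: it is enough that both
restrictions are compared with the same β, for then ρ followed by the inverse of τ respects the
balancings and lifts by full faithfulness. -/
theorem BalancedFunctor.IsUniversal.exists_iso {W : M ⥤ B ⥤ Q}
    (β : ∀ n a b, (W.obj (n ⊙ᵣ a)).obj b ⟶ (W.obj n).obj (F.obj a ⊗ b))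
    (ρ : (T.comp hG).functor ≅ W) (τ : (T.comp hH).functor ≅ W)
    (hρ : ∀ n a b, G.map (T.bal n a b).hom ≫ (ρ.hom.app n).app (F.obj a ⊗ b) =
      (ρ.hom.app (n ⊙ᵣ a)).app b ≫ β n a b)
    (hτ : ∀ n a b, H.map (T.bal n a b).hom ≫ (τ.hom.app n).app (F.obj a ⊗ b) =
      (τ.hom.app (n ⊙ᵣ a)).app b ≫ β n a b) :
    ∃ θ : G ≅ H, ∀ n b, θ.hom.app ((T.functor.obj n).obj b) ≫ (τ.hom.app n).app b =
      (ρ.hom.app n).app b := by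
  have := hT Q
  let σ : T.comp hG ⟶ T.comp hH :=
    { hom := ρ.hom ≫ τ.inv
      bal_hom := fun n a b ↦ by
        have h₁ : (τ.inv.app (n ⊙ᵣ a)).app b ≫ H.map (T.bal n a b).hom =
            β n a b ≫ (τ.inv.app n).app (F.obj a ⊗ b) := by
          exact inv_comp_eq_comp_inv ((τ.app (n ⊙ᵣ a)).app b) ((τ.app n).app (F.obj a ⊗ b))
            (hτ n a b)
        refine (Category.assoc _ _ _).symm.trans ((congrArg (· ≫ _) (hρ n a b)).trans ?_)
        refine (Category.assoc _ _ _).trans ((congrArg (_ ≫ ·) h₁.symm).trans ?_)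
        exact (Category.assoc _ _ _).symm }
  have : IsIso σ.hom := (ρ ≪≫ τ.symm).isIso_hom
  have : IsIso σ := BalancedHom.isIso σ
  let i : T.comp hG ≅ T.comp hH := asIso σ
  let j : (⟨G, hG⟩ : Rex k P Q) ≅ ⟨H, hH⟩ := (T.compFunctor Q).preimageIso i
  refine ⟨(ObjectProperty.ι _).mapIso j, fun n b ↦ ?_⟩
  have h : (T.compFunctor Q).map j.hom = σ := (T.compFunctor Q).map_preimage (X := ⟨G, hG⟩) (Y := ⟨H, hH⟩) σ
  have h₁ : j.hom.hom.app ((T.functor.obj n).obj b) = (ρ.hom.app n).app b ≫ (τ.inv.app n).app b :=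
    congrArg (fun t : BalancedHom (T.comp hG) (T.comp hH) ↦ (t.hom.app n).app b) h
  have e₁ := congrArg (fun t ↦ (t.app n).app b) τ.inv_hom_id
  refine (congrArg (· ≫ (τ.hom.app n).app b) h₁).trans ((Category.assoc _ _ _).trans
    ((congrArg ((ρ.hom.app n).app b ≫ ·) e₁).trans (Category.comp_id _)))

end Universal

/-! ### Linearity of the comparison of two base changes -/

section Linear

variable {k : Type w} [Field k] {A : Type u₁} [Category.{v₁} A] [MonoidalCategory A]
  {B : Type u₂} [Category.{v₂} B] [Preadditive B] [Linear k B] [MonoidalCategory B]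
  {F : A ⥤ B} [F.Monoidal]
  {M : Type u₃} [Category.{v₃} M] [Preadditive M] [Linear k M] [MonoidalRightAction A M]
  {P : Type u₄} [Category.{v} P] [Preadditive P] [Linear k P] [MonoidalRightAction B P]

/-- The linear structure on the functors `b ↦ m ⊠ b`. -/
@[reducible]
def BaseChange.rightLinear (T : BaseChange k F M P) (n : M) :
    (T.tensor.functor.obj n).RightLinear B := T.linear n

attribute [local instance] BaseChange.rightLinear

/-- The isomorphisms `(m ⊠ c) ⊗ b ≅ m ⊠ (c ⊗ b)`, natural in `m` and `c`. -/
def BaseChange.linearNat (T : BaseChange k F M P) (b : B) :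
    T.tensor.functor ⋙ (whiskeringRight B P P).obj (actionRight P b) ≅
      T.tensor.functor ⋙ (whiskeringLeft B B P).obj (tensorRight b) :=
  NatIso.ofComponents (fun n ↦ NatIso.ofComponents
      (fun c ↦ Functor.RightLinear.μᵣIso (T.tensor.functor.obj n) c b)
      fun f ↦ μᵣ_naturality_left (T.tensor.functor.obj n) f b)
    fun f ↦ NatTrans.ext (funext fun c ↦ T.linear_natural f c b)

/-- The balancing of `(m, c) ↦ m ⊠ (c ⊗ b)`. -/
def BaseChange.shiftBal (T : BaseChange k F M P) (b : B) (n : M) (a : A) (c : B) :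
    T.box (n ⊙ᵣ a) (c ⊗ b) ⟶ T.box n ((F.obj a ⊗ c) ⊗ b) :=
  (T.tensor.bal n a (c ⊗ b)).hom ≫ (T.tensor.functor.obj n).map (α_ (F.obj a) c b).inv

theorem BaseChange.bal_linearNat (T : BaseChange k F M P) (b : B) (n : M) (a : A) (c : B) :
    (T.tensor.bal n a c).hom ⊵ᵣ b ≫ μᵣ (T.tensor.functor.obj n) (F.obj a ⊗ c) b =
      μᵣ (T.tensor.functor.obj (n ⊙ᵣ a)) c b ≫ T.shiftBal b n a c := by
  rw [BaseChange.shiftBal, ← Category.assoc, T.linear_bal, Category.assoc, Category.assoc,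
    ← Functor.map_comp, Iso.hom_inv_id, CategoryTheory.Functor.map_id, Category.comp_id]

variable {Q : Type v} [SmallCategory Q] [Preadditive Q] [Linear k Q] [HasFiniteColimits Q]
  [MonoidalRightAction B Q] [RightExactAction B P] [BilinearAction k B P]
  [RightExactAction B Q] [BilinearAction k B Q]

theorem isRex_actionRight (k : Type w) [Field k] [Linear k B] [Linear k P] [BilinearAction k B P]
    (b : B) : IsRex k (actionRight P b) where
  map_add f g := BilinearAction.add_actionHomLeft k f g b
  map_smul r f := BilinearAction.smul_actionHomLeft r f b
  preservesFiniteColimits := RightExactAction.preservesFiniteColimits_actionRight b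

variable (T : BaseChange k F M P) (T' : BaseChange k F M Q) {Ψ : P ⥤ Q} (hΨ : IsRex k Ψ)
  (ψ : T.tensor.comp hΨ ≅ T'.tensor)

/-- The components of a morphism of balanced functors. -/
def BaseChange.comparison (n : M) (c : B) : Ψ.obj (T.box n c) ≅ T'.box n c where
  hom := (ψ.hom.hom.app n).app c
  inv := (ψ.inv.hom.app n).app c
  hom_inv_id := congrArg (fun t : BalancedHom (T.tensor.comp hΨ) (T.tensor.comp hΨ) ↦
    (t.hom.app n).app c) ψ.hom_inv_id
  inv_hom_id := congrArg (fun t : BalancedHom T'.tensor T'.tensor ↦ (t.hom.app n).app c)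
    ψ.inv_hom_id

theorem BaseChange.comparison_right (n : M) {c c' : B} (f : c ⟶ c') :
    Ψ.map ((T.tensor.functor.obj n).map f) ≫ (T.comparison T' hΨ ψ n c').hom =
      (T.comparison T' hΨ ψ n c).hom ≫ (T'.tensor.functor.obj n).map f :=
  (ψ.hom.hom.app n).naturality f

theorem BaseChange.comparison_bal (n : M) (a : A) (c : B) :
    Ψ.map (T.tensor.bal n a c).hom ≫ (T.comparison T' hΨ ψ n (F.obj a ⊗ c)).hom =
      (T.comparison T' hΨ ψ (n ⊙ᵣ a) c).hom ≫ (T'.tensor.bal n a c).hom :=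
  ψ.hom.bal_hom n a c

/-- Restricted along T, both p ↦ Ψ(p) ⊗ b and p ↦ Ψ(p ⊗ b) become (n, c) ↦ n ⊠ (c ⊗ b) in Q, with
the balancing `shiftBal`; universality of T then provides θ. -/
theorem BaseChange.exists_action_iso (b : B) :
    ∃ θ : Ψ ⋙ actionRight Q b ≅ actionRight P b ⋙ Ψ, ∀ n c,
      θ.hom.app (T.box n c) ≫ Ψ.map (μᵣ (T.tensor.functor.obj n) c b) ≫
        (T.comparison T' hΨ ψ n (c ⊗ b)).hom =
      (T.comparison T' hΨ ψ n c).hom ⊵ᵣ b ≫ μᵣ (T'.tensor.functor.obj n) c b := by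
  let j : (T.tensor.comp hΨ).functor ≅ T'.tensor.functor :=
    ⟨ψ.hom.hom, ψ.inv.hom, congrArg BalancedHom.hom ψ.hom_inv_id,
      congrArg BalancedHom.hom ψ.inv_hom_id⟩
  refine T.isUniversal.exists_iso (hΨ.comp k (isRex_actionRight k b))
    ((isRex_actionRight k b).comp k hΨ) (T'.shiftBal b)
    (Functor.isoWhiskerRight j ((whiskeringRight B Q Q).obj (actionRight Q b)) ≪≫
      T'.linearNat b)
    (Functor.isoWhiskerRight (T.linearNat b) ((whiskeringRight B P Q).obj Ψ) ≪≫
      Functor.isoWhiskerRight j ((whiskeringLeft B B Q).obj (tensorRight b))) ?_ ?_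
  · intro n a c
    have h := congrArg (· ⊵ᵣ b) (T.comparison_bal T' hΨ ψ n a c)
    simp only [comp_actionHomLeft] at h
    refine (Category.assoc _ _ _).symm.trans ((congrArg (· ≫ _) h).trans ?_)
    refine (Category.assoc _ _ _).trans ?_
    exact (congrArg (_ ≫ ·) (T'.bal_linearNat b n a c)).trans (Category.assoc _ _ _).symm
  · intro n a c
    have h := congrArg Ψ.map (T.bal_linearNat b n a c)
    rw [Functor.map_comp, Functor.map_comp, BaseChange.shiftBal, Functor.map_comp] at h
    refine (Category.assoc _ _ _).symm.trans ((congrArg (· ≫ _) h).trans ?_)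
    rw [BaseChange.shiftBal]
    refine Eq.trans ?_ (Category.assoc _ _ _).symm
    refine (Category.assoc _ _ _).trans (congrArg (_ ≫ ·) ?_)
    refine Eq.trans ?_ ((congrArg (· ≫ (T'.tensor.functor.obj n).map (α_ (F.obj a) c b).inv)
      (T.comparison_bal T' hΨ ψ n a (c ⊗ b))).trans (Category.assoc _ _ _))
    refine (Category.assoc _ _ _).trans (Eq.trans ?_ (Category.assoc _ _ _).symm)
    exact congrArg (_ ≫ ·) (T.comparison_right T' hΨ ψ n (α_ (F.obj a) c b).inv)

end Linear

end RexTensor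

namespace RexTensor

open Functor.LaxRightLinear Functor.OplaxRightLinear

section Linear

variable {k : Type w} [Field k] {A : Type u₁} [Category.{v₁} A] [MonoidalCategory A]
  {B : Type u₂} [Category.{v₂} B] [Preadditive B] [Linear k B] [MonoidalCategory B]
  {F : A ⥤ B} [F.Monoidal]
  {M : Type u₃} [Category.{v₃} M] [Preadditive M] [Linear k M] [MonoidalRightAction A M]
  {P : Type u₄} [Category.{v} P] [Preadditive P] [Linear k P] [MonoidalRightAction B P]
  {Q : Type v} [SmallCategory Q] [Preadditive Q] [Linear k Q] [HasFiniteColimits Q]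
  [MonoidalRightAction B Q] [RightExactAction B P] [BilinearAction k B P]
  [RightExactAction B Q] [BilinearAction k B Q]

attribute [local instance] BaseChange.rightLinear

theorem BaseChange.exists_action_hom (T : BaseChange k F M P) (T' : BaseChange k F M Q)
    {Ψ : P ⥤ Q} (hΨ : IsRex k Ψ) (ψ : T.tensor.comp hΨ ≅ T'.tensor) :
    ∃ θ : ∀ (b : B) (p : P), Ψ.obj p ⊙ᵣ b ⟶ Ψ.obj (p ⊙ᵣ b),
      (∀ (b : B) {p p' : P} (f : p ⟶ p'),
        Ψ.map f ⊵ᵣ b ≫ θ b p' = θ b p ≫ Ψ.map (f ⊵ᵣ b)) ∧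
      (∀ b p, IsIso (θ b p)) ∧
      ∀ b n c, θ b (T.box n c) ≫ Ψ.map (μᵣ (T.tensor.functor.obj n) c b) ≫
        (T.comparison T' hΨ ψ n (c ⊗ b)).hom =
      (T.comparison T' hΨ ψ n c).hom ⊵ᵣ b ≫ μᵣ (T'.tensor.functor.obj n) c b := by
  choose θ hθ using T.exists_action_iso T' hΨ ψ
  exact ⟨fun b p ↦ (θ b).hom.app p, fun b _ _ f ↦ (θ b).hom.naturality f,
    fun b p ↦ inferInstanceAs (IsIso ((θ b).hom.app p)), hθ⟩

/-- A right exact functor compatible with the universal balanced functors is linear. -/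
theorem BaseChange.exists_laxRightLinear (T : BaseChange k F M P) (T' : BaseChange k F M Q)
    {Ψ : P ⥤ Q} (hΨ : IsRex k Ψ) (ψ : T.tensor.comp hΨ ≅ T'.tensor) :
    ∃ L : Ψ.LaxRightLinear B, ∀ p b, IsIso (L.μᵣ p b) := by
  obtain ⟨θ, nat, hi, hθ⟩ := T.exists_action_hom T' hΨ ψ
  have hθ' (b : B) (n : M) (c : B) {Z : Q} (g : T'.box n (c ⊗ b) ⟶ Z) :
      θ b (T.box n c) ≫ Ψ.map (μᵣ (T.tensor.functor.obj n) c b) ≫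
        (T.comparison T' hΨ ψ n (c ⊗ b)).hom ≫ g =
      (T.comparison T' hΨ ψ n c).hom ⊵ᵣ b ≫ μᵣ (T'.tensor.functor.obj n) c b ≫ g := by
    have h := congrArg (· ≫ g) (hθ b n c)
    simpa only [Category.assoc] using h
  have mono_aux {b : B} {n : M} {c : B} {Z : Q} {f g : Z ⟶ Ψ.obj (T.box n c ⊙ᵣ b)}
      (h : f ≫ Ψ.map (μᵣ (T.tensor.functor.obj n) c b) ≫ (T.comparison T' hΨ ψ n (c ⊗ b)).hom =
        g ≫ Ψ.map (μᵣ (T.tensor.functor.obj n) c b) ≫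
          (T.comparison T' hΨ ψ n (c ⊗ b)).hom) : f = g := by
    rwa [cancel_mono] at h
  have hP (b : B) : IsRex k (actionRight P b) := isRex_actionRight k b
  have hQ (b : B) : IsRex k (actionRight Q b) := isRex_actionRight k b
  -- Each axiom is an equality of transformations between right exact functors of p, so by
  -- universality of T only the objects n ⊠ c matter, and there θ is expressed by `hθ` through the
  -- two linear structures. The same pattern proves `assoc` and `unit`.
  have natRight (p : P) {b b' : B} (f : b ⟶ b') :
      Ψ.obj p ⊴ᵣ f ≫ θ b' p = θ b p ≫ Ψ.map (p ⊴ᵣ f) := by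
    let s : Ψ ⋙ actionRight Q b ⟶ actionRight P b' ⋙ Ψ :=
      { app := fun p ↦ Ψ.obj p ⊴ᵣ f ≫ θ b' p
        naturality := fun p p' g ↦ by
          change Ψ.map g ⊵ᵣ b ≫ Ψ.obj p' ⊴ᵣ f ≫ θ b' p' = (Ψ.obj p ⊴ᵣ f ≫ θ b' p) ≫ Ψ.map (g ⊵ᵣ b')
          simp only [Category.assoc]
          rw [← nat, action_exchange_assoc] }
    let t : Ψ ⋙ actionRight Q b ⟶ actionRight P b' ⋙ Ψ :=
      { app := fun p ↦ θ b p ≫ Ψ.map (p ⊴ᵣ f)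
        naturality := fun p p' g ↦ by
          change Ψ.map g ⊵ᵣ b ≫ θ b p' ≫ Ψ.map (p' ⊴ᵣ f) = (θ b p ≫ Ψ.map (p ⊴ᵣ f)) ≫ Ψ.map (g ⊵ᵣ b')
          simp only [Category.assoc]
          rw [reassoc_of% nat, ← Functor.map_comp, ← Functor.map_comp, action_exchange] }
    refine congrArg (fun u : Ψ ⋙ actionRight Q b ⟶ actionRight P b' ⋙ Ψ ↦ u.app p)
      (T.isUniversal.hom_ext (f := s) (g := t) (hΨ.comp k (hQ b)) ((hP b').comp k hΨ)
        fun n c ↦ mono_aux ?_)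
    change (Ψ.obj (T.box n c) ⊴ᵣ f ≫ θ b' (T.box n c)) ≫ _ =
      (θ b (T.box n c) ≫ Ψ.map (T.box n c ⊴ᵣ f)) ≫ _
    have h₁ : Ψ.map (T.box n c ⊴ᵣ f) ≫ Ψ.map (μᵣ (T.tensor.functor.obj n) c b') =
        Ψ.map (μᵣ (T.tensor.functor.obj n) c b) ≫
          Ψ.map ((T.tensor.functor.obj n).map (c ◁ f)) := by
      rw [← Functor.map_comp, ← Functor.map_comp]
      exact congrArg Ψ.map (μᵣ_naturality_right (T.tensor.functor.obj n) c f)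
    rw [Category.assoc, Category.assoc, hθ, reassoc_of% h₁, T.comparison_right T' hΨ ψ n (c := c ⊗ b), hθ',
      action_exchange_assoc]
    exact congrArg (_ ≫ ·) (μᵣ_naturality_right (T'.tensor.functor.obj n) c f)
  have assoc (p : P) (b b' : B) : θ (b ⊗ b') p ≫ Ψ.map (αᵣ p b b').hom =
      (αᵣ (Ψ.obj p) b b').hom ≫ θ b p ⊵ᵣ b' ≫ θ b' (p ⊙ᵣ b) := by
    let s : Ψ ⋙ actionRight Q (b ⊗ b') ⟶ (actionRight P b ⋙ actionRight P b') ⋙ Ψ :=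
      { app := fun p ↦ θ (b ⊗ b') p ≫ Ψ.map (αᵣ p b b').hom
        naturality := fun p p' g ↦ by
          change Ψ.map g ⊵ᵣ (b ⊗ b') ≫ θ (b ⊗ b') p' ≫ Ψ.map (αᵣ p' b b').hom =
            (θ (b ⊗ b') p ≫ Ψ.map (αᵣ p b b').hom) ≫ Ψ.map ((g ⊵ᵣ b) ⊵ᵣ b')
          simp only [Category.assoc]
          rw [reassoc_of% nat, ← Functor.map_comp, ← Functor.map_comp, actionHomLeft_tensor]
          simp }
    let t : Ψ ⋙ actionRight Q (b ⊗ b') ⟶ (actionRight P b ⋙ actionRight P b') ⋙ Ψ :=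
      { app := fun p ↦
          (αᵣ (Ψ.obj p) b b').hom ≫ θ b p ⊵ᵣ b' ≫ θ b' (p ⊙ᵣ b)
        naturality := fun p p' g ↦ by
          change Ψ.map g ⊵ᵣ (b ⊗ b') ≫ (αᵣ (Ψ.obj p') b b').hom ≫ θ b p' ⊵ᵣ b' ≫ θ b' (p' ⊙ᵣ b) =
            ((αᵣ (Ψ.obj p) b b').hom ≫ θ b p ⊵ᵣ b' ≫ θ b' (p ⊙ᵣ b)) ≫ Ψ.map ((g ⊵ᵣ b) ⊵ᵣ b')
          simp only [Category.assoc]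
          rw [actionHomLeft_tensor_assoc, Iso.inv_hom_id_assoc, ← comp_actionHomLeft_assoc,
            nat, comp_actionHomLeft_assoc, nat] }
    refine congrArg (fun u : Ψ ⋙ actionRight Q (b ⊗ b') ⟶
      (actionRight P b ⋙ actionRight P b') ⋙ Ψ ↦ u.app p)
      (T.isUniversal.hom_ext (f := s) (g := t) (hΨ.comp k (hQ _))
        (((hP b).comp k (hP b')).comp k hΨ) fun n c ↦ ?_)
    change θ (b ⊗ b') (T.box n c) ≫ Ψ.map (αᵣ (T.box n c) b b').hom =
      (αᵣ (Ψ.obj (T.box n c)) b b').hom ≫ θ b (T.box n c) ⊵ᵣ b' ≫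
        θ b' (T.box n c ⊙ᵣ b)
    -- The target is identified with n ⊠ ((c ⊗ b) ⊗ b') in Q, so that the coherence of T and that of
    -- T' can be compared.
    rw [← cancel_mono (Ψ.map (μᵣ (T.tensor.functor.obj n) c b ⊵ᵣ b')),
      ← cancel_mono (Ψ.map (μᵣ (T.tensor.functor.obj n) (c ⊗ b) b') ≫
        (T.comparison T' hΨ ψ n ((c ⊗ b) ⊗ b')).hom)]
    have h₁ : Ψ.map (αᵣ (T.box n c) b b').hom ≫
        Ψ.map (μᵣ (T.tensor.functor.obj n) c b ⊵ᵣ b') ≫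
          Ψ.map (μᵣ (T.tensor.functor.obj n) (c ⊗ b) b') =
        Ψ.map (μᵣ (T.tensor.functor.obj n) c (b ⊗ b')) ≫
          Ψ.map ((T.tensor.functor.obj n).map (α_ c b b').inv) := by
      rw [← Functor.map_comp, ← Functor.map_comp, ← Functor.map_comp]
      exact congrArg Ψ.map (μᵣ_associativity (T.tensor.functor.obj n) c b b').symm
    have h₂ : θ b (T.box n c) ⊵ᵣ b' ≫
        Ψ.map (μᵣ (T.tensor.functor.obj n) c b) ⊵ᵣ b' ≫
          (T.comparison T' hΨ ψ n (c ⊗ b)).hom ⊵ᵣ b' =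
        ((T.comparison T' hΨ ψ n c).hom ⊵ᵣ b) ⊵ᵣ b' ≫
          μᵣ (T'.tensor.functor.obj n) c b ⊵ᵣ b' := by
      rw [← comp_actionHomLeft, ← comp_actionHomLeft, ← comp_actionHomLeft, hθ]
    have h₃ : (T.comparison T' hΨ ψ n c).hom ⊵ᵣ (b ⊗ b') ≫ (αᵣ _ b b').hom =
        (αᵣ _ b b').hom ≫ ((T.comparison T' hΨ ψ n c).hom ⊵ᵣ b) ⊵ᵣ b' := by
      rw [actionHomLeft_tensor]
      simp
    have h₄ : μᵣ (T'.tensor.functor.obj n) c (b ⊗ b') ≫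
        (T'.tensor.functor.obj n).map (α_ c b b').inv =
        (αᵣ _ b b').hom ≫ μᵣ (T'.tensor.functor.obj n) c b ⊵ᵣ b' ≫
          μᵣ (T'.tensor.functor.obj n) (c ⊗ b) b' :=
      μᵣ_associativity (T'.tensor.functor.obj n) c b b'
    have h₅ : θ b' (T.box n c ⊙ᵣ b) ≫ Ψ.map (μᵣ (T.tensor.functor.obj n) c b ⊵ᵣ b') =
        Ψ.map (μᵣ (T.tensor.functor.obj n) c b) ⊵ᵣ b' ≫ θ b' (T.box n (c ⊗ b)) :=
      (nat b' (μᵣ (T.tensor.functor.obj n) c b)).symm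
    simp only [Category.assoc]
    rw [reassoc_of% h₁, T.comparison_right T' hΨ ψ n (c := c ⊗ (b ⊗ b')), hθ', h₄,
      reassoc_of% h₃, reassoc_of% h₅, hθ,
      reassoc_of% h₂]
  have unit (p : P) : (ρᵣ (Ψ.obj p)).hom = θ (𝟙_ B) p ≫ Ψ.map (ρᵣ p).hom := by
    let s : Ψ ⋙ actionRight Q (𝟙_ B) ⟶ Ψ :=
      { app := fun p ↦ (ρᵣ (Ψ.obj p)).hom
        naturality := fun p p' g ↦ (actionUnitIso_hom_naturality (C := B) (Ψ.map g)).symm }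
    let t : Ψ ⋙ actionRight Q (𝟙_ B) ⟶ Ψ :=
      { app := fun p ↦ θ (𝟙_ B) p ≫ Ψ.map (ρᵣ p).hom
        naturality := fun p p' g ↦ by
          change Ψ.map g ⊵ᵣ (𝟙_ B) ≫ θ (𝟙_ B) p' ≫ Ψ.map (ρᵣ p').hom =
            (θ (𝟙_ B) p ≫ Ψ.map (ρᵣ p).hom) ≫ Ψ.map g
          simp only [Category.assoc]
          rw [reassoc_of% nat, ← Functor.map_comp, ← Functor.map_comp,
            actionUnitIso_hom_naturality] }
    refine congrArg (fun u : Ψ ⋙ actionRight Q (𝟙_ B) ⟶ Ψ ↦ u.app p)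
      (T.isUniversal.hom_ext (f := s) (g := t) (hΨ.comp k (hQ _)) hΨ fun n c ↦ ?_)
    change (ρᵣ (Ψ.obj (T.box n c))).hom =
      θ (𝟙_ B) (T.box n c) ≫ Ψ.map (ρᵣ (T.box n c)).hom
    have h₁ : (ρᵣ (T.box n c)).hom = μᵣ (T.tensor.functor.obj n) c (𝟙_ B) ≫
        (T.tensor.functor.obj n).map (ρ_ c).hom := μᵣ_unitality (T.tensor.functor.obj n) c
    have h₂ : (ρᵣ (T'.box n c)).hom = μᵣ (T'.tensor.functor.obj n) c (𝟙_ B) ≫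
        (T'.tensor.functor.obj n).map (ρ_ c).hom := μᵣ_unitality (T'.tensor.functor.obj n) c
    rw [← cancel_mono (T.comparison T' hΨ ψ n c).hom, h₁, Functor.map_comp, Category.assoc,
      Category.assoc, T.comparison_right T' hΨ ψ n (c := c ⊗ 𝟙_ B), hθ', ← h₂, actionUnitIso_hom_naturality]
  exact ⟨{  μᵣ := fun p b ↦ θ b p
            μᵣ_naturality_right := natRight
            μᵣ_naturality_left := fun f b ↦ nat b f
            μᵣ_associativity := assoc
            μᵣ_unitality := unit },
    fun p b ↦ hi b p⟩

end Linear

end RexTensor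

namespace RexTensor

open Functor.LaxMonoidal Functor.LaxRightLinear

theorem actionHomRight_tensorHom_assoc_hom {C : Type u₁} [Category.{v₁} C] [MonoidalCategory C]
    {D : Type u₂} [Category.{v₂} D] [MonoidalRightAction C D] {X : D} {Y Y' Z Z' : C} (w : Y ⟶ Y')
    (x : Z ⟶ Z') :
    X ⊴ᵣ (w ⊗ₘ x) ≫ (αᵣ X Y' Z').hom = (αᵣ X Y Z).hom ≫ (X ⊴ᵣ w) ⊵ᵣ Z ≫ (X ⊙ᵣ Y') ⊴ᵣ x := by
  rw [MonoidalCategory.tensorHom_def, actionHomRight_comp, actionHomRight_whiskerRight,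
    whiskerRight_actionHomLeft]
  simp only [Category.assoc, Iso.inv_hom_id_assoc, Iso.inv_hom_id, Category.comp_id]

/-! ### Extending a linear functor to ind-objects -/

section ExtLinear

variable {B : Type u₁} [Category.{v} B] [MonoidalCategory B] {P : Type u₂} [Category.{v} P]
  [MonoidalRightAction B P] {T : Type u₃} [Category.{w} T] [HasFilteredColimitsOfSize.{v, v} T]
  {K : P ⥤ T}

/-- The morphism `K p ⟶ K X` determined by `u : p ⟶ X`. -/
noncomputable def extEl {p : P} {X : Ind P} (u : Ind.yoneda.obj p ⟶ X) :
    K.obj p ⟶ ((ext P T).obj K).obj X :=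
  (extIso K).hom.app p ≫ ((ext P T).obj K).map u

theorem extEl_map {p : P} {X X' : Ind P} (u : Ind.yoneda.obj p ⟶ X) (f : X ⟶ X') :
    extEl (K := K) u ≫ ((ext P T).obj K).map f = extEl (u ≫ f) := by
  simp [extEl]

theorem map_extEl {p p' : P} {X : Ind P} (f : p ⟶ p') (u : Ind.yoneda.obj p' ⟶ X) :
    K.map f ≫ extEl u = extEl (Ind.yoneda.map f ≫ u) := by
  have := (extIso K).hom.naturality f
  refine (Category.assoc _ _ _).symm.trans
    ((congrArg (· ≫ ((ext P T).obj K).map u) this).trans ?_)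
  simp [extEl]

instance isIso_extEl {p : P} {X : Ind P} (u : Ind.yoneda.obj p ⟶ X) [IsIso u] :
    IsIso (extEl (K := K) u) := by
  dsimp only [extEl]
  infer_instance

variable [MonoidalRightAction (Ind B) T]
  [hl : ∀ Z, PreservesFilteredColimitsOfSize.{v, v} (actionLeft (Ind B) (D := T) Z)]
  [hr : ∀ Y, PreservesFilteredColimitsOfSize.{v, v} (actionRight (C := Ind B) T Y)]
  (s : SemiLin (Ind.yoneda (C := B)) K)

/-- The bifunctor `(X, Y) ↦ K X ⊙ Y`. -/
noncomputable def extAct (B : Type u₁) [Category.{v} B] [MonoidalCategory B]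
    [MonoidalRightAction (Ind B) T] (K : P ⥤ T) : Ind P ⥤ Ind B ⥤ T :=
  (ext P T).obj K ⋙ (curriedAction (Ind B) T).flip

instance presFilt_extAct_obj (X : Ind P) : PresFilt ((extAct B K).obj X) :=
  hl (((ext P T).obj K).obj X)

instance presFilt_extAct_flip (Y : Ind B) : PresFilt ((extAct B K).flip.obj Y) :=
  have := hr Y
  inferInstanceAs (PresFilt ((ext P T).obj K ⋙ actionRight (C := Ind B) T Y))

/-- The action preserves filtered colimits in each variable, so K(X) ⊙ Y is covered by the pieces
K(p) ⊙ b. -/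
theorem extEl_hom_ext {X : Ind P} {Y : Ind B} {W : T} {f g : ((ext P T).obj K).obj X ⊙ᵣ Y ⟶ W}
    (h : ∀ (p : P) (b : B) (u : Ind.yoneda.obj p ⟶ X) (w : Ind.yoneda.obj b ⟶ Y),
      extEl (K := K) u ⊵ᵣ Ind.yoneda.obj b ≫ ((ext P T).obj K).obj X ⊴ᵣ w ≫ f =
        extEl (K := K) u ⊵ᵣ Ind.yoneda.obj b ≫ ((ext P T).obj K).obj X ⊴ᵣ w ≫ g) : f = g := by
  refine IndExt.hom_ext ((extAct B K).obj X) fun b w ↦ ?_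
  refine IndExt.hom_ext ((extAct B K).flip.obj (Ind.yoneda.obj b)) fun p u ↦ ?_
  have : IsIso (extEl (K := K) (𝟙 (Ind.yoneda.obj p)) ⊵ᵣ Ind.yoneda.obj b) :=
    inferInstanceAs (IsIso ((actionRight T (Ind.yoneda.obj b)).map (extEl (K := K) (𝟙 _))))
  refine (cancel_epi (extEl (K := K) (𝟙 (Ind.yoneda.obj p)) ⊵ᵣ Ind.yoneda.obj b)).1 ?_
  have e : extEl (K := K) (𝟙 (Ind.yoneda.obj p)) ⊵ᵣ Ind.yoneda.obj b ≫
      ((ext P T).obj K).map u ⊵ᵣ Ind.yoneda.obj b = extEl (K := K) u ⊵ᵣ Ind.yoneda.obj b := by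
    rw [← comp_actionHomLeft, extEl_map, Category.id_comp]
  exact ((reassoc_of% e) _).trans ((h p b u w).trans ((reassoc_of% e) _).symm)

/-- The comparison is glued from the maps s on the pieces K(p) ⊙ b; naturality of s in both
variables is the compatibility condition. -/
theorem exists_extMul (X : Ind P) (Y : Ind B) :
    ∃ f : ((ext P T).obj K).obj X ⊙ᵣ Y ⟶ ((ext P T).obj K).obj (X ⊙ᵣ Y),
      ∀ (p : P) (b : B) (u : Ind.yoneda.obj p ⟶ X) (w : Ind.yoneda.obj b ⟶ Y),
        extEl (K := K) u ⊵ᵣ Ind.yoneda.obj b ≫ ((ext P T).obj K).obj X ⊴ᵣ w ≫ f =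
          s.app p b ≫ extEl (amul u w) := by
  have hi (p : P) (b : B) : IsIso (extEl (K := K) (𝟙 (Ind.yoneda.obj p)) ⊵ᵣ Ind.yoneda.obj b) :=
    inferInstanceAs (IsIso ((actionRight T (Ind.yoneda.obj b)).map (extEl (K := K) (𝟙 _))))
  let φ (p : P) (b : B) (u : Ind.yoneda.obj p ⟶ X) (w : Ind.yoneda.obj b ⟶ Y) :
      ((ext P T).obj K).obj (Ind.yoneda.obj p) ⊙ᵣ Ind.yoneda.obj b ⟶
        ((ext P T).obj K).obj (X ⊙ᵣ Y) :=
    CategoryTheory.inv (extEl (K := K) (𝟙 (Ind.yoneda.obj p)) ⊵ᵣ Ind.yoneda.obj b) ≫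
      s.app p b ≫ extEl (amul u w)
  obtain ⟨f, hf⟩ := exists_desc₂ (extAct B K) X Y (((ext P T).obj K).obj (X ⊙ᵣ Y)) φ
    (fun p p' b f u w ↦ by
      have h : ((ext P T).obj K).map (Ind.yoneda.map f) ⊵ᵣ Ind.yoneda.obj b ≫
          CategoryTheory.inv (extEl (K := K) (𝟙 (Ind.yoneda.obj p')) ⊵ᵣ Ind.yoneda.obj b) =
          CategoryTheory.inv (extEl (K := K) (𝟙 (Ind.yoneda.obj p)) ⊵ᵣ Ind.yoneda.obj b) ≫
            K.map f ⊵ᵣ Ind.yoneda.obj b := by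
        rw [IsIso.comp_inv_eq, Category.assoc, IsIso.eq_inv_comp, ← comp_actionHomLeft,
          ← comp_actionHomLeft, extEl_map, map_extEl, Category.id_comp, Category.comp_id]
      dsimp only [φ]
      rw [← map_amul_left, ← map_extEl, ← reassoc_of% s.natural_left]
      exact (reassoc_of% h) _)
    (fun p b b' g u w ↦ by
      have h : ((ext P T).obj K).obj (Ind.yoneda.obj p) ⊴ᵣ Ind.yoneda.map g ≫
          CategoryTheory.inv (extEl (K := K) (𝟙 (Ind.yoneda.obj p)) ⊵ᵣ Ind.yoneda.obj b') =
          CategoryTheory.inv (extEl (K := K) (𝟙 (Ind.yoneda.obj p)) ⊵ᵣ Ind.yoneda.obj b) ≫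
            K.obj p ⊴ᵣ Ind.yoneda.map g := by
        rw [IsIso.comp_inv_eq, Category.assoc, IsIso.eq_inv_comp, action_exchange]
      dsimp only [φ]
      rw [← map_amul_right, ← map_extEl, ← reassoc_of% s.natural_right]
      exact (reassoc_of% h) _)
  refine ⟨f, fun p b u w ↦ ?_⟩
  have e : extEl (K := K) (𝟙 (Ind.yoneda.obj p)) ⊵ᵣ Ind.yoneda.obj b ≫
      ((ext P T).obj K).map u ⊵ᵣ Ind.yoneda.obj b = extEl (K := K) u ⊵ᵣ Ind.yoneda.obj b := by
    rw [← comp_actionHomLeft, extEl_map, Category.id_comp]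
  have h : ((ext P T).obj K).map u ⊵ᵣ Ind.yoneda.obj b ≫ ((ext P T).obj K).obj X ⊴ᵣ w ≫ f =
      CategoryTheory.inv (extEl (K := K) (𝟙 (Ind.yoneda.obj p)) ⊵ᵣ Ind.yoneda.obj b) ≫
      s.app p b ≫ extEl (amul u w) := hf p b u w
  rw [← e, Category.assoc, h, IsIso.hom_inv_id_assoc]

/-- The comparison `K X ⊙ Y ⟶ K (X ⊙ Y)` on ind-objects. -/
noncomputable def extMul (X : Ind P) (Y : Ind B) :
    ((ext P T).obj K).obj X ⊙ᵣ Y ⟶ ((ext P T).obj K).obj (X ⊙ᵣ Y) :=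
  (exists_extMul s X Y).choose

theorem extEl_extMul {X : Ind P} {Y : Ind B} {p : P} {b : B} (u : Ind.yoneda.obj p ⟶ X)
    (w : Ind.yoneda.obj b ⟶ Y) :
    extEl (K := K) u ⊵ᵣ Ind.yoneda.obj b ≫ ((ext P T).obj K).obj X ⊴ᵣ w ≫ extMul s X Y =
      s.app p b ≫ extEl (amul u w) := (exists_extMul s X Y).choose_spec p b u w

theorem extMul_natural_left {X X' : Ind P} (f : X ⟶ X') (Y : Ind B) :
    ((ext P T).obj K).map f ⊵ᵣ Y ≫ extMul s X' Y =
      extMul s X Y ≫ ((ext P T).obj K).map (f ⊵ᵣ Y) := extEl_hom_ext fun p b u w ↦ by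
  rw [action_exchange_assoc, ← comp_actionHomLeft_assoc, extEl_map, extEl_extMul,
    reassoc_of% extEl_extMul s u w, extEl_map, amul_actionHomLeft]

theorem extMul_natural_right (X : Ind P) {Y Y' : Ind B} (f : Y ⟶ Y') :
    ((ext P T).obj K).obj X ⊴ᵣ f ≫ extMul s X Y' =
      extMul s X Y ≫ ((ext P T).obj K).map (X ⊴ᵣ f) := extEl_hom_ext fun p b u w ↦ by
  rw [← actionHomRight_comp_assoc, extEl_extMul,
    reassoc_of% extEl_extMul s u w, extEl_map, amul_actionHomRight]

theorem extMul_assoc (X : Ind P) (Y Z : Ind B) :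
    extMul s X (Y ⊗ Z) ≫ ((ext P T).obj K).map (αᵣ X Y Z).hom =
      (αᵣ (((ext P T).obj K).obj X) Y Z).hom ≫ extMul s X Y ⊵ᵣ Z ≫ extMul s (X ⊙ᵣ Y) Z :=
  extEl_hom_ext fun p d u v ↦ by
    -- Elements of Y ⊗ Z come from elements of Y and of Z up to a morphism g, which brings the
    -- identity down to the associativity of s.
    obtain ⟨b, c, w, x, g, rfl⟩ := tmul_surj v
    rw [actionHomRight_comp, Category.assoc, Category.assoc,
      ← action_exchange_assoc (extEl (K := K) u) (Ind.yoneda.map g),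
      ← action_exchange_assoc (extEl (K := K) u) (Ind.yoneda.map g)]
    refine congrArg (K.obj p ⊴ᵣ Ind.yoneda.map g ≫ ·) ?_
    have h₁ : extEl (K := K) u ⊵ᵣ (Ind.yoneda.obj b ⊗ Ind.yoneda.obj c) ≫ (αᵣ _ _ _).hom =
        (αᵣ _ _ _).hom ≫ (extEl (K := K) u ⊵ᵣ Ind.yoneda.obj b) ⊵ᵣ Ind.yoneda.obj c := by
      rw [actionHomLeft_tensor]
      simp
    have h₂ := congrArg (· ⊵ᵣ Ind.yoneda.obj c) (extEl_extMul s u w)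
    simp only [comp_actionHomLeft] at h₂
    rw [reassoc_of% extEl_extMul s u (tmul w x), extEl_map, amul_actionAssocIso, ← map_extEl,
      tmul_eq, actionHomRight_comp, Category.assoc,
      reassoc_of% actionHomRight_tensorHom_assoc_hom w x,
      ← action_exchange_assoc, ← cancel_epi (K.obj p ⊴ᵣ (yonedaTensorIso b c).hom),
      actionHomRight_hom_inv_assoc]
    have h := s.assoc p b c
    rw [μ_yoneda] at h
    rw [reassoc_of% h, reassoc_of% h₁, action_exchange_assoc, reassoc_of% h₂, extEl_extMul]

theorem extMul_unit (X : Ind P) : (ρᵣ (((ext P T).obj K).obj X)).hom =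
    extMul s X (𝟙_ (Ind B)) ≫ ((ext P T).obj K).map (ρᵣ X).hom :=
  extEl_hom_ext fun p b u w ↦ by
    obtain ⟨w, rfl⟩ := Ind.yoneda.map_surjective (Y := 𝟙_ B) w
    have h := s.unit p
    rw [ε_yoneda, actionHomRight_id, Category.id_comp] at h
    have h₁ := extEl_extMul s (Y := 𝟙_ (Ind B)) u (Ind.yoneda.map w)
    rw [reassoc_of% h₁, extEl_map, ← action_exchange_assoc]
    refine Eq.trans ?_ (congrArg (fun t ↦ s.app p b ≫ extEl (K := K) t)
      (amul_actionUnitIso u w)).symm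
    rw [← map_extEl, Functor.map_comp, Category.assoc, ← reassoc_of% s.natural_right]
    refine congrArg (K.obj p ⊴ᵣ Ind.yoneda.map w ≫ ·) ?_
    exact (actionUnitIso_hom_naturality (C := Ind B) (extEl (K := K) u)).symm.trans
      ((congrArg (· ≫ extEl (K := K) u) h.symm).trans (Category.assoc _ _ _))

variable [∀ p b, IsIso (s.app p b)]

/-- Both sides preserve filtered colimits in X and in Y; on representables the comparison is s up to
isomorphism. -/
instance isIso_extMul (X : Ind P) (Y : Ind B) : IsIso (extMul s X Y) := by
  let L := (ext P T).obj K
  have hL (Y : Ind B) : PresFilt (L ⋙ actionRight T Y) :=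
    have := hr Y
    inferInstance
  have hL' (Y : Ind B) : PresFilt (actionRight (Ind P) Y ⋙ L) :=
    inferInstanceAs (PresFilt ((indBi (actBi B P)).flip.obj Y ⋙ L))
  have hR (X : Ind P) : PresFilt (actionLeft (Ind B) (L.obj X)) := hl (L.obj X)
  have hR' (X : Ind P) : PresFilt (actionLeft (Ind B) X ⋙ L) :=
    inferInstanceAs (PresFilt ((indBi (actBi B P)).obj X ⋙ L))
  let τ (Y : Ind B) : L ⋙ actionRight T Y ⟶ actionRight (Ind P) Y ⋙ L :=
    { app := fun X ↦ extMul s X Y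
      naturality := fun X X' f ↦ extMul_natural_left s f Y }
  let σ (X : Ind P) : actionLeft (Ind B) (L.obj X) ⟶ actionLeft (Ind B) X ⋙ L :=
    { app := fun Y ↦ extMul s X Y
      naturality := fun Y Y' f ↦ extMul_natural_right s X f }
  refine isIso_app_of_yoneda (τ Y) (fun p ↦ isIso_app_of_yoneda (σ (Ind.yoneda.obj p))
    (fun b ↦ ?_) Y) X
  change IsIso (extMul s (Ind.yoneda.obj p) (Ind.yoneda.obj b))
  have h := extEl_extMul s (𝟙 (Ind.yoneda.obj p)) (𝟙 (Ind.yoneda.obj b))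
  rw [actionHomRight_id, Category.id_comp] at h
  have : IsIso (extEl (K := K) (𝟙 (Ind.yoneda.obj p)) ⊵ᵣ Ind.yoneda.obj b) :=
    inferInstanceAs (IsIso ((actionRight T (Ind.yoneda.obj b)).map (extEl (K := K) (𝟙 _))))
  exact IsIso.of_isIso_fac_left h

/-- The extension of a linear functor to ind-objects is linear. -/
@[reducible]
noncomputable def extRightLinear : ((ext P T).obj K).RightLinear (Ind B) where
  μᵣ X Y := extMul s X Y
  δᵣ X Y := CategoryTheory.inv (extMul s X Y)
  μᵣ_naturality_left f Y := extMul_natural_left s f Y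
  μᵣ_naturality_right X _ _ f := extMul_natural_right s X f
  μᵣ_associativity X Y Z := extMul_assoc s X Y Z
  μᵣ_unitality X := extMul_unit s X
  δᵣ_naturality_left f Y := by
    rw [IsIso.eq_inv_comp, ← reassoc_of% extMul_natural_left, IsIso.hom_inv_id, Category.comp_id]
  δᵣ_naturality_right X _ _ f := by
    rw [IsIso.eq_inv_comp, ← reassoc_of% extMul_natural_right, IsIso.hom_inv_id, Category.comp_id]
  δᵣ_associativity X Y Z := by
    rw [IsIso.inv_comp_eq, reassoc_of% extMul_assoc]
    simp [← comp_actionHomLeft]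
  δᵣ_unitality_inv X := by
    rw [← cancel_mono (extMul s X (𝟙_ (Ind B))), Category.assoc, IsIso.inv_hom_id,
      Category.comp_id, Iso.inv_comp_eq, extMul_unit s, Category.assoc, ← Functor.map_comp]
    simp
  μᵣ_comp_δᵣ X Y := IsIso.hom_inv_id _
  δᵣ_comp_μᵣ X Y := IsIso.inv_hom_id _

end ExtLinear

end RexTensor

namespace IndExt

/-- Elements of Y have unique preimages in X, so the preimages are compatible and glue to an
inverse. -/
theorem isIso_of_bijective_yoneda {C : Type u₁} [Category.{v} C] {X Y : Ind C} (f : X ⟶ Y)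
    (h : ∀ c, Function.Bijective (fun g : Ind.yoneda.obj c ⟶ X ↦ g ≫ f)) : IsIso f := by
  choose p hp using fun (c : C) (u : Ind.yoneda.obj c ⟶ Y) ↦ (h c).2 u
  dsimp only at hp
  obtain ⟨g, hg⟩ := exists_desc (𝟭 (Ind C)) Y X p (fun c c' f' u ↦ (h c).1 (by simp [hp]))
  have hg' (c : C) (u : Ind.yoneda.obj c ⟶ Y) : u ≫ g = p c u := hg c u
  refine ⟨g, hom_ext (𝟭 (Ind C)) fun c u ↦ (h c).1 ?_, hom_ext (𝟭 (Ind C)) fun c u ↦ ?_⟩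
  · change (u ≫ f ≫ g) ≫ f = (u ≫ 𝟙 X) ≫ f
    rw [← Category.assoc, hg', hp, Category.comp_id]
  · change u ≫ g ≫ f = u ≫ 𝟙 Y
    rw [← Category.assoc, hg', hp, Category.comp_id]

end IndExt

namespace RexTensor

open Functor.LaxMonoidal Functor.LaxRightLinear

/-- Composition of a linear functor with a functor linear over a monoidal functor. -/
def SemiLin.precomp {B : Type u₁} [Category.{v₁} B] [MonoidalCategory B] {C : Type u₂}
    [Category.{v₂} C] [MonoidalCategory C] {G : B ⥤ C} [G.LaxMonoidal] {P : Type u₃}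
    [Category.{v₃} P] [MonoidalRightAction B P] {Q : Type u₄} [Category.{v₄} Q]
    [MonoidalRightAction B Q] {D : Type u₅} [Category.{v} D] [MonoidalRightAction C D]
    {ι : Q ⥤ D} (s : SemiLin G ι) (Ψ : P ⥤ Q) [Ψ.LaxRightLinear B] : SemiLin G (Ψ ⋙ ι) where
  app p b := s.app (Ψ.obj p) b ≫ ι.map (μᵣ Ψ p b)
  natural_left f b := by
    simp only [Functor.comp_obj, Functor.comp_map, Category.assoc]
    rw [reassoc_of% s.natural_left, ← ι.map_comp, ← ι.map_comp, μᵣ_naturality_left]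
  natural_right p b b' f := by
    simp only [Functor.comp_obj, Functor.comp_map, Category.assoc]
    rw [reassoc_of% s.natural_right, ← ι.map_comp, ← ι.map_comp, μᵣ_naturality_right]
  assoc p b b' := by
    simp only [Functor.comp_obj, Functor.comp_map, Category.assoc, comp_actionHomLeft]
    rw [reassoc_of% s.natural_left, ← ι.map_comp, μᵣ_associativity, ι.map_comp, reassoc_of% s.assoc,
      ι.map_comp]
  unit p := by
    simp only [Functor.comp_obj, Functor.comp_map, Category.assoc]
    rw [← ι.map_comp, ← μᵣ_unitality, s.unit]

/-! ### Ind-objects of finite modules are all modules -/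

section Algebra

variable {B : Type u₁} [Category.{v} B] [EssentiallySmall.{v} B] [HasFiniteColimits B]
  [MonoidalCategory B] [RigidCategory B] (R : Ind B) [MonObj R]

instance hasFilteredColimits_mod : HasFilteredColimitsOfSize.{v, v} (Mod (Ind B) R) :=
  ⟨fun J _ _ ↦ inferInstance⟩

instance preservesFilteredColimits_modActionLeft (Z : Mod (Ind B) R) :
    PreservesFilteredColimitsOfSize.{v, v} (actionLeft (Ind B) Z) :=
  ⟨fun J _ _ ↦ inferInstance⟩

instance preservesFilteredColimits_modActionRight (Y : Ind B) :
    PreservesFilteredColimitsOfSize.{v, v} (actionRight (Mod (Ind B) R) Y) :=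
  ⟨fun J _ _ ↦ inferInstance⟩

variable {R} {P : Type u₂} [Category.{v} P] [EssentiallySmall.{v} P] [HasFiniteColimits P]

/-- The extension of an equivalence with the finite modules is an equivalence of the ind-completion
with all modules. -/
theorem isEquivalence_ext_incl (Ψ : P ⥤ FinMod R) [Ψ.IsEquivalence] :
    ((ext P (Mod (Ind B) R)).obj (Ψ ⋙ FinMod.incl R)).IsEquivalence := by
  let K : P ⥤ Mod (Ind B) R := Ψ ⋙ FinMod.incl R
  let Φ := (ext P (Mod (Ind B) R)).obj K
  let i : K ≅ Ind.yoneda ⋙ Φ := extIso K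
  have : (Ind.yoneda ⋙ Φ).Full := Functor.Full.of_iso i
  have : (Ind.yoneda ⋙ Φ).Faithful := Functor.Faithful.of_iso i
  have : PreservesFiniteColimits (Ind.yoneda ⋙ Φ) :=
    have : PreservesFiniteColimits K := comp_preservesFiniteColimits Ψ (FinMod.incl R)
    preservesFiniteColimits_of_natIso i
  have (c : P) : IsFinitelyPresentable.{v} (Φ.obj (Ind.yoneda.obj c)) :=
    have : IsFinitelyPresentable.{v} (K.obj c) :=
      isFinitelyPresentable_finMod R _ (FinMod.prop_incl R (Ψ.obj c))
    isFinitelyPresentable_of_iso' (i.app c)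
  refine isEquivalence_of_yoneda Φ fun {X Y} f h ↦ ?_
  -- Each free module R ⊗ b is, up to isomorphism, a value of Φ at a representable, and morphisms
  -- out of it are the b-valued elements of the underlying object. So the hypothesis on f says that
  -- f.hom is bijective on elements.
  have : IsIso f.hom := isIso_of_bijective_yoneda f.hom fun b ↦ by
    obtain ⟨Z, ⟨j⟩⟩ := FinMod.exists_iso (finMod_free R b)
    let l : Φ.obj (Ind.yoneda.obj (Ψ.objPreimage Z)) ≅ (modFree R).obj (Ind.yoneda.obj b) :=
      (i.app _).symm ≪≫ (FinMod.incl R).mapIso (Ψ.objObjPreimageIso Z) ≪≫ j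
    let t (W : Mod (Ind B) R) : (Φ.obj (Ind.yoneda.obj (Ψ.objPreimage Z)) ⟶ W) ≃
        (Ind.yoneda.obj b ⟶ W.X) := l.homFromEquiv.trans (modFreeEquiv R (Ind.yoneda.obj b) W)
    have ht : (fun g ↦ g ≫ f.hom) ∘ t X = t Y ∘ (fun g ↦ g ≫ f) := by
      funext g
      refine ((modFreeEquiv_naturality_right R (l.inv ≫ g) f).symm.trans ?_)
      exact congrArg (modFreeEquiv R (Ind.yoneda.obj b) Y) (Category.assoc _ _ _)
    exact ((t X).bijective.of_comp_iff _).1 (ht ▸ (t Y).bijective.comp (h _))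
  exact isIso_of_isIso_hom f

end Algebra

/-! ### Progenerators from free modules of rank one -/

section Progenerator

variable {B : Type u₁} [Category.{v} B] [EssentiallySmall.{v} B] [HasFiniteColimits B]
  [MonoidalCategory B] [RigidCategory B] {R : Ind B} [MonObj R]
  {P : Type u₂} [Category.{v} P] [HasFiniteColimits P] [MonoidalRightAction B P]
  [RightExactAction B P]

/-- An object sent to the free module of rank one by a linear equivalence is a progenerator. -/
theorem isProgenerator_of_rightLinear (e : Ind P ≌ Mod (Ind B) R) [e.functor.RightLinear (Ind B)]
    (p : P) (j : e.functor.obj (Ind.yoneda.obj p) ≅ Mod.regular R) : IsProgenerator B p := by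
  -- As e is linear and sends p to R, the action functor of p becomes Y ↦ R ⊗ Y.
  let i₁ : indAct B p ⋙ e.functor ≅ modFree R :=
    NatIso.ofComponents (fun Y ↦
      (Functor.RightLinear.μᵣIso e.functor (Ind.yoneda.obj p) Y).symm ≪≫
        (actionRight _ Y).mapIso j) (fun {Y Y'} f ↦ by
      have h₁ := Functor.OplaxRightLinear.δᵣ_naturality_right e.functor (Ind.yoneda.obj p) f
      have h₂ := action_exchange j.hom f
      refine ((Category.assoc _ _ _).symm.trans ((congrArg (· ≫ _) h₁).trans ?_))
      refine (Category.assoc _ _ _).trans ((congrArg (_ ≫ ·) h₂).trans ?_)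
      exact (Category.assoc _ _ _).symm)
  let i₂ : modFree R ⋙ e.inverse ≅ indAct B p :=
    Functor.isoWhiskerRight i₁.symm e.inverse ≪≫ Functor.associator _ _ _ ≪≫
      Functor.isoWhiskerLeft (indAct B p) e.unitIso.symm ≪≫ Functor.rightUnitor _
  -- Uniqueness of right adjoints then identifies act_p^R with e followed by the forgetful functor,
  -- which is faithful and preserves colimits.
  let adj : indAct B p ⊣ e.functor ⋙ modForget R :=
    ((modFreeAdj R).comp e.symm.toAdjunction).ofNatIsoLeft i₂
  let i₃ : indActR B p ≅ e.functor ⋙ modForget R :=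
    (Adjunction.ofIsLeftAdjoint (indAct B p)).rightAdjointUniq adj
  refine ⟨Functor.Faithful.of_iso i₃.symm, ⟨fun {J} _ ↦ ?_⟩⟩
  exact preservesColimitsOfShape_of_natIso i₃.symm

end Progenerator

end RexTensor

/-! ### Monadicity for base change -/

theorem mainTheorem9 {k : Type w} [Field k]
    {A : Type u₁} [Category.{v} A] [EssentiallySmall.{v} A] [Abelian A] [Linear k A]
    [MonoidalCategory A] [MonoidalPreadditive A] [MonoidalLinear k A] [RigidCategory A]
    {B : Type u₂} [Category.{v} B] [EssentiallySmall.{v} B] [Preadditive B] [Linear k B]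
    [HasFiniteColimits B] [MonoidalCategory B] [MonoidalPreadditive B] [MonoidalLinear k B]
    [RigidCategory B]
    {M : Type u₃} [Category.{v} M] [EssentiallySmall.{v} M] [Abelian M] [Linear k M]
    [MonoidalRightAction A M] [RightExactAction A M] [BilinearAction k A M]
    (F : A ⥤ B) [F.Monoidal] (hF : IsRex k F) (hdom : IsDominant F)
    (m : M) (hm : IsProgenerator A m) :
    (∃ (P : Type v) (_ : SmallCategory P) (_ : Preadditive P) (_ : Linear k P)
      (_ : HasFiniteColimits P) (_ : MonoidalRightAction B P) (_ : RightExactAction B P)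
      (_ : BilinearAction k B P), Nonempty (BaseChange k F M P)) ∧
    ∀ (P : Type u₄) [Category.{v} P] [EssentiallySmall.{v} P] [Preadditive P] [Linear k P]
      [HasFiniteColimits P] [MonoidalRightAction B P] [RightExactAction B P]
      [BilinearAction k B P] (T : BaseChange k F M P),
      IsProgenerator B (T.box m (𝟙_ B)) ∧
      ∃ e : Ind P ≌ Mod (Ind B) ((indMap F).obj (iEnd A m)),
        Nonempty (e.functor.RightLinear (Ind B)) := by
  have hl : (actionLeft (Ind A) (Ind.yoneda.obj m)).IsLeftAdjoint :=
    inferInstanceAs (indAct A m).IsLeftAdjoint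
  have hf : (rightAdjoint (actionLeft (Ind A) (Ind.yoneda.obj m))).Faithful := hm.isGenerator
  have hc : PreservesColimitsOfSize.{v, v} (rightAdjoint (actionLeft (Ind A) (Ind.yoneda.obj m))) :=
    hm.isProjective
  -- The generator condition enters here: a faithful right adjoint has epimorphic counits.
  have hev (n : Ind M) : Epi (internalEv (Ind A) (Ind.yoneda.obj m) n) :=
    (Adjunction.ofIsLeftAdjoint (actionLeft (Ind A) (Ind.yoneda.obj m))).counit_epi_of_R_faithful n
  have hD : IsRex k (imageMod F m) := isRex_imageMod hF m
  have hp := exists_presentation (A := A) hev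
  have h := finMod_imageMod hD hp
  have hU : (finTensor h hD).IsUniversal := fun E ↦ isEquivalence_compFunctor h hD hp
  let T₀ : BaseChange k F M (FinMod (imageEnd F m)) :=
    (finImageSemiLin h).baseChange (isRex_finImage h hD) hU
  refine ⟨⟨FinMod (imageEnd F m), inferInstance, inferInstance, inferInstance, inferInstance,
    inferInstance, inferInstance, inferInstance, ⟨T₀⟩⟩, ?_⟩
  intro P _ _ _ _ _ _ _ _ T
  -- The universality of the explicit model was proved against targets that need not be small, in
  -- particular against P itself; this gives the functor back from the model to P.
  obtain ⟨Ψ, hΨ, hΨ', ⟨ψ⟩⟩ := T.tensor.exists_isEquivalence T.isUniversal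
    (isEquivalence_compFunctor (E := P) h hD hp) (hU (FinMod (imageEnd F m)))
  obtain ⟨L, hL⟩ := T.exists_laxRightLinear T₀ hΨ ψ
  let s := (FinMod.inclSemiLin (imageEnd F m)).precomp Ψ
  have hs (p : P) (b : B) : IsIso (s.app p b) :=
    have := hL p b
    inferInstanceAs (IsIso ((FinMod.inclSemiLin (imageEnd F m)).app (Ψ.obj p) b ≫
      (FinMod.incl (imageEnd F m)).map (L.μᵣ p b)))
  have := isEquivalence_ext_incl Ψ
  let e := ((ext P (Mod (Ind B) (imageEnd F m))).obj (Ψ ⋙ FinMod.incl (imageEnd F m))).asEquivalence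
  let l : e.functor.RightLinear (Ind B) := extRightLinear s
  refine ⟨isProgenerator_of_rightLinear e _ ?_, e, ⟨l⟩⟩
  -- The object m ⊠ 𝟙 goes to F(End(m)) ⊗ 𝟙, which the right unitor identifies with the regular
  -- module.
  exact ((extIso (Ψ ⋙ FinMod.incl (imageEnd F m))).app (T.box m (𝟙_ B))).symm ≪≫
    (FinMod.incl _).mapIso (T.comparison T₀ hΨ ψ m (𝟙_ B)) ≪≫
      (finTensorIso h hD m (𝟙_ B)).symm ≪≫ ρᵣ ((imageMod F m).obj m)
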